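/- Throughout, $M$ is a smooth, finite-dimensional, Hausdorff, $\sigma$-compact manifold and all vector bundles are smooth, real and of finite rank. A double vector bundle $(D;A,B;M)$ is a commuting square of vector bundles $D\to B$, $D\to A$, $A\to M$, $B\to M$ such that $D\to B$ is a vector bundle morphism over $A\to M$ and the addition $D\times_B D\to D$ is a vector bundle morphism over the addition $A\times_M A\to A$. A section of $D\to B$ is linear if it is a vector bundle morphism from $B\to M$ to $D\to A$ over some section of $A$, and a core section if it is of the form $b\mapsto {}^B0_b+_A c(q_B(b))$ with $c$ a section of the core (the elements of $D$ projecting to zero in $A$ and in $B$). For a Lie algebroid $A\to M$, a VB-algebroid $(D\to B;A\to M)$ with side (base) algebroid $A$ is a double vector bundle $D$ with a Lie algebroid structure on $D\to B$ whose anchor $D\to TB$ is a vector bundle morphism from $D\to A$ to $TB\to TM$ over $\rho_A$, such that the bracket of two linear sections covering $a,a'\in\Gamma(A)$ is linear and covers $[a,a']_A$, the bracket of a linear and a core section is a core section, and the bracket of two core sections vanishes. A VB-algebroid morphism is a morphism of double vector bundles $F:D\to D'$ over $\mathrm{id}_M$ that is a Lie algebroid morphism from $D\to B$ to $D'\to B'$,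 i.e. $F^*$ intertwines the Lie algebroid differentials on forms. A 2-term representation up to homotopy of $A$ on $C_{[0]}\oplus B_{[1]}$ is given by structure operators: a bundle map $\partial:C\to B$, $A$-connections $\nabla^0$ on $C$ and $\nabla^1$ on $B$, and $K\in\Omega^2(A,\mathrm{Hom}(B,C))$ with $\partial\nabla^0=\nabla^1\partial$, $R_{\nabla^0}=-K\partial$, $R_{\nabla^1}=-\partial K$, $d_\nabla K=0$. A morphism $V\Rightarrow W$ of such representations on $C_{[0]}\oplus B_{[1]}$ and $C'_{[0]}\oplus B'_{[1]}$ is a triple $(\phi_0:C\to C',\ \phi_1:B\to B',\ \Phi\in\Omega^1(A,\mathrm{Hom}(B,C')))$ with $\phi_1\partial_V=\partial_W\phi_0$, $\nabla^{W,0}_a\phi_0-\phi_0\nabla^{V,0}_a=\Phi_a\partial_V$, $\nabla^{W,1}_a\phi_1-\phi_1\nabla^{V,1}_a=\partial_W\Phi_a$ for all $a \in \Gamma(A)$, and $d_\nabla\Phi=\phi_0K_V-K_W\phi_1$. If $W$ is a representation of another Lie algebroid $A'$, a morphism $(A,V)\Rightarrow(A',W)$ over a Lie algebroid morphism $T:A\to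 A'$ over $\mathrm{id}_M$ is a morphism from $V$ to the pullback $T^!W$ with structure operators $(\partial_W,\nabla^W_{T(\cdot)},K_W(T\cdot,T\cdot))$. On the trivial double vector bundle $D=A\oplus B\oplus C$, write $h(a)(b)=(a,b,0)$ for $a\in\Gamma(A)$ and $\widehat c(b)=(0,b,c)$ for $c\in\Gamma(C)$. A VB-algebroid structure on $D$ with side algebroid $A$ and a 2-term representation $(\partial,\nabla,K)$ of $A$ on $C_{[0]}\oplus B_{[1]}$ are associated if $\rho_D(h(a))$ is the linear vector field on $B$ given by the dual connection $(\nabla^1_a)^*$ on $B^*$, $\rho_D(\widehat c)$ is the vertical lift of $\partial c$, $[\widehat c,\widehat c']=0$, $[h(a),\widehat c]=\widehat{\nabla^0_ac}$ and $[h(a),h(a')](b)=(\,[a,a'],\,b,\,K(a,a')b)$. **Theorem.** (1) Every VB-algebroid structure on $A\oplus B\oplus C$ with side algebroid $A$ has exactly one associated 2-term representation up to homotopy of $A$ on $C_{[0]}\oplus B_{[1]}$. (2) Every morphism $F$ of double vector bundles over $\mathrm{id}_M$ from $D=A\oplus B\oplus C$ to $D'=A'\oplus B'\oplus C'$ has the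 form $F(a,b,c)=(F_{\rm ver}a,\,F_{\rm hor}b,\,F_cc+\Phi_a(b))$ for bundle maps $F_{\rm ver}:A\to A'$, $F_{\rm hor}:B\to B'$ (the side morphisms of $F$) and a unique bundle map $F_c:C\to C'$ and a unique $\Phi\in\Gamma(A^*\otimes B^*\otimes C')$. (3) Let $D$ and $D'$ carry VB-algebroid structures with side algebroids $A$ and $A'$ and associated representations $V=C_{[0]}\oplus B_{[1]}$ and $W=C'_{[0]}\oplus B'_{[1]}$. Then $F$ is a VB-algebroid morphism if and only if $F_{\rm ver}$ is a Lie algebroid morphism and $(F_c,F_{\rm hor},\Phi)$ are the components of a morphism $(A,V)\Rightarrow(A',W)$ over $F_{\rm ver}$. (4) For every Lie algebroid $A$ over $M$, the category of 2-term representations up to homotopy of $A$ is equivalent to the category of VB-algebroids with side algebroid $A$ (with the VB-algebroid morphisms inducing $\mathrm{id}_A$). More precisely, there is an equivalence of categories which, up to natural isomorphism, sends a representation on $C_{[0]}\oplus B_{[1]}$ to a VB-algebroid structure on $A\oplus B\oplus C$ associated with it and a morphism $(\phi_0,\phi_1,\Phi)$ to the map $(a,b,c)\mapsto(a,\phi_1b,\phi_0c+\Phi_a(b))$.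 -/

import Mathlib

open Bundle CategoryTheory
open scoped Manifold ContDiff

universe u

noncomputable section

/-! ### Smooth vector bundles -/

/-- A smooth real vector bundle of finite rank over a manifold `N`. -/
structure VB {E : Type*} [NormedAddCommGroup E] [NormedSpace ℝ E] {H : Type*} [TopologicalSpace H]
    (I : ModelWithCorners ℝ E H) (N : Type*) [TopologicalSpace N] [ChartedSpace H N] where
  /-- model fibre -/
  F : Type u
  /-- fibres -/
  fib : N → Type u
  [normedF : NormedAddCommGroup F]
  [spaceF : NormedSpace ℝ F]
  [finiteF : FiniteDimensional ℝ F]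
  [topTot : TopologicalSpace (TotalSpace F fib)]
  [addFib : ∀ x, AddCommGroup (fib x)]
  [modFib : ∀ x, Module ℝ (fib x)]
  [topFib : ∀ x, TopologicalSpace (fib x)]
  [fiberBundle : FiberBundle F fib]
  [vectorBundle : VectorBundle ℝ F fib]
  [smoothBundle : ContMDiffVectorBundle ∞ F fib I]

attribute [instance] VB.normedF VB.spaceF VB.finiteF VB.topTot VB.addFib VB.modFib VB.topFib
  VB.fiberBundle VB.vectorBundle VB.smoothBundle

section General

variable {E : Type*} [NormedAddCommGroup E] [NormedSpace ℝ E] {H : Type*} [TopologicalSpace H]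
  {I : ModelWithCorners ℝ E H} {N : Type*} [TopologicalSpace N] [ChartedSpace H N]
  {E' : Type*} [NormedAddCommGroup E'] [NormedSpace ℝ E'] {H' : Type*} [TopologicalSpace H']
  {I' : ModelWithCorners ℝ E' H'} {N' : Type*} [TopologicalSpace N'] [ChartedSpace H' N']
  {E'' : Type*} [NormedAddCommGroup E''] [NormedSpace ℝ E''] {H'' : Type*} [TopologicalSpace H'']
  {I'' : ModelWithCorners ℝ E'' H''} {N'' : Type*} [TopologicalSpace N''] [ChartedSpace H'' N'']

namespace VB

/-- The total space. -/
abbrev Tot (V : VB I N) := TotalSpace V.F V.fib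

/-- The model with corners of the total space. -/
abbrev IT (V : VB I N) : ModelWithCorners ℝ (E × V.F) (ModelProd H V.F) := I.prod 𝓘(ℝ, V.F)

/-- Smooth global sections. -/
abbrev Sec (V : VB I N) := ContMDiffSection I V.F ∞ V.fib

/-- `z = x + y`, where `x` and `y` lie in a common fibre. -/
def IsSum (V : VB I N) (x y z : V.Tot) : Prop :=
  ∃ (p : N) (s t : V.fib p), x = ⟨p, s⟩ ∧ y = ⟨p, t⟩ ∧ z = ⟨p, s + t⟩

/-- Fibrewise scalar multiplication. -/
def scale (V : VB I N) (r : ℝ) (x : V.Tot) : V.Tot := ⟨x.proj, r • x.2⟩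

/-- The direct sum of two vector bundles. -/
def prod (V W : VB.{u} I N) : VB.{u} I N where
  F := V.F × W.F
  fib := V.fib ×ᵇ W.fib

/-- The pullback of a vector bundle along a smooth map. -/
def pullback (V : VB.{u} I N) (f : C^∞⟮I', N'; I, N⟯) : VB.{u} I' N' where
  F := V.F
  fib := (f : N' → N) *ᵖ V.fib
  addFib := fun x => inferInstanceAs (AddCommGroup (V.fib (f x)))
  modFib := fun x => inferInstanceAs (Module ℝ (V.fib (f x)))
  topFib := fun x => inferInstanceAs (TopologicalSpace (V.fib (f x)))
  fiberBundle := FiberBundle.pullback f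
  vectorBundle := VectorBundle.pullback ℝ (F := V.F) (E := V.fib) f
  smoothBundle := ContMDiffVectorBundle.pullback V.F V.fib I' f

/-- The bundle projection as a smooth map. -/
def projMap (V : VB I N) : C^∞⟮V.IT, V.Tot; I, N⟯ := ⟨TotalSpace.proj, contMDiff_proj V.fib⟩

theorem contMDiff_zero (V : VB.{u} I N) : ContMDiff I V.IT ∞ (fun x => (⟨x, 0⟩ : V.Tot)) :=
  contMDiff_zeroSection ℝ V.fib

variable {X : Type*} [TopologicalSpace X] {EX : Type*} [NormedAddCommGroup EX] [NormedSpace ℝ EX]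
  {HX : Type*} [TopologicalSpace HX] [ChartedSpace HX X] {IX : ModelWithCorners ℝ EX HX}

theorem contMDiff_prod_iff (V W : VB.{u} I N) (f : X → (V.prod W).Tot) :
    ContMDiff IX (V.prod W).IT ∞ f ↔
      ContMDiff IX V.IT ∞ (fun x => (⟨(f x).proj, (f x).2.1⟩ : V.Tot)) ∧
      ContMDiff IX W.IT ∞ (fun x => (⟨(f x).proj, (f x).2.2⟩ : W.Tot)) := by
  simp only [ContMDiff, ← forall_and]
  refine forall_congr' fun x => ?_
  rw [contMDiffAt_totalSpace, contMDiffAt_totalSpace, contMDiffAt_totalSpace]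
  constructor
  · rintro ⟨h1, h2⟩
    exact ⟨⟨h1, ((ContinuousLinearMap.fst ℝ V.F W.F).contMDiff.contMDiffAt.comp x h2 :)⟩,
      ⟨h1, ((ContinuousLinearMap.snd ℝ V.F W.F).contMDiff.contMDiffAt.comp x h2 :)⟩⟩
  · rintro ⟨⟨h1, h2⟩, ⟨_, h3⟩⟩
    exact ⟨h1, h2.prodMk_space h3⟩

theorem contMDiff_pullback_iff (V : VB.{u} I N) (g : C^∞⟮I', N'; I, N⟯)
    (f : X → (V.pullback g).Tot) :
    ContMDiff IX (V.pullback g).IT ∞ f ↔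
      ContMDiff IX I' ∞ (fun x => (f x).proj) ∧
      ContMDiff IX V.IT ∞ (fun x => (⟨g (f x).proj, (f x).2⟩ : V.Tot)) := by
  simp only [ContMDiff, ← forall_and]
  refine forall_congr' fun x => ?_
  rw [contMDiffAt_totalSpace, contMDiffAt_totalSpace]
  constructor
  · rintro ⟨h1, h2⟩
    exact ⟨h1, g.contMDiff.contMDiffAt.comp x h1, h2⟩
  · rintro ⟨h1, _, h2⟩
    exact ⟨h1, h2⟩

end VB

/-! ### Vector bundle morphisms -/

/-- A smooth vector bundle morphism covering the identity. -/
@[ext] structure BundleMap (V W : VB.{u} I N) where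
  /-- the linear maps between the fibres -/
  fib : ∀ x, V.fib x →ₗ[ℝ] W.fib x
  smooth : ContMDiff V.IT W.IT ∞ (fun v : V.Tot => (⟨v.proj, fib v.proj v.2⟩ : W.Tot))

/-- A smooth vector bundle morphism covering the map `f` between the bases. -/
@[ext] structure VBHom (V : VB.{u} I N) (V' : VB.{u} I' N') (f : N → N') where
  /-- the linear maps between the fibres -/
  fib : ∀ x, V.fib x →ₗ[ℝ] V'.fib (f x)
  smooth : ContMDiff V.IT V'.IT ∞ (fun v : V.Tot => (⟨f v.proj, fib v.proj v.2⟩ : V'.Tot))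

namespace VBHom

/-- The map between the total spaces. -/
def total {V : VB.{u} I N} {V' : VB.{u} I' N'} {f : N → N'} (F : VBHom V V' f) (v : V.Tot) :
    V'.Tot := ⟨f v.proj, F.fib v.proj v.2⟩

/-- The identity morphism. -/
def id (V : VB.{u} I N) : VBHom V V (fun x => x) where
  fib _ := LinearMap.id
  smooth := contMDiff_id

/-- Composition, `F` first. -/
def comp {V : VB.{u} I N} {V' : VB.{u} I' N'} {V'' : VB.{u} I'' N''} {f : N → N'} {g : N' → N''}
    (F : VBHom V V' f) (G : VBHom V' V'' g) : VBHom V V'' (fun x => g (f x)) where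
  fib x := (G.fib (f x)).comp (F.fib x)
  smooth := (G.smooth.comp F.smooth :)

theorem contMDiff_base {V : VB.{u} I N} {V' : VB.{u} I' N'} {f : N → N'} (F : VBHom V V' f) :
    ContMDiff I I' ∞ f :=
  ((contMDiff_proj V'.fib).comp (F.smooth.comp (contMDiff_zeroSection ℝ V.fib)) :)

end VBHom

namespace BundleMap

variable {V W Y : VB.{u} I N}

/-- The map between the total spaces. -/
def total (φ : BundleMap V W) (v : V.Tot) : W.Tot := ⟨v.proj, φ.fib v.proj v.2⟩

/-- A morphism covering the identity, as a morphism covering the identity map. -/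
def toVBHom (φ : BundleMap V W) : VBHom V W (fun x => x) := ⟨φ.fib, φ.smooth⟩

/-- The induced map on sections. -/
def onSec (φ : BundleMap V W) (s : V.Sec) : W.Sec :=
  ⟨fun x => φ.fib x (s x), (φ.smooth.comp s.contMDiff :)⟩

/-- The identity morphism. -/
def id (V : VB.{u} I N) : BundleMap V V where
  fib _ := LinearMap.id
  smooth := contMDiff_id

/-- Composition, `φ` first. -/
def comp (φ : BundleMap V W) (ψ : BundleMap W Y) : BundleMap V Y where
  fib x := (ψ.fib x).comp (φ.fib x)
  smooth := (ψ.smooth.comp φ.smooth :)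

end BundleMap

/-- A smooth fibrewise bilinear map `V ×_N W → Y`, that is a section of `V^* ⊗ W^* ⊗ Y`. -/
@[ext] structure BilinMap (V W Y : VB.{u} I N) where
  /-- the bilinear maps between the fibres -/
  fib : ∀ x, V.fib x →ₗ[ℝ] W.fib x →ₗ[ℝ] Y.fib x
  smooth : ∀ (s : V.Sec) (t : W.Sec),
    ContMDiff I Y.IT ∞ (fun x => (⟨x, fib x (s x) (t x)⟩ : Y.Tot))

/-- The induced map on sections. -/
def BilinMap.onSec {V W Y : VB.{u} I N} (Φ : BilinMap V W Y) (s : V.Sec) (t : W.Sec) : Y.Sec :=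
  ⟨fun x => Φ.fib x (s x) (t x), Φ.smooth s t⟩

/-- A smooth fibrewise trilinear map `V ×_N V ×_N W → Y`. -/
@[ext] structure TrilinMap (V W Y : VB.{u} I N) where
  /-- the trilinear maps between the fibres -/
  fib : ∀ x, V.fib x →ₗ[ℝ] V.fib x →ₗ[ℝ] W.fib x →ₗ[ℝ] Y.fib x
  smooth : ∀ (s s' : V.Sec) (t : W.Sec),
    ContMDiff I Y.IT ∞ (fun x => (⟨x, fib x (s x) (s' x) (t x)⟩ : Y.Tot))

/-- The induced map on sections. -/
def TrilinMap.onSec {V W Y : VB.{u} I N} (K : TrilinMap V W Y) (s s' : V.Sec) (t : W.Sec) : Y.Sec :=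
  ⟨fun x => K.fib x (s x) (s' x) (t x), K.smooth s s' t⟩

/-! ### Forms on a vector bundle -/

/-- A smooth `k`-form on `V`, that is a section of `⋀^k V^*`. Smoothness is tested on local
sections. -/
@[ext] structure Form (V : VB.{u} I N) (k : ℕ) where
  /-- the alternating maps on the fibres -/
  toFun : ∀ x, V.fib x [⋀^Fin k]→ₗ[ℝ] ℝ
  smooth : ∀ (x₀ : N) (a : Fin k → ∀ x, V.fib x),
    (∀ i, ContMDiffAt I V.IT ∞ (fun x => (⟨x, a i x⟩ : V.Tot)) x₀) →
      ContMDiffAt I 𝓘(ℝ) ∞ (fun x => toFun x (fun i => a i x)) x₀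

namespace Form

/-- The function obtained by evaluating a form on sections. -/
def eval {V : VB.{u} I N} {k : ℕ} (θ : Form V k) (a : Fin k → V.Sec) (x : N) : ℝ :=
  θ.toFun x (fun i => a i x)

/-- The pullback `F^* θ` of a form along a vector bundle morphism. -/
def pullback {V : VB.{u} I N} {V' : VB.{u} I' N'} {f : N → N'} (F : VBHom V V' f) {k : ℕ}
    (θ : Form V' k) : Form V k where
  toFun x := (θ.toFun (f x)).compLinearMap (F.fib x)
  smooth x₀ a ha := by
    classical
    let e := trivializationAt V'.F V'.fib (f x₀)
    let b := Module.Basis.ofVectorSpace ℝ V'.F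
    have hx₀ : f x₀ ∈ e.baseSet := mem_baseSet_trivializationAt _ _ _
    have hf : ContMDiffAt I I' ∞ f x₀ := F.contMDiff_base x₀
    have hU : ∀ᶠ x in nhds x₀, f x ∈ e.baseSet :=
      hf.continuousAt.preimage_mem_nhds (e.open_baseSet.mem_nhds hx₀)
    -- the coefficients of the images of the sections in a local frame
    let c : Fin k → _ → N → ℝ := fun i r x =>
      b.repr ((e ⟨f x, F.fib x (a i x)⟩).2) r
    have hc : ∀ i r, ContMDiffAt I 𝓘(ℝ) ∞ (c i r) x₀ := by
      intro i r
      have h1 : ContMDiffAt I V'.IT ∞ (fun x => (⟨f x, F.fib x (a i x)⟩ : V'.Tot)) x₀ :=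
        (F.smooth.contMDiffAt.comp x₀ (ha i) :)
      have h2 := (contMDiffAt_totalSpace.1 h1).2
      exact ((LinearMap.toContinuousLinearMap (b.coord r)).contMDiff.contMDiffAt.comp x₀ h2 :)
    have hsum : ∀ i, ∀ x, f x ∈ e.baseSet →
        F.fib x (a i x) = ∑ r, c i r x • e.localFrame b r (f x) := by
      intro i x hx
      rw [← (e.basisAt b hx).sum_repr (F.fib x (a i x))]
      refine Finset.sum_congr rfl fun r _ => ?_
      rw [e.localFrame_apply_of_mem_baseSet b hx]
      congr 1
    have key : ∀ x, f x ∈ e.baseSet →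
        (θ.toFun (f x)).compLinearMap (F.fib x) (fun i => a i x) =
          ∑ r : Fin k → _, (∏ i, c i (r i) x) *
            θ.toFun (f x) (fun i => e.localFrame b (r i) (f x)) := by
      intro x hx
      simp only [AlternatingMap.compLinearMap_apply]
      rw [show (fun i => F.fib x (a i x)) =
        fun i => ∑ r, c i r x • e.localFrame b r (f x) from funext fun i => hsum i x hx]
      rw [← AlternatingMap.coe_multilinearMap, MultilinearMap.map_sum]
      simp only [MultilinearMap.map_smul_univ, smul_eq_mul]
    refine ContMDiffAt.congr_of_eventuallyEq ?_ (hU.mono key)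
    refine ContMDiffAt.sum fun r _ => ContMDiffAt.mul (contMDiffAt_finsetProd fun i _ => hc _ _) ?_
    exact (θ.smooth (f x₀) (fun i => e.localFrame b (r i)) (fun i =>
      contMDiffAt_localFrame_of_mem ∞ e b (r i) hx₀)).comp x₀ hf

end Form

/-! ### Lie algebroids -/

section Algebroids

variable [IsManifold I ∞ N] [IsManifold I' ∞ N'] [IsManifold I'' ∞ N'']

/-- The derivative of the function `g` in the direction of the tangent vector `v`. -/
def dirDeriv (I : ModelWithCorners ℝ E H) (g : N → ℝ) {x : N} (v : TangentSpace I x) : ℝ :=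
  mfderiv I 𝓘(ℝ) g x v

/-- A Lie algebroid structure on the vector bundle `V`. (That the anchor preserves brackets is a
consequence of the Jacobi identity and the Leibniz rule.) -/
structure LieAlgebroid (V : VB.{u} I N) where
  /-- the anchor -/
  anchor : ∀ x, V.fib x →ₗ[ℝ] TangentSpace I x
  anchor_smooth : ContMDiff V.IT I.tangent ∞
    (fun v : V.Tot => (⟨v.proj, anchor v.proj v.2⟩ : TangentBundle I N))
  /-- the bracket of sections -/
  bracket : V.Sec →ₗ[ℝ] V.Sec →ₗ[ℝ] V.Sec
  bracket_self : ∀ a, bracket a a = 0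
  jacobi : ∀ a b c, bracket a (bracket b c) = bracket (bracket a b) c + bracket b (bracket a c)
  leibniz : ∀ (a b c : V.Sec) (g : N → ℝ), ContMDiff I 𝓘(ℝ) ∞ g → (∀ x, c x = g x • b x) →
    ∀ x, bracket a c x = g x • bracket a b x + dirDeriv I g (anchor x (a x)) • b x

namespace LieAlgebroid

variable {V : VB.{u} I N} {V' : VB.{u} I' N'} {V'' : VB.{u} I'' N''}

/-- The anchor as a map to the tangent bundle. -/
def anchorTotal (L : LieAlgebroid V) (v : V.Tot) : TangentBundle I N :=
  ⟨v.proj, L.anchor v.proj v.2⟩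

/-- The derivative of the function `g` along the anchor of the section `a`. -/
def deriv (L : LieAlgebroid V) (a : V.Sec) (g : N → ℝ) (x : N) : ℝ :=
  dirDeriv I g (L.anchor x (a x))

/-- The Koszul formula for the Lie algebroid differential of a form, evaluated on sections:
`∑ᵢ (-1)ⁱ ρ(aᵢ) θ(…, âᵢ, …) + ∑_{i < j} (-1)^{i+j} θ([aᵢ, aⱼ], …, âᵢ, …, âⱼ, …)`.
In the second sum the pair `i < j` is written `(i, j + 1)` with `i ≤ j`, hence the sign. -/
def koszul (L : LieAlgebroid V) : ∀ {k : ℕ}, Form V k → (Fin (k + 1) → V.Sec) → N → ℝ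
  | 0, θ, a, x => L.deriv (a 0) (θ.eval (Fin.removeNth 0 a)) x
  | k + 1, θ, a, x =>
      ∑ i : Fin (k + 2), (-1) ^ (i : ℕ) * L.deriv (a i) (θ.eval (i.removeNth a)) x -
        ∑ i : Fin (k + 1), ∑ j ∈ Finset.Ici i, (-1) ^ (i + j : ℕ) *
          θ.eval (Matrix.vecCons (L.bracket (a i.castSucc) (a j.succ))
            (j.removeNth (i.castSucc.removeNth a))) x

/-- `η = d θ` for the Lie algebroid differential `d`. -/
def IsDifferential (L : LieAlgebroid V) {k : ℕ} (θ : Form V k) (η : Form V (k + 1)) : Prop :=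
  ∀ a x, η.eval a x = L.koszul θ a x

/-- A vector bundle morphism `F` is a Lie algebroid morphism if the pullback `F^*` of forms
intertwines the Lie algebroid differentials. -/
def IsMorphism (L : LieAlgebroid V) (L' : LieAlgebroid V') {f : N → N'} (F : VBHom V V' f) : Prop :=
  ∀ (k : ℕ) (θ : Form V' k) (η : Form V' (k + 1)),
    L'.IsDifferential θ η → L.IsDifferential (θ.pullback F) (η.pullback F)

theorem IsMorphism.id (L : LieAlgebroid V) : L.IsMorphism L (VBHom.id V) :=
  fun _ _ _ h => h

theorem IsMorphism.comp {L : LieAlgebroid V} {L' : LieAlgebroid V'} {L'' : LieAlgebroid V''}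
    {f : N → N'} {g : N' → N''} {F : VBHom V V' f} {G : VBHom V' V'' g}
    (hF : L.IsMorphism L' F) (hG : L'.IsMorphism L'' G) : L.IsMorphism L'' (F.comp G) :=
  fun k _ _ h => hF k _ _ (hG k _ _ h)

end LieAlgebroid

end Algebroids

/-! ### Two-term representations up to homotopy -/

/-- The data `(∂, ∇⁰, ∇¹, K)` underlying a representation up to homotopy of `A` on the graded
bundle with `C` in degree `0` and `B` in degree `1`. -/
@[ext] structure StructureOperators (A B C : VB.{u} I N) where
  /-- the bundle map `C → B` -/
  bd : BundleMap C B
  /-- the connection on `C` -/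
  nabla₀ : A.Sec → C.Sec → C.Sec
  /-- the connection on `B` -/
  nabla₁ : A.Sec → B.Sec → B.Sec
  /-- the curvature term in `Ω²(A, Hom(B, C))` -/
  K : TrilinMap A B C

/-- Precomposition of structure operators with a bundle map `T : A → A'`. -/
def StructureOperators.pullback {A A' B C : VB.{u} I N} (T : BundleMap A A')
    (W : StructureOperators A' B C) : StructureOperators A B C where
  bd := W.bd
  nabla₀ a := W.nabla₀ (T.onSec a)
  nabla₁ a := W.nabla₁ (T.onSec a)
  K := ⟨fun x => (W.K.fib x).compl₁₂ (T.fib x) (T.fib x),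
    fun s s' t => W.K.smooth (T.onSec s) (T.onSec s') t⟩

section Representations

variable [IsManifold I ∞ N] {A A' B C B' C' B'' C'' : VB.{u} I N}

/-- `D` is an `A`-connection on `V`. -/
structure LieAlgebroid.IsConnection (L : LieAlgebroid A) {V : VB.{u} I N}
    (D : A.Sec → V.Sec → V.Sec) : Prop where
  add_left : ∀ a a' s, D (a + a') s = D a s + D a' s
  smul_left : ∀ (a a' : A.Sec) (g : N → ℝ) (s : V.Sec), ContMDiff I 𝓘(ℝ) ∞ g →
    (∀ x, a' x = g x • a x) → ∀ x, D a' s x = g x • D a s x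
  add_right : ∀ a s s', D a (s + s') = D a s + D a s'
  leibniz : ∀ (a : A.Sec) (s s' : V.Sec) (g : N → ℝ), ContMDiff I 𝓘(ℝ) ∞ g →
    (∀ x, s' x = g x • s x) → ∀ x, D a s' x = g x • D a s x + L.deriv a g x • s x

/-- The curvature of a connection, evaluated on sections. -/
def LieAlgebroid.curvature (L : LieAlgebroid A) {V : VB.{u} I N} (D : A.Sec → V.Sec → V.Sec)
    (a a' : A.Sec) (s : V.Sec) : V.Sec :=
  D a (D a' s) - D a' (D a s) - D (L.bracket a a') s

namespace StructureOperators

/-- The covariant derivative `∇_a (K(a₁, a₂))` of the section `K(a₁, a₂)` of `Hom(B, C)`, evaluated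
on a section of `B`. -/
def nablaK (V : StructureOperators A B C) (a a₁ a₂ : A.Sec) (b : B.Sec) : C.Sec :=
  V.nabla₀ a (V.K.onSec a₁ a₂ b) - V.K.onSec a₁ a₂ (V.nabla₁ a b)

/-- The structure operators of a representation up to homotopy of the Lie algebroid `A` on
`C_{[0]} ⊕ B_{[1]}`. -/
structure IsRepresentation (L : LieAlgebroid A) (V : StructureOperators A B C) : Prop where
  connection₀ : L.IsConnection V.nabla₀
  connection₁ : L.IsConnection V.nabla₁
  bd_nabla : ∀ a c, V.bd.onSec (V.nabla₀ a c) = V.nabla₁ a (V.bd.onSec c)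
  K_self : ∀ x (a : A.fib x) (b : B.fib x), V.K.fib x a a b = 0
  curvature₀ : ∀ a₁ a₂ c, L.curvature V.nabla₀ a₁ a₂ c = -V.K.onSec a₁ a₂ (V.bd.onSec c)
  curvature₁ : ∀ a₁ a₂ b, L.curvature V.nabla₁ a₁ a₂ b = -V.bd.onSec (V.K.onSec a₁ a₂ b)
  closed : ∀ a₁ a₂ a₃ b,
    V.nablaK a₁ a₂ a₃ b - V.nablaK a₂ a₁ a₃ b + V.nablaK a₃ a₁ a₂ b
      - V.K.onSec (L.bracket a₁ a₂) a₃ b + V.K.onSec (L.bracket a₁ a₃) a₂ b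
      - V.K.onSec (L.bracket a₂ a₃) a₁ b = 0

/-- The covariant derivative `∇_a (Φ_{a'})` of the section `Φ_{a'}` of `Hom(B, C')`, evaluated on
a section of `B`. -/
def nablaHom (V : StructureOperators A B C) (W : StructureOperators A B' C')
    (Φ : BilinMap A B C') (a a' : A.Sec) (b : B.Sec) : C'.Sec :=
  W.nabla₀ a (Φ.onSec a' b) - Φ.onSec a' (V.nabla₁ a b)

/-- `(φ₀, φ₁, Φ)` are the components of a morphism `V ⇒ W` of two-term representations up to
homotopy of `A`. -/
structure IsMorphism (L : LieAlgebroid A) (V : StructureOperators A B C)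
    (W : StructureOperators A B' C') (φ₀ : BundleMap C C') (φ₁ : BundleMap B B')
    (Φ : BilinMap A B C') : Prop where
  bd_comm : ∀ c, φ₁.onSec (V.bd.onSec c) = W.bd.onSec (φ₀.onSec c)
  nabla₀_comm : ∀ a c,
    W.nabla₀ a (φ₀.onSec c) - φ₀.onSec (V.nabla₀ a c) = Φ.onSec a (V.bd.onSec c)
  nabla₁_comm : ∀ a b,
    W.nabla₁ a (φ₁.onSec b) - φ₁.onSec (V.nabla₁ a b) = W.bd.onSec (Φ.onSec a b)
  K_comm : ∀ a₁ a₂ b,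
    nablaHom V W Φ a₁ a₂ b - nablaHom V W Φ a₂ a₁ b - Φ.onSec (L.bracket a₁ a₂) b =
      φ₀.onSec (V.K.onSec a₁ a₂ b) - W.K.onSec a₁ a₂ (φ₁.onSec b)

end StructureOperators

end Representations

end General

/-! ### Double vector bundles -/

section Double

variable {E : Type*} [NormedAddCommGroup E] [NormedSpace ℝ E] {H : Type*} [TopologicalSpace H]
  {I : ModelWithCorners ℝ E H} {M : Type*} [TopologicalSpace M] [ChartedSpace H M]

/-- Two vector bundle structures, one over `B` and one over `A`, on the same smooth manifold, where
`A` and `B` are vector bundles over `M`. The map `flip` identifies the two total spaces. -/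
structure PreDVB (A B : VB.{u} I M) where
  /-- the vector bundle `D → B` -/
  overB : VB.{u} B.IT B.Tot
  /-- the vector bundle `D → A` -/
  overA : VB.{u} A.IT A.Tot
  /-- the identification of the two total spaces -/
  flip : Diffeomorph overB.IT overA.IT overB.Tot overA.Tot ∞

namespace PreDVB

variable {A B : VB.{u} I M} (D : PreDVB A B)

/-- The total space `D`. -/
abbrev Tot := D.overB.Tot

/-- The projection `D → A`. -/
def qA (d : D.Tot) : A.Tot := (D.flip d).proj

/-- The projection `D → B`. -/
def qB (d : D.Tot) : B.Tot := d.proj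

/-- `z` is the sum of `x` and `y` in the vector bundle `D → A`. -/
def IsSumA (x y z : D.Tot) : Prop := D.overA.IsSum (D.flip x) (D.flip y) (D.flip z)

/-- `z` is the sum of `x` and `y` in the vector bundle `D → B`. -/
def IsSumB (x y z : D.Tot) : Prop := D.overB.IsSum x y z

/-- Scalar multiplication in the vector bundle `D → A`. -/
def scaleA (r : ℝ) (x : D.Tot) : D.Tot := D.flip.symm (D.overA.scale r (D.flip x))

end PreDVB

/-- A double vector bundle `(D; A, B; M)`. The first group of axioms says that the square of
projections commutes and that `D → B` is a vector bundle morphism over `A → M`, the second one that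
the addition `D ×_B D → D` is a vector bundle morphism over the addition `A ×_M A → A`. -/
structure DVB (A B : VB.{u} I M) extends PreDVB A B where
  square : ∀ d, (toPreDVB.qA d).proj = (toPreDVB.qB d).proj
  qB_add : ∀ x y z, toPreDVB.IsSumA x y z →
    B.IsSum (toPreDVB.qB x) (toPreDVB.qB y) (toPreDVB.qB z)
  qB_scale : ∀ r x, toPreDVB.qB (toPreDVB.scaleA r x) = B.scale r (toPreDVB.qB x)
  qA_add : ∀ x y z, toPreDVB.IsSumB x y z →
    A.IsSum (toPreDVB.qA x) (toPreDVB.qA y) (toPreDVB.qA z)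
  interchange : ∀ x₁ y₁ z₁ x₂ y₂ z₂ x₃ y₃ z₃,
    toPreDVB.IsSumB x₁ y₁ z₁ → toPreDVB.IsSumB x₂ y₂ z₂ →
    toPreDVB.IsSumA x₁ x₂ x₃ → toPreDVB.IsSumA y₁ y₂ y₃ → toPreDVB.IsSumA z₁ z₂ z₃ →
    toPreDVB.IsSumB x₃ y₃ z₃
  scale_interchange : ∀ r x y z, toPreDVB.IsSumB x y z →
    toPreDVB.IsSumB (toPreDVB.scaleA r x) (toPreDVB.scaleA r y) (toPreDVB.scaleA r z)

/-- A morphism of double vector bundles covering the identity of `M`. -/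
@[ext] structure DVBHom {A B A' B' : VB.{u} I M} (D : DVB A B) (D' : DVB A' B') where
  /-- the vertical side morphism -/
  ver : BundleMap A A'
  /-- the horizontal side morphism -/
  hor : BundleMap B B'
  /-- the map `D → D'` as a vector bundle morphism over `hor` -/
  homB : VBHom D.overB D'.overB hor.total
  /-- the map `D → D'` as a vector bundle morphism over `ver` -/
  homA : VBHom D.overA D'.overA ver.total
  comm : ∀ d, D'.flip (homB.total d) = homA.total (D.flip d)

namespace DVBHom

variable {A B A' B' A'' B'' : VB.{u} I M} {D : DVB A B} {D' : DVB A' B'} {D'' : DVB A'' B''}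

/-- The identity morphism. -/
def id (D : DVB A B) : DVBHom D D where
  ver := BundleMap.id A
  hor := BundleMap.id B
  homB := VBHom.id D.overB
  homA := VBHom.id D.overA
  comm _ := rfl

/-- Composition, `F` first. -/
def comp (F : DVBHom D D') (G : DVBHom D' D'') : DVBHom D D'' where
  ver := F.ver.comp G.ver
  hor := F.hor.comp G.hor
  homB := F.homB.comp G.homB
  homA := F.homA.comp G.homA
  comm d := (G.comm _).trans (congrArg G.homA.total (F.comm d))

theorem id_comp (F : DVBHom D D') : (DVBHom.id D).comp F = F := by
  obtain ⟨⟨v, hv⟩, ⟨h, hh⟩, ⟨b, hb⟩, ⟨a, ha⟩, c⟩ := F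
  rfl

theorem comp_id (F : DVBHom D D') : F.comp (DVBHom.id D') = F := by
  obtain ⟨⟨v, hv⟩, ⟨h, hh⟩, ⟨b, hb⟩, ⟨a, ha⟩, c⟩ := F
  rfl

end DVBHom

/-! ### The trivial double vector bundle -/

namespace DVB

variable (A B C : VB.{u} I M)

/-- The vector bundle `q_B^!(A ⊕ C)` over `B`. -/
def trivialOver (B A C : VB.{u} I M) : VB.{u} B.IT B.Tot :=
  (A.prod C).pullback B.projMap

theorem contMDiff_trivialOver_iff {A B C : VB.{u} I M} {X : Type*} [TopologicalSpace X]
    {EX : Type*} [NormedAddCommGroup EX] [NormedSpace ℝ EX]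
    {HX : Type*} [TopologicalSpace HX] [ChartedSpace HX X] {IX : ModelWithCorners ℝ EX HX}
    (f : X → (trivialOver B A C).Tot) :
    ContMDiff IX (trivialOver B A C).IT ∞ f ↔
      ContMDiff IX B.IT ∞ (fun x => (f x).proj) ∧
      ContMDiff IX A.IT ∞ (fun x => (⟨(f x).proj.proj, (f x).2.1⟩ : A.Tot)) ∧
      ContMDiff IX C.IT ∞ (fun x => (⟨(f x).proj.proj, (f x).2.2⟩ : C.Tot)) :=
  (VB.contMDiff_pullback_iff _ _ _).trans (and_congr Iff.rfl (VB.contMDiff_prod_iff _ _ _))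

/-- The map `(b, (a, c)) ↦ (a, (b, c))`. -/
def trivialFlip (x : (trivialOver B A C).Tot) : (trivialOver A B C).Tot :=
  ⟨⟨x.proj.proj, x.2.1⟩, (x.proj.2, x.2.2)⟩

theorem trivialFlip_smooth : ContMDiff (trivialOver B A C).IT (trivialOver A B C).IT ∞
    (trivialFlip A B C) := by
  obtain ⟨h1, h2, h3⟩ := (contMDiff_trivialOver_iff (A := A) (B := B) (C := C) _).1
    (contMDiff_id (I := (trivialOver B A C).IT) (n := ∞))
  exact (contMDiff_trivialOver_iff _).2 ⟨h2, h1, h3⟩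

/-- The two vector bundle structures of the trivial double vector bundle. -/
def trivialPre : PreDVB A B where
  overB := trivialOver B A C
  overA := trivialOver A B C
  flip :=
    { toFun := trivialFlip A B C
      invFun := trivialFlip B A C
      left_inv := fun _ => rfl
      right_inv := fun _ => rfl
      contMDiff_toFun := trivialFlip_smooth A B C
      contMDiff_invFun := trivialFlip_smooth B A C }

variable {A B C} in
/-- The element `(a, b, c)` of `A ⊕ B ⊕ C`. -/
def trivialMk {m : M} (a : A.fib m) (b : B.fib m) (c : C.fib m) :
    (trivialOver B A C).Tot := ⟨⟨m, b⟩, (a, c)⟩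

theorem trivial_isSumA {x y z : (trivialPre A B C).Tot} (h : (trivialPre A B C).IsSumA x y z) :
    ∃ (m : M) (a : A.fib m) (b b' : B.fib m) (c c' : C.fib m), x = trivialMk a b c ∧
      y = trivialMk a b' c' ∧ z = trivialMk a (b + b') (c + c') := by
  obtain ⟨p, s, t, hx, hy, hz⟩ := h
  exact ⟨p.proj, p.2, s.1, t.1, s.2, t.2, congrArg (trivialFlip B A C) hx,
    congrArg (trivialFlip B A C) hy, congrArg (trivialFlip B A C) hz⟩

theorem trivial_isSumB {x y z : (trivialPre A B C).Tot} (h : (trivialPre A B C).IsSumB x y z) :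
    ∃ (m : M) (b : B.fib m) (a a' : A.fib m) (c c' : C.fib m), x = trivialMk a b c ∧
      y = trivialMk a' b c' ∧ z = trivialMk (a + a') b (c + c') := by
  obtain ⟨p, s, t, hx, hy, hz⟩ := h
  exact ⟨p.proj, p.2, s.1, t.1, s.2, t.2, hx, hy, hz⟩

/-- The trivial double vector bundle `A ⊕ B ⊕ C` with core `C`. -/
def trivial : DVB A B where
  toPreDVB := trivialPre A B C
  square _ := rfl
  qB_add x y z h := by
    obtain ⟨m, a, b, b', c, c', rfl, rfl, rfl⟩ := trivial_isSumA A B C h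
    exact ⟨m, b, b', rfl, rfl, rfl⟩
  qB_scale _ _ := rfl
  qA_add x y z h := by
    obtain ⟨m, b, a, a', c, c', rfl, rfl, rfl⟩ := trivial_isSumB A B C h
    exact ⟨m, a, a', rfl, rfl, rfl⟩
  interchange x₁ y₁ z₁ x₂ y₂ z₂ x₃ y₃ z₃ h₁ h₂ hx hy hz := by
    obtain ⟨m, b, a, a', c, c', rfl, rfl, rfl⟩ := trivial_isSumB A B C h₁
    obtain ⟨m', b₂, a₂, a₂', c₂, c₂', rfl, rfl, rfl⟩ := trivial_isSumB A B C h₂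
    obtain ⟨n, α, β, β', γ, γ', e₁, e₂, rfl⟩ := trivial_isSumA A B C hx
    obtain ⟨n', α', β₂, β₂', γ₂, γ₂', e₃, e₄, rfl⟩ := trivial_isSumA A B C hy
    obtain ⟨n'', α'', β₃, β₃', γ₃, γ₃', e₅, e₆, rfl⟩ := trivial_isSumA A B C hz
    cases e₁; cases e₂; cases e₃; cases e₄; cases e₅; cases e₆
    exact ⟨⟨m, _⟩, (a, _), (a', _), rfl, rfl,
      congrArg (trivialMk (a + a') _) (add_add_add_comm _ _ _ _)⟩
  scale_interchange r x y z h := by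
    obtain ⟨m, b, a, a', c, c', rfl, rfl, rfl⟩ := trivial_isSumB A B C h
    refine ⟨⟨m, r • b⟩, (a, r • c), (a', r • c'), rfl, rfl, ?_⟩
    change trivialMk (a + a') (r • b) (r • (c + c')) = _
    rw [smul_add]
    rfl

end DVB

/-! ### VB-algebroids -/

namespace VB

/-- `w` is the sum of `u` and `v` in the vector bundle `TB → TM`, whose addition is the tangent map
of the addition `B ×_M B → B`. -/
def IsTangentSum (B : VB.{u} I M) (u v w : TangentBundle B.IT B.Tot) : Prop :=
  ∃ ξ : TangentBundle (B.prod B).IT (B.prod B).Tot,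
    tangentMap (B.prod B).IT B.IT (fun x => (⟨x.proj, x.2.1⟩ : B.Tot)) ξ = u ∧
    tangentMap (B.prod B).IT B.IT (fun x => (⟨x.proj, x.2.2⟩ : B.Tot)) ξ = v ∧
    tangentMap (B.prod B).IT B.IT (fun x => (⟨x.proj, x.2.1 + x.2.2⟩ : B.Tot)) ξ = w

/-- Scalar multiplication in the vector bundle `TB → TM`. -/
def tangentScale (B : VB.{u} I M) (r : ℝ) (w : TangentBundle B.IT B.Tot) :
    TangentBundle B.IT B.Tot :=
  tangentMap B.IT B.IT (B.scale r) w

/-- The linear function on the total space of `B` defined by `ψ`. -/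
def linearFun (B : VB.{u} I M) (ψ : ∀ m, B.fib m →ₗ[ℝ] ℝ) (b : B.Tot) : ℝ := ψ b.proj b.2

end VB

namespace DVB

variable {A B : VB.{u} I M} (D : DVB A B)

/-- The section `X` of `D → B` is linear and covers the section `a` of `A`, that is, it is a vector
bundle morphism from `B → M` to `D → A` over `a`. -/
structure IsLinearSection (X : D.overB.Sec) (a : A.Sec) : Prop where
  covers : ∀ b : B.Tot, D.qA ⟨b, X b⟩ = ⟨b.proj, a b.proj⟩
  add : ∀ b b' b'' : B.Tot, B.IsSum b b' b'' → D.IsSumA ⟨b, X b⟩ ⟨b', X b'⟩ ⟨b'', X b''⟩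
  scale : ∀ (r : ℝ) (b : B.Tot), (⟨B.scale r b, X (B.scale r b)⟩ : D.Tot) = D.scaleA r ⟨b, X b⟩

/-- The section `X` of `D → B` is a core section: there is a smooth section `c` of the core, the
part of `D` that projects to zero in `A` and in `B`, such that `X(b)` is the sum over `A` of `c` and
the zero of `D → B` at `b`. -/
def IsCoreSection (X : D.overB.Sec) : Prop :=
  ∃ c : M → D.Tot, ContMDiff I D.overB.IT ∞ c ∧
    (∀ m, D.qA (c m) = ⟨m, 0⟩ ∧ D.qB (c m) = ⟨m, 0⟩) ∧
    ∀ b : B.Tot, D.IsSumA ⟨b, 0⟩ (c b.proj) ⟨b, X b⟩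

variable (A B) in
/-- The linear section `h(a) : b ↦ (a, b, 0)` of the trivial double vector bundle. -/
def liftSec (C : VB.{u} I M) (a : A.Sec) : (trivial A B C).overB.Sec :=
  ⟨fun b => (a b.proj, 0), (contMDiff_trivialOver_iff (A := A) (B := B) (C := C) _).2
    ⟨contMDiff_id, (a.contMDiff.comp B.projMap.contMDiff :),
      (C.contMDiff_zero.comp B.projMap.contMDiff :)⟩⟩

variable (A B) in
/-- The core section `b ↦ (0, b, c)` of the trivial double vector bundle. -/
def coreSec {C : VB.{u} I M} (c : C.Sec) : (trivial A B C).overB.Sec :=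
  ⟨fun b => (0, c b.proj), (contMDiff_trivialOver_iff (A := A) (B := B) (C := C) _).2
    ⟨contMDiff_id, (A.contMDiff_zero.comp B.projMap.contMDiff :),
      (c.contMDiff.comp B.projMap.contMDiff :)⟩⟩

end DVB

/-- `(F_ver, F_hor, F_c, Φ)` are the components of the morphism `F` between trivial double vector
bundles: `F(a, b, c) = (F_ver a, F_hor b, F_c c + Φ_a b)`. -/
def DVBHom.HasComponents {A B C A' B' C' : VB.{u} I M}
    (F : DVBHom (DVB.trivial A B C) (DVB.trivial A' B' C')) (Fver : BundleMap A A')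
    (Fhor : BundleMap B B') (Fc : BundleMap C C') (Φ : BilinMap A B C') : Prop :=
  F.ver = Fver ∧ F.hor = Fhor ∧ ∀ (m : M) (a : A.fib m) (b : B.fib m) (c : C.fib m),
    F.homB.total (DVB.trivialMk a b c) =
      DVB.trivialMk (Fver.fib m a) (Fhor.fib m b) (Fc.fib m c + Φ.fib m a b)

variable [IsManifold I ∞ M]

/-- The Lie algebroid structure `LD` on `D → B` makes `(D → B; A → M)` a VB-algebroid with base Lie
algebroid `LA`. The first three conditions say that the anchor `D → TB` is a vector bundle morphism
from `D → A` to `TB → TM` over the anchor `A → TM`. -/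
structure DVB.IsVBAlgebroid {A B : VB.{u} I M} (D : DVB A B) (LA : LieAlgebroid A)
    (LD : LieAlgebroid D.overB) : Prop where
  anchor_covers : ∀ d : D.Tot,
    tangentMap B.IT I TotalSpace.proj (LD.anchorTotal d) = LA.anchorTotal (D.qA d)
  anchor_add : ∀ x y z : D.Tot, D.IsSumA x y z →
    B.IsTangentSum (LD.anchorTotal x) (LD.anchorTotal y) (LD.anchorTotal z)
  anchor_scale : ∀ (r : ℝ) (d : D.Tot),
    LD.anchorTotal (D.scaleA r d) = B.tangentScale r (LD.anchorTotal d)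
  linear_linear : ∀ X Y a a', D.IsLinearSection X a → D.IsLinearSection Y a' →
    D.IsLinearSection (LD.bracket X Y) (LA.bracket a a')
  linear_core : ∀ X Y a, D.IsLinearSection X a → D.IsCoreSection Y →
    D.IsCoreSection (LD.bracket X Y)
  core_core : ∀ X Y, D.IsCoreSection X → D.IsCoreSection Y → LD.bracket X Y = 0

/-- The structure operators `V = (∂, ∇⁰, ∇¹, K)` on `C_{[0]} ⊕ B_{[1]}` and the Lie algebroid
structure `LD` on the trivial double vector bundle `A ⊕ B ⊕ C` correspond to each other. On
functions pulled back from `M` and on linear functions `ψ`, the anchor of `h(a)` acts as the linear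
vector field defined by the dual of `∇¹_a`, and the anchor of the core section of `c` acts as the
vertical lift of `∂ c`. -/
structure IsAssociated {A B C : VB.{u} I M} (LA : LieAlgebroid A) (V : StructureOperators A B C)
    (LD : LieAlgebroid (DVB.trivial A B C).overB) : Prop where
  anchor_lift_pullback : ∀ (a : A.Sec) (g : M → ℝ), ContMDiff I 𝓘(ℝ) ∞ g → ∀ b : B.Tot,
    LD.deriv (DVB.liftSec A B C a) (fun x => g x.proj) b = LA.deriv a g b.proj
  anchor_lift_linear : ∀ (a : A.Sec) (ψ : ∀ m, B.fib m →ₗ[ℝ] ℝ),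
    ContMDiff B.IT 𝓘(ℝ) ∞ (B.linearFun ψ) → ∀ (β : B.Sec) (m : M),
      LD.deriv (DVB.liftSec A B C a) (B.linearFun ψ) ⟨m, β m⟩ =
        LA.deriv a (fun x => ψ x (β x)) m - ψ m (V.nabla₁ a β m)
  anchor_core_pullback : ∀ (c : C.Sec) (g : M → ℝ), ContMDiff I 𝓘(ℝ) ∞ g → ∀ b : B.Tot,
    LD.deriv (DVB.coreSec A B c) (fun x => g x.proj) b = 0
  anchor_core_linear : ∀ (c : C.Sec) (ψ : ∀ m, B.fib m →ₗ[ℝ] ℝ),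
    ContMDiff B.IT 𝓘(ℝ) ∞ (B.linearFun ψ) → ∀ b : B.Tot,
      LD.deriv (DVB.coreSec A B c) (B.linearFun ψ) b = ψ b.proj (V.bd.fib b.proj (c b.proj))
  bracket_core_core : ∀ c c' : C.Sec, LD.bracket (DVB.coreSec A B c) (DVB.coreSec A B c') = 0
  bracket_lift_core : ∀ (a : A.Sec) (c : C.Sec),
    LD.bracket (DVB.liftSec A B C a) (DVB.coreSec A B c) = DVB.coreSec A B (V.nabla₀ a c)
  bracket_lift_lift : ∀ (a a' : A.Sec) (b : B.Tot),
    LD.bracket (DVB.liftSec A B C a) (DVB.liftSec A B C a') b =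
      (LA.bracket a a' b.proj, V.K.fib b.proj (a b.proj) (a' b.proj) b.2)

/-- A morphism of double vector bundles `F : D → D'` between VB-algebroids is a VB-algebroid
morphism if it is a Lie algebroid morphism from `D → B` to `D' → B'`. -/
def DVBHom.IsVBAlgebroidMorphism {A B A' B' : VB.{u} I M} {D : DVB A B} {D' : DVB A' B'}
    (F : DVBHom D D') (LD : LieAlgebroid D.overB) (LD' : LieAlgebroid D'.overB) : Prop :=
  LD.IsMorphism LD' F.homB

/-! ### The two categories -/

/-- A two-term representation up to homotopy of the Lie algebroid `L`. -/
structure TwoTermRep {A : VB.{u} I M} (L : LieAlgebroid A) where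
  /-- the part in degree `1` -/
  B : VB.{u} I M
  /-- the part in degree `0` -/
  C : VB.{u} I M
  /-- the structure operators -/
  ops : StructureOperators A B C
  isRepresentation : ops.IsRepresentation L

namespace TwoTermRep

variable {A : VB.{u} I M} {L : LieAlgebroid A}

/-- A morphism of two-term representations up to homotopy of `L`. -/
@[ext] structure Hom (V W : TwoTermRep L) where
  /-- the component in degree `0` -/
  φ₀ : BundleMap V.C W.C
  /-- the component in degree `1` -/
  φ₁ : BundleMap V.B W.B
  /-- the component in `Ω¹(A, Hom(V₁, W₀))` -/
  Φ : BilinMap A V.B W.C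
  isMorphism : V.ops.IsMorphism L W.ops φ₀ φ₁ Φ

theorem _root_.LieAlgebroid.IsConnection.map_zero {V : VB.{u} I M} {D : A.Sec → V.Sec → V.Sec}
    (h : L.IsConnection D) (a : A.Sec) : D a 0 = 0 := by
  have := h.add_right a 0 0
  simpa using this

/-- The identity morphism. -/
def Hom.id (V : TwoTermRep L) : Hom V V where
  φ₀ := BundleMap.id V.C
  φ₁ := BundleMap.id V.B
  Φ := ⟨fun _ => 0, fun _ _ => V.C.contMDiff_zero⟩
  isMorphism :=
    { bd_comm := fun _ => rfl
      nabla₀_comm := fun a c => sub_self (V.ops.nabla₀ a c)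
      nabla₁_comm := fun a b => by
        refine (sub_self (V.ops.nabla₁ a b)).trans ?_
        ext x
        exact ((V.ops.bd.fib x).map_zero).symm
      K_comm := fun a₁ a₂ b => by
        have h : ∀ a, V.ops.nabla₀ a 0 = 0 := V.isRepresentation.connection₀.map_zero
        change V.ops.nabla₀ a₁ 0 - 0 - (V.ops.nabla₀ a₂ 0 - 0) - 0 =
          V.ops.K.onSec a₁ a₂ b - V.ops.K.onSec a₁ a₂ b
        simp [h] }

/-- Composition, `f` first. -/
def Hom.comp {V W Y : TwoTermRep L} (f : Hom V W) (g : Hom W Y) : Hom V Y where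
  φ₀ := f.φ₀.comp g.φ₀
  φ₁ := f.φ₁.comp g.φ₁
  Φ := ⟨fun x => (f.Φ.fib x).compr₂ (g.φ₀.fib x) + (g.Φ.fib x).compl₂ (f.φ₁.fib x),
    fun s t => (g.φ₀.onSec (f.Φ.onSec s t) + g.Φ.onSec s (f.φ₁.onSec t)).contMDiff⟩
  isMorphism := by
    have hf := f.isMorphism
    have hg := g.isMorphism
    have sub₀ : ∀ s t, g.φ₀.onSec (s - t) = g.φ₀.onSec s - g.φ₀.onSec t :=
      fun s t => by ext x; exact (g.φ₀.fib x).map_sub _ _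
    have sub₁ : ∀ s t, g.φ₁.onSec (s - t) = g.φ₁.onSec s - g.φ₁.onSec t :=
      fun s t => by ext x; exact (g.φ₁.fib x).map_sub _ _
    have subΦ : ∀ a s t, g.Φ.onSec a (s - t) = g.Φ.onSec a s - g.Φ.onSec a t :=
      fun a s t => by ext x; exact (g.Φ.fib x (a x)).map_sub _ _
    have addY : ∀ s t, Y.ops.bd.onSec (s + t) = Y.ops.bd.onSec s + Y.ops.bd.onSec t :=
      fun s t => by ext x; exact (Y.ops.bd.fib x).map_add _ _
    constructor
    · intro c
      change g.φ₁.onSec (f.φ₁.onSec (V.ops.bd.onSec c)) =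
        Y.ops.bd.onSec (g.φ₀.onSec (f.φ₀.onSec c))
      rw [hf.bd_comm, hg.bd_comm]
    · intro a c
      change Y.ops.nabla₀ a (g.φ₀.onSec (f.φ₀.onSec c)) -
          g.φ₀.onSec (f.φ₀.onSec (V.ops.nabla₀ a c)) =
        g.φ₀.onSec (f.Φ.onSec a (V.ops.bd.onSec c)) +
          g.Φ.onSec a (f.φ₁.onSec (V.ops.bd.onSec c))
      rw [← hf.nabla₀_comm, hf.bd_comm, ← hg.nabla₀_comm, sub₀]
      abel
    · intro a b
      change Y.ops.nabla₁ a (g.φ₁.onSec (f.φ₁.onSec b)) -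
          g.φ₁.onSec (f.φ₁.onSec (V.ops.nabla₁ a b)) =
        Y.ops.bd.onSec (g.φ₀.onSec (f.Φ.onSec a b) + g.Φ.onSec a (f.φ₁.onSec b))
      rw [addY, ← hg.bd_comm, ← hf.nabla₁_comm, ← hg.nabla₁_comm, sub₁]
      abel
    · intro a₁ a₂ b
      change Y.ops.nabla₀ a₁ (g.φ₀.onSec (f.Φ.onSec a₂ b) + g.Φ.onSec a₂ (f.φ₁.onSec b)) -
          (g.φ₀.onSec (f.Φ.onSec a₂ (V.ops.nabla₁ a₁ b)) +
            g.Φ.onSec a₂ (f.φ₁.onSec (V.ops.nabla₁ a₁ b))) -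
        (Y.ops.nabla₀ a₂ (g.φ₀.onSec (f.Φ.onSec a₁ b) + g.Φ.onSec a₁ (f.φ₁.onSec b)) -
          (g.φ₀.onSec (f.Φ.onSec a₁ (V.ops.nabla₁ a₂ b)) +
            g.Φ.onSec a₁ (f.φ₁.onSec (V.ops.nabla₁ a₂ b)))) -
        (g.φ₀.onSec (f.Φ.onSec (L.bracket a₁ a₂) b) +
          g.Φ.onSec (L.bracket a₁ a₂) (f.φ₁.onSec b)) =
        g.φ₀.onSec (f.φ₀.onSec (V.ops.K.onSec a₁ a₂ b)) -
          Y.ops.K.onSec a₁ a₂ (g.φ₁.onSec (f.φ₁.onSec b))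
      have key : ∀ a a', Y.ops.nabla₀ a (g.φ₀.onSec (f.Φ.onSec a' b)) =
          g.φ₀.onSec (W.ops.nabla₀ a (f.Φ.onSec a' b)) +
            (g.Φ.onSec a (W.ops.nabla₁ a' (f.φ₁.onSec b)) -
              g.Φ.onSec a (f.φ₁.onSec (V.ops.nabla₁ a' b))) := by
        intro a a'
        rw [← subΦ, hf.nabla₁_comm, ← hg.nabla₀_comm]
        abel
      have h₁ := hg.K_comm a₁ a₂ (f.φ₁.onSec b)
      have h₂ := congrArg g.φ₀.onSec (hf.K_comm a₁ a₂ b)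
      simp only [StructureOperators.nablaHom, sub₀] at h₁ h₂
      rw [Y.isRepresentation.connection₀.add_right, Y.isRepresentation.connection₀.add_right,
        key, key, ← sub_eq_zero]
      rw [← sub_eq_zero] at h₁ h₂
      rw [← add_zero (0 : Y.C.Sec)]
      nth_rewrite 1 [← h₁]
      rw [← h₂]
      abel

instance : Category (TwoTermRep L) where
  Hom := Hom
  id := Hom.id
  comp := Hom.comp
  id_comp f := by
    refine Hom.ext rfl rfl (BilinMap.ext ?_)
    funext x
    ext a b
    change (Hom.φ₀ f).fib x 0 + (Hom.Φ f).fib x a b = _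
    rw [map_zero, zero_add]
  comp_id f := by
    refine Hom.ext rfl rfl (BilinMap.ext ?_)
    funext x
    ext a b
    exact add_zero _
  assoc f g h := by
    refine Hom.ext rfl rfl (BilinMap.ext ?_)
    funext x
    ext a b
    change (Hom.φ₀ h).fib x ((Hom.φ₀ g).fib x ((Hom.Φ f).fib x a b) +
      (Hom.Φ g).fib x a ((Hom.φ₁ f).fib x b)) + _ = (Hom.φ₀ h).fib x _ + (_ + _)
    rw [map_add, add_assoc]
    rfl

end TwoTermRep

/-- A VB-algebroid with side algebroid `L`. -/
structure VBAlgebroid {A : VB.{u} I M} (L : LieAlgebroid A) where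
  /-- the other side bundle -/
  B : VB.{u} I M
  /-- the double vector bundle -/
  D : DVB A B
  /-- the Lie algebroid structure on `D → B` -/
  LD : LieAlgebroid D.overB
  isVBAlgebroid : D.IsVBAlgebroid L LD

namespace VBAlgebroid

variable {A : VB.{u} I M} {L : LieAlgebroid A}

/-- A morphism of VB-algebroids with side algebroid `L`, inducing the identity of `A`. -/
@[ext] structure Hom (X Y : VBAlgebroid L) where
  /-- the morphism of double vector bundles -/
  map : DVBHom X.D Y.D
  ver_eq : map.ver = BundleMap.id A
  isMorphism : map.IsVBAlgebroidMorphism X.LD Y.LD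

/-- The identity morphism. -/
def Hom.id (X : VBAlgebroid L) : Hom X X where
  map := DVBHom.id X.D
  ver_eq := rfl
  isMorphism := LieAlgebroid.IsMorphism.id X.LD

/-- Composition, `f` first. -/
def Hom.comp {X Y Z : VBAlgebroid L} (f : Hom X Y) (g : Hom Y Z) : Hom X Z where
  map := f.map.comp g.map
  ver_eq := by
    change f.map.ver.comp g.map.ver = _
    rw [f.ver_eq, g.ver_eq]
    rfl
  isMorphism := LieAlgebroid.IsMorphism.comp f.isMorphism g.isMorphism

instance : Category (VBAlgebroid L) where
  Hom := Hom
  id := Hom.id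
  comp := Hom.comp
  id_comp f := Hom.ext (DVBHom.id_comp (Hom.map f))
  comp_id f := Hom.ext (DVBHom.comp_id (Hom.map f))
  assoc _ _ _ := Hom.ext rfl

end VBAlgebroid

end Double

end

/-! On D = A ⊕ B ⊕ C the sections h(a) and ĉ span every fibre of D → B, and near each point of B the
coordinates are sums of a function pulled back from M and a fibrewise linear function. A
VB-algebroid structure is therefore determined by how the anchors of h(a) and ĉ act on these two
kinds of functions and by the brackets of these sections. The axioms leave four unknowns: the
vertical vector of ĉ (this is ∂), the vertical part of the linear vector field of h(a) (∇¹), the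
core section [h(a), ĉ] (∇⁰) and the part of [h(a), h(a')] in Hom(B, C) (K). That the anchor respects
[h(a), ĉ] and [h(a), h(a')] amounts to ∂∇⁰ = ∇¹∂ and to the formula for the curvature of ∇¹. The
Jacobi identity on two lifts and a core section is the formula for the curvature of ∇⁰, and on three
lifts it is d_∇K = 0. The remaining cases are trivial, so these equations are sufficient as well as
necessary.

One principle recurs. If a section Z vanishes at a point, then [X, Z] at that point is the
derivative of Z along the anchor of X (`SkewAlgebroid.bracket_eq_sderiv`), and such a derivative
does not depend on a trivialization. It computes brackets with b ↦ (0, b, k(b)), which agrees at a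
given point with a core section; it makes the failure of the bracket condition for a morphism
tensorial; and it is the consistency condition for extending a bracket from generators to all
sections.

A bundle map F over f does not push sections forward. The bracket condition at x is therefore stated
with sections s, t of the target that agree with F(a), F(b) at f(x), corrected by the derivatives of
F(a) - s ∘ f and F(b) - t ∘ f. Together with the anchor condition this is equivalent to F^*
commuting with the differentials (`LieAlgebroid.isMorphism_iff`): degrees 0 and 1 yield the
conditions, and conversely the corrections cancel in the Koszul formula by
`AlternatingMap.sum_update_removeNth`. For trivial double vector bundles, evaluation on lifts and
core sections turns the conditions into the equations for the components of F (`anchor_iff`,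
`bracketDefect_lift_lift`, `bracketDefect_lift_core`).

In the other direction, ∂ and ∇¹ prescribe an anchor (`LieAlgebroid.IsConnection.exists_anchor`), ∇⁰
and K prescribe brackets of generators, `VB.exists_skewAlgebroid_of_generators` extends them, and
the Jacobi identity is checked on generators only
(`SkewAlgebroid.jacobiator_eq_zero_of_generators`). The resulting functor is full and faithful by
the criterion for components. It is essentially surjective because every double vector bundle is
isomorphic to a trivial one: a fibrewise linear function on D → B, differentiated at t = 0 along t ↦
t ·_A d, becomes linear for both structures and is unchanged on the core. A partition of unity glues
such functions to a map from D to the core (`DVB.exists_splitting`), which together with the two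
projections is an isomorphism by injectivity and equality of ranks. -/

noncomputable section

open Filter Topology

/-! ### Directional derivatives, frames, and derivatives of sections along a map -/

section Toolkit

variable {E : Type*} [NormedAddCommGroup E] [NormedSpace ℝ E] {H : Type*} [TopologicalSpace H]
  {I : ModelWithCorners ℝ E H} {N : Type*} [TopologicalSpace N] [ChartedSpace H N]
  {E' : Type*} [NormedAddCommGroup E'] [NormedSpace ℝ E'] {H' : Type*} [TopologicalSpace H']
  {I' : ModelWithCorners ℝ E' H'} {N' : Type*} [TopologicalSpace N'] [ChartedSpace H' N']

/-! ### Directional derivatives -/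

theorem dirDeriv_congr {g h : N → ℝ} {x : N} (hgh : g =ᶠ[𝓝 x] h) (v : TangentSpace I x) :
    dirDeriv I g v = dirDeriv I h v := by
  unfold dirDeriv
  rw [hgh.mfderiv_eq]
  rfl

theorem dirDeriv_const (c : ℝ) {x : N} (v : TangentSpace I x) :
    dirDeriv I (fun _ => c) v = 0 := by
  unfold dirDeriv
  rw [mfderiv_const]
  rfl

theorem dirDeriv_add {g h : N → ℝ} {x : N} (hg : MDifferentiableAt I 𝓘(ℝ) g x)
    (hh : MDifferentiableAt I 𝓘(ℝ) h x) (v : TangentSpace I x) :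
    dirDeriv I (fun y => g y + h y) v = dirDeriv I g v + dirDeriv I h v := by
  unfold dirDeriv
  exact DFunLike.congr_fun (hg.hasMFDerivAt.add hh.hasMFDerivAt).mfderiv v

theorem dirDeriv_sub {g h : N → ℝ} {x : N} (hg : MDifferentiableAt I 𝓘(ℝ) g x)
    (hh : MDifferentiableAt I 𝓘(ℝ) h x) (v : TangentSpace I x) :
    dirDeriv I (fun y => g y - h y) v = dirDeriv I g v - dirDeriv I h v := by
  unfold dirDeriv
  exact DFunLike.congr_fun (hg.hasMFDerivAt.sub hh.hasMFDerivAt).mfderiv v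

theorem dirDeriv_mul {g h : N → ℝ} {x : N} (hg : MDifferentiableAt I 𝓘(ℝ) g x)
    (hh : MDifferentiableAt I 𝓘(ℝ) h x) (v : TangentSpace I x) :
    dirDeriv I (fun y => g y * h y) v = g x * dirDeriv I h v + h x * dirDeriv I g v := by
  unfold dirDeriv
  exact DFunLike.congr_fun (hg.hasMFDerivAt.mul hh.hasMFDerivAt).mfderiv v

theorem mdifferentiableAt_finsetSum {ι : Type*} (t : Finset ι) {g : ι → N → ℝ} {x : N}
    (hg : ∀ i ∈ t, MDifferentiableAt I 𝓘(ℝ) (g i) x) :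
    MDifferentiableAt I 𝓘(ℝ) (fun y => ∑ i ∈ t, g i y) x := by
  classical
  induction t using Finset.induction_on with
  | empty => simpa using mdifferentiableAt_const
  | insert a t ha ih =>
    simp only [Finset.sum_insert ha]
    exact (hg a (Finset.mem_insert_self _ _)).add (ih fun i hi => hg i (Finset.mem_insert_of_mem hi))

theorem dirDeriv_sum {ι : Type*} (t : Finset ι) {g : ι → N → ℝ} {x : N}
    (hg : ∀ i ∈ t, MDifferentiableAt I 𝓘(ℝ) (g i) x) (v : TangentSpace I x) :
    dirDeriv I (fun y => ∑ i ∈ t, g i y) v = ∑ i ∈ t, dirDeriv I (g i) v := by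
  classical
  induction t using Finset.induction_on with
  | empty => simpa using dirDeriv_const 0 v
  | insert a t ha ih =>
    have h1 := fun i hi => hg i (Finset.mem_insert_of_mem hi)
    simp only [Finset.sum_insert ha]
    rw [dirDeriv_add (hg a (Finset.mem_insert_self _ _)) (mdifferentiableAt_finsetSum t h1), ih h1]

theorem dirDeriv_comp {g : N' → ℝ} {f : N → N'} {x : N} (hg : MDifferentiableAt I' 𝓘(ℝ) g (f x))
    (hf : MDifferentiableAt I I' f x) (v : TangentSpace I x) :
    dirDeriv I (fun y => g (f y)) v = dirDeriv I' g (mfderiv I I' f x v) := by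
  unfold dirDeriv
  exact DFunLike.congr_fun (mfderiv_comp x hg hf) v

theorem ContMDiff.mdiffAt {g : N → N'} (hg : ContMDiff I I' ∞ g) (x : N) :
    MDifferentiableAt I I' g x := hg.mdifferentiableAt (by simp)

theorem exists_bump [FiniteDimensional ℝ E] [T2Space N] [IsManifold I ∞ N] (x₀ : N) {U : Set N}
    (hU : U ∈ 𝓝 x₀) : ∃ χ : N → ℝ, ContMDiff I 𝓘(ℝ) ∞ χ ∧ χ =ᶠ[𝓝 x₀] 1 ∧ tsupport χ ⊆ U := by
  obtain ⟨f, -, hf⟩ := (SmoothBumpFunction.nhds_basis_tsupport (I := I) x₀).mem_iff.1 hU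
  exact ⟨f, f.contMDiff, f.eventuallyEq_one, hf⟩

namespace VB

/-- The product of a smooth function and a section. -/
def smulSec (V : VB.{u} I N) (g : N → ℝ) (hg : ContMDiff I 𝓘(ℝ) ∞ g) (s : V.Sec) : V.Sec :=
  ⟨fun x => g x • s x, hg.smul_section s.contMDiff⟩

@[simp] theorem smulSec_apply (V : VB.{u} I N) (g : N → ℝ) (hg : ContMDiff I 𝓘(ℝ) ∞ g) (s : V.Sec)
    (x : N) : V.smulSec g hg s x = g x • s x := rfl

/-- Global sections and fibrewise linear functions which are dual frames near `x₀`. -/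
structure Frame (V : VB.{u} I N) (x₀ : N) where
  n : ℕ
  sec : Fin n → V.Sec
  coef : Fin n → ∀ x, V.fib x →ₗ[ℝ] ℝ
  cut : N → ℝ
  smooth_coef : ∀ i, ContMDiff V.IT 𝓘(ℝ) ∞ (fun v : V.Tot => coef i v.proj v.2)
  smooth_cut : ContMDiff I 𝓘(ℝ) ∞ cut
  cut_eq : cut =ᶠ[𝓝 x₀] 1
  sum_eq : ∀ x (v : V.fib x), cut x • v = ∑ i, coef i x v • sec i x

theorem Frame.cut_self {V : VB.{u} I N} {x₀ : N} (fr : V.Frame x₀) : fr.cut x₀ = 1 := fr.cut_eq.eq_of_nhds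

theorem Frame.sum_self {V : VB.{u} I N} {x₀ : N} (fr : V.Frame x₀) (v : V.fib x₀) :
    v = ∑ i, fr.coef i x₀ v • fr.sec i x₀ := by
  rw [← fr.sum_eq, fr.cut_self, one_smul]

theorem Frame.eventually_sum {V : VB.{u} I N} {x₀ : N} (fr : V.Frame x₀) :
    ∀ᶠ x in 𝓝 x₀, ∀ v : V.fib x, v = ∑ i, fr.coef i x v • fr.sec i x := by
  filter_upwards [fr.cut_eq] with x hx v
  rw [← fr.sum_eq, hx, Pi.one_apply, one_smul]

/-- A local frame and its dual coordinates are both multiplied by the same bump function χ and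
extended by zero. Their contraction is then χ² times the identity on the whole of N, which is why
`sum_eq` holds globally with a factor `cut` that equals 1 only near x₀. -/
theorem nonempty_frame [FiniteDimensional ℝ E] [T2Space N] [IsManifold I ∞ N] (V : VB.{u} I N)
    (x₀ : N) : Nonempty (V.Frame x₀) := by
  let e := trivializationAt V.F V.fib x₀
  let b := Module.finBasis ℝ V.F
  have hx₀ : x₀ ∈ e.baseSet := mem_baseSet_trivializationAt _ _ _
  obtain ⟨χ, hχ, hχ1, hsupp⟩ := exists_bump (I := I) x₀ (e.open_baseSet.mem_nhds hx₀)
  have hz : ∀ x, x ∉ e.baseSet → χ x = 0 := fun x hx =>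
    image_eq_zero_of_notMem_tsupport fun h => hx (hsupp h)
  let w : Fin (Module.finrank ℝ V.F) → V.Sec := fun i =>
    ⟨χ • e.localFrame b i, (hχ.contMDiffOn).smul_section_of_tsupport e.open_baseSet hsupp
      (e.contMDiffOn_localFrame_baseSet ∞ b i)⟩
  let cf : Fin (Module.finrank ℝ V.F) → ∀ x, V.fib x →ₗ[ℝ] ℝ := fun i x =>
    χ x • ((b.coord i).comp (e.linearMapAt ℝ x))
  refine ⟨⟨_, w, cf, fun x => χ x * χ x, ?_, hχ.mul hχ, ?_, ?_⟩⟩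
  · intro i v₀
    by_cases h : v₀.proj ∈ tsupport χ
    · have hv : v₀.proj ∈ e.baseSet := hsupp h
      have h1 : ContMDiffAt V.IT 𝓘(ℝ) ∞ (fun v : V.Tot => χ v.proj * b.coord i (e v).2) v₀ := by
        refine ((hχ.comp (contMDiff_proj V.fib)).contMDiffAt).mul ?_
        have h2 := (e.contMDiffOn (IB := I) (n := ∞)).contMDiffAt
          (e.open_source.mem_nhds (e.mem_source.2 hv))
        have h3 := h2.snd
        exact (((LinearMap.toContinuousLinearMap (b.coord i)).contMDiff.contMDiffAt).comp v₀ h3 :)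
      refine h1.congr_of_eventuallyEq ?_
      have : ∀ᶠ v : V.Tot in 𝓝 v₀, v.proj ∈ e.baseSet :=
        (FiberBundle.continuous_proj V.F V.fib).continuousAt.preimage_mem_nhds
          (e.open_baseSet.mem_nhds hv)
      filter_upwards [this] with v hv
      simp [cf, hv]
    · refine (contMDiffAt_const (c := (0 : ℝ))).congr_of_eventuallyEq ?_
      have : ∀ᶠ v : V.Tot in 𝓝 v₀, v.proj ∈ (tsupport χ)ᶜ :=
        (FiberBundle.continuous_proj V.F V.fib).continuousAt.preimage_mem_nhds
          ((isClosed_tsupport χ).isOpen_compl.mem_nhds h)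
      filter_upwards [this] with v hv
      simp [cf, image_eq_zero_of_notMem_tsupport hv]
  · filter_upwards [hχ1] with x hx
    simp [hx]
  · intro x v
    by_cases hx : x ∈ e.baseSet
    · have h1 : ∀ i, cf i x v • w i x = (χ x * χ x) • ((e.basisAt b hx).repr v i • e.basisAt b hx i) := by
        intro i
        change (χ x * b.coord i (e.linearMapAt ℝ x v)) • (χ x • e.localFrame b i x) = _
        rw [e.localFrame_apply_of_mem_baseSet b hx, smul_smul, smul_smul]
        congr 1
        simp [Trivialization.basisAt, e.linearMapAt_apply, hx]
        ring
      simp_rw [h1, ← Finset.smul_sum]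
      rw [(e.basisAt b hx).sum_repr v]
    · simp [cf, hz x hx]

end VB
namespace VB

theorem sum_apply (V : VB.{u} I N) {ι : Type*} (t : Finset ι) (s : ι → V.Sec) (x : N) :
    (∑ i ∈ t, s i) x = ∑ i ∈ t, s i x := by
  classical
  induction t using Finset.induction_on with
  | empty => rfl
  | insert a t ha ih => rw [Finset.sum_insert ha, Finset.sum_insert ha, ← ih]; rfl

namespace Frame

variable {V : VB.{u} I N} {x₀ : N} (fr : V.Frame x₀)

theorem smooth_coefSec (i : Fin fr.n) (s : V.Sec) :
    ContMDiff I 𝓘(ℝ) ∞ (fun x => fr.coef i x (s x)) :=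
  ((fr.smooth_coef i).comp s.contMDiff :)

theorem smulSec_cut (s : V.Sec) : V.smulSec fr.cut fr.smooth_cut s =
    ∑ i, V.smulSec (fun x => fr.coef i x (s x)) (fr.smooth_coefSec i s) (fr.sec i) := by
  ext x
  rw [V.sum_apply]
  exact fr.sum_eq x (s x)

end Frame

section Pointwise

variable [FiniteDimensional ℝ E] [T2Space N] [IsManifold I ∞ N] (V : VB.{u} I N)

/-- A frame near `x`. -/
def frame (x : N) : V.Frame x := (V.nonempty_frame x).some

/-- A global section through a given vector. -/
def secThrough {x : N} (v : V.fib x) : V.Sec :=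
  ∑ i, (V.frame x).coef i x v • (V.frame x).sec i

@[simp] theorem secThrough_self {x : N} (v : V.fib x) : V.secThrough v x = v := by
  rw [secThrough, V.sum_apply]
  exact ((V.frame x).sum_self v).symm

/-- Since `cut` is 1 at x, T s equals T of the section cut • s, which is a combination of the frame
with smooth global coefficients. The locality of T never has to be proved separately. -/
theorem exists_linear_of_tensorial {G : Type*} [AddCommGroup G] [Module ℝ G] (x : N) (T : V.Sec → G)
    (hadd : ∀ s t, T (s + t) = T s + T t)
    (hsmul : ∀ g (hg : ContMDiff I 𝓘(ℝ) ∞ g) s, T (V.smulSec g hg s) = g x • T s) :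
    ∃ ℓ : V.fib x →ₗ[ℝ] G, ∀ s, T s = ℓ (s x) := by
  let fr := V.frame x
  refine ⟨∑ i, (fr.coef i x).smulRight (T (fr.sec i)), fun s => ?_⟩
  have h0 : T s = T (V.smulSec fr.cut fr.smooth_cut s) := by
    rw [hsmul, fr.cut_self, one_smul]
  let T' : V.Sec →+ G := AddMonoidHom.mk' T hadd
  rw [h0, fr.smulSec_cut]
  change T' _ = _
  rw [map_sum]
  simp only [LinearMap.coe_sum, Finset.sum_apply, LinearMap.smulRight_apply]
  exact Finset.sum_congr rfl fun i _ => hsmul _ _ _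

theorem tensorial_eq_zero {G : Type*} [AddCommGroup G] [Module ℝ G] (x : N) (T : V.Sec → G)
    (hadd : ∀ s t, T (s + t) = T s + T t)
    (hsmul : ∀ g (hg : ContMDiff I 𝓘(ℝ) ∞ g) s, T (V.smulSec g hg s) = g x • T s)
    {s : V.Sec} (h : s x = 0) : T s = 0 := by
  obtain ⟨ℓ, hℓ⟩ := V.exists_linear_of_tensorial x T hadd hsmul
  rw [hℓ, h, map_zero]

theorem ext_linearFun {x : N} {v w : V.fib x}
    (h : ∀ ψ : ∀ m, V.fib m →ₗ[ℝ] ℝ, ContMDiff V.IT 𝓘(ℝ) ∞ (V.linearFun ψ) → ψ x v = ψ x w) :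
    v = w := by
  rw [(V.frame x).sum_self v, (V.frame x).sum_self w]
  exact Finset.sum_congr rfl fun i _ => by rw [h _ ((V.frame x).smooth_coef i)]

end Pointwise

/-- The coordinates of the vectors over `x` in the preferred trivialization at `x₀`. -/
def coord (V : VB.{u} I N) (x₀ x : N) : V.fib x →ₗ[ℝ] V.F :=
  (trivializationAt V.F V.fib x₀).linearMapAt ℝ x

/-- The vector over `x` with given coordinates in the preferred trivialization at `x₀`. -/
def coordSymm (V : VB.{u} I N) (x₀ x : N) : V.F →ₗ[ℝ] V.fib x :=
  (trivializationAt V.F V.fib x₀).symmₗ ℝ x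

theorem coordSymm_coord (V : VB.{u} I N) {x₀ x : N}
    (hx : x ∈ (trivializationAt V.F V.fib x₀).baseSet) (v : V.fib x) :
    V.coordSymm x₀ x (V.coord x₀ x v) = v :=
  (trivializationAt V.F V.fib x₀).symmₗ_linearMapAt hx v

theorem coord_coordSymm (V : VB.{u} I N) {x₀ x : N}
    (hx : x ∈ (trivializationAt V.F V.fib x₀).baseSet) (v : V.F) :
    V.coord x₀ x (V.coordSymm x₀ x v) = v :=
  (trivializationAt V.F V.fib x₀).linearMapAt_symmₗ hx v

theorem coord_eq (V : VB.{u} I N) {x₀ x : N}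
    (hx : x ∈ (trivializationAt V.F V.fib x₀).baseSet) (v : V.fib x) :
    V.coord x₀ x v = (trivializationAt V.F V.fib x₀ ⟨x, v⟩).2 := by
  simp [coord, Trivialization.linearMapAt_apply, hx]

theorem contMDiffAt_iff_coord (V : VB.{u} I' N') {f : N → N'} {ξ : ∀ x, V.fib (f x)} {x₀ : N} {p : N'}
    (hp : f x₀ ∈ (trivializationAt V.F V.fib p).baseSet) :
    ContMDiffAt I V.IT ∞ (fun x => (⟨f x, ξ x⟩ : V.Tot)) x₀ ↔
      ContMDiffAt I I' ∞ f x₀ ∧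
        ContMDiffAt I 𝓘(ℝ, V.F) ∞ (fun x => V.coord p (f x) (ξ x)) x₀ := by
  rw [(trivializationAt V.F V.fib p).contMDiffAt_iff (IB := I')
    ((trivializationAt V.F V.fib p).mem_source.2 hp)]
  refine and_congr_right fun hf => ?_
  refine Filter.EventuallyEq.contMDiffAt_iff ?_
  filter_upwards [hf.continuousAt.preimage_mem_nhds
    ((trivializationAt V.F V.fib p).open_baseSet.mem_nhds hp)] with x hx
  rw [V.coord_eq hx]

theorem contMDiffAt_iff_coord_self (V : VB.{u} I' N') {f : N → N'} {ξ : ∀ x, V.fib (f x)} {x₀ : N} :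
    ContMDiffAt I V.IT ∞ (fun x => (⟨f x, ξ x⟩ : V.Tot)) x₀ ↔
      ContMDiffAt I I' ∞ f x₀ ∧
        ContMDiffAt I 𝓘(ℝ, V.F) ∞ (fun x => V.coord (f x₀) (f x) (ξ x)) x₀ :=
  V.contMDiffAt_iff_coord (mem_baseSet_trivializationAt _ _ _)

section Along

variable {V : VB.{u} I' N'} {f : N → N'} {ξ η : ∀ x, V.fib (f x)} {x₀ : N}

theorem contMDiffAt_add (hξ : ContMDiffAt I V.IT ∞ (fun x => (⟨f x, ξ x⟩ : V.Tot)) x₀)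
    (hη : ContMDiffAt I V.IT ∞ (fun x => (⟨f x, η x⟩ : V.Tot)) x₀) :
    ContMDiffAt I V.IT ∞ (fun x => (⟨f x, ξ x + η x⟩ : V.Tot)) x₀ := by
  rw [contMDiffAt_iff_coord_self] at *
  refine ⟨hξ.1, ?_⟩
  simp only [map_add]
  exact hξ.2.add hη.2

theorem contMDiffAt_sub (hξ : ContMDiffAt I V.IT ∞ (fun x => (⟨f x, ξ x⟩ : V.Tot)) x₀)
    (hη : ContMDiffAt I V.IT ∞ (fun x => (⟨f x, η x⟩ : V.Tot)) x₀) :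
    ContMDiffAt I V.IT ∞ (fun x => (⟨f x, ξ x - η x⟩ : V.Tot)) x₀ := by
  rw [contMDiffAt_iff_coord_self] at *
  refine ⟨hξ.1, ?_⟩
  simp only [map_sub]
  exact hξ.2.sub hη.2

theorem contMDiffAt_smul {g : N → ℝ} (hg : ContMDiffAt I 𝓘(ℝ) ∞ g x₀)
    (hξ : ContMDiffAt I V.IT ∞ (fun x => (⟨f x, ξ x⟩ : V.Tot)) x₀) :
    ContMDiffAt I V.IT ∞ (fun x => (⟨f x, g x • ξ x⟩ : V.Tot)) x₀ := by
  rw [contMDiffAt_iff_coord_self] at *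
  refine ⟨hξ.1, ?_⟩
  simp only [map_smul]
  exact hg.smul hξ.2

theorem contMDiffAt_zero (hf : ContMDiffAt I I' ∞ f x₀) :
    ContMDiffAt I V.IT ∞ (fun x => (⟨f x, 0⟩ : V.Tot)) x₀ :=
  (V.contMDiff_zero.contMDiffAt.comp x₀ hf :)

theorem contMDiffAt_sum {ι : Type*} (t : Finset ι) {ζ : ι → ∀ x, V.fib (f x)}
    (hf : ContMDiffAt I I' ∞ f x₀)
    (hζ : ∀ i ∈ t, ContMDiffAt I V.IT ∞ (fun x => (⟨f x, ζ i x⟩ : V.Tot)) x₀) :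
    ContMDiffAt I V.IT ∞ (fun x => (⟨f x, ∑ i ∈ t, ζ i x⟩ : V.Tot)) x₀ := by
  classical
  induction t using Finset.induction_on with
  | empty => simpa using contMDiffAt_zero hf
  | insert a t ha ih =>
    simp only [Finset.sum_insert ha]
    exact contMDiffAt_add (hζ a (Finset.mem_insert_self _ _))
      (ih fun i hi => hζ i (Finset.mem_insert_of_mem hi))

theorem contMDiffAt_congr (h : ∀ᶠ x in 𝓝 x₀, ξ x = η x)
    (hξ : ContMDiffAt I V.IT ∞ (fun x => (⟨f x, ξ x⟩ : V.Tot)) x₀) :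
    ContMDiffAt I V.IT ∞ (fun x => (⟨f x, η x⟩ : V.Tot)) x₀ :=
  hξ.congr_of_eventuallyEq (h.mono fun x hx => by simp only [hx])

/-- Smoothness along a map can be tested on linear functions. -/
theorem contMDiffAt_of_linearFun [FiniteDimensional ℝ E'] [T2Space N'] [IsManifold I' ∞ N']
    (hf : ContMDiffAt I I' ∞ f x₀)
    (h : ∀ ψ : ∀ m, V.fib m →ₗ[ℝ] ℝ, ContMDiff V.IT 𝓘(ℝ) ∞ (V.linearFun ψ) →
      ContMDiffAt I 𝓘(ℝ) ∞ (fun x => ψ (f x) (ξ x)) x₀) :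
    ContMDiffAt I V.IT ∞ (fun x => (⟨f x, ξ x⟩ : V.Tot)) x₀ := by
  let fr := V.frame (f x₀)
  refine contMDiffAt_congr (ξ := fun x => ∑ i, fr.coef i (f x) (ξ x) • fr.sec i (f x)) ?_ ?_
  · filter_upwards [hf.continuousAt.eventually fr.eventually_sum] with x hx using (hx _).symm
  · exact contMDiffAt_sum _ hf fun i _ => contMDiffAt_smul (h _ (fr.smooth_coef i))
      ((fr.sec i).contMDiff.contMDiffAt.comp x₀ hf :)

/-- The derivative of a section along `f` in the preferred trivialization at `f x₀`. -/
def pderiv (I : ModelWithCorners ℝ E H) (V : VB.{u} I' N') (f : N → N') (ξ : ∀ x, V.fib (f x)) (x₀ : N)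
    (v : TangentSpace I x₀) : V.fib (f x₀) :=
  V.coordSymm (f x₀) (f x₀) (mvfderiv I (fun x => V.coord (f x₀) (f x) (ξ x)) x₀ v)

theorem mdiffAt_coord (hξ : ContMDiffAt I V.IT ∞ (fun x => (⟨f x, ξ x⟩ : V.Tot)) x₀) :
    MDifferentiableAt I 𝓘(ℝ, V.F) (fun x => V.coord (f x₀) (f x) (ξ x)) x₀ :=
  ((contMDiffAt_iff_coord_self V).1 hξ).2.mdifferentiableAt (by simp)

theorem pderiv_add (hξ : ContMDiffAt I V.IT ∞ (fun x => (⟨f x, ξ x⟩ : V.Tot)) x₀)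
    (hη : ContMDiffAt I V.IT ∞ (fun x => (⟨f x, η x⟩ : V.Tot)) x₀) (v : TangentSpace I x₀) :
    pderiv I V f (fun x => ξ x + η x) x₀ v = pderiv I V f ξ x₀ v + pderiv I V f η x₀ v := by
  unfold pderiv
  rw [← map_add]
  congr 1
  simp only [map_add]
  exact DFunLike.congr_fun (mvfderiv_add (mdiffAt_coord hξ) (mdiffAt_coord hη)) v

theorem pderiv_sub (hξ : ContMDiffAt I V.IT ∞ (fun x => (⟨f x, ξ x⟩ : V.Tot)) x₀)
    (hη : ContMDiffAt I V.IT ∞ (fun x => (⟨f x, η x⟩ : V.Tot)) x₀) (v : TangentSpace I x₀) :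
    pderiv I V f (fun x => ξ x - η x) x₀ v = pderiv I V f ξ x₀ v - pderiv I V f η x₀ v := by
  unfold pderiv
  rw [← map_sub]
  congr 1
  simp only [map_sub]
  exact DFunLike.congr_fun (mvfderiv_sub (mdiffAt_coord hξ) (mdiffAt_coord hη)) v

theorem pderiv_zero (v : TangentSpace I x₀) : pderiv I V f (fun _ => 0) x₀ v = 0 := by
  unfold pderiv
  simp only [map_zero]
  rw [mvfderiv_const]
  exact map_zero _

/-- By this rule the derivatives in two trivializations differ by a term that is linear in ξ x₀. At
a zero of ξ the derivative is thus intrinsic; the bracket conditions below apply it to differences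
of sections that vanish at the point in question. -/
theorem pderiv_smul {g : N → ℝ} (hg : ContMDiffAt I 𝓘(ℝ) ∞ g x₀)
    (hξ : ContMDiffAt I V.IT ∞ (fun x => (⟨f x, ξ x⟩ : V.Tot)) x₀) (v : TangentSpace I x₀) :
    pderiv I V f (fun x => g x • ξ x) x₀ v =
      dirDeriv I g v • ξ x₀ + g x₀ • pderiv I V f ξ x₀ v := by
  have h := DFunLike.congr_fun
    (mvfderiv_smul (hg.mdifferentiableAt (by simp)) (mdiffAt_coord hξ)) v
  unfold pderiv
  simp only [map_smul]
  refine (congrArg _ h).trans ?_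
  refine (map_add _ _ _).trans ?_
  rw [add_comm]
  refine congrArg₂ _ ?_ ?_
  · refine (map_smul (V.coordSymm (f x₀) (f x₀)) _ _).trans ?_
    rw [V.coordSymm_coord (mem_baseSet_trivializationAt _ _ _)]
    rfl
  · exact (map_smul (V.coordSymm (f x₀) (f x₀)) _ _)

theorem pderiv_congr (h : ∀ᶠ x in 𝓝 x₀, ξ x = η x) (v : TangentSpace I x₀) :
    pderiv I V f ξ x₀ v = pderiv I V f η x₀ v := by
  unfold pderiv
  congr 1
  have : (fun x => V.coord (f x₀) (f x) (ξ x)) =ᶠ[𝓝 x₀] fun x => V.coord (f x₀) (f x) (η x) :=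
    h.mono fun x hx => by simp only [hx]
  unfold mvfderiv
  rw [this.mfderiv_eq]
  rfl

theorem pderiv_sum {ι : Type*} (t : Finset ι) {ζ : ι → ∀ x, V.fib (f x)}
    (hf : ContMDiffAt I I' ∞ f x₀)
    (hζ : ∀ i ∈ t, ContMDiffAt I V.IT ∞ (fun x => (⟨f x, ζ i x⟩ : V.Tot)) x₀) (v : TangentSpace I x₀) :
    pderiv I V f (fun x => ∑ i ∈ t, ζ i x) x₀ v = ∑ i ∈ t, pderiv I V f (ζ i) x₀ v := by
  classical
  induction t using Finset.induction_on with
  | empty => simpa using pderiv_zero v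
  | insert a t ha ih =>
    have h1 := fun i hi => hζ i (Finset.mem_insert_of_mem hi)
    simp only [Finset.sum_insert ha]
    rw [pderiv_add (hζ a (Finset.mem_insert_self _ _)) (contMDiffAt_sum t hf h1), ih h1]

theorem pderiv_add_vec (v w : TangentSpace I x₀) :
    pderiv I V f ξ x₀ (v + w) = pderiv I V f ξ x₀ v + pderiv I V f ξ x₀ w := by
  unfold pderiv
  rw [map_add]
  exact map_add (V.coordSymm (f x₀) (f x₀)) _ _

theorem pderiv_smul_vec (r : ℝ) (v : TangentSpace I x₀) :
    pderiv I V f ξ x₀ (r • v) = r • pderiv I V f ξ x₀ v := by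
  unfold pderiv
  rw [map_smul]
  exact map_smul (V.coordSymm (f x₀) (f x₀)) _ _

/-- The derivative of a section, in the preferred trivialization at `x₀`. -/
abbrev sderiv (V : VB.{u} I N) (s : ∀ x, V.fib x) (x₀ : N) (v : TangentSpace I x₀) : V.fib x₀ :=
  pderiv I V (fun x => x) s x₀ v

/-- The chain rule needs no correction, because both sides are computed in the preferred
trivialization at the same point f x₀. -/
theorem pderiv_comp {s : ∀ y, V.fib y} (hf : ContMDiffAt I I' ∞ f x₀)
    (hs : ContMDiffAt I' V.IT ∞ (fun y => (⟨y, s y⟩ : V.Tot)) (f x₀)) (v : TangentSpace I x₀) :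
    pderiv I V f (fun x => s (f x)) x₀ v = V.sderiv s (f x₀) (mfderiv I I' f x₀ v) := by
  unfold sderiv pderiv
  congr 1
  exact DFunLike.congr_fun (mfderiv_comp x₀ (mdiffAt_coord (f := fun y => y) hs)
    (hf.mdifferentiableAt (by simp))) v

end Along

/-- The bundle D → B lives over the total space of B, so bump functions and frames over that total
space require it to be Hausdorff. Distinct fibres are separated in the base, points of one fibre by
a trivialization. -/
instance [T2Space N] (V : VB.{u} I N) : T2Space V.Tot := by
  refine ⟨fun x y hxy => ?_⟩
  by_cases h : x.proj = y.proj
  · let e := trivializationAt V.F V.fib x.proj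
    have hx : x ∈ e.source := e.mem_source.2 (mem_baseSet_trivializationAt _ _ _)
    have hy : y ∈ e.source := e.mem_source.2 (h ▸ mem_baseSet_trivializationAt _ _ _)
    obtain ⟨u, v, hu, hv, hxu, hyv, huv⟩ := t2_separation fun he => hxy (e.injOn hx hy he)
    refine ⟨e.source ∩ e ⁻¹' u, e.source ∩ e ⁻¹' v,
      e.toOpenPartialHomeomorph.isOpen_inter_preimage hu,
      e.toOpenPartialHomeomorph.isOpen_inter_preimage hv, ⟨hx, hxu⟩, ⟨hy, hyv⟩, ?_⟩
    exact (huv.preimage e).mono Set.inter_subset_right Set.inter_subset_right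
  · obtain ⟨u, v, hu, hv, hxu, hyv, huv⟩ := t2_separation h
    have hc := FiberBundle.continuous_proj V.F V.fib
    exact ⟨_, _, hu.preimage hc, hv.preimage hc, hxu, hyv, huv.preimage _⟩

end VB
end Toolkit

/-! ### Derivatives of forms evaluated on sections along a map -/

section Forms

variable {E : Type*} [NormedAddCommGroup E] [NormedSpace ℝ E] {H : Type*} [TopologicalSpace H]
  {I : ModelWithCorners ℝ E H} {N : Type*} [TopologicalSpace N] [ChartedSpace H N]
  {E' : Type*} [NormedAddCommGroup E'] [NormedSpace ℝ E'] {H' : Type*} [TopologicalSpace H']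
  {I' : ModelWithCorners ℝ E' H'} {N' : Type*} [TopologicalSpace N'] [ChartedSpace H' N']

theorem contMDiff_dirDeriv [IsManifold I ∞ N] {X : Type*} [TopologicalSpace X] {EX : Type*}
    [NormedAddCommGroup EX] [NormedSpace ℝ EX] {HX : Type*} [TopologicalSpace HX]
    [ChartedSpace HX X] {IX : ModelWithCorners ℝ EX HX} {g : N → ℝ} (hg : ContMDiff I 𝓘(ℝ) ∞ g)
    {f : X → N} {v : ∀ x, TangentSpace I (f x)}
    (hv : ContMDiff IX I.tangent ∞ (fun x => (⟨f x, v x⟩ : TangentBundle I N))) :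
    ContMDiff IX 𝓘(ℝ) ∞ (fun x => dirDeriv I g (v x)) := by
  have h1 : ContMDiff I.tangent 𝓘(ℝ).tangent ∞ (tangentMap I 𝓘(ℝ) g) :=
    hg.contMDiff_tangentMap le_rfl
  exact ((contMDiff_snd_tangentBundle_modelSpace ℝ 𝓘(ℝ)).comp (h1.comp hv) :)

theorem dirDeriv_clm {G : Type*} [NormedAddCommGroup G] [NormedSpace ℝ G] (L : G →L[ℝ] ℝ) {g : N → G}
    {x : N} (hg : MDifferentiableAt I 𝓘(ℝ, G) g x) (v : TangentSpace I x) :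
    dirDeriv I (fun y => L (g y)) v = L (mvfderiv I g x v) := by
  have h2 : HasMFDerivAt 𝓘(ℝ, G) 𝓘(ℝ) L (g x) L := L.hasMFDerivAt
  exact DFunLike.congr_fun (h2.comp x hg.hasMFDerivAt).mfderiv v

theorem dirDeriv_prod {ι : Type*} [DecidableEq ι] (t : Finset ι) {g : ι → N → ℝ} {x : N}
    (hg : ∀ i, ContMDiffAt I 𝓘(ℝ) ∞ (g i) x) (v : TangentSpace I x) :
    dirDeriv I (fun y => ∏ i ∈ t, g i y) v =
      ∑ l ∈ t, (∏ i ∈ t.erase l, g i x) * dirDeriv I (g l) v := by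
  induction t using Finset.induction_on with
  | empty => simpa using dirDeriv_const 1 v
  | insert a t ha ih =>
    have h1 : ContMDiffAt I 𝓘(ℝ) ∞ (fun y => ∏ i ∈ t, g i y) x :=
      contMDiffAt_finsetProd fun i _ => hg i
    simp only [Finset.prod_insert ha]
    rw [dirDeriv_mul ((hg a).mdifferentiableAt (by simp)) (h1.mdifferentiableAt (by simp)), ih,
      Finset.sum_insert ha, Finset.erase_insert ha, add_comm, Finset.mul_sum]
    congr 1
    refine Finset.sum_congr rfl fun l hl => ?_
    have hla : l ≠ a := fun h => ha (h ▸ hl)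
    rw [Finset.erase_insert_of_ne hla.symm, Finset.prod_insert (fun h => ha (Finset.mem_of_mem_erase h))]
    ring

namespace VB

variable (V : VB.{u} I' N')

theorem contMDiffAt_coordSymm {p y₀ : N'} (hp : y₀ ∈ (trivializationAt V.F V.fib p).baseSet) (w : V.F) :
    ContMDiffAt I' V.IT ∞ (fun y => (⟨y, V.coordSymm p y w⟩ : V.Tot)) y₀ := by
  rw [V.contMDiffAt_iff_coord (f := fun y => y) hp]
  refine ⟨contMDiffAt_id, (contMDiffAt_const (c := w)).congr_of_eventuallyEq ?_⟩
  filter_upwards [(trivializationAt V.F V.fib p).open_baseSet.mem_nhds hp] with y hy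
  exact V.coord_coordSymm hy w

end VB

namespace Form

variable {V : VB.{u} I' N'} {k : ℕ} (θ : Form V k) {f : N → N'} {x₀ : N}

/-- This is the product rule in a local frame. The first sum differentiates the coefficients of θ
and sees the sections only through their values at x₀; the second one collects the derivatives of
the sections, one slot at a time. -/
theorem contMDiffAt_along (hf : ContMDiffAt I I' ∞ f x₀) {ξ : Fin k → ∀ x, V.fib (f x)}
    (hξ : ∀ i, ContMDiffAt I V.IT ∞ (fun x => (⟨f x, ξ i x⟩ : V.Tot)) x₀) :
    ContMDiffAt I 𝓘(ℝ) ∞ (fun x => θ.toFun (f x) (fun i => ξ i x)) x₀ ∧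
    ∀ v, dirDeriv I (fun x => θ.toFun (f x) (fun i => ξ i x)) v =
      (∑ R : Fin k → Fin (Module.finrank ℝ V.F),
        (∏ i, (Module.finBasis ℝ V.F).coord (R i) (V.coord (f x₀) (f x₀) (ξ i x₀))) *
        dirDeriv I (fun x => θ.toFun (f x) fun i =>
          V.coordSymm (f x₀) (f x) (Module.finBasis ℝ V.F (R i))) v) +
      ∑ l, θ.toFun (f x₀) (Function.update (fun i => ξ i x₀) l (VB.pderiv I V f (ξ l) x₀ v)) := by
  classical
  set b := Module.finBasis ℝ V.F with hb
  have hp : f x₀ ∈ (trivializationAt V.F V.fib (f x₀)).baseSet := mem_baseSet_trivializationAt _ _ _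
  let e : Fin (Module.finrank ℝ V.F) → ∀ y, V.fib y := fun r y => V.coordSymm (f x₀) y (b r)
  let c : Fin k → Fin (Module.finrank ℝ V.F) → N → ℝ := fun i r x =>
    b.coord r (V.coord (f x₀) (f x) (ξ i x))
  have he : ∀ r, ContMDiffAt I' V.IT ∞ (fun y => (⟨y, e r y⟩ : V.Tot)) (f x₀) := fun r =>
    V.contMDiffAt_coordSymm hp (b r)
  have hc : ∀ i r, ContMDiffAt I 𝓘(ℝ) ∞ (c i r) x₀ := fun i r =>
    ((LinearMap.toContinuousLinearMap (b.coord r)).contMDiff.contMDiffAt.comp x₀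
      (V.contMDiffAt_iff_coord_self.1 (hξ i)).2 :)
  have hθ : ∀ R : Fin k → Fin (Module.finrank ℝ V.F),
      ContMDiffAt I 𝓘(ℝ) ∞ (fun x => θ.toFun (f x) fun i => e (R i) (f x)) x₀ := fun R =>
    ((θ.smooth (f x₀) (fun i => e (R i)) fun i => he _).comp x₀ hf :)
  have hpr : ∀ R : Fin k → Fin (Module.finrank ℝ V.F),
      ContMDiffAt I 𝓘(ℝ) ∞ (fun x => ∏ i, c i (R i) x) x₀ := fun R =>
    contMDiffAt_finsetProd fun i _ => hc _ _
  have key : ∀ᶠ x in 𝓝 x₀, θ.toFun (f x) (fun i => ξ i x) =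
      ∑ R : Fin k → Fin (Module.finrank ℝ V.F), (∏ i, c i (R i) x) *
        θ.toFun (f x) (fun i => e (R i) (f x)) := by
    filter_upwards [hf.continuousAt.preimage_mem_nhds
      ((trivializationAt V.F V.fib (f x₀)).open_baseSet.mem_nhds hp)] with x hx
    have : (fun i => ξ i x) = fun i => ∑ r, c i r x • e r (f x) := by
      funext i
      rw [← V.coordSymm_coord hx (ξ i x)]
      conv_lhs => rw [← b.sum_repr (V.coord (f x₀) (f x) (ξ i x)), map_sum]
      simp only [map_smul]
      rfl
    rw [this, ← AlternatingMap.coe_multilinearMap, MultilinearMap.map_sum]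
    simp only [MultilinearMap.map_smul_univ, smul_eq_mul]
  have hterm : ∀ R : Fin k → Fin (Module.finrank ℝ V.F), ContMDiffAt I 𝓘(ℝ) ∞ (fun x =>
      (∏ i, c i (R i) x) * θ.toFun (f x) (fun i => e (R i) (f x))) x₀ := fun R => (hpr R).mul (hθ R)
  refine ⟨ContMDiffAt.congr_of_eventuallyEq (ContMDiffAt.sum fun R _ => hterm R) key, fun v => ?_⟩
  rw [dirDeriv_congr key, dirDeriv_sum _ fun R _ => (hterm R).mdifferentiableAt (by simp)]
  have hpd : ∀ l, VB.pderiv I V f (ξ l) x₀ v = ∑ r, dirDeriv I (c l r) v • e r (f x₀) := by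
    intro l
    unfold VB.pderiv
    conv_lhs => rw [← b.sum_repr (mvfderiv I _ x₀ v), map_sum]
    refine Finset.sum_congr rfl fun r _ => ?_
    rw [map_smul]
    congr 1
    exact (dirDeriv_clm (LinearMap.toContinuousLinearMap (b.coord r)) (VB.mdiffAt_coord (hξ l)) v).symm
  have h0 : ∀ i, ξ i x₀ = ∑ r, c i r x₀ • e r (f x₀) := by
    intro i
    rw [← V.coordSymm_coord hp (ξ i x₀)]
    conv_lhs => rw [← b.sum_repr (V.coord (f x₀) (f x₀) (ξ i x₀)), map_sum]
    simp only [map_smul]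
    rfl
  -- Putting the derivative into slot l replaces the coefficients of the l-th section by their
  -- derivatives and leaves the others alone. The same multilinear expansion as in `key` then
  -- applies.
  have hup : ∀ l, θ.toFun (f x₀) (Function.update (fun i => ξ i x₀) l (VB.pderiv I V f (ξ l) x₀ v)) =
      ∑ R : Fin k → Fin (Module.finrank ℝ V.F), ((∏ i ∈ Finset.univ.erase l, c i (R i) x₀) *
        dirDeriv I (c l (R l)) v) * θ.toFun (f x₀) (fun i => e (R i) (f x₀)) := by
    intro l
    have : Function.update (fun i => ξ i x₀) l (VB.pderiv I V f (ξ l) x₀ v) =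
        fun i => ∑ r, (if i = l then dirDeriv I (c l r) v else c i r x₀) • e r (f x₀) := by
      funext i
      by_cases hi : i = l
      · subst hi; simp [hpd]
      · simp [hi, ← h0]
    rw [this, ← AlternatingMap.coe_multilinearMap, MultilinearMap.map_sum]
    refine Finset.sum_congr rfl fun R _ => ?_
    rw [MultilinearMap.map_smul_univ, smul_eq_mul]
    congr 1
    rw [← Finset.mul_prod_erase _ _ (Finset.mem_univ l), if_pos rfl, mul_comm]
    congr 1
    exact Finset.prod_congr rfl fun i hi => if_neg (Finset.ne_of_mem_erase hi)
  simp only [hup]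
  rw [Finset.sum_comm, ← Finset.sum_add_distrib]
  refine Finset.sum_congr rfl fun R _ => ?_
  rw [dirDeriv_mul ((hpr R).mdifferentiableAt (by simp)) ((hθ R).mdifferentiableAt (by simp)),
    dirDeriv_prod _ fun i => hc _ _, ← Finset.sum_mul]
  rw [mul_comm (θ.toFun _ _)]

/-- Sections with equal values at x₀ have the same frame term in `contMDiffAt_along`, so only the
derivatives of their differences survive. These are the correction terms of the bracket condition
for morphisms. -/
theorem dirDeriv_eq_add (hf : ContMDiffAt I I' ∞ f x₀) {ξ η : Fin k → ∀ x, V.fib (f x)}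
    (hξ : ∀ i, ContMDiffAt I V.IT ∞ (fun x => (⟨f x, ξ i x⟩ : V.Tot)) x₀)
    (hη : ∀ i, ContMDiffAt I V.IT ∞ (fun x => (⟨f x, η i x⟩ : V.Tot)) x₀)
    (h : ∀ i, ξ i x₀ = η i x₀) (v : TangentSpace I x₀) :
    dirDeriv I (fun x => θ.toFun (f x) (fun i => ξ i x)) v =
      dirDeriv I (fun x => θ.toFun (f x) (fun i => η i x)) v +
      ∑ l, θ.toFun (f x₀) (Function.update (fun i => η i x₀) l
        (VB.pderiv I V f (fun x => ξ l x - η l x) x₀ v)) := by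
  rw [(θ.contMDiffAt_along hf hξ).2, (θ.contMDiffAt_along hf hη).2]
  simp only [h, VB.pderiv_sub (hξ _) (hη _), AlternatingMap.map_update_sub, Finset.sum_sub_distrib]
  ring

end Form
end Forms

/-! ### Skew algebroids, and bracket conditions that imply compatibility with the differentials -/

section Algebroids

variable {E : Type*} [NormedAddCommGroup E] [NormedSpace ℝ E] {H : Type*} [TopologicalSpace H]
  {I : ModelWithCorners ℝ E H} {N : Type*} [TopologicalSpace N] [ChartedSpace H N]
  {E' : Type*} [NormedAddCommGroup E'] [NormedSpace ℝ E'] {H' : Type*} [TopologicalSpace H']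
  {I' : ModelWithCorners ℝ E' H'} {N' : Type*} [TopologicalSpace N'] [ChartedSpace H' N']

/-- The vector A i j takes the place of argument j in the term from which argument i was removed.
Moving it to the front costs a sign, and the two orders of a pair of distinct indices combine into
the antisymmetric expression A i j - A j i. The right-hand side has the shape of the bracket terms
in the Koszul formula, so that derivative corrections from the anchors cancel those from the
brackets. -/
theorem AlternatingMap.sum_update_removeNth {R M P : Type*} [CommRing R] [AddCommGroup M]
    [AddCommGroup P] [Module R M] [Module R P] {n : ℕ} (θ : M [⋀^Fin (n + 1)]→ₗ[R] P)
    (u : Fin (n + 2) → M) (A : Fin (n + 2) → Fin (n + 2) → M) :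
    ∑ i : Fin (n + 2), ∑ l : Fin (n + 1), (-1 : R) ^ (i : ℕ) •
        θ (Function.update (i.removeNth u) l (A i (i.succAbove l))) =
      ∑ i : Fin (n + 1), ∑ j ∈ Finset.Ici i, (-1 : R) ^ (i + j : ℕ) •
        θ (Matrix.vecCons (A i.castSucc j.succ - A j.succ i.castSucc)
          (j.removeNth (i.castSucc.removeNth u))) := by
  -- The pairs (i, l) are the ordered pairs of distinct indices; they are grouped as a triangle in
  -- which both orders of each pair appear together.
  rw [Fin.sum_sum_eq_sum_triangle_add]
  refine Fintype.sum_congr _ _ fun i => Finset.sum_congr rfl fun j hj => ?_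
  rw [Finset.mem_Ici] at hj
  simp only [← Fin.insertNth_removeNth, AlternatingMap.map_insertNth]
  rw [Fin.removeNth_removeNth_eq_swap]
  have H₁ : i.castSucc.succAbove j = j.succ := by simp [Fin.succAbove_of_le_castSucc, hj]
  have H₂ : j.predAbove i.castSucc = i := by simp [Fin.predAbove_of_le_castSucc, hj]
  have H₃ : j.succ.succAbove i = i.castSucc := by simp [Fin.succAbove_of_castSucc_lt, hj]
  have H₄ : ∀ (v w : M) (r : Fin n → M), θ (Matrix.vecCons (v - w) r) =
      θ (Matrix.vecCons v r) - θ (Matrix.vecCons w r) := by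
    intro v w r
    have := θ.map_update_sub (Matrix.vecCons v r) 0 v w
    simpa [Matrix.vecCons, Fin.cons_update] using! this
  rw [H₁, H₂, H₃, H₄]
  simp only [← Int.cast_smul_eq_zsmul R, Int.cast_pow, Int.cast_neg, Int.cast_one, smul_smul, smul_sub,
    Fin.val_succ, Fin.val_castSucc, pow_add, pow_one]
  rw [sub_eq_add_neg, ← neg_smul]
  congr 2
  ring

variable [IsManifold I ∞ N] [IsManifold I' ∞ N']

/-- An anchored vector bundle with a skew-symmetric bracket of sections that satisfies the Leibniz
rule. -/
structure SkewAlgebroid (V : VB.{u} I N) where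
  anchor : ∀ x, V.fib x →ₗ[ℝ] TangentSpace I x
  anchor_smooth : ContMDiff V.IT I.tangent ∞
    (fun v : V.Tot => (⟨v.proj, anchor v.proj v.2⟩ : TangentBundle I N))
  bracket : V.Sec →ₗ[ℝ] V.Sec →ₗ[ℝ] V.Sec
  bracket_self : ∀ a, bracket a a = 0
  leibniz : ∀ (a b c : V.Sec) (g : N → ℝ), ContMDiff I 𝓘(ℝ) ∞ g → (∀ x, c x = g x • b x) →
    ∀ x, bracket a c x = g x • bracket a b x + dirDeriv I g (anchor x (a x)) • b x

/-- Forget the Jacobi identity. -/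
def LieAlgebroid.toSkew {V : VB.{u} I N} (L : LieAlgebroid V) : SkewAlgebroid V where
  anchor := L.anchor
  anchor_smooth := L.anchor_smooth
  bracket := L.bracket
  bracket_self := L.bracket_self
  leibniz := L.leibniz

namespace SkewAlgebroid

variable {V : VB.{u} I N} (L : SkewAlgebroid V)

/-- The derivative of the function `g` along the anchor of the section `a`. -/
def deriv (a : V.Sec) (g : N → ℝ) (x : N) : ℝ := dirDeriv I g (L.anchor x (a x))

theorem contMDiff_deriv (a : V.Sec) {g : N → ℝ} (hg : ContMDiff I 𝓘(ℝ) ∞ g) :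
    ContMDiff I 𝓘(ℝ) ∞ (L.deriv a g) :=
  contMDiff_dirDeriv hg (f := fun x => x) (L.anchor_smooth.comp a.contMDiff :)

theorem bracket_skew (a b : V.Sec) : L.bracket a b = -L.bracket b a := by
  have h := L.bracket_self (a + b)
  simp only [map_add, LinearMap.add_apply, L.bracket_self, zero_add, add_zero] at h
  exact eq_neg_of_add_eq_zero_right h

theorem bracket_smulSec (a b : V.Sec) (g : N → ℝ) (hg : ContMDiff I 𝓘(ℝ) ∞ g) (x : N) :
    L.bracket a (V.smulSec g hg b) x = g x • L.bracket a b x + L.deriv a g x • b x :=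
  L.leibniz a b _ g hg (fun _ => rfl) x

theorem bracket_smulSec_left (a b : V.Sec) (g : N → ℝ) (hg : ContMDiff I 𝓘(ℝ) ∞ g) (x : N) :
    L.bracket (V.smulSec g hg a) b x = g x • L.bracket a b x - L.deriv b g x • a x := by
  rw [L.bracket_skew, L.bracket_skew a b]
  simp only [ContMDiffSection.coe_neg, Pi.neg_apply]
  rw [L.bracket_smulSec]
  module

variable [FiniteDimensional ℝ E] [T2Space N]

/-- The bracket and the derivative along the anchor satisfy the same Leibniz rule in z, so their
difference is linear over smooth functions and vanishes wherever z does. -/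
theorem bracket_eq_sderiv (a z : V.Sec) {x : N} (hz : z x = 0) :
    L.bracket a z x = V.sderiv z x (L.anchor x (a x)) := by
  rw [← sub_eq_zero]
  refine V.tensorial_eq_zero x (fun z => L.bracket a z x - V.sderiv z x (L.anchor x (a x))) ?_ ?_ hz
  · intro s t
    have := VB.pderiv_add (f := fun x => x) s.contMDiff.contMDiffAt t.contMDiff.contMDiffAt
      (L.anchor x (a x))
    rw [map_add]
    refine (congrArg₂ _ rfl this).trans ?_
    rw [ContMDiffSection.coe_add, Pi.add_apply]
    abel
  · intro g hg s
    have := VB.pderiv_smul (f := fun x => x) hg.contMDiffAt s.contMDiff.contMDiffAt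
      (L.anchor x (a x))
    refine (congrArg₂ _ (L.bracket_smulSec a s g hg x) this).trans ?_
    unfold deriv
    module

end SkewAlgebroid

namespace LieAlgebroid

variable {V : VB.{u} I N} {V' : VB.{u} I' N'} {f : N → N'}

/-- The description of Lie algebroid morphisms by means of the anchors and the brackets. -/
structure IsBracketMorphism (L : LieAlgebroid V) (L' : LieAlgebroid V') (F : VBHom V V' f) : Prop where
  anchor : ∀ (x : N) (v : V.fib x) (g : N' → ℝ), ContMDiff I' 𝓘(ℝ) ∞ g →
    dirDeriv I (fun y => g (f y)) (L.anchor x v) = dirDeriv I' g (L'.anchor (f x) (F.fib x v))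
  bracket : ∀ (x : N) (a b : V.Sec) (s t : V'.Sec), F.fib x (a x) = s (f x) → F.fib x (b x) = t (f x) →
    F.fib x (L.bracket a b x) = L'.bracket s t (f x) +
      VB.pderiv I V' f (fun y => F.fib y (b y) - t (f y)) x (L.anchor x (a x)) -
      VB.pderiv I V' f (fun y => F.fib y (a y) - s (f y)) x (L.anchor x (b x))

theorem contMDiff_map (F : VBHom V V' f) (a : V.Sec) :
    ContMDiff I V'.IT ∞ (fun x => (⟨f x, F.fib x (a x)⟩ : V'.Tot)) := (F.smooth.comp a.contMDiff :)

theorem contMDiff_along (F : VBHom V V' f) (s : V'.Sec) :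
    ContMDiff I V'.IT ∞ (fun x => (⟨f x, s (f x)⟩ : V'.Tot)) := (s.contMDiff.comp F.contMDiff_base :)

theorem contMDiff_eval {k : ℕ} (θ : Form V k) (a : Fin k → V.Sec) : ContMDiff I 𝓘(ℝ) ∞ (θ.eval a) :=
  fun x => θ.smooth x (fun i => a i) fun i => (a i).contMDiff.contMDiffAt

variable [FiniteDimensional ℝ E'] [T2Space N']

/-- The anchor terms of the Koszul formula produce corrections through `dirDeriv_eq_add`, the
bracket terms produce the corrections in the hypothesis, and `AlternatingMap.sum_update_removeNth`
shows that the two families cancel. -/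
theorem IsBracketMorphism.isMorphism {L : LieAlgebroid V} {L' : LieAlgebroid V'} {F : VBHom V V' f}
    (h : L.IsBracketMorphism L' F) : L.IsMorphism L' F := by
  intro k θ η hd a x
  -- The images of the sections are sections along f only. Any sections of V' with the right values
  -- at the single point f x can replace them.
  let S : Fin (k + 1) → V'.Sec := fun i => V'.secThrough (F.fib x (a i x))
  have hS : ∀ i, S i (f x) = F.fib x (a i x) := fun i => V'.secThrough_self _
  have h0 : (η.pullback F).eval a x = η.eval S (f x) := by
    change η.toFun (f x) (fun i => F.fib x (a i x)) = η.toFun (f x) (fun i => S i (f x))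
    simp only [hS]
  rw [h0, hd]
  have hf := F.contMDiff_base.contMDiffAt (x := x)
  have hanch : ∀ i (b : Fin k → V'.Sec), L'.deriv (S i) (θ.eval b) (f x) =
      dirDeriv I (fun y => θ.eval b (f y)) (L.anchor x (a i x)) := by
    intro i b
    rw [h.anchor x _ _ (contMDiff_eval θ b), ← hS]
    rfl
  have hpb : ∀ (i : Fin (k + 1)), L.deriv (a i) ((θ.pullback F).eval (i.removeNth a)) x =
      L'.deriv (S i) (θ.eval (i.removeNth S)) (f x) +
      ∑ l : Fin k, θ.toFun (f x) (Function.update (i.removeNth fun j => S j (f x)) l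
        (VB.pderiv I V' f (fun y => F.fib y (a (i.succAbove l) y) - S (i.succAbove l) (f y)) x
          (L.anchor x (a i x)))) := by
    intro i
    rw [hanch]
    exact θ.dirDeriv_eq_add hf (ξ := fun l y => F.fib y (a (i.succAbove l) y))
      (η := fun l y => S (i.succAbove l) (f y)) (fun l => (contMDiff_map F _).contMDiffAt)
      (fun l => (contMDiff_along F _).contMDiffAt) (fun l => (hS _).symm) _
  cases k with
  | zero =>
    change _ = L.deriv (a 0) ((θ.pullback F).eval (Fin.removeNth 0 a)) x
    rw [hpb]
    simp
    rfl
  | succ k =>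
    have hbr : ∀ i j : Fin (k + 2), F.fib x (L.bracket (a i) (a j) x) =
        L'.bracket (S i) (S j) (f x) +
        (VB.pderiv I V' f (fun y => F.fib y (a j y) - S j (f y)) x (L.anchor x (a i x)) -
        VB.pderiv I V' f (fun y => F.fib y (a i y) - S i (f y)) x (L.anchor x (a j x))) := by
      intro i j
      rw [h.bracket x (a i) (a j) (S i) (S j) (hS i).symm (hS j).symm, add_sub_assoc]
    have hadd : ∀ (v w : V'.fib (f x)) (r : Fin k → V'.fib (f x)), θ.toFun (f x) (Matrix.vecCons (v + w) r) =
        θ.toFun (f x) (Matrix.vecCons v r) + θ.toFun (f x) (Matrix.vecCons w r) := by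
      intro v w r
      have := (θ.toFun (f x)).map_update_add (Matrix.vecCons v r) 0 v w
      simpa [Matrix.vecCons, Fin.cons_update] using! this
    have hev : ∀ (i : Fin (k + 1)) (j : Fin (k + 1)),
        (θ.pullback F).eval (Matrix.vecCons (L.bracket (a i.castSucc) (a j.succ))
            (j.removeNth (i.castSucc.removeNth a))) x =
        θ.eval (Matrix.vecCons (L'.bracket (S i.castSucc) (S j.succ))
            (j.removeNth (i.castSucc.removeNth S))) (f x) +
        θ.toFun (f x) (Matrix.vecCons
          (VB.pderiv I V' f (fun y => F.fib y (a j.succ y) - S j.succ (f y)) x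
              (L.anchor x (a i.castSucc x)) -
            VB.pderiv I V' f (fun y => F.fib y (a i.castSucc y) - S i.castSucc (f y)) x
              (L.anchor x (a j.succ x)))
          (j.removeNth (i.castSucc.removeNth fun j => S j (f x)))) := by
      intro i j
      have e1 : (θ.pullback F).eval (Matrix.vecCons (L.bracket (a i.castSucc) (a j.succ))
            (j.removeNth (i.castSucc.removeNth a))) x =
          θ.toFun (f x) (Matrix.vecCons (F.fib x (L.bracket (a i.castSucc) (a j.succ) x))
            (j.removeNth (i.castSucc.removeNth fun j => S j (f x)))) := by
        refine congrArg (θ.toFun (f x)) (funext fun l => ?_)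
        refine Fin.cases rfl (fun l => ?_) l
        exact (hS _).symm
      have e2 : θ.eval (Matrix.vecCons (L'.bracket (S i.castSucc) (S j.succ))
            (j.removeNth (i.castSucc.removeNth S))) (f x) =
          θ.toFun (f x) (Matrix.vecCons (L'.bracket (S i.castSucc) (S j.succ) (f x))
            (j.removeNth (i.castSucc.removeNth fun j => S j (f x)))) := by
        refine congrArg (θ.toFun (f x)) (funext fun l => ?_)
        exact Fin.cases rfl (fun l => rfl) l
      rw [e1, e2, hbr, hadd]
    simp only [koszul, hpb, hev]
    have comb := (θ.toFun (f x)).sum_update_removeNth (fun j => S j (f x))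
      (fun i l => VB.pderiv I V' f (fun y => F.fib y (a l y) - S l (f y)) x (L.anchor x (a i x)))
    simp only [mul_add, Finset.sum_add_distrib, Finset.mul_sum]
    simp only [smul_eq_mul] at comb
    rw [comb]
    ring

end LieAlgebroid
end Algebroids
-- Differentials of functions and of linear functions; morphisms preserve anchors and brackets
section Differentials
variable {E : Type*} [NormedAddCommGroup E] [NormedSpace ℝ E] {H : Type*} [TopologicalSpace H]
  {I : ModelWithCorners ℝ E H} {N : Type*} [TopologicalSpace N] [ChartedSpace H N]
  {E' : Type*} [NormedAddCommGroup E'] [NormedSpace ℝ E'] {H' : Type*} [TopologicalSpace H']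
  {I' : ModelWithCorners ℝ E' H'} {N' : Type*} [TopologicalSpace N'] [ChartedSpace H' N']

theorem dirDeriv_add_vec (g : N → ℝ) {x : N} (v w : TangentSpace I x) :
    dirDeriv I g (v + w) = dirDeriv I g v + dirDeriv I g w :=
  map_add (mfderiv I 𝓘(ℝ) g x) v w

theorem dirDeriv_smul_vec (g : N → ℝ) (r : ℝ) {x : N} (v : TangentSpace I x) :
    dirDeriv I g (r • v) = r * dirDeriv I g v :=
  map_smul (mfderiv I 𝓘(ℝ) g x) r v

namespace VB

variable [FiniteDimensional ℝ E] [T2Space N] [IsManifold I ∞ N] (V W : VB.{u} I N)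

theorem exists_bilinear_of_tensorial {G : Type*} [AddCommGroup G] [Module ℝ G] (x : N)
    (T : V.Sec → W.Sec → G) (add_left : ∀ s s' t, T (s + s') t = T s t + T s' t)
    (smul_left : ∀ g (hg : ContMDiff I 𝓘(ℝ) ∞ g) s t, T (V.smulSec g hg s) t = g x • T s t)
    (add_right : ∀ s t t', T s (t + t') = T s t + T s t')
    (smul_right : ∀ g (hg : ContMDiff I 𝓘(ℝ) ∞ g) s t, T s (W.smulSec g hg t) = g x • T s t) :
    ∃ ℓ : V.fib x →ₗ[ℝ] W.fib x →ₗ[ℝ] G, ∀ s t, T s t = ℓ (s x) (t x) := by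
  choose ℓ hℓ using fun s => W.exists_linear_of_tensorial x (T s) (add_right s)
    (fun g hg t => smul_right g hg s t)
  obtain ⟨m, hm⟩ := V.exists_linear_of_tensorial x ℓ
    (fun s s' => LinearMap.ext fun w => by
      rw [← W.secThrough_self w, LinearMap.add_apply, ← hℓ, ← hℓ, ← hℓ, add_left])
    (fun g hg s => LinearMap.ext fun w => by
      rw [← W.secThrough_self w, LinearMap.smul_apply, ← hℓ, ← hℓ, smul_left])
  exact ⟨m, fun s t => by rw [hℓ, hm]⟩

end VB

namespace Form

variable {V : VB.{u} I N}

/-- A smooth function as a form of degree `0`. -/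
def ofFun (V : VB.{u} I N) (g : N → ℝ) (hg : ContMDiff I 𝓘(ℝ) ∞ g) : Form V 0 where
  toFun x := AlternatingMap.constOfIsEmpty ℝ (V.fib x) (Fin 0) (g x)
  smooth _ _ _ := hg.contMDiffAt

/-- A smooth fibrewise linear function as a form of degree `1`. -/
def ofLinear (ψ : ∀ x, V.fib x →ₗ[ℝ] ℝ) (hψ : ContMDiff V.IT 𝓘(ℝ) ∞ (V.linearFun ψ)) : Form V 1 where
  toFun x := AlternatingMap.ofSubsingleton ℝ (V.fib x) ℝ (0 : Fin 1) (ψ x)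
  smooth x₀ _ ha := (hψ.contMDiffAt.comp x₀ (ha 0) :)

/-- The form of degree `2` representing an alternating bilinear map on sections. -/
theorem exists_of_tensorial [FiniteDimensional ℝ E] [T2Space N] [IsManifold I ∞ N]
    (T : V.Sec → V.Sec → N → ℝ) (smooth : ∀ s t, ContMDiff I 𝓘(ℝ) ∞ (T s t))
    (self : ∀ s, T s s = 0)
    (add_right : ∀ s t t', T s (t + t') = T s t + T s t')
    (add_left : ∀ s s' t, T (s + s') t = T s t + T s' t)
    (smul_right : ∀ g (hg : ContMDiff I 𝓘(ℝ) ∞ g) s t x, T s (V.smulSec g hg t) x = g x • T s t x) :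
    ∃ η : Form V 2, ∀ a, η.eval a = T (a 0) (a 1) := by
  have skew : ∀ s t, T s t = -T t s := fun s t => by
    have h := self (s + t)
    rw [add_right, add_left, add_left, self, self, zero_add, add_zero] at h
    exact eq_neg_of_add_eq_zero_right h
  choose ℓ hℓ using fun x => V.exists_bilinear_of_tensorial V x (fun s t => T s t x)
    (fun s s' t => by simp only [add_left, Pi.add_apply])
    (fun g hg s t => by
      rw [skew, skew s, Pi.neg_apply, smul_right, Pi.neg_apply, smul_neg])
    (fun s t t' => by simp only [add_right, Pi.add_apply])
    (fun g hg s t => smul_right g hg s t x)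
  refine ⟨⟨fun x => ⟨⟨fun v => ℓ x (v 0) (v 1), ?_, ?_⟩, ?_⟩, ?_⟩, ?_⟩
  · intro _ m i v w
    fin_cases i <;> simp
  · intro _ m i c v
    fin_cases i <;> simp
  · intro v i j hv hij
    have h01 : v 0 = v 1 := by
      fin_cases i <;> fin_cases j <;> first | exact absurd rfl hij | exact hv | exact hv.symm
    change ℓ x (v 0) (v 1) = 0
    rw [← h01, ← V.secThrough_self (v 0), ← hℓ, self]
    rfl
  -- A form must be smooth on arbitrary local sections, while T is defined on global ones. Expansion
  -- in a frame of global sections reduces the former to the latter.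
  · intro x₀ a ha
    let fr := V.frame x₀
    have h1 : ContMDiffAt I 𝓘(ℝ) ∞ (fun x => ∑ i, ∑ j, fr.coef i x (a 0 x) * (fr.coef j x (a 1 x) *
        T (fr.sec i) (fr.sec j) x)) x₀ := by
      refine ContMDiffAt.sum fun i _ => ContMDiffAt.sum fun j _ => ?_
      have hc : ∀ i k, ContMDiffAt I 𝓘(ℝ) ∞ (fun x => fr.coef i x (a k x)) x₀ := fun i k =>
        ((fr.smooth_coef i).contMDiffAt.comp x₀ (ha k) :)
      exact (hc i 0).mul ((hc j 1).mul (smooth _ _).contMDiffAt)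
    refine h1.congr_of_eventuallyEq ?_
    filter_upwards [fr.eventually_sum] with x hx
    change ℓ x (a 0 x) (a 1 x) = _
    conv_lhs => rw [hx (a 0 x), hx (a 1 x)]
    simp only [map_sum, map_smul, LinearMap.sum_apply, LinearMap.smul_apply, smul_eq_mul, hℓ]
    rw [Finset.sum_comm]
    simp only [Finset.mul_sum]
    refine Finset.sum_congr rfl fun i _ => Finset.sum_congr rfl fun j _ => by ring
  · intro a
    funext x
    exact (hℓ x _ _).symm

end Form

namespace LieAlgebroid

variable [IsManifold I ∞ N] [IsManifold I' ∞ N'] {V : VB.{u} I N} {V' : VB.{u} I' N'} {f : N → N'}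

/-- Compatibility with differentials is stated only for pairs of forms related by `IsDifferential`.
To use it, a form representing the differential has to be produced, here for functions and next for
fibrewise linear functions. -/
theorem exists_isDifferential_ofFun (L : LieAlgebroid V) (g : N → ℝ) (hg : ContMDiff I 𝓘(ℝ) ∞ g) :
    ∃ η : Form V 1, L.IsDifferential (Form.ofFun V g hg) η ∧
      ∀ x v, η.toFun x v = dirDeriv I g (L.anchor x (v 0)) := by
  let ψ : ∀ x, V.fib x →ₗ[ℝ] ℝ := fun x => (mvfderiv I g x).toLinearMap ∘ₗ L.anchor x
  have hψ : ContMDiff V.IT 𝓘(ℝ) ∞ (V.linearFun ψ) := contMDiff_dirDeriv hg L.anchor_smooth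
  exact ⟨Form.ofLinear ψ hψ, fun a x => rfl, fun x v => rfl⟩

variable [FiniteDimensional ℝ E] [T2Space N]

/-- In the Koszul expression the derivative of the factor g coming from an anchor term cancels the
one coming from the bracket, so the expression is tensorial and defines a 2-form. -/
theorem exists_isDifferential_ofLinear (L : LieAlgebroid V) (ψ : ∀ x, V.fib x →ₗ[ℝ] ℝ)
    (hψ : ContMDiff V.IT 𝓘(ℝ) ∞ (V.linearFun ψ)) :
    ∃ η : Form V 2, L.IsDifferential (Form.ofLinear ψ hψ) η ∧
      ∀ a x, η.eval a x = L.deriv (a 0) (fun y => ψ y (a 1 y)) x -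
        L.deriv (a 1) (fun y => ψ y (a 0 y)) x - ψ x (L.bracket (a 0) (a 1) x) := by
  have hs : ∀ a : V.Sec, ContMDiff I 𝓘(ℝ) ∞ (fun y => ψ y (a y)) := fun a => (hψ.comp a.contMDiff :)
  obtain ⟨η, hη⟩ := Form.exists_of_tensorial (V := V) (fun a b x => L.deriv a (fun y => ψ y (b y)) x -
        L.deriv b (fun y => ψ y (a y)) x - ψ x (L.bracket a b x))
    (fun a b => ((L.toSkew.contMDiff_deriv a (hs b)).sub (L.toSkew.contMDiff_deriv b (hs a))).sub
      (hs (L.bracket a b)))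
    (fun a => by
      funext x
      simp only [sub_self, L.bracket_self, zero_sub]
      exact neg_eq_zero.2 (map_zero (ψ x)))
    (fun a b b' => by
      funext x
      have h1 := dirDeriv_add ((hs b).mdiffAt x) ((hs b').mdiffAt x) (L.anchor x (a x))
      simp only [map_add, ContMDiffSection.coe_add, Pi.add_apply, deriv] at h1 ⊢
      rw [h1]
      simp only [dirDeriv_add_vec]
      ring)
    (fun a a' b => by
      funext x
      have h1 := dirDeriv_add ((hs a).mdiffAt x) ((hs a').mdiffAt x) (L.anchor x (b x))
      simp only [map_add, ContMDiffSection.coe_add, Pi.add_apply, deriv, LinearMap.add_apply] at h1 ⊢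
      rw [h1]
      simp only [dirDeriv_add_vec]
      ring)
    (fun g hg a b x => by
      have h1 := dirDeriv_mul (hg.mdiffAt x) ((hs b).mdiffAt x) (L.anchor x (a x))
      have h2 := L.toSkew.bracket_smulSec a b g hg x
      change L.bracket a (V.smulSec g hg b) x = g x • L.bracket a b x + dirDeriv I g (L.anchor x (a x)) • b x at h2
      simp only [VB.smulSec_apply, map_smul, smul_eq_mul, deriv, h2, map_add] at h1 ⊢
      rw [h1]
      simp only [dirDeriv_smul_vec]
      ring)
  refine ⟨η, fun a x => ?_, fun a x => by rw [hη]⟩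
  rw [hη]
  simp only [koszul]
  simp
  rfl

/-- A Lie algebroid morphism preserves the anchors and the brackets. -/
theorem IsMorphism.isBracketMorphism [FiniteDimensional ℝ E'] [T2Space N'] {L : LieAlgebroid V}
    {L' : LieAlgebroid V'} {F : VBHom V V' f} (h : L.IsMorphism L' F) : L.IsBracketMorphism L' F := by
  have hanch : ∀ (x : N) (v : V.fib x) (g : N' → ℝ), ContMDiff I' 𝓘(ℝ) ∞ g →
    dirDeriv I (fun y => g (f y)) (L.anchor x v) = dirDeriv I' g (L'.anchor (f x) (F.fib x v)) := by
    intro x v g hg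
    -- Compatibility in degree 0, applied to the function g, is the anchor condition.
    obtain ⟨η, h1, h2⟩ := L'.exists_isDifferential_ofFun g hg
    have h3 := h 0 _ _ h1 (fun _ => V.secThrough v) x
    have h4 := h2 (f x) (fun i => F.fib x (V.secThrough v x))
    rw [VB.secThrough_self] at h4
    rw [← h4]
    refine Eq.trans ?_ (h3.symm.trans ?_)
    · change _ = dirDeriv I (fun y => g (f y)) (L.anchor x (V.secThrough v x))
      rw [VB.secThrough_self]
    · change η.toFun (f x) (fun i => F.fib x (V.secThrough v x)) = _
      rw [VB.secThrough_self]
  refine ⟨hanch, fun x a b s t ha hb => V'.ext_linearFun fun ψ hψ => ?_⟩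
  -- Compatibility in degree 1 is applied to fibrewise linear functions, which separate the vectors
  -- of a fibre. The sections s and t agree with the images of a and b at f x, and `key` measures
  -- the difference of their derivatives.
  obtain ⟨η, h1, h2⟩ := L'.exists_isDifferential_ofLinear ψ hψ
  have h3 := h 1 _ _ h1 ![a, b] x
  have h4 : (η.pullback F).eval ![a, b] x = η.eval ![s, t] (f x) := by
    refine congrArg (η.toFun (f x)) (funext fun i => ?_)
    fin_cases i
    · exact ha
    · exact hb
  have hf := F.contMDiff_base.contMDiffAt (x := x)
  have hs : ∀ a : V'.Sec, ContMDiff I' 𝓘(ℝ) ∞ (fun y => ψ y (a y)) := fun a =>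
    (hψ.comp a.contMDiff :)
  have key : ∀ (a b : V.Sec) (s t : V'.Sec), F.fib x (a x) = s (f x) → F.fib x (b x) = t (f x) →
      L.deriv a (fun y => ψ (f y) (F.fib y (b y))) x = L'.deriv s (fun y => ψ y (t y)) (f x) +
        ψ (f x) (VB.pderiv I V' f (fun y => F.fib y (b y) - t (f y)) x (L.anchor x (a x))) := by
    intro a b s t ha hb
    have := (Form.ofLinear ψ hψ).dirDeriv_eq_add hf (ξ := fun _ y => F.fib y (b y))
      (η := fun _ y => t (f y)) (fun l => (contMDiff_map F _).contMDiffAt)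
      (fun l => (contMDiff_along F _).contMDiffAt) (fun _ => hb) (L.anchor x (a x))
    have e := hanch x (a x) _ (hs t)
    rw [ha] at e
    refine this.trans (congrArg₂ _ e ?_)
    simp [Form.ofLinear]
  have h5 := h2 ![s, t] (f x)
  rw [← h4, h3] at h5
  have h6 : L.koszul ((Form.ofLinear ψ hψ).pullback F) ![a, b] x =
      L.deriv a (fun y => ψ (f y) (F.fib y (b y))) x - L.deriv b (fun y => ψ (f y) (F.fib y (a y))) x -
        ψ (f x) (F.fib x (L.bracket a b x)) := by
    simp only [koszul]
    simp
    rfl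
  rw [h6, key a b s t ha hb, key b a t s hb ha] at h5
  simp only [Matrix.cons_val_zero, Matrix.cons_val_one] at h5
  rw [map_sub, map_add]
  linarith

theorem isMorphism_iff [FiniteDimensional ℝ E'] [T2Space N'] (L : LieAlgebroid V)
    (L' : LieAlgebroid V') (F : VBHom V V' f) : L.IsMorphism L' F ↔ L.IsBracketMorphism L' F :=
  ⟨fun h => h.isBracketMorphism, fun h => h.isMorphism⟩

end LieAlgebroid
end Differentials

/-! ### Tangent vectors of the total space of a vector bundle -/

section TotalSpace

variable {E : Type*} [NormedAddCommGroup E] [NormedSpace ℝ E] {H : Type*} [TopologicalSpace H]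
  {I : ModelWithCorners ℝ E H} {M : Type*} [TopologicalSpace M] [ChartedSpace H M]

theorem exists_contMDiff_eventuallyEq [FiniteDimensional ℝ E] [T2Space M] [IsManifold I ∞ M]
    {g : M → ℝ} {U : Set M} (hg : ContMDiffOn I 𝓘(ℝ) ∞ g U) {x₀ : M} (hU : U ∈ 𝓝 x₀) :
    ∃ h : M → ℝ, ContMDiff I 𝓘(ℝ) ∞ h ∧ h =ᶠ[𝓝 x₀] g := by
  obtain ⟨χ, hχ, hχ1, hsupp⟩ := exists_bump (I := I) x₀ (interior_mem_nhds.2 hU)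
  refine ⟨fun x => χ x * g x, fun x => ?_, ?_⟩
  · by_cases h : x ∈ tsupport χ
    · exact hχ.contMDiffAt.mul (hg.contMDiffAt (mem_interior_iff_mem_nhds.1 (hsupp h)))
    · refine (contMDiffAt_const (c := (0 : ℝ))).congr_of_eventuallyEq ?_
      filter_upwards [(isClosed_tsupport χ).isOpen_compl.mem_nhds h] with y hy
      rw [image_eq_zero_of_notMem_tsupport hy, zero_mul]
  · filter_upwards [hχ1] with x hx
    rw [hx, Pi.one_apply, one_mul]

theorem dirDeriv_sum_mul {ι : Type*} (t : Finset ι) {f g : ι → M → ℝ} (hf : ∀ i, ContMDiff I 𝓘(ℝ) ∞ (f i))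
    (hg : ∀ i, ContMDiff I 𝓘(ℝ) ∞ (g i)) {x : M} (v : TangentSpace I x) :
    dirDeriv I (fun y => ∑ i ∈ t, f i y * g i y) v =
      ∑ i ∈ t, (f i x * dirDeriv I (g i) v + g i x * dirDeriv I (f i) v) := by
  rw [dirDeriv_sum t (g := fun i y => f i y * g i y) fun i _ => ((hf i).mul (hg i)).mdiffAt x]
  exact Finset.sum_congr rfl fun i _ => dirDeriv_mul ((hf i).mdiffAt x) ((hg i).mdiffAt x) v

namespace VB

variable (B : VB.{u} I M)

theorem contMDiff_comp_proj {g : M → ℝ} (hg : ContMDiff I 𝓘(ℝ) ∞ g) :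
    ContMDiff B.IT 𝓘(ℝ) ∞ (fun b : B.Tot => g b.proj) := hg.comp (contMDiff_proj B.fib)

theorem contMDiff_linearFun_sec {ψ : ∀ m, B.fib m →ₗ[ℝ] ℝ} (hψ : ContMDiff B.IT 𝓘(ℝ) ∞ (B.linearFun ψ))
    (β : B.Sec) : ContMDiff I 𝓘(ℝ) ∞ (fun m => ψ m (β m)) := (hψ.comp β.contMDiff :)

theorem contMDiff_linearFun_smul {ψ : ∀ m, B.fib m →ₗ[ℝ] ℝ}
    (hψ : ContMDiff B.IT 𝓘(ℝ) ∞ (B.linearFun ψ)) {g : M → ℝ} (hg : ContMDiff I 𝓘(ℝ) ∞ g) :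
    ContMDiff B.IT 𝓘(ℝ) ∞ (B.linearFun (fun m => g m • ψ m)) :=
  (B.contMDiff_comp_proj hg).mul hψ

theorem contMDiff_linearFun_sum {ι : Type*} (t : Finset ι) {ψ : ι → ∀ m, B.fib m →ₗ[ℝ] ℝ}
    (hψ : ∀ i ∈ t, ContMDiff B.IT 𝓘(ℝ) ∞ (B.linearFun (ψ i))) :
    ContMDiff B.IT 𝓘(ℝ) ∞ (B.linearFun (fun m => ∑ i ∈ t, ψ i m)) := by
  have : B.linearFun (fun m => ∑ i ∈ t, ψ i m) = fun b => ∑ i ∈ t, B.linearFun (ψ i) b := by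
    funext b
    simp [linearFun]
  rw [this]
  intro b
  exact ContMDiffAt.sum fun i hi => (hψ i hi).contMDiffAt

/-- The derivative of the base point along a tangent vector of the total space. -/
def tproj {b : B.Tot} (v : TangentSpace B.IT b) : TangentSpace I b.proj :=
  mfderiv B.IT I TotalSpace.proj b v

theorem dirDeriv_comp_proj {g : M → ℝ} (hg : ContMDiff I 𝓘(ℝ) ∞ g) {b : B.Tot}
    (v : TangentSpace B.IT b) : dirDeriv B.IT (fun b : B.Tot => g b.proj) v = dirDeriv I g (B.tproj v) :=
  dirDeriv_comp (f := (TotalSpace.proj : B.Tot → M)) (hg.mdiffAt _)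
    ((contMDiff_proj (IB := I) (n := ∞) B.fib).mdifferentiableAt (by simp)) v

variable [FiniteDimensional ℝ E] [T2Space M] [IsManifold I ∞ M]

/-- Near a point of the total space, every coordinate is the sum of a function on the base and a
fibrewise linear function. -/
theorem exists_coordinate (b₀ : B.Tot) (ℓ : E × B.F →L[ℝ] ℝ) :
    ∃ (g : M → ℝ) (ψ : ∀ m, B.fib m →ₗ[ℝ] ℝ), ContMDiff I 𝓘(ℝ) ∞ g ∧
      ContMDiff B.IT 𝓘(ℝ) ∞ (B.linearFun ψ) ∧
      (fun b : B.Tot => g b.proj + B.linearFun ψ b) =ᶠ[𝓝 b₀] fun b => ℓ (extChartAt B.IT b₀ b) := by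
  -- The restriction of ℓ to E gives a function of the base point alone; its restriction to the
  -- model fibre is fibrewise linear, with coefficients given by its values on a frame. Both are
  -- smooth near the point only and are cut off to become global.
  have hφ : ContMDiffOn I 𝓘(ℝ) ∞ (fun m => ℓ (extChartAt I b₀.proj m, 0)) (chartAt H b₀.proj).source :=
    (ℓ.comp (ContinuousLinearMap.inl ℝ E B.F)).contMDiff.comp_contMDiffOn
      (contMDiffOn_extChartAt (I := I) (n := ∞) (x := b₀.proj))
  obtain ⟨g, hg, hg'⟩ := exists_contMDiff_eventuallyEq hφ (chart_source_mem_nhds H b₀.proj)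
  let e := trivializationAt B.F B.fib b₀.proj
  have he : e.baseSet ∈ 𝓝 b₀.proj := e.open_baseSet.mem_nhds (mem_baseSet_trivializationAt _ _ _)
  let fr := B.frame b₀.proj
  have hc : ∀ i, ContMDiffOn I 𝓘(ℝ) ∞ (fun m => ℓ (0, B.coord b₀.proj m (fr.sec i m))) e.baseSet := by
    intro i m hm
    have h1 := ((B.contMDiffAt_iff_coord (f := fun m => m) (ξ := fr.sec i) (p := b₀.proj) hm).1
      (fr.sec i).contMDiff.contMDiffAt).2
    exact ((ℓ.comp (ContinuousLinearMap.inr ℝ E B.F)).contMDiff.contMDiffAt.comp m h1).contMDiffWithinAt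
  choose c hc hc' using fun i => exists_contMDiff_eventuallyEq (hc i) he
  refine ⟨g, fun m => ∑ i, c i m • fr.coef i m, hg, ?_, ?_⟩
  · exact B.contMDiff_linearFun_sum _ fun i _ => B.contMDiff_linearFun_smul (fr.smooth_coef i) (hc i)
  · have hq : Tendsto (TotalSpace.proj : B.Tot → M) (𝓝 b₀) (𝓝 b₀.proj) :=
      (FiberBundle.continuous_proj B.F B.fib).continuousAt
    filter_upwards [hq hg', hq he, hq fr.eventually_sum, hq (Filter.eventually_all.2 hc')] with b h1 h2 h3 h4
    rw [FiberBundle.extChartAt]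
    have h5 : (e b).1 = b.proj := e.coe_fst (e.mem_source.2 h2)
    change g b.proj + _ = ℓ (extChartAt I b₀.proj (e b).1, (e b).2)
    have h6 : (e b).2 = B.coord b₀.proj b.proj b.2 := (B.coord_eq h2 b.2).symm
    have h7 : ∀ (x : E) (y : B.F), ℓ (x, y) = ℓ (x, 0) + ℓ (0, y) := fun x y => by
      rw [← map_add]; simp
    rw [h5, h6, h7]
    refine congrArg₂ _ h1 ?_
    conv_rhs => rw [h3 b.2]
    have h8 : ∀ y, ℓ (0, y) = ℓ.comp (ContinuousLinearMap.inr ℝ E B.F) y := fun _ => rfl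
    simp only [linearFun, LinearMap.sum_apply, LinearMap.smul_apply, smul_eq_mul, h8, map_sum, map_smul]
    refine Finset.sum_congr rfl fun i _ => ?_
    rw [h4 i, ← h8]
    exact mul_comm _ _

/-- The trivialization of the tangent bundle is the derivative of the chart. Every coordinate of a
tangent vector, at all nearby points at once, is therefore the derivative of a pulled back function
plus that of a linear one. This yields both the separation of tangent vectors and the smoothness
test for vector fields. -/
theorem exists_dirDeriv_eq (b₀ : B.Tot) (ℓ : E × B.F →L[ℝ] ℝ) :
    ∃ (g : M → ℝ) (ψ : ∀ m, B.fib m →ₗ[ℝ] ℝ), ContMDiff I 𝓘(ℝ) ∞ g ∧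
      ContMDiff B.IT 𝓘(ℝ) ∞ (B.linearFun ψ) ∧ ∀ᶠ b in 𝓝 b₀, ∀ v : TangentSpace B.IT b,
        dirDeriv B.IT (fun b : B.Tot => g b.proj) v + dirDeriv B.IT (B.linearFun ψ) v =
          ℓ (trivializationAt (E × B.F) (TangentSpace B.IT) b₀ (⟨b, v⟩ : TangentBundle B.IT B.Tot)).2 := by
  obtain ⟨g, ψ, hg, hψ, h⟩ := B.exists_coordinate b₀ ℓ
  refine ⟨g, ψ, hg, hψ, ?_⟩
  filter_upwards [h.eventually_nhds, chart_source_mem_nhds (ModelProd H B.F) b₀] with b hb hs v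
  rw [← dirDeriv_add ((B.contMDiff_comp_proj hg).mdiffAt b) (hψ.mdiffAt b), dirDeriv_congr hb]
  have h1 : MDifferentiableAt B.IT 𝓘(ℝ, E × B.F) (extChartAt B.IT b₀) b := mdifferentiableAt_extChartAt hs
  rw [dirDeriv_clm ℓ h1 v]
  congr 1
  have h2 := TangentBundle.continuousLinearMapAt_trivializationAt (I := B.IT) hs
  have h3 : b ∈ (trivializationAt (E × B.F) (TangentSpace B.IT) b₀).baseSet := by
    rwa [TangentBundle.trivializationAt_baseSet]
  refine (DFunLike.congr_fun h2 v).symm.trans ?_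
  rw [Trivialization.continuousLinearMapAt_apply, Trivialization.linearMapAt_apply, if_pos h3]

theorem tangent_ext {b : B.Tot} {v w : TangentSpace B.IT b}
    (h₀ : ∀ g : M → ℝ, ContMDiff I 𝓘(ℝ) ∞ g →
      dirDeriv B.IT (fun b : B.Tot => g b.proj) v = dirDeriv B.IT (fun b : B.Tot => g b.proj) w)
    (h₁ : ∀ ψ : ∀ m, B.fib m →ₗ[ℝ] ℝ, ContMDiff B.IT 𝓘(ℝ) ∞ (B.linearFun ψ) →
      dirDeriv B.IT (B.linearFun ψ) v = dirDeriv B.IT (B.linearFun ψ) w) : v = w := by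
  let e := trivializationAt (E × B.F) (TangentSpace B.IT) b
  have hb : b ∈ e.baseSet := mem_baseSet_trivializationAt _ _ _
  have key : (e (⟨b, v⟩ : TangentBundle B.IT B.Tot)).2 = (e (⟨b, w⟩ : TangentBundle B.IT B.Tot)).2 := by
    refine (SeparatingDual.eq_iff_forall_dual_eq (R := ℝ)).2 fun ℓ => ?_
    obtain ⟨g, ψ, hg, hψ, h⟩ := B.exists_dirDeriv_eq b ℓ
    have := h.self_of_nhds
    rw [← this v, ← this w, h₀ g hg, h₁ ψ hψ]
  have hv : (⟨b, v⟩ : TangentBundle B.IT B.Tot) ∈ e.source := e.mem_source.2 hb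
  have hw : (⟨b, w⟩ : TangentBundle B.IT B.Tot) ∈ e.source := e.mem_source.2 hb
  have h2 := e.injOn hv hw (Prod.ext ((e.coe_fst hv).trans (e.coe_fst hw).symm) key)
  simpa using h2

theorem contMDiff_tangent {X : Type*} [TopologicalSpace X] {EX : Type*} [NormedAddCommGroup EX]
    [NormedSpace ℝ EX] {HX : Type*} [TopologicalSpace HX] [ChartedSpace HX X]
    {IX : ModelWithCorners ℝ EX HX} {f : X → B.Tot} (hf : ContMDiff IX B.IT ∞ f)
    {v : ∀ x, TangentSpace B.IT (f x)}
    (h₀ : ∀ g : M → ℝ, ContMDiff I 𝓘(ℝ) ∞ g →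
      ContMDiff IX 𝓘(ℝ) ∞ (fun x => dirDeriv B.IT (fun b : B.Tot => g b.proj) (v x)))
    (h₁ : ∀ ψ : ∀ m, B.fib m →ₗ[ℝ] ℝ, ContMDiff B.IT 𝓘(ℝ) ∞ (B.linearFun ψ) →
      ContMDiff IX 𝓘(ℝ) ∞ (fun x => dirDeriv B.IT (B.linearFun ψ) (v x))) :
    ContMDiff IX B.IT.tangent ∞ (fun x => (⟨f x, v x⟩ : TangentBundle B.IT B.Tot)) := by
  intro x₀
  refine contMDiffAt_totalSpace.2 ⟨hf.contMDiffAt, ?_⟩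
  let bs := Module.finBasis ℝ (E × B.F)
  let L := bs.equivFunL
  have key : ContMDiffAt IX 𝓘(ℝ, Fin (Module.finrank ℝ (E × B.F)) → ℝ) ∞ (fun x => L (trivializationAt (E × B.F) (TangentSpace B.IT) (f x₀)
      (⟨f x, v x⟩ : TangentBundle B.IT B.Tot)).2) x₀ := by
    rw [contMDiffAt_pi_space]
    intro i
    obtain ⟨g, ψ, hg, hψ, h⟩ := B.exists_dirDeriv_eq (f x₀)
      ((ContinuousLinearMap.proj i).comp (L : E × B.F →L[ℝ] Fin (Module.finrank ℝ (E × B.F)) → ℝ))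
    refine ((h₀ g hg).contMDiffAt.add (h₁ ψ hψ).contMDiffAt).congr_of_eventuallyEq ?_
    filter_upwards [hf.continuous.continuousAt.eventually h] with x hx
    exact (hx (v x)).symm
  have := (L.symm : (Fin (Module.finrank ℝ (E × B.F)) → ℝ) →L[ℝ] E × B.F).contMDiff.contMDiffAt.comp x₀ key
  refine this.congr_of_eventuallyEq (Filter.Eventually.of_forall fun x => ?_)
  simp

section Vert

variable {B} {m : M}

/-- The vertical part of a tangent vector at `b` relative to a section with value `b`. -/
def vert (β : B.Sec) {b : B.Tot} (v : TangentSpace B.IT b) : B.fib b.proj :=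
  ∑ i, (dirDeriv B.IT (B.linearFun ((B.frame b.proj).coef i)) v -
    dirDeriv I (fun x => (B.frame b.proj).coef i x (β x)) (B.tproj v)) • (B.frame b.proj).sec i b.proj

/-- Subtracting from v the image of its projection under the tangent map of β leaves a vertical
vector. In the expansion of ψ in a frame, the derivatives of its coefficients enter both sides with
the same weights because β passes through b, and so they cancel. -/
theorem vert_spec (β : B.Sec) {b : B.Tot} (hb : β b.proj = b.2) (v : TangentSpace B.IT b) {ψ : ∀ m, B.fib m →ₗ[ℝ] ℝ}
    (hψ : ContMDiff B.IT 𝓘(ℝ) ∞ (B.linearFun ψ)) :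
    dirDeriv B.IT (B.linearFun ψ) v =
      dirDeriv I (fun x => ψ x (β x)) (B.tproj v) + ψ b.proj (vert β v) := by
  let fr := B.frame b.proj
  have hs : ∀ i, ContMDiff I 𝓘(ℝ) ∞ (fun x => ψ x (fr.sec i x)) := fun i =>
    B.contMDiff_linearFun_sec hψ (fr.sec i)
  have hq : Tendsto (TotalSpace.proj : B.Tot → M) (𝓝 b) (𝓝 b.proj) :=
    (FiberBundle.continuous_proj B.F B.fib).continuousAt
  have e1 : dirDeriv B.IT (B.linearFun ψ) v =
      ∑ i, (ψ b.proj (fr.sec i b.proj) * dirDeriv B.IT (B.linearFun (fr.coef i)) v +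
        fr.coef i b.proj b.2 * dirDeriv I (fun x => ψ x (fr.sec i x)) (B.tproj v)) := by
    rw [dirDeriv_congr (h := fun b : B.Tot => ∑ i, ψ b.proj (fr.sec i b.proj) * B.linearFun (fr.coef i) b),
      dirDeriv_sum_mul _ (g := fun i => B.linearFun (fr.coef i)) (fun i => B.contMDiff_comp_proj (hs i))
        fr.smooth_coef]
    · refine Finset.sum_congr rfl fun i _ => ?_
      rw [B.dirDeriv_comp_proj (hs i)]
      rfl
    · filter_upwards [hq fr.eventually_sum] with y hy
      unfold linearFun
      conv_lhs => rw [hy y.2]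
      simp only [map_sum, map_smul, smul_eq_mul, mul_comm]
  have e2 : dirDeriv I (fun x => ψ x (β x)) (B.tproj v) =
      ∑ i, (ψ b.proj (fr.sec i b.proj) * dirDeriv I (fun x => fr.coef i x (β x)) (B.tproj v) +
        fr.coef i b.proj b.2 * dirDeriv I (fun x => ψ x (fr.sec i x)) (B.tproj v)) := by
    rw [dirDeriv_congr (h := fun x => ∑ i, ψ x (fr.sec i x) * fr.coef i x (β x)),
      dirDeriv_sum_mul _ hs fun i => fr.smooth_coefSec i β, hb]
    · filter_upwards [fr.eventually_sum] with y hy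
      conv_lhs => rw [hy (β y)]
      simp only [map_sum, map_smul, smul_eq_mul, mul_comm]
  rw [e1, e2, vert, map_sum, ← Finset.sum_add_distrib]
  refine Finset.sum_congr rfl fun i _ => ?_
  rw [map_smul, smul_eq_mul]
  change _ = _ + (dirDeriv B.IT (B.linearFun (fr.coef i)) v -
    dirDeriv I (fun x => fr.coef i x (β x)) (B.tproj v)) * ψ b.proj (fr.sec i b.proj)
  ring

theorem eq_vert (β : B.Sec) {b : B.Tot} (hb : β b.proj = b.2) (v : TangentSpace B.IT b) {y : B.fib b.proj}
    (h : ∀ ψ : ∀ m, B.fib m →ₗ[ℝ] ℝ, ContMDiff B.IT 𝓘(ℝ) ∞ (B.linearFun ψ) →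
      dirDeriv B.IT (B.linearFun ψ) v =
        dirDeriv I (fun x => ψ x (β x)) (B.tproj v) + ψ b.proj y) : vert β v = y := by
  refine B.ext_linearFun fun ψ hψ => ?_
  have := (B.vert_spec β hb v hψ).symm.trans (h ψ hψ)
  exact add_left_cancel this

end Vert

end VB

end TotalSpace
-- Lifts, core sections and homomorphism sections of the trivial double vector bundle
section TrivialGenerators

variable {E : Type*} [NormedAddCommGroup E] [NormedSpace ℝ E] {H : Type*} [TopologicalSpace H]
  {I : ModelWithCorners ℝ E H} {M : Type*} [TopologicalSpace M] [ChartedSpace H M]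
  {A B C A' B' C' : VB.{u} I M}

namespace DVB

/-- The section `b ↦ (0, b, k(b))` of the trivial double vector bundle. -/
def homSec (A : VB.{u} I M) {B C : VB.{u} I M} (k : BundleMap B C) : (trivial A B C).overB.Sec :=
  ⟨fun b => (0, k.fib b.proj b.2), (contMDiff_trivialOver_iff (A := A) (B := B) (C := C) _).2
    ⟨contMDiff_id, (A.contMDiff_zero.comp B.projMap.contMDiff :), k.smooth⟩⟩

/-- The vector `(a, b, c)` of the bundle `D → B`, for the trivial double vector bundle. -/
def vec {b : B.Tot} (a : A.fib b.proj) (c : C.fib b.proj) : (trivial A B C).overB.fib b := (a, c)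

/-- The component in `A` of a vector of `D → B`. -/
def vecA (b : B.Tot) : (trivial A B C).overB.fib b →ₗ[ℝ] A.fib b.proj where
  toFun v := v.1
  map_add' _ _ := rfl
  map_smul' _ _ := rfl

/-- The component in `C` of a vector of `D → B`. -/
def vecC (b : B.Tot) : (trivial A B C).overB.fib b →ₗ[ℝ] C.fib b.proj where
  toFun v := v.2
  map_add' _ _ := rfl
  map_smul' _ _ := rfl

section Vec

variable {b : B.Tot} (a a' : A.fib b.proj) (c c' : C.fib b.proj)

@[simp] theorem vecA_vec : vecA b (vec a c) = a := rfl

@[simp] theorem vecC_vec : vecC b (vec a c) = c := rfl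

theorem vec_eta (v : (trivial A B C).overB.fib b) : vec (vecA b v) (vecC b v) = v := rfl

theorem vec_ext {v w : (trivial A B C).overB.fib b} (h₁ : vecA b v = vecA b w) (h₂ : vecC b v = vecC b w) :
    v = w := Prod.ext h₁ h₂

theorem vec_add_vec : (vec a c + vec a' c' : (trivial A B C).overB.fib b) = vec (a + a') (c + c') := rfl

theorem vec_sub_vec : (vec a c - vec a' c' : (trivial A B C).overB.fib b) = vec (a - a') (c - c') := rfl

theorem smul_vec (r : ℝ) : (r • vec a c : (trivial A B C).overB.fib b) = vec (r • a) (r • c) := rfl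

theorem vec_zero : (vec 0 0 : (trivial A B C).overB.fib b) = 0 := rfl

theorem sum_smul_vec_zero {ι : Type*} (t : Finset ι) (r : ι → ℝ) (c : ι → C.fib b.proj) :
    ∑ i ∈ t, (r i • vec 0 (c i) : (trivial A B C).overB.fib b) = vec 0 (∑ i ∈ t, r i • c i) := by
  refine vec_ext ?_ ?_ <;> simp

end Vec

theorem liftSec_apply (a : A.Sec) (b : B.Tot) : liftSec A B C a b = vec (a b.proj) 0 := rfl

theorem coreSec_apply (c : C.Sec) (b : B.Tot) : coreSec A B c b = vec 0 (c b.proj) := rfl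

theorem homSec_apply (k : BundleMap B C) (b : B.Tot) : homSec A k b = vec 0 (k.fib b.proj b.2) := rfl

theorem liftSec_add (a a' : A.Sec) : liftSec A B C (a + a') = liftSec A B C a + liftSec A B C a' := by
  ext b
  exact Prod.ext rfl (add_zero _).symm

theorem liftSec_smul (r : ℝ) (a : A.Sec) : liftSec A B C (r • a) = r • liftSec A B C a := by
  ext b
  exact Prod.ext rfl (smul_zero _).symm

theorem coreSec_add (c c' : C.Sec) : coreSec A B (c + c') = coreSec A B c + coreSec A B c' := by
  ext b
  exact Prod.ext (add_zero _).symm rfl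

theorem coreSec_smul (r : ℝ) (c : C.Sec) : coreSec A B (r • c) = r • coreSec A B c := by
  ext b
  exact Prod.ext (smul_zero _).symm rfl

theorem liftSec_smulSec (g : M → ℝ) (hg : ContMDiff I 𝓘(ℝ) ∞ g) (a : A.Sec) :
    liftSec A B C (A.smulSec g hg a) =
      (trivial A B C).overB.smulSec (fun b => g b.proj) (B.contMDiff_comp_proj hg) (liftSec A B C a) := by
  ext b
  exact Prod.ext rfl (smul_zero _).symm

theorem coreSec_smulSec (g : M → ℝ) (hg : ContMDiff I 𝓘(ℝ) ∞ g) (c : C.Sec) :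
    coreSec A B (C.smulSec g hg c) =
      (trivial A B C).overB.smulSec (fun b => g b.proj) (B.contMDiff_comp_proj hg) (coreSec A B c) := by
  ext b
  exact Prod.ext (smul_zero _).symm rfl

theorem coreSec_injective : Function.Injective (coreSec A B : C.Sec → (trivial A B C).overB.Sec) := by
  intro c c' h
  ext m
  exact congrArg Prod.snd (congrArg (fun X : (trivial A B C).overB.Sec => X ⟨m, 0⟩) h)

variable [FiniteDimensional ℝ E] [T2Space M] [IsManifold I ∞ M]

theorem eq_liftSec_add_coreSec {b : B.Tot} (v : (trivial A B C).overB.fib b) :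
    v = liftSec A B C (A.secThrough (vecA b v)) b + coreSec A B (C.secThrough (vecC b v)) b := by
  rw [liftSec_apply, coreSec_apply, VB.secThrough_self, VB.secThrough_self, vec_add_vec, add_zero,
    zero_add, vec_eta]

/-- The derivative of `k(b)` in the core direction. -/
theorem pderiv_homSec (φ : BundleMap B B') (k : BundleMap B C') (β : B.Sec) {b : B.Tot}
    (hb : β b.proj = b.2) (v : TangentSpace B.IT b) :
    VB.pderiv B.IT (trivial A' B' C').overB φ.total
      (fun y => vec (b := φ.total y) 0 (k.fib y.proj y.2 - k.fib y.proj (β y.proj))) b v =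
      vec (b := φ.total b) 0 (k.fib b.proj (VB.vert β v)) := by
  let fr := B.frame b.proj
  have hq : Tendsto (TotalSpace.proj : B.Tot → M) (𝓝 b) (𝓝 b.proj) :=
    (FiberBundle.continuous_proj B.F B.fib).continuousAt
  -- The difference k(y) - k(β) is written as ∑ w_r ζ_r with functions w_r that vanish at b. Only
  -- the derivatives of the w_r contribute, and they are the coefficients that define `VB.vert`.
  let ζ : Fin fr.n → ∀ y : B.Tot, (trivial A' B' C').overB.fib (φ.total y) := fun r y =>
    vec 0 (k.fib y.proj (fr.sec r y.proj))
  let w : Fin fr.n → B.Tot → ℝ := fun r y => B.linearFun (fr.coef r) y - fr.coef r y.proj (β y.proj)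
  have hβ : ∀ r, ContMDiff B.IT 𝓘(ℝ) ∞ (fun y : B.Tot => fr.coef r y.proj (β y.proj)) := fun r =>
    B.contMDiff_comp_proj (fr.smooth_coefSec r β)
  have hw : ∀ r, ContMDiff B.IT 𝓘(ℝ) ∞ (w r) := fun r => (fr.smooth_coef r).sub (hβ r)
  have hφ : ContMDiff B.IT B'.IT ∞ φ.total := φ.smooth
  have hζ : ∀ r, ContMDiff B.IT (trivial A' B' C').overB.IT ∞
      (fun y => (⟨φ.total y, ζ r y⟩ : (trivial A' B' C').overB.Tot)) := fun r =>
    ((coreSec A' B' (k.onSec (fr.sec r))).contMDiff.comp hφ :)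
  have h1 : ∀ᶠ y in 𝓝 b, vec (A := A') (b := φ.total y) 0 (k.fib y.proj y.2 - k.fib y.proj (β y.proj)) =
      ∑ r, w r y • ζ r y := by
    filter_upwards [hq fr.eventually_sum] with y hy
    have h2 : k.fib y.proj y.2 - k.fib y.proj (β y.proj) = ∑ r, w r y • k.fib y.proj (fr.sec r y.proj) := by
      conv_lhs => rw [hy y.2, hy (β y.proj)]
      rw [← map_sub, ← Finset.sum_sub_distrib, map_sum]
      refine Finset.sum_congr rfl fun r _ => ?_
      rw [← sub_smul, map_smul]
      rfl
    exact (congrArg (vec (b := φ.total y) 0) h2).trans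
      (sum_smul_vec_zero (b := φ.total y) _ (fun r => w r y) _).symm
  have h4 : ∀ r, VB.pderiv B.IT (trivial A' B' C').overB φ.total (fun y => w r y • ζ r y) b v =
      (dirDeriv B.IT (B.linearFun (fr.coef r)) v -
        dirDeriv I (fun x => fr.coef r x (β x)) (B.tproj v)) • ζ r b := by
    intro r
    rw [VB.pderiv_smul (hw r).contMDiffAt (hζ r).contMDiffAt]
    have h5 : w r b = 0 := by
      change fr.coef r b.proj b.2 - fr.coef r b.proj (β b.proj) = 0
      rw [hb, sub_self]
    have h6 : dirDeriv B.IT (w r) v = _ := dirDeriv_sub ((fr.smooth_coef r).mdiffAt b) ((hβ r).mdiffAt b) v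
    rw [h5, zero_smul, add_zero, ← B.dirDeriv_comp_proj (fr.smooth_coefSec r β), h6]
    rfl
  refine (VB.pderiv_congr h1 v).trans ((VB.pderiv_sum _ hφ.contMDiffAt (fun r _ =>
    VB.contMDiffAt_smul (hw r).contMDiffAt (hζ r).contMDiffAt) v).trans ?_)
  rw [Finset.sum_congr rfl fun r _ => h4 r]
  refine (sum_smul_vec_zero (b := φ.total b) _ _ _).trans (congrArg (vec (b := φ.total b) 0) ?_)
  unfold VB.vert
  rw [map_sum]
  exact Finset.sum_congr rfl fun r _ => (map_smul _ _ _).symm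

theorem sderiv_homSec (k : BundleMap B C) (β : B.Sec) {b : B.Tot}
    (hb : β b.proj = b.2) (v : TangentSpace B.IT b) :
    (trivial A B C).overB.sderiv (fun y => homSec A k y - coreSec A B (k.onSec β) y) b v =
      vec 0 (k.fib b.proj (VB.vert β v)) := by
  refine Eq.trans ?_ (pderiv_homSec (A' := A) (BundleMap.id B) k β hb v)
  refine VB.pderiv_congr (f := fun x : B.Tot => x) (Filter.Eventually.of_forall fun y => ?_) v
  rw [homSec_apply, coreSec_apply, vec_sub_vec, sub_self]
  rfl

end DVB

/-- The conditions relating structure operators and a bracket on the trivial double vector bundle. -/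
structure SkewAlgebroid.IsAssociated [IsManifold I ∞ M] (LA : LieAlgebroid A) (V : StructureOperators A B C)
    (L : SkewAlgebroid (DVB.trivial A B C).overB) : Prop where
  anchor_lift_pullback : ∀ (a : A.Sec) (g : M → ℝ), ContMDiff I 𝓘(ℝ) ∞ g → ∀ b : B.Tot,
    L.deriv (DVB.liftSec A B C a) (fun x => g x.proj) b = LA.deriv a g b.proj
  anchor_lift_linear : ∀ (a : A.Sec) (ψ : ∀ m, B.fib m →ₗ[ℝ] ℝ),
    ContMDiff B.IT 𝓘(ℝ) ∞ (B.linearFun ψ) → ∀ (β : B.Sec) (m : M),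
      L.deriv (DVB.liftSec A B C a) (B.linearFun ψ) ⟨m, β m⟩ =
        LA.deriv a (fun x => ψ x (β x)) m - ψ m (V.nabla₁ a β m)
  anchor_core_pullback : ∀ (c : C.Sec) (g : M → ℝ), ContMDiff I 𝓘(ℝ) ∞ g → ∀ b : B.Tot,
    L.deriv (DVB.coreSec A B c) (fun x => g x.proj) b = 0
  anchor_core_linear : ∀ (c : C.Sec) (ψ : ∀ m, B.fib m →ₗ[ℝ] ℝ),
    ContMDiff B.IT 𝓘(ℝ) ∞ (B.linearFun ψ) → ∀ b : B.Tot,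
      L.deriv (DVB.coreSec A B c) (B.linearFun ψ) b = ψ b.proj (V.bd.fib b.proj (c b.proj))
  bracket_core_core : ∀ c c' : C.Sec, L.bracket (DVB.coreSec A B c) (DVB.coreSec A B c') = 0
  bracket_lift_core : ∀ (a : A.Sec) (c : C.Sec),
    L.bracket (DVB.liftSec A B C a) (DVB.coreSec A B c) = DVB.coreSec A B (V.nabla₀ a c)
  bracket_lift_lift : ∀ (a a' : A.Sec) (b : B.Tot),
    L.bracket (DVB.liftSec A B C a) (DVB.liftSec A B C a') b =
      DVB.vec (LA.bracket a a' b.proj) (V.K.fib b.proj (a b.proj) (a' b.proj) b.2)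

theorem IsAssociated.toSkew [IsManifold I ∞ M] {LA : LieAlgebroid A} {V : StructureOperators A B C}
    {L : LieAlgebroid (DVB.trivial A B C).overB} (h : IsAssociated LA V L) : L.toSkew.IsAssociated LA V :=
  ⟨h.1, h.2, h.3, h.4, h.5, h.6, h.7⟩

namespace SkewAlgebroid.IsAssociated

variable [FiniteDimensional ℝ E] [T2Space M] [IsManifold I ∞ M]
  {LA : LieAlgebroid A} {V : StructureOperators A B C} {L : SkewAlgebroid (DVB.trivial A B C).overB}
  (h : L.IsAssociated LA V)

include h

theorem dirDeriv_tproj_lift (a : A.Sec) {g : M → ℝ} (hg : ContMDiff I 𝓘(ℝ) ∞ g) (b : B.Tot) :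
    dirDeriv I g (B.tproj (L.anchor b (DVB.liftSec A B C a b))) = LA.deriv a g b.proj :=
  (B.dirDeriv_comp_proj hg _).symm.trans (h.anchor_lift_pullback a g hg b)

theorem dirDeriv_tproj_core (c : C.Sec) {g : M → ℝ} (hg : ContMDiff I 𝓘(ℝ) ∞ g) (b : B.Tot) :
    dirDeriv I g (B.tproj (L.anchor b (DVB.coreSec A B c b))) = 0 :=
  (B.dirDeriv_comp_proj hg _).symm.trans (h.anchor_core_pullback c g hg b)

/-- The anchor of h(a) is horizontal for ∇¹, whereas the derivative of β along ρ(a) has the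
covariant derivative of β as its vertical part. This accounts for the sign. -/
theorem vert_lift (a : A.Sec) (β : B.Sec) {b : B.Tot} (hb : β b.proj = b.2) :
    VB.vert β (L.anchor b (DVB.liftSec A B C a b)) = -V.nabla₁ a β b.proj := by
  refine VB.eq_vert β hb _ fun ψ hψ => ?_
  rw [h.dirDeriv_tproj_lift a (B.contMDiff_linearFun_sec hψ β), map_neg, ← sub_eq_add_neg,
    ← h.anchor_lift_linear a ψ hψ]
  rw [hb]
  rfl

theorem vert_core (c : C.Sec) (β : B.Sec) {b : B.Tot} (hb : β b.proj = b.2) :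
    VB.vert β (L.anchor b (DVB.coreSec A B c b)) = V.bd.fib b.proj (c b.proj) := by
  refine VB.eq_vert β hb _ fun ψ hψ => ?_
  rw [h.dirDeriv_tproj_core c (B.contMDiff_linearFun_sec hψ β), zero_add, ← h.anchor_core_linear c ψ hψ]
  rfl

/-- At b the section defined by k agrees with the core section of k(β). The bracket with their
difference is a derivative along the anchor, by `bracket_eq_sderiv`, and this derivative sees only
the vertical part. The outcome is the covariant derivative of k as a section of Hom(B, C). -/
theorem bracket_lift_hom (a : A.Sec) (k : BundleMap B C) (β : B.Sec) {b : B.Tot} (hb : β b.proj = b.2) :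
    L.bracket (DVB.liftSec A B C a) (DVB.homSec A k) b =
      DVB.vec 0 (V.nabla₀ a (k.onSec β) b.proj - k.fib b.proj (V.nabla₁ a β b.proj)) := by
  have h1 : DVB.homSec A k b = DVB.coreSec A B (k.onSec β) b :=
    congrArg (DVB.vec 0) (congrArg (k.fib b.proj) hb.symm)
  have h2 := L.bracket_eq_sderiv (DVB.liftSec A B C a) (DVB.homSec A k - DVB.coreSec A B (k.onSec β))
    (x := b) (sub_eq_zero.2 h1)
  have h3 := h2.trans (DVB.sderiv_homSec k β hb _)
  rw [map_sub, h.bracket_lift_core, h.vert_lift a β hb] at h3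
  refine (sub_eq_iff_eq_add.1 h3).trans ?_
  rw [DVB.coreSec_apply, DVB.vec_add_vec, add_zero, map_neg, neg_add_eq_sub]

/-- The method of `bracket_lift_hom` applies; the core sections commute, and the vertical part of
the anchor of ĉ is ∂c. -/
theorem bracket_core_hom (c : C.Sec) (k : BundleMap B C) (b : B.Tot) :
    L.bracket (DVB.coreSec A B c) (DVB.homSec A k) b =
      DVB.vec 0 (k.fib b.proj (V.bd.fib b.proj (c b.proj))) := by
  let β := B.secThrough b.2
  have hb : β b.proj = b.2 := B.secThrough_self _
  have h1 : DVB.homSec A k b = DVB.coreSec A B (k.onSec β) b :=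
    congrArg (DVB.vec 0) (congrArg (k.fib b.proj) hb.symm)
  have h2 := L.bracket_eq_sderiv (DVB.coreSec A B c) (DVB.homSec A k - DVB.coreSec A B (k.onSec β))
    (x := b) (sub_eq_zero.2 h1)
  have h3 := h2.trans (DVB.sderiv_homSec k β hb _)
  rw [map_sub, h.bracket_core_core, h.vert_core c β hb, sub_zero] at h3
  exact h3

end SkewAlgebroid.IsAssociated

end TrivialGenerators

/-! ### Anchors preserve brackets; linear and core sections of the trivial double vector bundle -/

section TrivialVBAlgebroid

variable {E : Type*} [NormedAddCommGroup E] [NormedSpace ℝ E] {H : Type*} [TopologicalSpace H]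
  {I : ModelWithCorners ℝ E H} {M : Type*} [TopologicalSpace M] [ChartedSpace H M]

/-- The anchor of a Lie algebroid preserves brackets. -/
theorem LieAlgebroid.deriv_bracket [FiniteDimensional ℝ E] [T2Space M] [IsManifold I ∞ M] {V : VB.{u} I M}
    (L : LieAlgebroid V) (a b : V.Sec) {g : M → ℝ} (hg : ContMDiff I 𝓘(ℝ) ∞ g) (x : M) :
    L.deriv (L.bracket a b) g x = L.deriv a (L.deriv b g) x - L.deriv b (L.deriv a g) x := by
  -- With a section c that is nonzero at x, the Jacobi identity for a, b and g c has the claimed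
  -- identity as its coefficient of c. If the fibre is zero there is no such c, but then all anchors
  -- at x vanish.
  by_cases h : ∃ v : V.fib x, v ≠ 0
  · obtain ⟨v, hv⟩ := h
    let c := V.secThrough v
    have hc : c x = v := V.secThrough_self v
    have hda : ∀ a, ContMDiff I 𝓘(ℝ) ∞ (L.deriv a g) := fun a => L.toSkew.contMDiff_deriv a hg
    have e : ∀ (a b : V.Sec) (g : M → ℝ) (hg : ContMDiff I 𝓘(ℝ) ∞ g) (y : M),
        L.bracket a (V.smulSec g hg b) y = g y • L.bracket a b y + L.deriv a g y • b y :=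
      fun a b g hg y => L.toSkew.bracket_smulSec a b g hg y
    have e2 : ∀ a, L.bracket a (V.smulSec g hg c) = V.smulSec g hg (L.bracket a c) +
        V.smulSec (L.deriv a g) (hda a) c := fun a => by
      ext y
      rw [e]
      rfl
    have e3 : ∀ a b, L.bracket a (L.bracket b (V.smulSec g hg c)) x =
        g x • L.bracket a (L.bracket b c) x + L.deriv a g x • L.bracket b c x +
        (L.deriv b g x • L.bracket a c x + L.deriv a (L.deriv b g) x • c x) := fun a b => by
      rw [e2, map_add, ContMDiffSection.coe_add, Pi.add_apply, e, e]
    have j := congrArg (fun s : V.Sec => s x) (L.jacobi a b (V.smulSec g hg c))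
    simp only [ContMDiffSection.coe_add, Pi.add_apply] at j
    rw [e3, e3, e, L.jacobi a b c] at j
    have h0 : (L.deriv (L.bracket a b) g x - (L.deriv a (L.deriv b g) x - L.deriv b (L.deriv a g) x)) •
        c x = 0 := by
      simp only [ContMDiffSection.coe_add, Pi.add_apply] at j
      rw [← sub_eq_zero] at j
      rw [← neg_eq_zero, ← j]
      module
    rw [hc] at h0
    exact sub_eq_zero.1 ((smul_eq_zero.1 h0).resolve_right hv)
  · push Not at h
    have h0 : ∀ (a : V.Sec) (g : M → ℝ), L.deriv a g x = 0 := fun a g => by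
      unfold deriv
      rw [h (a x), map_zero]
      exact map_zero (mfderiv I 𝓘(ℝ) g x)
    rw [h0, h0, h0, sub_zero]

/-- A fibrewise linear map that is smooth on sections is smooth. -/
def BundleMap.ofSec [FiniteDimensional ℝ E] [T2Space M] [IsManifold I ∞ M] {V W : VB.{u} I M}
    (φ : ∀ x, V.fib x →ₗ[ℝ] W.fib x)
    (h : ∀ s : V.Sec, ContMDiff I W.IT ∞ (fun x => (⟨x, φ x (s x)⟩ : W.Tot))) : BundleMap V W where
  fib := φ
  smooth := by
    intro v₀
    let fr := V.frame v₀.proj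
    have hq : ContMDiff V.IT I ∞ (TotalSpace.proj : V.Tot → M) := contMDiff_proj V.fib
    refine VB.contMDiffAt_congr (f := (TotalSpace.proj : V.Tot → M))
      (ξ := fun v => ∑ i, fr.coef i v.proj v.2 • φ v.proj (fr.sec i v.proj)) ?_ ?_
    · filter_upwards [hq.continuous.continuousAt.eventually fr.eventually_sum] with v hv
      conv_rhs => rw [hv v.2]
      simp only [map_sum, map_smul]
    · exact VB.contMDiffAt_sum _ hq.contMDiffAt fun i _ =>
        VB.contMDiffAt_smul (fr.smooth_coef i).contMDiffAt ((h (fr.sec i)).comp hq).contMDiffAt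

variable {A B C : VB.{u} I M}

/-- The bundle map `K(a, a') : B → C`. -/
def TrilinMap.hom [FiniteDimensional ℝ E] [T2Space M] [IsManifold I ∞ M] (K : TrilinMap A B C)
    (a a' : A.Sec) : BundleMap B C :=
  BundleMap.ofSec (fun x => K.fib x (a x) (a' x)) (K.smooth a a')

/-- The bundle map `Φ_a : B → C`. -/
def BilinMap.hom [FiniteDimensional ℝ E] [T2Space M] [IsManifold I ∞ M] (Φ : BilinMap A B C)
    (a : A.Sec) : BundleMap B C :=
  BundleMap.ofSec (fun x => Φ.fib x (a x)) (Φ.smooth a)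

theorem VB.mk_inj {V : VB.{u} I M} {m : M} {v w : V.fib m} (h : (⟨m, v⟩ : V.Tot) = ⟨m, w⟩) : v = w :=
  eq_of_heq ((TotalSpace.mk.injEq _ _ _ _).mp h).2

namespace DVB

theorem trivialMk_inj {m : M} {a a' : A.fib m} {b b' : B.fib m} {c c' : C.fib m}
    (h : trivialMk a b c = trivialMk a' b' c') : a = a' ∧ b = b' ∧ c = c' := by
  have h1 : b = b' := VB.mk_inj (congrArg TotalSpace.proj h)
  subst h1
  have h2 : ((a, c) : A.fib m × C.fib m) = (a', c') := by
    exact VB.mk_inj (V := (trivial A B C).overB) h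
  exact ⟨congrArg Prod.fst h2, rfl, congrArg Prod.snd h2⟩

theorem isSumA_trivialMk {m : M} (a : A.fib m) (b b' : B.fib m) (c c' : C.fib m) :
    (trivial A B C).IsSumA (trivialMk a b c) (trivialMk a b' c') (trivialMk a (b + b') (c + c')) :=
  ⟨⟨m, a⟩, (b, c), (b', c'), rfl, rfl, rfl⟩

theorem isSumA_trivialMk_iff {m : M} {a a' a'' : A.fib m} {b b' b'' : B.fib m} {c c' c'' : C.fib m} :
    (trivial A B C).IsSumA (trivialMk a b c) (trivialMk a' b' c') (trivialMk a'' b'' c'') ↔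
      a' = a ∧ a'' = a ∧ b'' = b + b' ∧ c'' = c + c' := by
  constructor
  · intro h
    obtain ⟨n, α, β, β', γ, γ', e1, e2, e3⟩ := trivial_isSumA A B C h
    obtain rfl : m = n := congrArg (fun x : (trivialOver B A C).Tot => x.proj.proj) e1
    obtain ⟨rfl, rfl, rfl⟩ := trivialMk_inj e1
    obtain ⟨rfl, rfl, rfl⟩ := trivialMk_inj e2
    obtain ⟨rfl, rfl, rfl⟩ := trivialMk_inj e3
    exact ⟨rfl, rfl, rfl, rfl⟩
  · rintro ⟨rfl, rfl, rfl, rfl⟩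
    exact isSumA_trivialMk _ _ _ _ _

/-- The core component of X does not depend on the point of the fibre of B, so it can be read off
along the zero section, where smoothness in the base point is visible. -/
theorem isCoreSection_iff (X : (trivial A B C).overB.Sec) :
    (trivial A B C).IsCoreSection X ↔ ∃ c, X = coreSec A B c := by
  constructor
  · rintro ⟨c', -, h, h'⟩
    have hX := (contMDiff_trivialOver_iff (A := A) (B := B) (C := C) _).1
      (X.contMDiff.comp B.contMDiff_zero)
    refine ⟨⟨fun m => vecC ⟨m, 0⟩ (X ⟨m, 0⟩), hX.2.2⟩, ?_⟩
    ext b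
    have hc : ∃ c : C.fib b.proj, c' b.proj = trivialMk 0 0 c := by
      obtain ⟨n, α, β, β', γ, γ', e1, e2, e3⟩ := trivial_isSumA A B C (h' b)
      obtain ⟨m, b⟩ := b
      obtain rfl : m = n := congrArg (fun x : (trivialOver B A C).Tot => x.proj.proj) e1
      have e4 := (h m).1
      have e5 := (h m).2
      change c' m = _ at e2
      rw [e2] at e4 e5
      have e6 : α = 0 := VB.mk_inj e4
      have e7 : β' = 0 := VB.mk_inj e5
      exact ⟨γ', by rw [← e6, ← e7]; exact e2⟩
    obtain ⟨c, hc⟩ := hc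
    have key : ∀ b₁ : B.fib b.proj, X ⟨b.proj, b₁⟩ = vec 0 c := by
      intro b₁
      have h1 := h' ⟨b.proj, b₁⟩
      rw [hc] at h1
      have h2 := isSumA_trivialMk_iff.1 h1
      refine vec_ext h2.2.1 (h2.2.2.2.trans (zero_add _))
    refine (key b.2).trans ?_
    exact congrArg (vec 0) (congrArg (vecC _) (key 0)).symm
  · rintro ⟨c, rfl⟩
    refine ⟨fun m => trivialMk 0 0 (c m), (contMDiff_trivialOver_iff _).2
      ⟨B.contMDiff_zero, A.contMDiff_zero, c.contMDiff⟩, fun m => ⟨rfl, rfl⟩, fun b => ?_⟩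
    exact isSumA_trivialMk_iff.2 ⟨rfl, rfl, (add_zero _).symm, (zero_add _).symm⟩

/-- A linear section over a has the same component in A as h(a), and its component in C depends
additively and homogeneously on b. -/
theorem isLinearSection_iff (X : (trivial A B C).overB.Sec) (a : A.Sec) :
    (trivial A B C).IsLinearSection X a ↔ ∃ k, X = liftSec A B C a + homSec A k := by
  constructor
  · intro h
    have hX := (contMDiff_trivialOver_iff (A := A) (B := B) (C := C) _).1 X.contMDiff
    have h1 : ∀ b : B.Tot, vecA b (X b) = a b.proj := fun b => VB.mk_inj (h.covers b)
    refine ⟨⟨fun m =>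
      { toFun := fun b => vecC ⟨m, b⟩ (X ⟨m, b⟩)
        map_add' := fun b b' => ?_
        map_smul' := fun r b => ?_ }, hX.2.2⟩, ?_⟩
    · exact (isSumA_trivialMk_iff.1 (h.add ⟨m, b⟩ ⟨m, b'⟩ ⟨m, b + b'⟩ ⟨m, b, b', rfl, rfl, rfl⟩)).2.2.2
    · exact (trivialMk_inj (h.scale r ⟨m, b⟩)).2.2
    · ext b
      refine vec_ext ?_ ?_
      · exact (h1 b).trans (add_zero _).symm
      · exact (zero_add _).symm
  · rintro ⟨k, rfl⟩
    have h1 : ∀ b : B.Tot, (⟨b, (liftSec A B C a + homSec A k) b⟩ : (trivial A B C).Tot) =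
        trivialMk (a b.proj) b.2 (k.fib b.proj b.2) := by
      intro b
      have : (liftSec A B C a + homSec A k) b = vec (a b.proj) (k.fib b.proj b.2) := by
        rw [ContMDiffSection.coe_add, Pi.add_apply, liftSec_apply, homSec_apply, vec_add_vec, add_zero,
          zero_add]
      rw [this]
      rfl
    refine ⟨fun b => ?_, fun b b' b'' hb => ?_, fun r b => ?_⟩
    · rw [h1]
      rfl
    · obtain ⟨m, b, b', rfl, rfl, rfl⟩ := hb
      rw [h1, h1, h1]
      exact isSumA_trivialMk_iff.2 ⟨rfl, rfl, rfl, map_add _ _ _⟩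
    · rw [h1, h1]
      exact congrArg (trivialMk (a b.proj) (r • b.2)) (map_smul _ _ _)

end DVB

end TrivialVBAlgebroid
-- Structure operators associated with an algebroid form a representation
section AssociatedRepresentation

variable {E : Type*} [NormedAddCommGroup E] [NormedSpace ℝ E] {H : Type*} [TopologicalSpace H]
  {I : ModelWithCorners ℝ E H} {M : Type*} [TopologicalSpace M] [ChartedSpace H M]
  {A B C : VB.{u} I M} [FiniteDimensional ℝ E] [T2Space M] [IsManifold I ∞ M]

namespace DVB

theorem vecC_liftSec (a : A.Sec) (b : B.Tot) : vecC b (liftSec A B C a b) = 0 := rfl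

theorem vecC_coreSec (c : C.Sec) (b : B.Tot) : vecC b (coreSec A B c b) = c b.proj := rfl

theorem vecC_homSec (k : BundleMap B C) (b : B.Tot) : vecC b (homSec A k b) = k.fib b.proj b.2 := rfl

end DVB

namespace SkewAlgebroid.IsAssociated

variable {LA : LieAlgebroid A} {V : StructureOperators A B C} {L : SkewAlgebroid (DVB.trivial A B C).overB}

theorem bracket_lift_lift_eq (h : L.IsAssociated LA V) (a a' : A.Sec) :
    L.bracket (DVB.liftSec A B C a) (DVB.liftSec A B C a') =
      DVB.liftSec A B C (LA.bracket a a') + DVB.homSec A (V.K.hom a a') := by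
  ext b
  rw [h.bracket_lift_lift, ContMDiffSection.coe_add, Pi.add_apply, DVB.liftSec_apply, DVB.homSec_apply,
    DVB.vec_add_vec, add_zero, zero_add]
  rfl

end SkewAlgebroid.IsAssociated

namespace IsAssociated

variable {LA : LieAlgebroid A} {V W : StructureOperators A B C} {L : LieAlgebroid (DVB.trivial A B C).overB}

/-- Each structure operator is read off from one of the defining identities: ∂ and ∇¹ because linear
functions separate points, ∇⁰ because a core section determines its section of C, and K because
lifts take every value. -/
theorem eq (h : IsAssociated LA V L) (h' : IsAssociated LA W L) : V = W := by
  have e₁ : V.bd = W.bd := by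
    refine BundleMap.ext (funext fun m => LinearMap.ext fun c => B.ext_linearFun fun ψ hψ => ?_)
    have e := (h.anchor_core_linear (C.secThrough c) ψ hψ ⟨m, 0⟩).symm.trans
      (h'.anchor_core_linear (C.secThrough c) ψ hψ ⟨m, 0⟩)
    simpa using e
  have e₂ : V.nabla₀ = W.nabla₀ := funext fun a => funext fun c =>
    DVB.coreSec_injective (A := A) (B := B) ((h.bracket_lift_core a c).symm.trans (h'.bracket_lift_core a c))
  have e₃ : V.nabla₁ = W.nabla₁ := by
    funext a β
    ext m
    refine B.ext_linearFun fun ψ hψ => ?_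
    have e := (h.anchor_lift_linear a ψ hψ β m).symm.trans (h'.anchor_lift_linear a ψ hψ β m)
    exact sub_right_injective e
  have e₄ : V.K = W.K := by
    refine TrilinMap.ext (funext fun m => ?_)
    ext a a' b
    have e := (h.bracket_lift_lift (A.secThrough a) (A.secThrough a') ⟨m, b⟩).symm.trans
      (h'.bracket_lift_lift (A.secThrough a) (A.secThrough a') ⟨m, b⟩)
    simpa using congrArg Prod.snd e
  exact StructureOperators.ext e₁ e₂ e₃ e₄

/-- Both rules for ∇⁰ are the Leibniz rule for [h(a), ĉ] with functions pulled back from M. It is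
tensorial in a because the anchor of a core section annihilates such functions. -/
theorem connection₀ (h : IsAssociated LA V L) : LA.IsConnection V.nabla₀ where
  add_left a a' c := by
    apply DVB.coreSec_injective (A := A) (B := B)
    rw [← h.bracket_lift_core, DVB.liftSec_add, map_add, LinearMap.add_apply, h.bracket_lift_core,
      h.bracket_lift_core, DVB.coreSec_add]
  smul_left a a' g c hg ha x := by
    obtain rfl : a' = A.smulSec g hg a := by ext x; exact ha x
    have e := L.toSkew.bracket_smulSec_left (DVB.liftSec A B C a) (DVB.coreSec A B c) _
      (B.contMDiff_comp_proj hg) ⟨x, 0⟩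
    rw [← DVB.liftSec_smulSec, h.toSkew.bracket_lift_core, h.toSkew.bracket_lift_core,
      h.toSkew.anchor_core_pullback c g hg, zero_smul, sub_zero] at e
    exact congrArg (DVB.vecC _) e
  add_right a c c' := by
    apply DVB.coreSec_injective (A := A) (B := B)
    rw [← h.bracket_lift_core, DVB.coreSec_add, map_add, h.bracket_lift_core,
      h.bracket_lift_core, DVB.coreSec_add]
  leibniz a c c' g hg hc x := by
    obtain rfl : c' = C.smulSec g hg c := by ext x; exact hc x
    have e := L.toSkew.bracket_smulSec (DVB.liftSec A B C a) (DVB.coreSec A B c) _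
      (B.contMDiff_comp_proj hg) ⟨x, 0⟩
    rw [← DVB.coreSec_smulSec, h.toSkew.bracket_lift_core, h.toSkew.bracket_lift_core,
      h.toSkew.anchor_lift_pullback a g hg] at e
    exact congrArg (DVB.vecC _) e

theorem K_self (h : IsAssociated LA V L) (x : M) (a : A.fib x) (b : B.fib x) : V.K.fib x a a b = 0 := by
  have e := h.bracket_lift_lift (A.secThrough a) (A.secThrough a) ⟨x, b⟩
  rw [L.bracket_self] at e
  have e' := congrArg (DVB.vecC _) e
  change 0 = V.K.fib x (A.secThrough a x) (A.secThrough a x) b at e'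
  rw [VB.secThrough_self] at e'
  exact e'.symm

theorem K_skew (h : IsAssociated LA V L) (a a' : A.Sec) (β : B.Sec) :
    V.K.onSec a a' β = -V.K.onSec a' a β := by
  ext x
  have e := h.K_self x (a x + a' x) (β x)
  simp only [map_add, LinearMap.add_apply, h.K_self, zero_add, add_zero] at e
  exact eq_neg_of_add_eq_zero_right e

end IsAssociated

theorem LieAlgebroid.IsConnection.map_smul {LA : LieAlgebroid A} {D : A.Sec → B.Sec → B.Sec}
    (h : LA.IsConnection D) (a : A.Sec) (r : ℝ) (β : B.Sec) : D a (r • β) = r • D a β := by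
  ext x
  have e := h.leibniz a β (r • β) (fun _ => r) contMDiff_const (fun _ => rfl) x
  have e0 : LA.deriv a (fun _ => r) x = 0 := dirDeriv_const r _
  rwa [e0, zero_smul, add_zero] at e

namespace SkewAlgebroid

variable (L : SkewAlgebroid (DVB.trivial A B C).overB)

theorem deriv_congr_sec {X Y : (DVB.trivial A B C).overB.Sec} {b : B.Tot} (h : X b = Y b) (f : B.Tot → ℝ) :
    L.deriv X f b = L.deriv Y f b := by
  unfold deriv
  rw [h]

theorem deriv_add_sec (X Y : (DVB.trivial A B C).overB.Sec) (f : B.Tot → ℝ) (b : B.Tot) :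
    L.deriv (X + Y) f b = L.deriv X f b + L.deriv Y f b := by
  unfold deriv
  rw [ContMDiffSection.coe_add, Pi.add_apply, map_add, dirDeriv_add_vec]

variable {L}

namespace IsAssociated

variable {LA : LieAlgebroid A} {V : StructureOperators A B C} (h : L.IsAssociated LA V)

include h

theorem deriv_bracket_lift_lift_pullback (a a' : A.Sec) {g : M → ℝ} (hg : ContMDiff I 𝓘(ℝ) ∞ g) (b : B.Tot) :
    L.deriv (L.bracket (DVB.liftSec A B C a) (DVB.liftSec A B C a')) (fun x => g x.proj) b =
      LA.deriv (LA.bracket a a') g b.proj := by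
  rw [h.bracket_lift_lift_eq, deriv_add_sec, h.anchor_lift_pullback _ g hg]
  have e := h.anchor_core_pullback ((V.K.hom a a').onSec (B.secThrough b.2)) g hg b
  rw [L.deriv_congr_sec (Y := DVB.homSec A (V.K.hom a a'))] at e
  · rw [e, add_zero]
  · rw [DVB.coreSec_apply, DVB.homSec_apply]
    exact congrArg (DVB.vec 0) (congrArg ((V.K.hom a a').fib b.proj) (B.secThrough_self b.2))

theorem deriv_bracket_lift_lift_linear (a a' : A.Sec) {ψ : ∀ m, B.fib m →ₗ[ℝ] ℝ}
    (hψ : ContMDiff B.IT 𝓘(ℝ) ∞ (B.linearFun ψ)) (β : B.Sec) (m : M) :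
    L.deriv (L.bracket (DVB.liftSec A B C a) (DVB.liftSec A B C a')) (B.linearFun ψ) ⟨m, β m⟩ =
      LA.deriv (LA.bracket a a') (fun x => ψ x (β x)) m - ψ m (V.nabla₁ (LA.bracket a a') β m) +
        ψ m (V.bd.onSec (V.K.onSec a a' β) m) := by
  rw [h.bracket_lift_lift_eq, deriv_add_sec, h.anchor_lift_linear _ ψ hψ]
  congr 1
  exact h.anchor_core_linear ((V.K.hom a a').onSec β) ψ hψ ⟨m, β m⟩

variable (hV : LA.IsConnection V.nabla₁)

include hV

/-- The anchor of h(a) is a linear vector field and so maps linear functions to linear functions.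
Iterated derivatives can then be computed by applying `anchor_lift_linear` again. -/
theorem exists_deriv_lift_eq (a : A.Sec) {ψ : ∀ m, B.fib m →ₗ[ℝ] ℝ}
    (hψ : ContMDiff B.IT 𝓘(ℝ) ∞ (B.linearFun ψ)) :
    ∃ ψ' : ∀ m, B.fib m →ₗ[ℝ] ℝ, ContMDiff B.IT 𝓘(ℝ) ∞ (B.linearFun ψ') ∧
      L.deriv (DVB.liftSec A B C a) (B.linearFun ψ) = B.linearFun ψ' ∧
      ∀ (β : B.Sec) m, ψ' m (β m) = LA.deriv a (fun x => ψ x (β x)) m - ψ m (V.nabla₁ a β m) := by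
  have e : ∀ (m : M) (b : B.fib m), L.deriv (DVB.liftSec A B C a) (B.linearFun ψ) ⟨m, b⟩ =
      LA.deriv a (fun x => ψ x (B.secThrough b x)) m - ψ m (V.nabla₁ a (B.secThrough b) m) := by
    intro m b
    rw [← h.anchor_lift_linear a ψ hψ, VB.secThrough_self]
  have hs := fun β : B.Sec => (B.contMDiff_linearFun_sec hψ β)
  let ψ' : ∀ m, B.fib m →ₗ[ℝ] ℝ := fun m =>
    { toFun := fun b => L.deriv (DVB.liftSec A B C a) (B.linearFun ψ) ⟨m, b⟩
      map_add' := fun b b' => by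
        have e1 := h.anchor_lift_linear a ψ hψ (B.secThrough b + B.secThrough b') m
        have e2 := dirDeriv_add ((hs (B.secThrough b)).mdiffAt m) ((hs (B.secThrough b')).mdiffAt m)
          (LA.anchor m (a m))
        rw [hV.add_right] at e1
        simp only [ContMDiffSection.coe_add, Pi.add_apply, VB.secThrough_self, map_add] at e1
        rw [e1, e, e]
        unfold LieAlgebroid.deriv
        rw [e2]
        ring
      map_smul' := fun r b => by
        have e1 := h.anchor_lift_linear a ψ hψ (r • B.secThrough b) m
        have e2 := dirDeriv_mul (mdifferentiableAt_const (c := r)) ((hs (B.secThrough b)).mdiffAt m)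
          (LA.anchor m (a m))
        rw [dirDeriv_const, mul_zero, add_zero] at e2
        rw [hV.map_smul] at e1
        simp only [ContMDiffSection.coe_smul, Pi.smul_apply, VB.secThrough_self, _root_.map_smul,
          smul_eq_mul] at e1
        rw [e1, e]
        unfold LieAlgebroid.deriv
        rw [e2]
        simp only [smul_eq_mul, RingHom.id_apply]
        ring }
  exact ⟨ψ', L.contMDiff_deriv _ hψ, rfl, fun β m => h.anchor_lift_linear a ψ hψ β m⟩

theorem deriv_lift_deriv_lift (a a' : A.Sec) {ψ : ∀ m, B.fib m →ₗ[ℝ] ℝ}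
    (hψ : ContMDiff B.IT 𝓘(ℝ) ∞ (B.linearFun ψ)) (β : B.Sec) (m : M) :
    L.deriv (DVB.liftSec A B C a) (L.deriv (DVB.liftSec A B C a') (B.linearFun ψ)) ⟨m, β m⟩ =
      LA.deriv a (LA.deriv a' (fun x => ψ x (β x))) m -
        LA.deriv a (fun x => ψ x (V.nabla₁ a' β x)) m -
        LA.deriv a' (fun x => ψ x (V.nabla₁ a β x)) m + ψ m (V.nabla₁ a' (V.nabla₁ a β) m) := by
  obtain ⟨ψ', hψ', e1, e2⟩ := h.exists_deriv_lift_eq hV a' hψ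
  rw [e1, h.anchor_lift_linear a ψ' hψ', e2]
  simp only [e2]
  have e3 := dirDeriv_sub ((LA.toSkew.contMDiff_deriv a' (B.contMDiff_linearFun_sec hψ β)).mdiffAt m)
    ((B.contMDiff_linearFun_sec hψ (V.nabla₁ a' β)).mdiffAt m) (LA.anchor m (a m))
  change LA.deriv a _ m - _ = _
  refine (congrArg (· - _) e3).trans ?_
  change LA.deriv a (LA.deriv a' (fun x => ψ x (β x))) m - LA.deriv a (fun x => ψ x (V.nabla₁ a' β x)) m - _ = _
  ring

/-- The mixed terms in the second derivatives are symmetric in a and a' and drop out of the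
commutator. -/
theorem commutator_lift_lift (a a' : A.Sec) {ψ : ∀ m, B.fib m →ₗ[ℝ] ℝ}
    (hψ : ContMDiff B.IT 𝓘(ℝ) ∞ (B.linearFun ψ)) (β : B.Sec) (m : M) :
    L.deriv (DVB.liftSec A B C a) (L.deriv (DVB.liftSec A B C a') (B.linearFun ψ)) ⟨m, β m⟩ -
      L.deriv (DVB.liftSec A B C a') (L.deriv (DVB.liftSec A B C a) (B.linearFun ψ)) ⟨m, β m⟩ =
      LA.deriv (LA.bracket a a') (fun x => ψ x (β x)) m -
        ψ m (V.nabla₁ a (V.nabla₁ a' β) m) + ψ m (V.nabla₁ a' (V.nabla₁ a β) m) := by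
  rw [h.deriv_lift_deriv_lift hV a a' hψ, h.deriv_lift_deriv_lift hV a' a hψ,
    LA.deriv_bracket a a' (B.contMDiff_linearFun_sec hψ β)]
  ring

theorem commutator_lift_core (a : A.Sec) (c : C.Sec) {ψ : ∀ m, B.fib m →ₗ[ℝ] ℝ}
    (hψ : ContMDiff B.IT 𝓘(ℝ) ∞ (B.linearFun ψ)) (b : B.Tot) :
    L.deriv (DVB.liftSec A B C a) (L.deriv (DVB.coreSec A B c) (B.linearFun ψ)) b -
      L.deriv (DVB.coreSec A B c) (L.deriv (DVB.liftSec A B C a) (B.linearFun ψ)) b =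
      ψ b.proj (V.nabla₁ a (V.bd.onSec c) b.proj) := by
  obtain ⟨ψ', hψ', e1, e2⟩ := h.exists_deriv_lift_eq hV a hψ
  have e3 : L.deriv (DVB.coreSec A B c) (B.linearFun ψ) = fun b => ψ b.proj (V.bd.onSec c b.proj) :=
    funext fun b => h.anchor_core_linear c ψ hψ b
  rw [e3, h.anchor_lift_pullback a _ (B.contMDiff_linearFun_sec hψ (V.bd.onSec c)), e1,
    h.anchor_core_linear c ψ' hψ']
  have e4 := e2 (V.bd.onSec c) b.proj
  change _ - ψ' b.proj (V.bd.onSec c b.proj) = _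
  rw [e4]
  ring

end IsAssociated

end SkewAlgebroid

namespace IsAssociated

variable {LA : LieAlgebroid A} {V W : StructureOperators A B C} {L : LieAlgebroid (DVB.trivial A B C).overB}

/-- The structure operators associated with a VB-algebroid structure are a representation. -/
theorem isRepresentation (h : IsAssociated LA V L) (hV : LA.IsConnection V.nabla₁) :
    V.IsRepresentation LA where
  connection₀ := h.connection₀
  connection₁ := hV
  K_self := h.K_self
  bd_nabla a c := by
    ext m
    refine B.ext_linearFun fun ψ hψ => ?_
    -- The anchor preserves the bracket [h(a), ĉ] = (∇⁰_a c)^; on linear functions this reads ∂∇⁰ =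
    -- ∇¹∂.
    have e := L.deriv_bracket (DVB.liftSec A B C a) (DVB.coreSec A B c) hψ ⟨m, 0⟩
    have e1 := h.toSkew.commutator_lift_core hV a c hψ ⟨m, 0⟩
    rw [h.bracket_lift_core, h.anchor_core_linear _ ψ hψ] at e
    exact e.trans e1
  curvature₀ a a' c := by
    -- The Jacobi identity for two lifts and a core section. The term with K appears through the
    -- bracket of a homomorphism section and a core section, which involves K(a, a')∂c.
    have j := L.jacobi (DVB.liftSec A B C a) (DVB.liftSec A B C a') (DVB.coreSec A B c)
    have e1 : ∀ b, DVB.vecC b (L.bracket (DVB.homSec A (V.K.hom a a')) (DVB.coreSec A B c) b) =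
        -(V.K.onSec a a' (V.bd.onSec c) b.proj) := fun b => by
      have e2 := h.toSkew.bracket_core_hom c (V.K.hom a a') b
      rw [L.toSkew.bracket_skew] at e2
      exact neg_eq_iff_eq_neg.1 (congrArg (DVB.vecC b) e2)
    have e5 := h.toSkew.bracket_lift_lift_eq a a'
    change L.bracket _ _ = _ at e5
    rw [e5, map_add, LinearMap.add_apply, h.bracket_lift_core, h.bracket_lift_core, h.bracket_lift_core,
      h.bracket_lift_core, h.bracket_lift_core] at j
    ext m
    have j' := fun b => congrArg (fun X : (DVB.trivial A B C).overB.Sec => DVB.vecC b (X b)) j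
    simp only [ContMDiffSection.coe_add, Pi.add_apply, e1, DVB.vecC_coreSec, map_add] at j'
    simp only [LieAlgebroid.curvature, ContMDiffSection.coe_sub, Pi.sub_apply, ContMDiffSection.coe_neg,
      Pi.neg_apply]
    rw [show V.nabla₀ a (V.nabla₀ a' c) m = _ from j' ⟨m, 0⟩]
    abel
  curvature₁ a a' β := by
    ext m
    refine B.ext_linearFun fun ψ hψ => ?_
    -- The anchor preserves [h(a), h(a')]. On linear functions the part of this bracket in Hom(B, C)
    -- acts by ∂K.
    have e := L.deriv_bracket (DVB.liftSec A B C a) (DVB.liftSec A B C a') hψ ⟨m, β m⟩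
    have e1 := h.toSkew.commutator_lift_lift hV a a' hψ β m
    have e2 := h.toSkew.deriv_bracket_lift_lift_linear a a' hψ β m
    have e3 := (e2.symm.trans e).trans e1
    simp only [LieAlgebroid.curvature, ContMDiffSection.coe_sub, Pi.sub_apply, ContMDiffSection.coe_neg,
      Pi.neg_apply, map_sub, map_neg]
    linarith
  closed a₁ a₂ a₃ β := by
    -- The component in C of the Jacobi identity for three lifts is d_∇K = 0, once skew-symmetry of
    -- K has restored the order of the arguments.
    have j := L.jacobi (DVB.liftSec A B C a₁) (DVB.liftSec A B C a₂) (DVB.liftSec A B C a₃)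
    have e5 : ∀ a a', L.bracket (DVB.liftSec A B C a) (DVB.liftSec A B C a') = _ :=
      h.toSkew.bracket_lift_lift_eq
    ext m
    have e1 : ∀ (b : B.Tot) (_ : β b.proj = b.2) a a' a'', DVB.vecC b (L.bracket (DVB.liftSec A B C a)
        (DVB.homSec A (V.K.hom a' a'')) b) = V.nablaK a a' a'' β b.proj := fun b hb a a' a'' =>
      congrArg (DVB.vecC _) (h.toSkew.bracket_lift_hom a (V.K.hom a' a'') β hb)
    have e2 : L.bracket (DVB.homSec A (V.K.hom a₁ a₂)) (DVB.liftSec A B C a₃) =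
        -L.bracket (DVB.liftSec A B C a₃) (DVB.homSec A (V.K.hom a₁ a₂)) := L.toSkew.bracket_skew _ _
    rw [e5 a₂ a₃, e5 a₁ a₂, e5 a₁ a₃, map_add, map_add, map_add, LinearMap.add_apply, e5, e5, e5, e2] at j
    have j' := fun (b : B.Tot) (hb : β b.proj = b.2) =>
      congrArg (fun X : (DVB.trivial A B C).overB.Sec => DVB.vecC b (X b)) j
    simp only [ContMDiffSection.coe_add, Pi.add_apply, ContMDiffSection.coe_neg, Pi.neg_apply,
      DVB.vecC_liftSec, DVB.vecC_homSec, map_add, map_neg, zero_add] at j'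
    replace j' := j' ⟨m, β m⟩ rfl
    rw [e1 ⟨m, β m⟩ rfl, e1 ⟨m, β m⟩ rfl, e1 ⟨m, β m⟩ rfl] at j'
    have e3 : ∀ a a', ((V.K.hom a a').fib m (β m)) = V.K.onSec a a' β m := fun _ _ => rfl
    simp only [e3] at j'
    have s1 := congrArg (fun s : C.Sec => s m) (h.K_skew (LA.bracket a₁ a₃) a₂ β)
    have s2 := congrArg (fun s : C.Sec => s m) (h.K_skew (LA.bracket a₂ a₃) a₁ β)
    simp only [ContMDiffSection.coe_neg, Pi.neg_apply] at s1 s2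
    simp only [ContMDiffSection.coe_add, ContMDiffSection.coe_sub, Pi.sub_apply, Pi.add_apply, s1, s2]
    rw [← sub_eq_zero] at j'
    refine Eq.trans ?_ j'
    abel

end IsAssociated

end AssociatedRepresentation

/-! ### Existence of the associated representation -/

section ExistsAssociated

variable {E : Type*} [NormedAddCommGroup E] [NormedSpace ℝ E] {H : Type*} [TopologicalSpace H]
  {I : ModelWithCorners ℝ E H} {M : Type*} [TopologicalSpace M] [ChartedSpace H M]
  {A B C : VB.{u} I M}

theorem VB.dirDeriv_tangentMap {X : Type*} [TopologicalSpace X] {EX : Type*} [NormedAddCommGroup EX]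
    [NormedSpace ℝ EX] {HX : Type*} [TopologicalSpace HX] [ChartedSpace HX X]
    {IX : ModelWithCorners ℝ EX HX} {f : X → M} (hf : ContMDiff IX I ∞ f) {g : M → ℝ}
    (hg : ContMDiff I 𝓘(ℝ) ∞ g) {ξ : TangentBundle IX X} {η : TangentBundle I M}
    (h : tangentMap IX I f ξ = η) : dirDeriv I g η.2 = dirDeriv IX (fun x => g (f x)) ξ.2 := by
  rw [← h]
  exact (dirDeriv_comp (hg.mdiffAt _) (hf.mdiffAt _) ξ.2).symm

/-- On B ⊕ B the function ψ composed with the addition is the sum of its compositions with the two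
projections; this is differentiated along the tangent vector that witnesses the sum. -/
theorem VB.IsTangentSum.dirDeriv_linearFun {u v w : TangentBundle B.IT B.Tot} (h : B.IsTangentSum u v w)
    {ψ : ∀ m, B.fib m →ₗ[ℝ] ℝ} (hψ : ContMDiff B.IT 𝓘(ℝ) ∞ (B.linearFun ψ)) :
    dirDeriv B.IT (B.linearFun ψ) w.2 = dirDeriv B.IT (B.linearFun ψ) u.2 + dirDeriv B.IT (B.linearFun ψ) v.2 := by
  obtain ⟨ξ, h1, h2, h3⟩ := h
  obtain ⟨hp₁, hp₂⟩ := (VB.contMDiff_prod_iff B B _).1 (contMDiff_id (I := (B.prod B).IT) (n := ∞))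
  have hs : ContMDiff (B.prod B).IT B.IT ∞ (fun x : (B.prod B).Tot => (⟨x.proj, x.2.1 + x.2.2⟩ : B.Tot)) :=
    fun x => VB.contMDiffAt_add (f := fun x : (B.prod B).Tot => x.proj) (hp₁ x) (hp₂ x)
  rw [VB.dirDeriv_tangentMap hp₁ hψ h1, VB.dirDeriv_tangentMap hp₂ hψ h2, VB.dirDeriv_tangentMap hs hψ h3]
  refine Eq.trans ?_ (dirDeriv_add ((hψ.comp hp₁).mdiffAt ξ.proj) ((hψ.comp hp₂).mdiffAt ξ.proj) ξ.2)
  exact congrArg (fun f => dirDeriv (B.prod B).IT f ξ.2) (funext fun x => map_add (ψ x.proj) _ _)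

theorem VB.contMDiff_scale (B : VB.{u} I M) (r : ℝ) : ContMDiff B.IT B.IT ∞ (B.scale r) := fun _ =>
  VB.contMDiffAt_smul (f := fun x : B.Tot => x.proj) (contMDiffAt_const (c := r))
    (contMDiff_id (I := B.IT)).contMDiffAt

theorem VB.dirDeriv_tangentScale (r : ℝ) (w : TangentBundle B.IT B.Tot)
    {ψ : ∀ m, B.fib m →ₗ[ℝ] ℝ} (hψ : ContMDiff B.IT 𝓘(ℝ) ∞ (B.linearFun ψ)) :
    dirDeriv B.IT (B.linearFun ψ) (B.tangentScale r w).2 = r * dirDeriv B.IT (B.linearFun ψ) w.2 := by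
  rw [VB.dirDeriv_tangentMap (B.contMDiff_scale r) hψ (rfl : _ = B.tangentScale r w)]
  have h := dirDeriv_mul (mdifferentiableAt_const (c := r)) (hψ.mdiffAt w.proj) w.2
  rw [dirDeriv_const, mul_zero, add_zero] at h
  rw [← h]
  refine congrArg (fun f => dirDeriv B.IT f w.2) (funext fun x => ?_)
  exact map_smul (ψ x.proj) _ _

theorem DVB.isLinearSection_liftSec (a : A.Sec) :
    (DVB.trivial A B C).IsLinearSection (DVB.liftSec A B C a) a :=
  (DVB.isLinearSection_iff _ _).2 ⟨⟨fun _ => 0, (C.contMDiff_zero.comp B.projMap.contMDiff :)⟩, by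
    ext b
    exact DVB.vec_ext (add_zero _).symm (add_zero _).symm⟩

namespace DVB.IsVBAlgebroid

variable [FiniteDimensional ℝ E] [T2Space M] [IsManifold I ∞ M]

variable {LA : LieAlgebroid A} {LD : LieAlgebroid (DVB.trivial A B C).overB}
  (h : (DVB.trivial A B C).IsVBAlgebroid LA LD)

include h

theorem dirDeriv_anchor_pullback {g : M → ℝ} (hg : ContMDiff I 𝓘(ℝ) ∞ g) {b : B.Tot}
    (v : (trivial A B C).overB.fib b) :
    dirDeriv B.IT (fun x : B.Tot => g x.proj) (LD.anchor b v) = dirDeriv I g (LA.anchor b.proj (vecA b v)) :=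
  (VB.dirDeriv_tangentMap (contMDiff_proj B.fib) hg (h.anchor_covers ⟨b, v⟩)).symm

theorem dirDeriv_anchor_add {ψ : ∀ m, B.fib m →ₗ[ℝ] ℝ} (hψ : ContMDiff B.IT 𝓘(ℝ) ∞ (B.linearFun ψ))
    {m : M} (a : A.fib m) (b b' : B.fib m) (c c' : C.fib m) :
    dirDeriv B.IT (B.linearFun ψ) (LD.anchor ⟨m, b + b'⟩ (vec a (c + c'))) =
      dirDeriv B.IT (B.linearFun ψ) (LD.anchor ⟨m, b⟩ (vec a c)) +
        dirDeriv B.IT (B.linearFun ψ) (LD.anchor ⟨m, b'⟩ (vec a c')) :=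
  (h.anchor_add _ _ _ (isSumA_trivialMk a b b' c c')).dirDeriv_linearFun hψ

theorem dirDeriv_anchor_smul {ψ : ∀ m, B.fib m →ₗ[ℝ] ℝ} (hψ : ContMDiff B.IT 𝓘(ℝ) ∞ (B.linearFun ψ))
    {m : M} (r : ℝ) (a : A.fib m) (b : B.fib m) (c : C.fib m) :
    dirDeriv B.IT (B.linearFun ψ) (LD.anchor ⟨m, r • b⟩ (vec a (r • c))) =
      r * dirDeriv B.IT (B.linearFun ψ) (LD.anchor ⟨m, b⟩ (vec a c)) :=
  (congrArg (fun η : TangentBundle B.IT B.Tot => dirDeriv B.IT (B.linearFun ψ) η.2)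
    (h.anchor_scale r (trivialMk a b c))).trans (VB.dirDeriv_tangentScale r _ hψ)

/-- One has (0, b, c) = (0, b, 0) +_A (0, 0, c), and the first summand is a zero vector of D → B,
whose anchor vanishes. -/
theorem dirDeriv_anchor_core {ψ : ∀ m, B.fib m →ₗ[ℝ] ℝ} (hψ : ContMDiff B.IT 𝓘(ℝ) ∞ (B.linearFun ψ))
    {m : M} (b : B.fib m) (c : C.fib m) :
    dirDeriv B.IT (B.linearFun ψ) (LD.anchor ⟨m, b⟩ (vec 0 c)) =
      dirDeriv B.IT (B.linearFun ψ) (LD.anchor ⟨m, 0⟩ (vec 0 c)) := by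
  have e := h.dirDeriv_anchor_add hψ 0 b 0 0 c
  have e0 : dirDeriv B.IT (B.linearFun ψ) (LD.anchor ⟨m, b⟩ (vec 0 0)) = 0 := by
    rw [vec_zero, map_zero]
    exact map_zero (mfderiv B.IT 𝓘(ℝ) (B.linearFun ψ) _)
  rw [e0, zero_add, zero_add, add_zero] at e
  exact e

theorem vert_zero_spec {ψ : ∀ m, B.fib m →ₗ[ℝ] ℝ} (hψ : ContMDiff B.IT 𝓘(ℝ) ∞ (B.linearFun ψ))
    {m : M} (c : C.fib m) :
    ψ m (VB.vert 0 (LD.anchor ⟨m, 0⟩ (vec 0 c))) =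
      dirDeriv B.IT (B.linearFun ψ) (LD.anchor ⟨m, 0⟩ (vec 0 c)) := by
  rw [VB.vert_spec (B := B) 0 (b := ⟨m, 0⟩) rfl _ hψ]
  have e : (fun x => ψ x ((0 : B.Sec) x)) = fun _ => 0 := funext fun x => map_zero (ψ x)
  rw [e, dirDeriv_const, zero_add]

/-- By `dirDeriv_anchor_core` the anchor of a core vector acts on linear functions independently of
the point of the fibre. It can thus be taken on the zero section, where its vertical part relative
to β = 0 is ∂c. -/
theorem exists_bd : ∃ bd : BundleMap C B, ∀ (ψ : ∀ m, B.fib m →ₗ[ℝ] ℝ),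
    ContMDiff B.IT 𝓘(ℝ) ∞ (B.linearFun ψ) → ∀ (b : B.Tot) (c : C.fib b.proj),
      dirDeriv B.IT (B.linearFun ψ) (LD.anchor b (vec 0 c)) = ψ b.proj (bd.fib b.proj c) := by
  refine ⟨⟨fun m =>
    { toFun := fun c => VB.vert 0 (LD.anchor ⟨m, 0⟩ (vec 0 c))
      map_add' := fun c c' => ?_
      map_smul' := fun r c => ?_ }, fun c₀ => ?_⟩, fun ψ hψ b c => ?_⟩
  · refine B.ext_linearFun fun ψ hψ => ?_
    refine (h.vert_zero_spec hψ (c + c')).trans (Eq.trans ?_ (map_add (ψ m) _ _).symm)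
    rw [h.vert_zero_spec hψ c, h.vert_zero_spec hψ c', ← dirDeriv_add_vec, ← map_add, vec_add_vec, add_zero]
  · refine B.ext_linearFun fun ψ hψ => ?_
    refine (h.vert_zero_spec hψ (r • c)).trans (Eq.trans ?_ (map_smul (ψ m) r _).symm)
    rw [h.vert_zero_spec hψ c, smul_eq_mul, ← dirDeriv_smul_vec, ← map_smul, smul_vec, smul_zero]
  · have hp : ContMDiff C.IT I ∞ (TotalSpace.proj : C.Tot → M) := contMDiff_proj C.fib
    refine VB.contMDiffAt_of_linearFun (f := (TotalSpace.proj : C.Tot → M)) hp.contMDiffAt fun ψ hψ => ?_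
    have hz : ContMDiff C.IT (trivial A B C).overB.IT ∞
        (fun c : C.Tot => (⟨⟨c.proj, 0⟩, vec 0 c.2⟩ : (trivial A B C).overB.Tot)) :=
      (contMDiff_trivialOver_iff _).2 ⟨(B.contMDiff_zero.comp hp :), (A.contMDiff_zero.comp hp :), contMDiff_id⟩
    refine (contMDiff_dirDeriv hψ (LD.anchor_smooth.comp hz)).contMDiffAt.congr_of_eventuallyEq
      (Filter.Eventually.of_forall fun c => h.vert_zero_spec hψ c.2)
  · exact (h.dirDeriv_anchor_core hψ b.2 c).trans (h.vert_zero_spec hψ c).symm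

/-- The covariant derivative is minus the vertical part of the anchor of h(a) along β. The rules in
a come from linearity of the anchor over B. Those in β come from its additivity and homogeneity over
A, while the condition that it covers the anchor of A supplies the derivative terms. -/
theorem exists_nabla₁ : ∃ D : A.Sec → B.Sec → B.Sec, LA.IsConnection D ∧
    ∀ (a : A.Sec) (ψ : ∀ m, B.fib m →ₗ[ℝ] ℝ), ContMDiff B.IT 𝓘(ℝ) ∞ (B.linearFun ψ) →
      ∀ (β : B.Sec) (m : M), LD.deriv (liftSec A B C a) (B.linearFun ψ) ⟨m, β m⟩ =
        LA.deriv a (fun x => ψ x (β x)) m - ψ m (D a β m) := by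
  let d : A.Sec → B.Sec → ∀ m, B.fib m := fun a β m =>
    -VB.vert β (LD.anchor ⟨m, β m⟩ (liftSec A B C a ⟨m, β m⟩))
  have hd : ∀ (a : A.Sec) (β : B.Sec) (ψ : ∀ m, B.fib m →ₗ[ℝ] ℝ)
      (hψ : ContMDiff B.IT 𝓘(ℝ) ∞ (B.linearFun ψ)) (m : M),
      ψ m (d a β m) = LA.deriv a (fun x => ψ x (β x)) m -
        LD.deriv (liftSec A B C a) (B.linearFun ψ) ⟨m, β m⟩ := by
    intro a β ψ hψ m
    have e := VB.vert_spec (B := B) β (b := ⟨m, β m⟩) rfl (LD.anchor ⟨m, β m⟩ (liftSec A B C a ⟨m, β m⟩)) hψ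
    rw [← B.dirDeriv_comp_proj (B.contMDiff_linearFun_sec hψ β),
      h.dirDeriv_anchor_pullback (B.contMDiff_linearFun_sec hψ β)] at e
    have e1 := map_neg (ψ m) (VB.vert β (LD.anchor ⟨m, β m⟩ (liftSec A B C a ⟨m, β m⟩)))
    refine e1.trans ?_
    exact ((congrArg (LA.deriv a (fun x => ψ x (β x)) m - ·) e).trans (sub_add_cancel_left _ _)).symm
  have hs : ∀ a β, ContMDiff I B.IT ∞ (fun m => (⟨m, d a β m⟩ : B.Tot)) := by
    intro a β m
    refine VB.contMDiffAt_of_linearFun (f := fun m => m) contMDiffAt_id fun ψ hψ => ?_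
    refine ContMDiffAt.congr_of_eventuallyEq ?_ (Filter.Eventually.of_forall fun m => hd a β ψ hψ m)
    exact ((LA.toSkew.contMDiff_deriv a (B.contMDiff_linearFun_sec hψ β)).sub
      ((LD.toSkew.contMDiff_deriv _ hψ).comp β.contMDiff)).contMDiffAt
  refine ⟨fun a β => ⟨d a β, hs a β⟩, ⟨?_, ?_, ?_, ?_⟩, fun a ψ hψ β m => ?_⟩
  · intro a a' β
    ext m
    refine B.ext_linearFun fun ψ hψ => ?_
    refine (hd _ β ψ hψ m).trans (Eq.trans ?_ (map_add (ψ m) _ _).symm)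
    refine Eq.trans ?_ (congrArg₂ _ (hd a β ψ hψ m) (hd a' β ψ hψ m)).symm
    unfold LieAlgebroid.deriv
    rw [liftSec_add]
    simp only [ContMDiffSection.coe_add, Pi.add_apply, map_add, dirDeriv_add_vec]
    ring
  · intro a a' g β hg ha m
    obtain rfl : a' = A.smulSec g hg a := by ext x; exact ha x
    refine B.ext_linearFun fun ψ hψ => ?_
    refine (hd _ β ψ hψ m).trans (Eq.trans ?_ (map_smul (ψ m) _ _).symm)
    refine Eq.trans ?_ (congrArg (g m • ·) (hd a β ψ hψ m)).symm
    unfold LieAlgebroid.deriv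
    rw [liftSec_smulSec]
    simp only [VB.smulSec_apply, map_smul, dirDeriv_smul_vec, smul_eq_mul]
    ring
  · intro a β β'
    ext m
    refine B.ext_linearFun fun ψ hψ => ?_
    refine (hd a _ ψ hψ m).trans (Eq.trans ?_ (map_add (ψ m) _ _).symm)
    refine Eq.trans ?_ (congrArg₂ _ (hd a β ψ hψ m) (hd a β' ψ hψ m)).symm
    have e1 := h.dirDeriv_anchor_add hψ (a m) (β m) (β' m) 0 0
    have e2 := dirDeriv_add ((B.contMDiff_linearFun_sec hψ β).mdiffAt m)
      ((B.contMDiff_linearFun_sec hψ β').mdiffAt m) (LA.anchor m (a m))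
    rw [add_zero] at e1
    have e3 : (fun x => ψ x ((β + β') x)) = fun x => ψ x (β x) + ψ x (β' x) :=
      funext fun x => map_add (ψ x) _ _
    unfold LieAlgebroid.deriv
    rw [e3, e2]
    refine (congrArg (_ - ·) e1).trans ?_
    simp only [liftSec_apply]
    ring
  · intro a β β' g hg hβ m
    obtain rfl : β' = B.smulSec g hg β := by ext x; exact hβ x
    refine B.ext_linearFun fun ψ hψ => ?_
    refine (hd a _ ψ hψ m).trans (Eq.trans ?_ (map_add (ψ m) _ _).symm)
    rw [map_smul, map_smul]
    refine Eq.trans ?_ (congrArg (fun t => g m • t + _) (hd a β ψ hψ m)).symm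
    have e1 := h.dirDeriv_anchor_smul hψ (g m) (a m) (β m) 0
    have e2 := dirDeriv_mul (hg.mdiffAt m) ((B.contMDiff_linearFun_sec hψ β).mdiffAt m) (LA.anchor m (a m))
    rw [smul_zero] at e1
    have e3 : (fun x => ψ x ((B.smulSec g hg β) x)) = fun x => g x * ψ x (β x) :=
      funext fun x => map_smul (ψ x) _ _
    unfold LieAlgebroid.deriv
    rw [e3, e2]
    refine (congrArg (_ - ·) e1).trans ?_
    simp only [liftSec_apply, smul_eq_mul]
    ring
  · exact (sub_sub_cancel _ _).symm.trans
      (congrArg (LA.deriv a (fun x => ψ x (β x)) m - ·) (hd a β ψ hψ m).symm)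

theorem exists_bracket_lift_core : ∃ D : A.Sec → C.Sec → C.Sec, ∀ a c,
    LD.bracket (liftSec A B C a) (coreSec A B c) = coreSec A B (D a c) := by
  choose D hD using fun a c => (isCoreSection_iff _).1
    (h.linear_core _ _ a (isLinearSection_liftSec a) ((isCoreSection_iff _).2 ⟨c, rfl⟩))
  exact ⟨D, hD⟩

/-- The Leibniz rule adds only multiples of lifts to the bracket. These have no component in C, so
the part in Hom(B, C) is tensorial in both arguments. -/
theorem exists_bracket_lift_lift : ∃ K : TrilinMap A B C, ∀ a a' b,
    LD.bracket (liftSec A B C a) (liftSec A B C a') b =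
      vec (LA.bracket a a' b.proj) (K.fib b.proj (a b.proj) (a' b.proj) b.2) := by
  choose k hk using fun a a' => (isLinearSection_iff _ _).1 (h.linear_linear _ _ a a' (isLinearSection_liftSec a) (isLinearSection_liftSec a'))
  have hk' : ∀ a a' (b : B.Tot), vecC b (LD.bracket (liftSec A B C a) (liftSec A B C a') b) =
      (k a a').fib b.proj b.2 := fun a a' b => by
    rw [hk, ContMDiffSection.coe_add, Pi.add_apply, map_add, vecC_liftSec, vecC_homSec, zero_add]
  have hz : ∀ (r : ℝ) a (b : B.Tot), vecC b (r • liftSec A B C a b) = 0 := fun r a b => by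
    rw [map_smul, vecC_liftSec, smul_zero]
  choose ℓ hℓ using fun x => A.exists_bilinear_of_tensorial A x (fun a a' => (k a a').fib x)
    (fun a₁ a₂ a' => LinearMap.ext fun b => by
      have e := hk' (a₁ + a₂) a' ⟨x, b⟩
      rw [liftSec_add, map_add, LinearMap.add_apply, ContMDiffSection.coe_add, Pi.add_apply, map_add,
        hk', hk'] at e
      exact e.symm)
    (fun g hg a a' => LinearMap.ext fun b => by
      have e := hk' (A.smulSec g hg a) a' ⟨x, b⟩
      have e2 := LD.toSkew.bracket_smulSec_left (liftSec A B C a) (liftSec A B C a') _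
        (B.contMDiff_comp_proj hg) ⟨x, b⟩
      rw [liftSec_smulSec] at e
      have e3 := e.symm.trans (congrArg (vecC _) e2)
      rw [map_sub, hz, sub_zero, map_smul] at e3
      exact e3.trans (congrArg (g x • ·) (hk' a a' ⟨x, b⟩)))
    (fun a a₁ a₂ => LinearMap.ext fun b => by
      have e := hk' a (a₁ + a₂) ⟨x, b⟩
      rw [liftSec_add, map_add, ContMDiffSection.coe_add, Pi.add_apply, map_add,
        hk', hk'] at e
      exact e.symm)
    (fun g hg a a' => LinearMap.ext fun b => by
      have e := hk' a (A.smulSec g hg a') ⟨x, b⟩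
      have e2 := LD.toSkew.bracket_smulSec (liftSec A B C a) (liftSec A B C a') _
        (B.contMDiff_comp_proj hg) ⟨x, b⟩
      rw [liftSec_smulSec] at e
      have e3 := e.symm.trans (congrArg (vecC _) e2)
      rw [map_add, hz, add_zero, map_smul] at e3
      exact e3.trans (congrArg (g x • ·) (hk' a a' ⟨x, b⟩)))
  refine ⟨⟨ℓ, fun s s' t => ?_⟩, fun a a' b => ?_⟩
  · have : (fun x => (⟨x, ℓ x (s x) (s' x) (t x)⟩ : C.Tot)) = fun x => ⟨x, (k s s').onSec t x⟩ :=
      funext fun x => by rw [← hℓ]; rfl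
    rw [this]
    exact ((k s s').onSec t).contMDiff
  · refine vec_ext ?_ ?_
    · rw [hk]
      exact add_zero _
    · rw [hk', vecC_vec]
      exact congrArg (fun f => f b.2) (hℓ b.proj a a')

/-- Every VB-algebroid structure on a trivial double vector bundle has an associated representation. -/
theorem existsUnique_isAssociated :
    ∃! V : StructureOperators A B C, V.IsRepresentation LA ∧ IsAssociated LA V LD := by
  obtain ⟨bd, hbd⟩ := h.exists_bd
  obtain ⟨D₁, hD₁, hD₁'⟩ := h.exists_nabla₁
  obtain ⟨D₀, hD₀⟩ := h.exists_bracket_lift_core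
  obtain ⟨K, hK⟩ := h.exists_bracket_lift_lift
  have hV : IsAssociated LA ⟨bd, D₀, D₁, K⟩ LD :=
    { anchor_lift_pullback := fun a g hg b => h.dirDeriv_anchor_pullback hg _
      anchor_lift_linear := hD₁'
      anchor_core_pullback := fun c g hg b => (h.dirDeriv_anchor_pullback hg _).trans (by
        rw [coreSec_apply, vecA_vec, map_zero]
        exact map_zero (mfderiv I 𝓘(ℝ) g b.proj))
      anchor_core_linear := fun c ψ hψ b => hbd ψ hψ b (c b.proj)
      bracket_core_core := fun c c' => h.core_core _ _ ((isCoreSection_iff _).2 ⟨c, rfl⟩)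
        ((isCoreSection_iff _).2 ⟨c', rfl⟩)
      bracket_lift_core := hD₀
      bracket_lift_lift := hK }
  exact ⟨_, ⟨hV.isRepresentation hD₁, hV⟩, fun W hW => hW.2.eq hV⟩

end DVB.IsVBAlgebroid

end ExistsAssociated
-- Components of morphisms between trivial double vector bundles
section TrivialMorphisms

variable {E : Type*} [NormedAddCommGroup E] [NormedSpace ℝ E] {H : Type*} [TopologicalSpace H]
  {I : ModelWithCorners ℝ E H} {M : Type*} [TopologicalSpace M] [ChartedSpace H M]
  {A B C A' B' C' : VB.{u} I M}

namespace DVBHom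

variable (F : DVBHom (DVB.trivial A B C) (DVB.trivial A' B' C'))

/-- The component in `C'` of a morphism of trivial double vector bundles. -/
def coreComp {m : M} (a : A.fib m) (b : B.fib m) (c : C.fib m) : C'.fib m :=
  DVB.vecC (F.hor.total ⟨m, b⟩) (F.homB.fib ⟨m, b⟩ (DVB.vec a c))

theorem total_trivialMk {m : M} (a : A.fib m) (b : B.fib m) (c : C.fib m) :
    F.homB.total (DVB.trivialMk a b c) =
      DVB.trivialMk (F.ver.fib m a) (F.hor.fib m b) (F.coreComp a b c) := by
  have e : DVB.vecA (F.hor.total ⟨m, b⟩) (F.homB.fib ⟨m, b⟩ (DVB.vec a c)) = F.ver.fib m a :=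
    VB.mk_inj (congrArg TotalSpace.proj (F.comm (DVB.trivialMk a b c)))
  rw [← e]
  rfl

theorem total_trivialMk' {m : M} (a : A.fib m) (b : B.fib m) (c : C.fib m) :
    F.homA.total (DVB.trivialMk (A := B) (B := A) b a c) =
      DVB.trivialMk (F.hor.fib m b) (F.ver.fib m a) (F.coreComp a b c) :=
  (F.comm (DVB.trivialMk a b c)).symm.trans
    (congrArg (DVB.trivial A' B' C').flip (F.total_trivialMk a b c))

theorem fibA_vec {m : M} (a : A.fib m) (b : B.fib m) (c : C.fib m) :
    F.homA.fib ⟨m, a⟩ (DVB.vec (A := B) (B := A) (b := ⟨m, a⟩) b c) =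
      DVB.vec (b := F.ver.total ⟨m, a⟩) (F.hor.fib m b) (F.coreComp a b c) :=
  VB.mk_inj (F.total_trivialMk' a b c)

theorem coreComp_add_left {m : M} (a a' : A.fib m) (b : B.fib m) (c c' : C.fib m) :
    F.coreComp (a + a') b (c + c') = F.coreComp a b c + F.coreComp a' b c' := by
  have e := (F.homB.fib ⟨m, b⟩).map_add (DVB.vec a c) (DVB.vec a' c')
  exact congrArg (DVB.vecC (F.hor.total ⟨m, b⟩)) e

theorem coreComp_smul_left {m : M} (r : ℝ) (a : A.fib m) (b : B.fib m) (c : C.fib m) :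
    F.coreComp (r • a) b (r • c) = r • F.coreComp a b c :=
  congrArg (DVB.vecC (F.hor.total ⟨m, b⟩)) ((F.homB.fib ⟨m, b⟩).map_smul r (DVB.vec a c))

theorem coreComp_add_right {m : M} (a : A.fib m) (b b' : B.fib m) (c c' : C.fib m) :
    F.coreComp a (b + b') (c + c') = F.coreComp a b c + F.coreComp a b' c' := by
  have e := (F.homA.fib ⟨m, a⟩).map_add (DVB.vec (A := B) (B := A) (b := ⟨m, a⟩) b c)
    (DVB.vec (A := B) (B := A) (b := ⟨m, a⟩) b' c')
  rw [fibA_vec, fibA_vec] at e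
  exact congrArg (DVB.vecC (F.ver.total ⟨m, a⟩))
    ((F.fibA_vec a (b + b') (c + c')).symm.trans e)

theorem coreComp_smul_right {m : M} (r : ℝ) (a : A.fib m) (b : B.fib m) (c : C.fib m) :
    F.coreComp a (r • b) (r • c) = r • F.coreComp a b c := by
  have e := (F.homA.fib ⟨m, a⟩).map_smul r (DVB.vec (A := B) (B := A) (b := ⟨m, a⟩) b c)
  rw [fibA_vec] at e
  exact congrArg (DVB.vecC (F.ver.total ⟨m, a⟩)) ((F.fibA_vec a (r • b) (r • c)).symm.trans e)

/-- One has (a, b, c) = (a, b, 0) +_B (0, b, c) and (0, b, c) = (0, b, 0) +_A (0, 0, c), and the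
morphism respects both additions. The element (0, b, 0) is a zero of D → B and contributes nothing.
-/
theorem coreComp_eq {m : M} (a : A.fib m) (b : B.fib m) (c : C.fib m) :
    F.coreComp a b c = F.coreComp 0 0 c + F.coreComp a b 0 := by
  have e1 := F.coreComp_add_left a 0 b 0 c
  have e2 := F.coreComp_add_right 0 b 0 0 c
  have e3 := F.coreComp_smul_left 0 0 b (0 : C.fib m)
  rw [zero_smul, zero_smul, zero_smul] at e3
  rw [add_zero, zero_add] at e1 e2
  rw [e1, e2, e3, zero_add, add_comm]

/-- The morphism induced on the cores. -/
def coreMap : BundleMap C C' where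
  fib m :=
    { toFun := fun c => F.coreComp 0 0 c
      map_add' := fun c c' => by rw [← F.coreComp_add_left, add_zero]
      map_smul' := fun r c => by
        change _ = r • _
        rw [← F.coreComp_smul_left, smul_zero] }
  smooth := by
    have hz : ContMDiff C.IT (DVB.trivial A B C).overB.IT ∞
        (fun c : C.Tot => (⟨⟨c.proj, 0⟩, DVB.vec 0 c.2⟩ : (DVB.trivial A B C).overB.Tot)) :=
      (DVB.contMDiff_trivialOver_iff _).2 ⟨(B.contMDiff_zero.comp C.projMap.contMDiff :),
        (A.contMDiff_zero.comp C.projMap.contMDiff :), contMDiff_id⟩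
    exact ((DVB.contMDiff_trivialOver_iff _).1 (F.homB.smooth.comp hz)).2.2

/-- The bilinear part of a morphism of trivial double vector bundles. -/
def bilinPart : BilinMap A B C' where
  fib m := LinearMap.mk₂ ℝ (fun a b => F.coreComp a b 0)
    (fun a a' b => by rw [← F.coreComp_add_left, add_zero])
    (fun r a b => by rw [← F.coreComp_smul_left, smul_zero])
    (fun a b b' => by rw [← F.coreComp_add_right, add_zero])
    (fun r a b => by rw [← F.coreComp_smul_right, smul_zero])
  smooth s t := by
    have hz : ContMDiff I (DVB.trivial A B C).overB.IT ∞
        (fun x => (⟨⟨x, t x⟩, DVB.vec (s x) 0⟩ : (DVB.trivial A B C).overB.Tot)) :=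
      (DVB.contMDiff_trivialOver_iff _).2 ⟨t.contMDiff, s.contMDiff, C.contMDiff_zero⟩
    exact ((DVB.contMDiff_trivialOver_iff _).1 (F.homB.smooth.comp hz)).2.2

theorem hasComponents : F.HasComponents F.ver F.hor F.coreMap F.bilinPart :=
  ⟨rfl, rfl, fun _ a b c => (F.total_trivialMk a b c).trans
    (congrArg (DVB.trivialMk _ _) (F.coreComp_eq a b c))⟩

/-- The components of a morphism of trivial double vector bundles exist and are unique. -/
theorem existsUnique_components :
    ∃! p : BundleMap C C' × BilinMap A B C', F.HasComponents F.ver F.hor p.1 p.2 := by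
  refine ⟨(F.coreMap, F.bilinPart), F.hasComponents, fun p hp => ?_⟩
  have e : ∀ {m : M} (a : A.fib m) (b : B.fib m) (c : C.fib m),
      F.coreComp a b c = p.1.fib m c + p.2.fib m a b := fun a b c =>
    (DVB.trivialMk_inj ((F.total_trivialMk a b c).symm.trans (hp.2.2 _ a b c))).2.2
  refine Prod.ext (BundleMap.ext (funext fun m => LinearMap.ext fun c => ?_))
    (BilinMap.ext (funext fun m => LinearMap.ext fun a => LinearMap.ext fun b => ?_))
  · refine Eq.trans ?_ (e 0 0 c).symm
    simp
  · refine Eq.trans ?_ (e a b 0).symm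
    simp

end DVBHom

end TrivialMorphisms

/-! ### The bracket condition is tensorial and can be tested on generators -/

section BracketMorphisms

variable {E : Type*} [NormedAddCommGroup E] [NormedSpace ℝ E] {H : Type*} [TopologicalSpace H]
  {I : ModelWithCorners ℝ E H} {N : Type*} [TopologicalSpace N] [ChartedSpace H N]
  {E' : Type*} [NormedAddCommGroup E'] [NormedSpace ℝ E'] {H' : Type*} [TopologicalSpace H']
  {I' : ModelWithCorners ℝ E' H'} {N' : Type*} [TopologicalSpace N'] [ChartedSpace H' N']
  [IsManifold I ∞ N] [IsManifold I' ∞ N']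

/-- Tangent vectors are determined by their action on smooth functions. -/
theorem tangent_ext [FiniteDimensional ℝ E] [T2Space N] {x : N} {v w : TangentSpace I x}
    (h : ∀ g : N → ℝ, ContMDiff I 𝓘(ℝ) ∞ g → dirDeriv I g v = dirDeriv I g w) : v = w := by
  let e := trivializationAt E (TangentSpace I) x
  have hb : x ∈ e.baseSet := mem_baseSet_trivializationAt _ _ _
  have hs : x ∈ (chartAt H x).source := mem_chart_source H x
  have hv : (⟨x, v⟩ : TangentBundle I N) ∈ e.source := e.mem_source.2 hb
  have hw : (⟨x, w⟩ : TangentBundle I N) ∈ e.source := e.mem_source.2 hb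
  have h2 := TangentBundle.continuousLinearMapAt_trivializationAt (I := I) hs
  have h3 : ∀ v : TangentSpace I x, (e (⟨x, v⟩ : TangentBundle I N)).2 =
      mvfderiv I (extChartAt I x) x v := fun v => by
    refine Eq.trans ?_ (DFunLike.congr_fun h2 v)
    rw [Trivialization.continuousLinearMapAt_apply, Trivialization.linearMapAt_apply, if_pos hb]
  have key : (e (⟨x, v⟩ : TangentBundle I N)).2 = (e (⟨x, w⟩ : TangentBundle I N)).2 := by
    refine (SeparatingDual.eq_iff_forall_dual_eq (R := ℝ)).2 fun ℓ => ?_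
    have hφ : ContMDiffOn I 𝓘(ℝ) ∞ (fun m => ℓ (extChartAt I x m)) (chartAt H x).source :=
      ℓ.contMDiff.comp_contMDiffOn (contMDiffOn_extChartAt (I := I) (n := ∞) (x := x))
    obtain ⟨g, hg, hg'⟩ := exists_contMDiff_eventuallyEq hφ (chart_source_mem_nhds H x)
    have h1 : MDifferentiableAt I 𝓘(ℝ, E) (extChartAt I x) x := mdifferentiableAt_extChartAt hs
    rw [h3, h3, ← dirDeriv_clm ℓ h1 v, ← dirDeriv_clm ℓ h1 w, ← dirDeriv_congr hg' v, ← dirDeriv_congr hg' w]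
    exact h g hg
  simpa using e.injOn hv hw (Prod.ext ((e.coe_fst hv).trans (e.coe_fst hw).symm) key)

namespace LieAlgebroid

variable {V : VB.{u} I N} {V' : VB.{u} I' N'} {f : N → N'} (L : LieAlgebroid V) (L' : LieAlgebroid V')
  (F : VBHom V V' f)

theorem IsBracketMorphism.mfderiv_anchor [FiniteDimensional ℝ E'] [T2Space N'] {L : LieAlgebroid V}
    {L' : LieAlgebroid V'} {F : VBHom V V' f} (h : L.IsBracketMorphism L' F) (x : N) (v : V.fib x) :
    mfderiv I I' f x (L.anchor x v) = L'.anchor (f x) (F.fib x v) :=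
  tangent_ext fun g hg => (dirDeriv_comp (hg.mdiffAt _) (F.contMDiff_base.mdiffAt _) _).symm.trans
    (h.anchor x v g hg)

/-- The failure of the bracket condition for the sections `a`, `b`, relative to sections `s`, `t` with the
values of their images at `f x`. -/
def bracketDefect (x : N) (a b : V.Sec) (s t : V'.Sec) : V'.fib (f x) :=
  F.fib x (L.bracket a b x) - (L'.bracket s t (f x) +
      VB.pderiv I V' f (fun y => F.fib y (b y) - t (f y)) x (L.anchor x (a x)) -
      VB.pderiv I V' f (fun y => F.fib y (a y) - s (f y)) x (L.anchor x (b x)))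

variable {L L' F} {x : N} {a a' b : V.Sec} {s s' t : V'.Sec}

theorem contMDiff_map_sub (F : VBHom V V' f) (a : V.Sec) (s : V'.Sec) :
    ContMDiff I V'.IT ∞ (fun y => (⟨f y, F.fib y (a y) - s (f y)⟩ : V'.Tot)) := fun y =>
  VB.contMDiffAt_sub (contMDiff_map F a y) (contMDiff_along F s y)

theorem bracketDefect_skew : L.bracketDefect L' F x b a t s = -L.bracketDefect L' F x a b s t := by
  have e : L.bracket a b = -L.bracket b a := L.toSkew.bracket_skew a b
  have e' : L'.bracket s t = -L'.bracket t s := L'.toSkew.bracket_skew s t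
  unfold bracketDefect
  rw [e, e']
  simp only [ContMDiffSection.coe_neg, Pi.neg_apply, map_neg]
  abel

theorem bracketDefect_add_left : L.bracketDefect L' F x (a + a') b (s + s') t =
    L.bracketDefect L' F x a b s t + L.bracketDefect L' F x a' b s' t := by
  have e : VB.pderiv I V' f (fun y => F.fib y ((a + a') y) - (s + s') (f y)) x (L.anchor x (b x)) =
      VB.pderiv I V' f (fun y => F.fib y (a y) - s (f y)) x (L.anchor x (b x)) +
      VB.pderiv I V' f (fun y => F.fib y (a' y) - s' (f y)) x (L.anchor x (b x)) := by
    rw [← VB.pderiv_add (contMDiff_map_sub F a s x) (contMDiff_map_sub F a' s' x)]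
    congr 1
    funext y
    simp only [ContMDiffSection.coe_add, Pi.add_apply, map_add]
    abel
  unfold bracketDefect
  rw [e]
  simp only [ContMDiffSection.coe_add, Pi.add_apply, map_add, LinearMap.add_apply, VB.pderiv_add_vec]
  abel

/-- The function g does not descend to N', so s is multiplied by the constant g x. The resulting
term dg ⊗ s in the derivative cancels the anchor term of the Leibniz rule. -/
theorem bracketDefect_smul_left {g : N → ℝ} (hg : ContMDiff I 𝓘(ℝ) ∞ g) (hs : F.fib x (a x) = s (f x)) :
    L.bracketDefect L' F x (V.smulSec g hg a) b (g x • s) t = g x • L.bracketDefect L' F x a b s t := by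
  have hg' : ContMDiff I 𝓘(ℝ) ∞ (fun y => g y - g x) := hg.sub contMDiff_const
  have hd : ∀ v : TangentSpace I x, dirDeriv I (fun y => g y - g x) v = dirDeriv I g v := fun v => by
    rw [dirDeriv_sub (hg.mdiffAt x) (mdifferentiableAt_const (c := g x)), dirDeriv_const, sub_zero]
  have e : VB.pderiv I V' f (fun y => F.fib y (V.smulSec g hg a y) - (g x • s) (f y)) x (L.anchor x (b x)) =
      g x • VB.pderiv I V' f (fun y => F.fib y (a y) - s (f y)) x (L.anchor x (b x)) +
      dirDeriv I g (L.anchor x (b x)) • s (f x) := by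
    -- Both summands are products of a function and a section along f: the section vanishes at x in
    -- the first, the function in the second.
    have e1 : (fun y => F.fib y (V.smulSec g hg a y) - (g x • s) (f y)) =
        fun y => g y • (F.fib y (a y) - s (f y)) + (g y - g x) • s (f y) := by
      funext y
      rw [VB.smulSec_apply, map_smul, ContMDiffSection.coe_smul, Pi.smul_apply]
      module
    have e2 := VB.pderiv_smul hg.contMDiffAt (contMDiff_map_sub F a s x) (L.anchor x (b x))
    have e3 := VB.pderiv_smul hg'.contMDiffAt (contMDiff_along F s x) (L.anchor x (b x))
    rw [e1, VB.pderiv_add (VB.contMDiffAt_smul hg.contMDiffAt (contMDiff_map_sub F a s x))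
      (VB.contMDiffAt_smul hg'.contMDiffAt (contMDiff_along F s x)), e2, e3, hd]
    simp only [hs, sub_self, smul_zero, zero_add, zero_smul, add_zero]
  have e4 : L.bracket (V.smulSec g hg a) b x = _ := L.toSkew.bracket_smulSec_left a b g hg x
  unfold bracketDefect
  rw [e, e4]
  simp only [map_smul, LinearMap.smul_apply, map_sub, VB.smulSec_apply, VB.pderiv_smul_vec,
    ContMDiffSection.coe_smul, Pi.smul_apply, hs]
  have e5 : L.toSkew.deriv b g x = dirDeriv I g (L.anchor x (b x)) := rfl
  have e6 : L.toSkew.bracket a b x = L.bracket a b x := rfl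
  rw [e5, e6]
  module

variable [FiniteDimensional ℝ E'] [T2Space N']

/-- Changing s by a section that vanishes at f x changes the bracket by a derivative along the
anchor of t, by `bracket_eq_sderiv`, and the correction term by the derivative along the image of
the anchor of b. The anchor condition identifies the two directions. -/
theorem bracketDefect_congr_left
    (h : ∀ (x : N) (v : V.fib x), mfderiv I I' f x (L.anchor x v) = L'.anchor (f x) (F.fib x v))
    (hs : s (f x) = s' (f x)) (ht : F.fib x (b x) = t (f x)) :
    L.bracketDefect L' F x a b s t = L.bracketDefect L' F x a b s' t := by
  have e1 := L'.toSkew.bracket_eq_sderiv t (s - s') (x := f x) (by simp [hs])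
  have e2 := VB.pderiv_comp F.contMDiff_base.contMDiffAt (s - s').contMDiff.contMDiffAt (L.anchor x (b x))
  have e3 : mfderiv I I' f x (L.anchor x (b x)) = L'.anchor (f x) (t (f x)) := (h x (b x)).trans (by rw [ht])
  rw [e3] at e2
  have e4 := e1.trans e2.symm
  have e5 : VB.pderiv I V' f (fun y => F.fib y (a y) - s (f y)) x (L.anchor x (b x)) =
      VB.pderiv I V' f (fun y => F.fib y (a y) - s' (f y)) x (L.anchor x (b x)) -
      VB.pderiv I V' f (fun y => (s - s') (f y)) x (L.anchor x (b x)) := by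
    rw [← VB.pderiv_sub (contMDiff_map_sub F a s' x) (contMDiff_along F (s - s') x)]
    congr 1
    funext y
    simp only [ContMDiffSection.coe_sub, Pi.sub_apply]
    abel
  have e6 : ∀ s, L'.bracket s t = -L'.bracket t s := fun s => L'.toSkew.bracket_skew s t
  have e7 : L'.bracket t (s - s') (f x) = L'.bracket t s (f x) - L'.bracket t s' (f x) := by
    rw [map_sub]
    rfl
  unfold bracketDefect
  rw [e5, ← e4, e6 s, e6 s']
  change _ - (_ + _ - (_ - L'.bracket t (s - s') (f x))) = _
  rw [e7]
  simp only [ContMDiffSection.coe_neg, Pi.neg_apply]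
  abel

variable [FiniteDimensional ℝ E] [T2Space N]

/-- The defect does not depend on which s through the image of a x is chosen. A choice for each a
makes it a function of a alone, to which tensoriality applies. -/
theorem exists_linear_bracketDefect
    (h : ∀ (x : N) (v : V.fib x), mfderiv I I' f x (L.anchor x v) = L'.anchor (f x) (F.fib x v))
    (ht : F.fib x (b x) = t (f x)) : ∃ ℓ : V.fib x →ₗ[ℝ] V'.fib (f x), ∀ (a : V.Sec) (s : V'.Sec),
      F.fib x (a x) = s (f x) → L.bracketDefect L' F x a b s t = ℓ (a x) := by
  let S : V.Sec → V'.Sec := fun a => V'.secThrough (F.fib x (a x))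
  have hS : ∀ a : V.Sec, S a (f x) = F.fib x (a x) := fun a => V'.secThrough_self _
  obtain ⟨ℓ, hℓ⟩ := V.exists_linear_of_tensorial x (fun a => L.bracketDefect L' F x a b (S a) t)
    (fun a a' => by
      rw [← bracketDefect_add_left]
      refine bracketDefect_congr_left h ?_ ht
      rw [ContMDiffSection.coe_add, Pi.add_apply, hS, hS, hS, ContMDiffSection.coe_add, Pi.add_apply, map_add])
    (fun g hg a => by
      rw [← bracketDefect_smul_left hg (hS a).symm]
      refine bracketDefect_congr_left h ?_ ht
      rw [ContMDiffSection.coe_smul, Pi.smul_apply, hS, hS, VB.smulSec_apply, map_smul])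
  exact ⟨ℓ, fun a s hs => (bracketDefect_congr_left h (hs.symm.trans (hS a).symm) ht).trans (hℓ a)⟩

/-- The bracket condition can be checked on generating sections. -/
theorem isBracketMorphism_of_generators (G : Set V.Sec)
    (hG : ∀ (x : N) (v : V.fib x), ∃ a ∈ G, ∃ b ∈ G, v = a x + b x)
    (h : ∀ (x : N) (v : V.fib x), mfderiv I I' f x (L.anchor x v) = L'.anchor (f x) (F.fib x v))
    (hb : ∀ x, ∀ a ∈ G, ∀ b ∈ G, ∃ s t : V'.Sec, F.fib x (a x) = s (f x) ∧ F.fib x (b x) = t (f x) ∧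
      L.bracketDefect L' F x a b s t = 0) : L.IsBracketMorphism L' F := by
  -- This extends the vanishing from generators to all sections in the first argument. Skew-symmetry
  -- then serves the second argument.
  have step : ∀ (x : N) (b : V.Sec) (t : V'.Sec), F.fib x (b x) = t (f x) →
      (∀ a ∈ G, ∃ s : V'.Sec, F.fib x (a x) = s (f x) ∧ L.bracketDefect L' F x a b s t = 0) →
      ∀ (a : V.Sec) (s : V'.Sec), F.fib x (a x) = s (f x) → L.bracketDefect L' F x a b s t = 0 := by
    intro x b t ht hz a s hs
    obtain ⟨ℓ, hℓ⟩ := exists_linear_bracketDefect h ht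
    have hℓ0 : ∀ a ∈ G, ℓ (a x) = 0 := fun a ha => by
      obtain ⟨s, hs, hd⟩ := hz a ha
      rw [← hℓ a s hs, hd]
    obtain ⟨a₁, h₁, a₂, h₂, e⟩ := hG x (a x)
    rw [hℓ a s hs, e, map_add, hℓ0 a₁ h₁, hℓ0 a₂ h₂, add_zero]
  refine ⟨fun x v g hg => ?_, fun x a b s t hs ht => ?_⟩
  · rw [← h x v]
    exact dirDeriv_comp (hg.mdiffAt _) (F.contMDiff_base.mdiffAt _) _
  · refine sub_eq_zero.1 (step x b t ht (fun a ha => ?_) a s hs)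
    refine ⟨V'.secThrough (F.fib x (a x)), (V'.secThrough_self _).symm, ?_⟩
    rw [bracketDefect_skew, neg_eq_zero]
    refine step x a _ (V'.secThrough_self _).symm (fun b hb' => ?_) b t ht
    obtain ⟨s', t', hs', ht', hd⟩ := hb x a ha b hb'
    refine ⟨t', ht', ?_⟩
    rw [bracketDefect_skew, neg_eq_zero, ← hd]
    exact bracketDefect_congr_left h ((V'.secThrough_self _).trans hs') ht'

theorem isBracketMorphism_iff_bracketDefect : L.IsBracketMorphism L' F ↔
    (∀ (x : N) (v : V.fib x), mfderiv I I' f x (L.anchor x v) = L'.anchor (f x) (F.fib x v)) ∧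
    ∀ x a b s t, F.fib x (a x) = s (f x) → F.fib x (b x) = t (f x) →
      L.bracketDefect L' F x a b s t = 0 := by
  refine ⟨fun h => ⟨h.mfderiv_anchor, fun x a b s t hs ht => sub_eq_zero.2 (h.bracket x a b s t hs ht)⟩,
    fun h => isBracketMorphism_of_generators Set.univ (fun x v => ?_) h.1 fun x a _ b _ => ?_⟩
  · exact ⟨V.secThrough v, trivial, 0, trivial, by simp⟩
  · exact ⟨V'.secThrough (F.fib x (a x)), V'.secThrough (F.fib x (b x)), (V'.secThrough_self _).symm,
      (V'.secThrough_self _).symm, h.2 _ _ _ _ _ (V'.secThrough_self _).symm (V'.secThrough_self _).symm⟩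

end LieAlgebroid

/-- A bundle map covering the identity is a Lie algebroid morphism if and only if it preserves anchors and
brackets. -/
theorem LieAlgebroid.isMorphism_toVBHom_iff [FiniteDimensional ℝ E] [T2Space N] {V W : VB.{u} I N}
    (L : LieAlgebroid V) (L' : LieAlgebroid W) (φ : BundleMap V W) : L.IsMorphism L' φ.toVBHom ↔
      (∀ (x : N) (v : V.fib x), L.anchor x v = L'.anchor x (φ.fib x v)) ∧
      ∀ a b, φ.onSec (L.bracket a b) = L'.bracket (φ.onSec a) (φ.onSec b) := by
  rw [L.isMorphism_iff L']
  -- Over the identity, images of sections are sections. With this choice of s and t the corrections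
  -- are derivatives of the zero section.
  have hz : ∀ (x : N) (a b : V.Sec), L.bracketDefect L' φ.toVBHom x a b (φ.onSec a) (φ.onSec b) =
      φ.onSec (L.bracket a b) x - L'.bracket (φ.onSec a) (φ.onSec b) x := by
    intro x a b
    have e : ∀ (a : V.Sec) v, VB.pderiv I W (fun x : N => x)
        (fun y => φ.toVBHom.fib y (a y) - φ.onSec a y) x v = 0 := by
      intro a v
      have : (fun y => φ.toVBHom.fib y (a y) - φ.onSec a y) = fun y => (0 : W.fib y) :=
        funext fun y => sub_self _
      rw [this, VB.pderiv_zero]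
    unfold bracketDefect
    rw [e, e, add_zero, sub_zero]
    rfl
  have hid : ∀ (x : N) (v : TangentSpace I x), mfderiv I I (fun x : N => x) x v = v := fun x v =>
    DFunLike.congr_fun (mfderiv_id (I := I) (x := x)) v
  constructor
  · intro h
    refine ⟨fun x v => (hid x _).symm.trans (h.mfderiv_anchor x v), fun a b => ?_⟩
    ext x
    rw [← sub_eq_zero, ← hz]
    exact (isBracketMorphism_iff_bracketDefect.1 h).2 x a b _ _ rfl rfl
  · rintro ⟨h₁, h₂⟩
    refine isBracketMorphism_of_generators Set.univ (fun x v => ⟨V.secThrough v, trivial, 0, trivial, by simp⟩)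
      (fun x v => (hid x _).trans (h₁ x v)) fun x a _ b _ => ⟨φ.onSec a, φ.onSec b, rfl, rfl, ?_⟩
    rw [hz, h₂, sub_self]

end BracketMorphisms
-- The criterion for VB-algebroid morphisms in terms of components
section VBAlgebroidMorphisms

variable {E : Type*} [NormedAddCommGroup E] [NormedSpace ℝ E] {H : Type*} [TopologicalSpace H]
  {I : ModelWithCorners ℝ E H} {M : Type*} [TopologicalSpace M] [ChartedSpace H M]
  {A B C A' B' C' : VB.{u} I M}

namespace DVBHom.HasComponents

variable {F : DVBHom (DVB.trivial A B C) (DVB.trivial A' B' C')} {Fc : BundleMap C C'} {Φ : BilinMap A B C'}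
  (h : F.HasComponents F.ver F.hor Fc Φ)

include h

theorem fib_vec {b : B.Tot} (a : A.fib b.proj) (c : C.fib b.proj) :
    F.homB.fib b (DVB.vec a c) =
      DVB.vec (b := F.hor.total b) (F.ver.fib b.proj a) (Fc.fib b.proj c + Φ.fib b.proj a b.2) :=
  VB.mk_inj (h.2.2 b.proj a b.2 c)

theorem fib_liftSec (a : A.Sec) (b : B.Tot) : F.homB.fib b (DVB.liftSec A B C a b) =
    DVB.vec (b := F.hor.total b) (F.ver.fib b.proj (a b.proj)) (Φ.fib b.proj (a b.proj) b.2) := by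
  rw [DVB.liftSec_apply, h.fib_vec, map_zero, zero_add]

theorem fib_coreSec (c : C.Sec) (b : B.Tot) : F.homB.fib b (DVB.coreSec A B c b) =
    DVB.coreSec A' B' (Fc.onSec c) (F.hor.total b) := by
  rw [DVB.coreSec_apply, h.fib_vec]
  simp only [map_zero, LinearMap.zero_apply, add_zero]
  rfl

variable [FiniteDimensional ℝ E] [T2Space M] [IsManifold I ∞ M]

/-- A section of `D'` with the value of `F(h(a))` at the images of the values of `β`. -/
def _root_.DVBHom.liftImage (F : DVBHom (DVB.trivial A B C) (DVB.trivial A' B' C')) (Φ : BilinMap A B C')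
    (a : A.Sec) (β : B.Sec) : (DVB.trivial A' B' C').overB.Sec :=
  DVB.liftSec A' B' C' (F.ver.onSec a) + DVB.coreSec A' B' (Φ.onSec a β)

theorem fib_liftSec_eq (a : A.Sec) (β : B.Sec) {b : B.Tot} (hb : β b.proj = b.2) :
    F.homB.fib b (DVB.liftSec A B C a b) = F.liftImage Φ a β (F.hor.total b) := by
  rw [h.fib_liftSec, ← hb]
  exact DVB.vec_ext (add_zero _).symm (zero_add _).symm

/-- The components in A' cancel, and what remains is Φ_a(y) - Φ_a(β) in the core direction. By
`pderiv_homSec` its derivative is Φ_a of the vertical part. -/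
theorem pderiv_liftSec (a : A.Sec) (β : B.Sec) {b : B.Tot} (hb : β b.proj = b.2) (v : TangentSpace B.IT b) :
    VB.pderiv B.IT (DVB.trivial A' B' C').overB F.hor.total
      (fun y => F.homB.fib y (DVB.liftSec A B C a y) - F.liftImage Φ a β (F.hor.total y)) b v =
      DVB.vec (b := F.hor.total b) 0 (Φ.fib b.proj (a b.proj) (VB.vert β v)) := by
  refine Eq.trans ?_ (DVB.pderiv_homSec (A' := A') F.hor (Φ.hom a) β hb v)
  refine congrArg (fun ξ => VB.pderiv B.IT (DVB.trivial A' B' C').overB F.hor.total ξ b v)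
    (funext fun y => ?_)
  rw [h.fib_liftSec, DVBHom.liftImage, ContMDiffSection.coe_add, Pi.add_apply, DVB.liftSec_apply,
    DVB.coreSec_apply, DVB.vec_add_vec]
  refine congrArg₂ (DVB.vec (b := F.hor.total y)) ?_ ?_
  · change F.ver.fib y.proj (a y.proj) - (F.ver.fib y.proj (a y.proj) + 0) = 0
    rw [add_zero, sub_self]
  · exact congrArg (Φ.fib y.proj (a y.proj) y.2 - ·) (zero_add (Φ.fib y.proj (a y.proj) (β y.proj)))

theorem pderiv_coreSec (c : C.Sec) (b : B.Tot) (v : TangentSpace B.IT b) :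
    VB.pderiv B.IT (DVB.trivial A' B' C').overB F.hor.total
      (fun y => F.homB.fib y (DVB.coreSec A B c y) - DVB.coreSec A' B' (Fc.onSec c) (F.hor.total y)) b v =
      0 := by
  have e : (fun y => F.homB.fib y (DVB.coreSec A B c y) -
      DVB.coreSec A' B' (Fc.onSec c) (F.hor.total y)) = fun y => 0 :=
    funext fun y => sub_eq_zero.2 (h.fib_coreSec c y)
  rw [e, VB.pderiv_zero]

variable {LA : LieAlgebroid A} {LA' : LieAlgebroid A'} {LD : LieAlgebroid (DVB.trivial A B C).overB}
  {LD' : LieAlgebroid (DVB.trivial A' B' C').overB} {V : StructureOperators A B C}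
  {W : StructureOperators A' B' C'} (hV : IsAssociated LA V LD) (hW : IsAssociated LA' W LD')

include hV hW

omit h hV in
theorem bracket_liftImage (a a' : A.Sec) (β : B.Sec) (y : B'.Tot) :
    LD'.bracket (F.liftImage Φ a β) (F.liftImage Φ a' β) y =
      DVB.vec (LA'.bracket (F.ver.onSec a) (F.ver.onSec a') y.proj)
        (W.K.fib y.proj (F.ver.onSec a y.proj) (F.ver.onSec a' y.proj) y.2 +
          W.nabla₀ (F.ver.onSec a) (Φ.onSec a' β) y.proj - W.nabla₀ (F.ver.onSec a') (Φ.onSec a β) y.proj) := by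
  have e5 : ∀ c a', LD'.bracket (DVB.coreSec A' B' c) (DVB.liftSec A' B' C' a') =
      -DVB.coreSec A' B' (W.nabla₀ a' c) := fun c a' => by
    rw [← hW.bracket_lift_core]
    exact LD'.toSkew.bracket_skew _ _
  have e4 : LD'.bracket (DVB.liftSec A' B' C' (F.ver.onSec a)) (DVB.liftSec A' B' C' (F.ver.onSec a')) y =
      DVB.vec _ _ := hW.bracket_lift_lift _ _ y
  simp only [DVBHom.liftImage, map_add, LinearMap.add_apply, e5, hW.bracket_lift_core, hW.bracket_core_core,
    ContMDiffSection.coe_add, Pi.add_apply, ContMDiffSection.coe_neg, Pi.neg_apply,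
    ContMDiffSection.coe_zero, Pi.zero_apply]
  rw [e4, DVB.coreSec_apply, DVB.coreSec_apply]
  refine DVB.vec_ext ?_ ?_ <;> simp only [map_add, map_neg, DVB.vecA_vec, DVB.vecC_vec, map_zero] <;> abel

/-- The vertical parts of the anchors are -∇¹β, so the corrections are terms Φ(∇¹β). With the terms
∇⁰Φ from `bracket_liftImage` they form the covariant derivative of Φ. The component in A' is the
bracket condition for F_ver, the one in C' the condition d_∇Φ = φ₀K - Kφ₁. -/
theorem bracketDefect_lift_lift (a a' : A.Sec) (β : B.Sec) {b : B.Tot} (hb : β b.proj = b.2) :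
    LD.bracketDefect LD' F.homB b (DVB.liftSec A B C a) (DVB.liftSec A B C a')
      (F.liftImage Φ a β) (F.liftImage Φ a' β) =
    DVB.vec (b := F.hor.total b)
      ((F.ver.onSec (LA.bracket a a') - LA'.bracket (F.ver.onSec a) (F.ver.onSec a')) b.proj)
      ((Fc.onSec (V.K.onSec a a' β) - W.K.onSec (F.ver.onSec a) (F.ver.onSec a') (F.hor.onSec β) -
        (StructureOperators.nablaHom V (W.pullback F.ver) Φ a a' β -
          StructureOperators.nablaHom V (W.pullback F.ver) Φ a' a β - Φ.onSec (LA.bracket a a') β)) b.proj) := by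
  have e1 := h.pderiv_liftSec a β hb (LD.anchor b (DVB.liftSec A B C a' b))
  have e2 := h.pderiv_liftSec a' β hb (LD.anchor b (DVB.liftSec A B C a b))
  have v1 : VB.vert β (LD.anchor b (DVB.liftSec A B C a' b)) = -V.nabla₁ a' β b.proj :=
    hV.toSkew.vert_lift a' β hb
  have v2 : VB.vert β (LD.anchor b (DVB.liftSec A B C a b)) = -V.nabla₁ a β b.proj :=
    hV.toSkew.vert_lift a β hb
  have e3 : LD.bracket (DVB.liftSec A B C a) (DVB.liftSec A B C a') b =
      DVB.vec (LA.bracket a a' b.proj) (V.K.fib b.proj (a b.proj) (a' b.proj) (β b.proj)) :=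
    (hV.bracket_lift_lift a a' b).trans (by rw [hb]; rfl)
  unfold LieAlgebroid.bracketDefect
  rw [e1, e2, v1, v2, e3, bracket_liftImage hW, h.fib_vec, ← hb, map_neg, map_neg]
  refine congrArg₂ (DVB.vec (b := F.hor.total b)) ?_ ?_
  · change F.ver.fib b.proj (LA.bracket a a' b.proj) -
      (LA'.bracket (F.ver.onSec a) (F.ver.onSec a') b.proj + 0 - 0) = _
    rw [add_zero, sub_zero]
    rfl
  · have hK : F.hor.fib b.proj b.2 = F.hor.onSec β b.proj := by rw [← hb]; rfl
    change _ - (W.K.fib b.proj _ _ (F.hor.fib b.proj b.2) + _ - _ + -_ - -_) = Fc.fib b.proj _ - _ -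
      (W.nabla₀ (F.ver.onSec a) (Φ.onSec a' β) b.proj - _ - (W.nabla₀ (F.ver.onSec a') (Φ.onSec a β) b.proj - _) - _)
    rw [hK]
    change (Fc.fib b.proj _ + _) - (W.K.onSec (F.ver.onSec a) (F.ver.onSec a') (F.hor.onSec β) b.proj + _ - _ + -_ - -_) = _
    have key : ∀ P Q R X Y p q : C'.fib b.proj,
        (P + Q) - (R + X - Y + -q - -p) = P - R - (X - q - (Y - p) - Q) := fun P Q R X Y p q => by abel
    exact key _ _ _ _ _ _ _

/-- Only the lift has a correction, namely Φ_a of ∂c, the vertical part of the anchor of ĉ. The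
defect is thus the equation that compares ∇⁰ on C and C'. -/
theorem bracketDefect_lift_core (a : A.Sec) (c : C.Sec) (β : B.Sec) {b : B.Tot} (hb : β b.proj = b.2) :
    LD.bracketDefect LD' F.homB b (DVB.liftSec A B C a) (DVB.coreSec A B c)
      (F.liftImage Φ a β) (DVB.coreSec A' B' (Fc.onSec c)) =
    DVB.coreSec A' B' (Fc.onSec (V.nabla₀ a c) - W.nabla₀ (F.ver.onSec a) (Fc.onSec c) +
      Φ.onSec a (V.bd.onSec c)) (F.hor.total b) := by
  have e1 := h.pderiv_liftSec a β hb (LD.anchor b (DVB.coreSec A B c b))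
  have v1 : VB.vert β (LD.anchor b (DVB.coreSec A B c b)) = V.bd.fib b.proj (c b.proj) :=
    hV.toSkew.vert_core c β hb
  have e2 : LD'.bracket (F.liftImage Φ a β) (DVB.coreSec A' B' (Fc.onSec c)) =
      DVB.coreSec A' B' (W.nabla₀ (F.ver.onSec a) (Fc.onSec c)) := by
    rw [DVBHom.liftImage, map_add, LinearMap.add_apply, hW.bracket_lift_core, hW.bracket_core_core, add_zero]
  unfold LieAlgebroid.bracketDefect
  rw [e1, v1, h.pderiv_coreSec, hV.bracket_lift_core, h.fib_coreSec, e2, add_zero]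
  refine congrArg₂ (DVB.vec (b := F.hor.total b)) ?_ ?_
  · change (0 : A'.fib b.proj) - (0 - 0) = 0
    simp
  · exact (sub_sub_eq_add_sub _ _ _).trans (sub_add_eq_add_sub _ _ _).symm

theorem bracketDefect_core_core (c c' : C.Sec) (b : B.Tot) :
    LD.bracketDefect LD' F.homB b (DVB.coreSec A B c) (DVB.coreSec A B c')
      (DVB.coreSec A' B' (Fc.onSec c)) (DVB.coreSec A' B' (Fc.onSec c')) = 0 := by
  unfold LieAlgebroid.bracketDefect
  rw [h.pderiv_coreSec, h.pderiv_coreSec, hV.bracket_core_core, hW.bracket_core_core]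
  simp

omit h hV hW [T2Space M] [FiniteDimensional ℝ E] in
theorem dirDeriv_mfderiv_pullback {g : M → ℝ} (hg : ContMDiff I 𝓘(ℝ) ∞ g) {b : B.Tot}
    (v : TangentSpace B.IT b) :
    dirDeriv B'.IT (fun y : B'.Tot => g y.proj) (mfderiv B.IT B'.IT F.hor.total b v) =
      dirDeriv B.IT (fun y : B.Tot => g y.proj) v :=
  (dirDeriv_comp ((B'.contMDiff_comp_proj hg).mdiffAt _) (F.hor.smooth.mdiffAt b) v).symm

omit h hV hW [T2Space M] [FiniteDimensional ℝ E] in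
theorem dirDeriv_mfderiv_linear {ψ : ∀ m, B'.fib m →ₗ[ℝ] ℝ}
    (hψ : ContMDiff B'.IT 𝓘(ℝ) ∞ (B'.linearFun ψ)) {b : B.Tot} (v : TangentSpace B.IT b) :
    dirDeriv B'.IT (B'.linearFun ψ) (mfderiv B.IT B'.IT F.hor.total b v) =
      dirDeriv B.IT (B.linearFun fun m => ψ m ∘ₗ F.hor.fib m) v :=
  (dirDeriv_comp (hψ.mdiffAt _) (F.hor.smooth.mdiffAt b) v).symm

/-- Tangent vectors of B' are tested on two kinds of functions. Pulled back functions give the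
anchor condition for F_ver, linear functions on lifts compare the connections ∇¹, and linear
functions on core sections give φ₁∂ = ∂φ₀. -/
theorem anchor_iff :
    (∀ (b : B.Tot) (v : (DVB.trivial A B C).overB.fib b),
      mfderiv B.IT B'.IT F.hor.total b (LD.anchor b v) = LD'.anchor (F.hor.total b) (F.homB.fib b v)) ↔
    (∀ (m : M) (a : A.fib m), LA.anchor m a = LA'.anchor m (F.ver.fib m a)) ∧
    (∀ a β, W.nabla₁ (F.ver.onSec a) (F.hor.onSec β) - F.hor.onSec (V.nabla₁ a β) =
      W.bd.onSec (Φ.onSec a β)) ∧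
    ∀ c, F.hor.onSec (V.bd.onSec c) = W.bd.onSec (Fc.onSec c) := by
  have hsmooth : ∀ {ψ : ∀ m, B'.fib m →ₗ[ℝ] ℝ}, ContMDiff B'.IT 𝓘(ℝ) ∞ (B'.linearFun ψ) →
      ContMDiff B.IT 𝓘(ℝ) ∞ (B.linearFun fun m => ψ m ∘ₗ F.hor.fib m) := fun hψ =>
    hψ.comp F.hor.smooth
  -- In these identities `l` and `r` are the left and right sides of the anchor condition on lifts,
  -- `c` and `d` the two sides on core sections; the digit 0 stands for pulled back functions and 1
  -- for linear ones.
  have l0 : ∀ (a : A.Sec) (b : B.Tot) (g : M → ℝ) (_ : ContMDiff I 𝓘(ℝ) ∞ g),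
      dirDeriv B'.IT (fun y : B'.Tot => g y.proj)
        (mfderiv B.IT B'.IT F.hor.total b (LD.anchor b (DVB.liftSec A B C a b))) = LA.deriv a g b.proj :=
    fun a b g hg => (dirDeriv_mfderiv_pullback hg _).trans (hV.anchor_lift_pullback a g hg b)
  have l1 : ∀ (a : A.Sec) (β : B.Sec) (m : M) (ψ : ∀ m, B'.fib m →ₗ[ℝ] ℝ)
      (_ : ContMDiff B'.IT 𝓘(ℝ) ∞ (B'.linearFun ψ)), dirDeriv B'.IT (B'.linearFun ψ)
        (mfderiv B.IT B'.IT F.hor.total ⟨m, β m⟩ (LD.anchor ⟨m, β m⟩ (DVB.liftSec A B C a ⟨m, β m⟩))) =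
        LA.deriv a (fun x => ψ x (F.hor.onSec β x)) m - ψ m (F.hor.onSec (V.nabla₁ a β) m) :=
    fun a β m ψ hψ => (dirDeriv_mfderiv_linear hψ _).trans (hV.anchor_lift_linear a _ (hsmooth hψ) β m)
  have r : ∀ (a : A.Sec) (β : B.Sec) (m : M) (f : B'.Tot → ℝ), dirDeriv B'.IT f
      (LD'.anchor (F.hor.total ⟨m, β m⟩) (F.homB.fib ⟨m, β m⟩ (DVB.liftSec A B C a ⟨m, β m⟩))) =
      LD'.deriv (DVB.liftSec A' B' C' (F.ver.onSec a)) f (F.hor.total ⟨m, β m⟩) +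
      LD'.deriv (DVB.coreSec A' B' (Φ.onSec a β)) f (F.hor.total ⟨m, β m⟩) := fun a β m f => by
    rw [h.fib_liftSec_eq a β rfl]
    exact LD'.toSkew.deriv_add_sec _ _ _ _
  have r0 : ∀ (a : A.Sec) (β : B.Sec) (m : M) (g : M → ℝ) (_ : ContMDiff I 𝓘(ℝ) ∞ g),
      dirDeriv B'.IT (fun y : B'.Tot => g y.proj)
        (LD'.anchor (F.hor.total ⟨m, β m⟩) (F.homB.fib ⟨m, β m⟩ (DVB.liftSec A B C a ⟨m, β m⟩))) =
      LA'.deriv (F.ver.onSec a) g m := fun a β m g hg => by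
    rw [r, hW.anchor_lift_pullback _ g hg, hW.anchor_core_pullback _ g hg, add_zero]
    rfl
  have r1 : ∀ (a : A.Sec) (β : B.Sec) (m : M) (ψ : ∀ m, B'.fib m →ₗ[ℝ] ℝ)
      (_ : ContMDiff B'.IT 𝓘(ℝ) ∞ (B'.linearFun ψ)), dirDeriv B'.IT (B'.linearFun ψ)
        (LD'.anchor (F.hor.total ⟨m, β m⟩) (F.homB.fib ⟨m, β m⟩ (DVB.liftSec A B C a ⟨m, β m⟩))) =
      LA'.deriv (F.ver.onSec a) (fun x => ψ x (F.hor.onSec β x)) m -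
        ψ m (W.nabla₁ (F.ver.onSec a) (F.hor.onSec β) m) + ψ m (W.bd.onSec (Φ.onSec a β) m) :=
    fun a β m ψ hψ => (r a β m _).trans (congrArg₂ (· + ·)
      (hW.anchor_lift_linear _ ψ hψ (F.hor.onSec β) m) (hW.anchor_core_linear _ ψ hψ _))
  have c1 : ∀ (c : C.Sec) (b : B.Tot) (ψ : ∀ m, B'.fib m →ₗ[ℝ] ℝ)
      (_ : ContMDiff B'.IT 𝓘(ℝ) ∞ (B'.linearFun ψ)), dirDeriv B'.IT (B'.linearFun ψ)
        (mfderiv B.IT B'.IT F.hor.total b (LD.anchor b (DVB.coreSec A B c b))) =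
        ψ b.proj (F.hor.onSec (V.bd.onSec c) b.proj) := fun c b ψ hψ =>
    (dirDeriv_mfderiv_linear hψ _).trans (hV.anchor_core_linear c _ (hsmooth hψ) b)
  have d1 : ∀ (c : C.Sec) (b : B.Tot) (ψ : ∀ m, B'.fib m →ₗ[ℝ] ℝ)
      (_ : ContMDiff B'.IT 𝓘(ℝ) ∞ (B'.linearFun ψ)), dirDeriv B'.IT (B'.linearFun ψ)
        (LD'.anchor (F.hor.total b) (F.homB.fib b (DVB.coreSec A B c b))) =
        ψ b.proj (W.bd.onSec (Fc.onSec c) b.proj) := fun c b ψ hψ => by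
    rw [h.fib_coreSec]
    exact hW.anchor_core_linear _ ψ hψ _
  constructor
  · intro H
    have hA : ∀ (m : M) (a : A.fib m), LA.anchor m a = LA'.anchor m (F.ver.fib m a) := fun m a =>
      _root_.tangent_ext fun g hg => by
        have e := (l0 (A.secThrough a) ⟨m, (0 : B.Sec) m⟩ g hg).symm.trans
          ((congrArg _ (H _ _)).trans (r0 (A.secThrough a) 0 m g hg))
        change dirDeriv I g (LA.anchor m (A.secThrough a m)) =
          dirDeriv I g (LA'.anchor m (F.ver.fib m (A.secThrough a m))) at e
        rwa [VB.secThrough_self] at e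
    refine ⟨hA, fun a β => ?_, fun c => ?_⟩
    · ext m
      refine B'.ext_linearFun fun ψ hψ => ?_
      have e := (l1 a β m ψ hψ).symm.trans ((congrArg _ (H _ _)).trans (r1 a β m ψ hψ))
      have e2 : LA.deriv a (fun x => ψ x (F.hor.onSec β x)) m =
          LA'.deriv (F.ver.onSec a) (fun x => ψ x (F.hor.onSec β x)) m := congrArg _ (hA m (a m))
      rw [e2] at e
      rw [ContMDiffSection.coe_sub, Pi.sub_apply, map_sub]
      linarith
    · ext m
      exact B'.ext_linearFun fun ψ hψ => (c1 c ⟨m, 0⟩ ψ hψ).symm.trans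
        ((congrArg _ (H _ _)).trans (d1 c ⟨m, 0⟩ ψ hψ))
  · rintro ⟨hA, h1, hc⟩ b v
    have hlift : ∀ (a : A.Sec) (β : B.Sec) (m : M), mfderiv B.IT B'.IT F.hor.total ⟨m, β m⟩
        (LD.anchor ⟨m, β m⟩ (DVB.liftSec A B C a ⟨m, β m⟩)) =
        LD'.anchor (F.hor.total ⟨m, β m⟩) (F.homB.fib ⟨m, β m⟩ (DVB.liftSec A B C a ⟨m, β m⟩)) := by
      intro a β m
      have e2 : ∀ g, LA.deriv a g m = LA'.deriv (F.ver.onSec a) g m := fun g => congrArg _ (hA m (a m))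
      refine VB.tangent_ext B' (fun g hg => (l0 a _ g hg).trans ((e2 g).trans (r0 a β m g hg).symm))
        fun ψ hψ => (l1 a β m ψ hψ).trans (Eq.trans ?_ (r1 a β m ψ hψ).symm)
      rw [e2, ← h1, ContMDiffSection.coe_sub, Pi.sub_apply, map_sub]
      ring
    have hcore : ∀ c : C.Sec, mfderiv B.IT B'.IT F.hor.total b (LD.anchor b (DVB.coreSec A B c b)) =
        LD'.anchor (F.hor.total b) (F.homB.fib b (DVB.coreSec A B c b)) := by
      intro c
      refine VB.tangent_ext B' (fun g hg => ?_)
        fun ψ hψ => (c1 c b ψ hψ).trans (Eq.trans (by rw [hc]) (d1 c b ψ hψ).symm)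
      rw [h.fib_coreSec]
      exact ((dirDeriv_mfderiv_pullback hg _).trans (hV.anchor_core_pullback c g hg b)).trans
        (hW.anchor_core_pullback _ g hg _).symm
    rw [DVB.eq_liftSec_add_coreSec v, map_add, map_add, map_add, map_add]
    refine congrArg₂ (· + ·) ?_ (hcore _)
    have e := hlift (A.secThrough (DVB.vecA b v)) (B.secThrough b.2) b.proj
    rw [VB.secThrough_self] at e
    exact e

/-- The criterion for morphisms of VB-algebroids in terms of components. -/
theorem isVBAlgebroidMorphism_iff : F.IsVBAlgebroidMorphism LD LD' ↔
    LA.IsMorphism LA' F.ver.toVBHom ∧ V.IsMorphism LA (W.pullback F.ver) Fc F.hor Φ := by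
  rw [LieAlgebroid.isMorphism_toVBHom_iff, DVBHom.IsVBAlgebroidMorphism, LD.isMorphism_iff LD']
  have hb : ∀ b : B.Tot, B.secThrough b.2 b.proj = b.2 := fun b => B.secThrough_self _
  constructor
  · intro H
    obtain ⟨H₁, H₂⟩ := LieAlgebroid.isBracketMorphism_iff_bracketDefect.1 H
    obtain ⟨hA, h1, hc⟩ := (h.anchor_iff hV hW).1 H₁
    have h2 : ∀ (a a' : A.Sec) (β : B.Sec) (b : B.Tot) (hb : β b.proj = b.2), _ := fun a a' β b hb =>
      (h.bracketDefect_lift_lift hV hW a a' β hb).symm.trans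
        (H₂ _ _ _ _ _ (h.fib_liftSec_eq a β hb) (h.fib_liftSec_eq a' β hb))
    refine ⟨⟨hA, fun a a' => ?_⟩, ⟨hc, fun a c => ?_, h1, fun a a' β => ?_⟩⟩
    · ext m
      -- The component in A' does not involve β, so the zero section is as good as any other.
      exact sub_eq_zero.1 (congrArg (DVB.vecA _) (h2 a a' 0 ⟨m, (0 : B.Sec) m⟩ rfl))
    · ext m
      have e := (h.bracketDefect_lift_core hV hW a c 0 (b := ⟨m, (0 : B.Sec) m⟩) rfl).symm.trans
        (H₂ _ _ _ _ _ (h.fib_liftSec_eq a 0 rfl) (h.fib_coreSec c _))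
      have e' : (Fc.onSec (V.nabla₀ a c) - W.nabla₀ (F.ver.onSec a) (Fc.onSec c) +
        Φ.onSec a (V.bd.onSec c)) m = 0 := congrArg (DVB.vecC _) e
      change (W.nabla₀ (F.ver.onSec a) (Fc.onSec c) - Fc.onSec (V.nabla₀ a c)) m = _
      rw [ContMDiffSection.coe_add, Pi.add_apply, ContMDiffSection.coe_sub, Pi.sub_apply] at e'
      rw [ContMDiffSection.coe_sub, Pi.sub_apply, ← sub_eq_zero, ← neg_eq_zero, ← e']
      abel
    · ext m
      exact (sub_eq_zero.1 (congrArg (DVB.vecC _) (h2 a a' β ⟨m, β m⟩ rfl))).symm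
  · rintro ⟨⟨hA, hbr⟩, hm⟩
    have H₁ := (h.anchor_iff hV hW).2 ⟨hA, hm.nabla₁_comm, hm.bd_comm⟩
    have hlc : ∀ (a : A.Sec) (c : C.Sec) (b : B.Tot), LD.bracketDefect LD' F.homB b (DVB.liftSec A B C a)
        (DVB.coreSec A B c) (F.liftImage Φ a (B.secThrough b.2)) (DVB.coreSec A' B' (Fc.onSec c)) = 0 := by
      intro a c b
      rw [h.bracketDefect_lift_core hV hW a c _ (hb b), ← hm.nabla₀_comm]
      have e : Fc.onSec (V.nabla₀ a c) - W.nabla₀ (F.ver.onSec a) (Fc.onSec c) +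
          ((W.pullback F.ver).nabla₀ a (Fc.onSec c) - Fc.onSec (V.nabla₀ a c)) = 0 := by
        change _ - _ + (W.nabla₀ (F.ver.onSec a) (Fc.onSec c) - _) = _
        abel
      rw [e]
      rfl
    refine LieAlgebroid.isBracketMorphism_of_generators
      (Set.range (DVB.liftSec A B C) ∪ Set.range (DVB.coreSec A B)) (fun b v => ?_) H₁ ?_
    · exact ⟨_, Or.inl ⟨A.secThrough (DVB.vecA b v), rfl⟩, _, Or.inr ⟨C.secThrough (DVB.vecC b v), rfl⟩,
        DVB.eq_liftSec_add_coreSec v⟩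
    · rintro b _ (⟨a, rfl⟩ | ⟨c, rfl⟩) _ (⟨a', rfl⟩ | ⟨c', rfl⟩)
      · refine ⟨_, _, h.fib_liftSec_eq a _ (hb b), h.fib_liftSec_eq a' _ (hb b), ?_⟩
        rw [h.bracketDefect_lift_lift hV hW a a' _ (hb b), hbr, hm.K_comm]
        refine congrArg₂ (DVB.vec (b := F.hor.total b)) ?_ ?_
        · exact congrArg (fun s : A'.Sec => s b.proj) (sub_self _)
        · exact congrArg (fun s : C'.Sec => s b.proj) (sub_self _)
      · exact ⟨_, _, h.fib_liftSec_eq a _ (hb b), h.fib_coreSec c' b, hlc a c' b⟩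
      · refine ⟨_, _, h.fib_coreSec c b, h.fib_liftSec_eq a' _ (hb b), ?_⟩
        rw [LieAlgebroid.bracketDefect_skew, hlc, neg_zero]
      · exact ⟨_, _, h.fib_coreSec c b, h.fib_coreSec c' b, h.bracketDefect_core_core hV hW c c' b⟩

end DVBHom.HasComponents

end VBAlgebroidMorphisms

/-! ### Commutators of vector fields, the Jacobi identity, and extension of brackets from generators
-/

section Commutators

variable {E : Type*} [NormedAddCommGroup E] [NormedSpace ℝ E] {H : Type*} [TopologicalSpace H]
  {I : ModelWithCorners ℝ E H} {N : Type*} [TopologicalSpace N] [ChartedSpace H N]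
  [IsManifold I ∞ N]

/-- The commutator of two vector fields is given by a tangent vector. -/
theorem exists_dirDeriv_commutator [I.Boundaryless] {X Y : ∀ x : N, TangentSpace I x}
    (hX : ContMDiff I I.tangent ∞ (fun x => (⟨x, X x⟩ : TangentBundle I N)))
    (hY : ContMDiff I I.tangent ∞ (fun x => (⟨x, Y x⟩ : TangentBundle I N))) (x : N) :
    ∃ w : TangentSpace I x, ∀ f : N → ℝ, ContMDiff I 𝓘(ℝ) ∞ f →
      dirDeriv I (fun y => dirDeriv I f (Y y)) (X x) - dirDeriv I (fun y => dirDeriv I f (X y)) (Y x) =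
        dirDeriv I f w := by
  let φ : N → E := extChartAt I x
  let e := trivializationAt E (TangentSpace I) x
  have hb : x ∈ e.baseSet := mem_baseSet_trivializationAt _ _ _
  have hx : x ∈ (chartAt H x).source := mem_chart_source H x
  have hφ : ∀ y ∈ (chartAt H x).source, MDifferentiableAt I 𝓘(ℝ, E) φ y := fun y hy => mdifferentiableAt_extChartAt hy
  -- the components of a vector field in the chart
  let u : (∀ y : N, TangentSpace I y) → N → E := fun Z y => (e (⟨y, Z y⟩ : TangentBundle I N)).2
  have hu : ∀ (Z : ∀ y : N, TangentSpace I y), ∀ y ∈ (chartAt H x).source, u Z y = mvfderiv I φ y (Z y) := by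
    intro Z y hy
    have h3 : y ∈ e.baseSet := by rwa [TangentBundle.trivializationAt_baseSet]
    refine Eq.trans ?_ (DFunLike.congr_fun (TangentBundle.continuousLinearMapAt_trivializationAt (I := I) hy) (Z y))
    rw [Trivialization.continuousLinearMapAt_apply, Trivialization.linearMapAt_apply, if_pos h3]
  have hud : ∀ Z : ∀ y : N, TangentSpace I y,
      ContMDiff I I.tangent ∞ (fun x => (⟨x, Z x⟩ : TangentBundle I N)) → MDifferentiableAt I 𝓘(ℝ, E) (u Z) x :=
    fun Z hZ => ((contMDiffAt_totalSpace.1 (hZ x)).2).mdifferentiableAt (by simp)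
  -- functions in the chart
  have key : ∀ f : N → ℝ, ContMDiff I 𝓘(ℝ) ∞ f → ∃ F : E → ℝ, ContDiffAt ℝ ∞ F (φ x) ∧
      ∀ᶠ y in 𝓝 x, ∀ v : TangentSpace I y, dirDeriv I f v = fderiv ℝ F (φ y) (mvfderiv I φ y v) := by
    intro f hf
    -- Without boundary the target of the chart is a neighbourhood of the point, so f in the chart
    -- is smooth in the ordinary sense and has a symmetric second derivative.
    have hF : ContMDiffAt 𝓘(ℝ, E) 𝓘(ℝ) ∞ (f ∘ (extChartAt I x).symm) (φ x) :=
      (hf.contMDiffAt).comp _ ((contMDiffOn_extChartAt_symm x).contMDiffAt (extChartAt_target_mem_nhds x))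
    refine ⟨f ∘ (extChartAt I x).symm, hF.contDiffAt, ?_⟩
    filter_upwards [chart_source_mem_nhds H x] with y hy v
    have hy' : y ∈ (extChartAt I x).source := by rwa [extChartAt_source]
    have hFy : MDifferentiableAt 𝓘(ℝ, E) 𝓘(ℝ) (f ∘ (extChartAt I x).symm) (φ y) :=
      (ContMDiffAt.comp _ hf.contMDiffAt ((contMDiffOn_extChartAt_symm (n := ∞) x).contMDiffAt
        (extChartAt_target_mem_nhds' ((extChartAt I x).map_source hy')))).mdifferentiableAt (by simp)
    have e1 : f =ᶠ[𝓝 y] fun z => (f ∘ (extChartAt I x).symm) (φ z) := by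
      filter_upwards [(chartAt H x).open_source.mem_nhds hy] with z hz
      exact congrArg f ((extChartAt I x).left_inv (by rwa [extChartAt_source])).symm
    rw [dirDeriv_congr e1, dirDeriv_comp hFy (hφ y hy)]
    unfold dirDeriv
    rw [mfderiv_eq_fderiv]
    rfl
  -- The derivative of Z(f) along v is the Hessian S of f on v and Z plus the differential G of f on
  -- the derivative of the components of Z. Since S is symmetric, it cancels in the commutator.
  have key2 : ∀ f : N → ℝ, ContMDiff I 𝓘(ℝ) ∞ f → ∃ (G : E →L[ℝ] ℝ) (S : E → E → ℝ), (∀ a b, S a b = S b a) ∧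
      (∀ v : TangentSpace I x, dirDeriv I f v = G (mvfderiv I φ x v)) ∧
      ∀ Z : ∀ y : N, TangentSpace I y, ContMDiff I I.tangent ∞ (fun x => (⟨x, Z x⟩ : TangentBundle I N)) →
        ∀ v : TangentSpace I x, dirDeriv I (fun y => dirDeriv I f (Z y)) v =
          S (mvfderiv I φ x v) (mvfderiv I φ x (Z x)) + G (mvfderiv I (u Z) x v) := by
    intro f hf
    obtain ⟨F, hF, hFe⟩ := key f hf
    have hsymm : IsSymmSndFDerivAt ℝ F (φ x) := hF.isSymmSndFDerivAt (by
      simpa using (WithTop.coe_le_coe.2 (le_top : (2 : ℕ∞) ≤ ⊤)))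
    refine ⟨fderiv ℝ F (φ x), fun a b => fderiv ℝ (fderiv ℝ F) (φ x) a b, hsymm, hFe.self_of_nhds, ?_⟩
    intro Z hZ v
    have e1 : (fun y => dirDeriv I f (Z y)) =ᶠ[𝓝 x] fun y => fderiv ℝ F (φ y) (u Z y) := by
      filter_upwards [hFe, chart_source_mem_nhds H x] with y hy hs
      rw [hy, hu Z y hs]
    have hF' : HasFDerivAt (fderiv ℝ F) (fderiv ℝ (fderiv ℝ F) (φ x)) (φ x) :=
      ((hF.fderiv_right (m := 1) (WithTop.coe_le_coe.2 (le_top : (1 + 1 : ℕ∞) ≤ ⊤))).differentiableAt one_ne_zero).hasFDerivAt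
    have h1 := (hφ x hx).hasMFDerivAt
    have h2 := (hud Z hZ).hasMFDerivAt
    have h3 : HasFDerivAt (fun p : E × E => fderiv ℝ F p.1 p.2) _ (φ x, u Z x) :=
      HasFDerivAt.clm_apply (HasFDerivAt.comp (φ x, u Z x) hF' hasFDerivAt_fst) hasFDerivAt_snd
    have h5 : HasMFDerivAt I 𝓘(ℝ, E × E) (fun y => (φ y, u Z y)) x
        ((mvfderiv I φ x).prod (mvfderiv I (u Z) x)) := ⟨h1.1.prodMk h2.1, h1.2.prodMk h2.2⟩
    have h4 := HasMFDerivAt.comp (f := fun y => (φ y, u Z y)) x h3.hasMFDerivAt h5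
    rw [dirDeriv_congr e1]
    refine (DFunLike.congr_fun h4.mfderiv v).trans ?_
    rw [← hu Z x hx]
    exact add_comm _ _
  -- The Lie bracket of X and Y in the chart.
  let w : E := mvfderiv I (u Y) x (X x) - mvfderiv I (u X) x (Y x)
  refine ⟨e.symm x w, fun f hf => ?_⟩
  obtain ⟨G, S, hS, h1, h2⟩ := key2 f hf
  have hw : mvfderiv I φ x (e.symm x w) = w := by
    rw [← hu (fun y => e.symm y w) x hx]
    change (e (⟨x, e.symm x w⟩ : TangentBundle I N)).2 = w
    rw [e.apply_mk_symm hb]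
  rw [h2 Y hY, h2 X hX, h1, hw, map_sub, hS]
  ring

namespace SkewAlgebroid

variable {V : VB.{u} I N} (L : SkewAlgebroid V)

/-- The failure of the anchor to preserve the bracket of two sections. -/
def anchorDefect (X Y : V.Sec) (f : N → ℝ) (x : N) : ℝ :=
  L.deriv (L.bracket X Y) f x - (L.deriv X (L.deriv Y f) x - L.deriv Y (L.deriv X f) x)

/-- The failure of the Jacobi identity. -/
def jacobiator (X Y Z : V.Sec) : V.Sec :=
  L.bracket X (L.bracket Y Z) - (L.bracket (L.bracket X Y) Z + L.bracket Y (L.bracket X Z))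

variable {L}

theorem deriv_neg_sec (X : V.Sec) (f : N → ℝ) (x : N) : L.deriv (-X) f x = -L.deriv X f x := by
  have e := dirDeriv_smul_vec f (-1) (L.anchor x (X x))
  rw [neg_one_smul, neg_one_mul] at e
  unfold deriv
  rw [ContMDiffSection.coe_neg, Pi.neg_apply, map_neg, e]

theorem deriv_add_section (X Y : V.Sec) (f : N → ℝ) (x : N) :
    L.deriv (X + Y) f x = L.deriv X f x + L.deriv Y f x := by
  unfold deriv
  rw [ContMDiffSection.coe_add, Pi.add_apply, map_add, dirDeriv_add_vec]

theorem deriv_smulSec {g : N → ℝ} (hg : ContMDiff I 𝓘(ℝ) ∞ g) (X : V.Sec) (f : N → ℝ) (x : N) :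
    L.deriv (V.smulSec g hg X) f x = g x * L.deriv X f x := by
  unfold deriv
  rw [VB.smulSec_apply, map_smul, dirDeriv_smul_vec]

theorem anchorDefect_skew (X Y : V.Sec) (f : N → ℝ) (x : N) :
    L.anchorDefect Y X f x = -L.anchorDefect X Y f x := by
  unfold anchorDefect
  rw [L.bracket_skew Y X, deriv_neg_sec]
  ring

theorem anchorDefect_add (X Y Y' : V.Sec) {f : N → ℝ} (hf : ContMDiff I 𝓘(ℝ) ∞ f) (x : N) :
    L.anchorDefect X (Y + Y') f x = L.anchorDefect X Y f x + L.anchorDefect X Y' f x := by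
  have e : L.deriv (Y + Y') f = fun x => L.deriv Y f x + L.deriv Y' f x :=
    funext fun x => deriv_add_section Y Y' f x
  have e2 : L.deriv X (L.deriv (Y + Y') f) x = L.deriv X (L.deriv Y f) x + L.deriv X (L.deriv Y' f) x := by
    rw [e]
    exact dirDeriv_add ((L.contMDiff_deriv Y hf).mdiffAt x) ((L.contMDiff_deriv Y' hf).mdiffAt x) _
  unfold anchorDefect
  rw [map_add, deriv_add_section, e2, deriv_add_section]
  ring

/-- The second-order terms of the two products cancel, so the defect is tensorial without any
assumption on the bracket. It can therefore be tested on generators before anything is known about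
the Jacobi identity. -/
theorem anchorDefect_smul (X Y : V.Sec) {f g : N → ℝ} (hf : ContMDiff I 𝓘(ℝ) ∞ f)
    (hg : ContMDiff I 𝓘(ℝ) ∞ g) (x : N) :
    L.anchorDefect X (V.smulSec g hg Y) f x = g x * L.anchorDefect X Y f x := by
  have e : L.deriv (V.smulSec g hg Y) f = fun x => g x * L.deriv Y f x :=
    funext fun x => deriv_smulSec hg Y f x
  have e2 : L.deriv X (L.deriv (V.smulSec g hg Y) f) x =
      g x * L.deriv X (L.deriv Y f) x + L.deriv Y f x * L.deriv X g x := by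
    rw [e]
    exact dirDeriv_mul (hg.mdiffAt x) ((L.contMDiff_deriv Y hf).mdiffAt x) _
  have e3 : L.deriv (L.bracket X (V.smulSec g hg Y)) f x =
      g x * L.deriv (L.bracket X Y) f x + L.deriv X g x * L.deriv Y f x := by
    conv_lhs => unfold deriv
    rw [L.bracket_smulSec, map_add, map_smul, map_smul, dirDeriv_add_vec, dirDeriv_smul_vec, dirDeriv_smul_vec]
    rfl
  unfold anchorDefect
  rw [e2, e3, deriv_smulSec]
  ring

theorem jacobiator_swap_left (X Y Z : V.Sec) : L.jacobiator Y X Z = -L.jacobiator X Y Z := by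
  unfold jacobiator
  rw [L.bracket_skew Y X, map_neg, LinearMap.neg_apply]
  abel

theorem jacobiator_swap_right (X Y Z : V.Sec) : L.jacobiator X Z Y = -L.jacobiator X Y Z := by
  unfold jacobiator
  rw [L.bracket_skew Z Y, L.bracket_skew (L.bracket X Z) Y, L.bracket_skew Z (L.bracket X Y), map_neg]
  abel

theorem jacobiator_add (X Y Z Z' : V.Sec) :
    L.jacobiator X Y (Z + Z') = L.jacobiator X Y Z + L.jacobiator X Y Z' := by
  unfold jacobiator
  simp only [map_add]
  abel

/-- The only term that is not a multiple of g is the anchor defect of g times Z. Tensoriality of the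
Jacobiator thus presupposes that the anchor preserves brackets. -/
theorem jacobiator_smul (h : ∀ X Y f x, ContMDiff I 𝓘(ℝ) ∞ f → L.anchorDefect X Y f x = 0)
    (X Y Z : V.Sec) {g : N → ℝ} (hg : ContMDiff I 𝓘(ℝ) ∞ g) (x : N) :
    L.jacobiator X Y (V.smulSec g hg Z) x = g x • L.jacobiator X Y Z x := by
  have e2 : ∀ X Y, L.bracket X (V.smulSec g hg Y) = V.smulSec g hg (L.bracket X Y) +
      V.smulSec (L.deriv X g) (L.contMDiff_deriv X hg) Y := fun X Y => by
    ext y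
    exact L.bracket_smulSec X Y g hg y
  have e := sub_eq_zero.1 (h X Y g x hg)
  unfold jacobiator
  simp only [e2, map_add, ContMDiffSection.coe_sub, ContMDiffSection.coe_add, Pi.sub_apply, Pi.add_apply,
    VB.smulSec_apply, L.bracket_smulSec, e]
  module

variable [FiniteDimensional ℝ E] [T2Space N]

/-- If `V` is generated by sections for which anchors and the Jacobi identity are as required, then the
anchor preserves brackets and the Jacobi identity holds. -/
theorem jacobiator_eq_zero_of_generators (G : Set V.Sec)
    (hG : ∀ (x : N) (v : V.fib x), ∃ X ∈ G, ∃ Y ∈ G, v = X x + Y x)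
    (hP : ∀ X ∈ G, ∀ Y ∈ G, ∀ f x, ContMDiff I 𝓘(ℝ) ∞ f → L.anchorDefect X Y f x = 0)
    (hJ : ∀ X ∈ G, ∀ Y ∈ G, ∀ Z ∈ G, L.jacobiator X Y Z = 0) (X Y Z : V.Sec) : L.jacobiator X Y Z = 0 := by
  have stepP : ∀ (X : V.Sec) f x, ContMDiff I 𝓘(ℝ) ∞ f → (∀ Y ∈ G, L.anchorDefect X Y f x = 0) →
      ∀ Y, L.anchorDefect X Y f x = 0 := by
    intro X f x hf h Y
    obtain ⟨ℓ, hℓ⟩ := V.exists_linear_of_tensorial x (fun Y => L.anchorDefect X Y f x)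
      (fun Y Y' => anchorDefect_add X Y Y' hf x) (fun g hg Y => anchorDefect_smul X Y hf hg x)
    obtain ⟨Y₁, h₁, Y₂, h₂, e⟩ := hG x (Y x)
    rw [hℓ, e, map_add, ← hℓ, ← hℓ, h _ h₁, h _ h₂, add_zero]
  have hP' : ∀ X Y f x, ContMDiff I 𝓘(ℝ) ∞ f → L.anchorDefect X Y f x = 0 := by
    intro X Y f x hf
    refine stepP X f x hf (fun Y hY => ?_) Y
    rw [anchorDefect_skew, neg_eq_zero]
    exact stepP Y f x hf (fun X hX => hP Y hY X hX f x hf) X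
  have stepJ : ∀ X Y, (∀ Z ∈ G, L.jacobiator X Y Z = 0) → ∀ Z, L.jacobiator X Y Z = 0 := by
    intro X Y h Z
    ext x
    obtain ⟨ℓ, hℓ⟩ := V.exists_linear_of_tensorial x (fun Z => L.jacobiator X Y Z x)
      (fun Z Z' => by rw [jacobiator_add]; rfl) (fun g hg Z => jacobiator_smul hP' X Y Z hg x)
    obtain ⟨Z₁, h₁, Z₂, h₂, e⟩ := hG x (Z x)
    rw [hℓ, e, map_add, ← hℓ, ← hℓ, h _ h₁, h _ h₂]
    exact add_zero _
  -- Each of the three arguments is moved in turn to the last slot, where `stepJ` replaces it by a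
  -- generator.
  refine stepJ X Y (fun Z hZ => ?_) Z
  rw [← neg_eq_zero, ← jacobiator_swap_right]
  refine stepJ X Z (fun Y hY => ?_) Y
  rw [← neg_eq_zero, ← jacobiator_swap_left, ← neg_eq_zero, ← jacobiator_swap_right]
  exact stepJ Z Y (fun X hX => hJ Z hZ Y hY X hX) X

end SkewAlgebroid

/-! ### Extending a bracket from generating sections -/

namespace VB

variable {V : VB.{u} I N} {S : Type*} [AddCommGroup S] [Module ℝ S]

variable [FiniteDimensional ℝ E] [T2Space N]

/-- A bracket on generating sections extends to all sections by the Leibniz rule. -/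
theorem exists_skewAlgebroid_of_generators (γ : S →ₗ[ℝ] V.Sec) (ρ : ∀ x, V.fib x →ₗ[ℝ] TangentSpace I x)
    (hρ : ContMDiff V.IT I.tangent ∞ (fun v : V.Tot => (⟨v.proj, ρ v.proj v.2⟩ : TangentBundle I N)))
    (β : S →ₗ[ℝ] S →ₗ[ℝ] V.Sec) (hβ : ∀ s, β s s = 0)
    (hloc : ∀ (X : V.Sec) (x₀ : N), ∃ (ι : Type) (_ : Fintype ι) (s : ι → S) (f : ι → N → ℝ)
      (hf : ∀ i, ContMDiff I 𝓘(ℝ) ∞ (f i)), ∀ᶠ x in 𝓝 x₀, X x = (∑ i, V.smulSec (f i) (hf i) (γ (s i))) x)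
    (h₀ : ∀ s t x, γ t x = 0 → β s t x = V.sderiv (γ t) x (ρ x (γ s x))) :
    ∃ L : SkewAlgebroid V, L.anchor = ρ ∧ ∀ s t, L.bracket (γ s) (γ t) = β s t := by
  have hγ : ∀ x (v : V.fib x), ∃ s, γ s x = v := by
    intro x v
    obtain ⟨ι, _, s, f, hf, h⟩ := hloc (V.secThrough v) x
    have e := h.self_of_nhds
    rw [V.secThrough_self] at e
    refine ⟨∑ i, f i x • s i, ?_⟩
    rw [e, map_sum, V.sum_apply, V.sum_apply]
    refine Finset.sum_congr rfl fun i _ => ?_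
    rw [map_smul]
    rfl
  choose σ hσ using hγ
  -- the bracket computed with generators `s`, `t` through the given values
  let br : S → S → V.Sec → V.Sec → ∀ x, V.fib x := fun s t X Y x =>
    β s t x + V.sderiv (fun y => Y y - γ t y) x (ρ x (X x)) - V.sderiv (fun y => X y - γ s y) x (ρ x (Y x))
  have hskew : ∀ s t, β s t = -β t s := fun s t => by
    have e := hβ (s + t)
    simp only [map_add, LinearMap.add_apply, hβ, zero_add, add_zero] at e
    exact eq_neg_of_add_eq_zero_right e
  have br_skew : ∀ s t X Y x, br s t X Y x = -br t s Y X x := fun s t X Y x => by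
    simp only [br]
    rw [hskew]
    simp only [ContMDiffSection.coe_neg, Pi.neg_apply]
    abel
  have hsub : ∀ (X Y : V.Sec) x, ContMDiffAt I V.IT ∞ (fun y => (⟨y, X y - Y y⟩ : V.Tot)) x :=
    fun X Y => (X - Y).contMDiff
  -- Two generators with the same value at x differ by one that vanishes there. Hypothesis `h₀` says
  -- that its bracket is the derivative that appears with the opposite sign in the correction.
  have br_right : ∀ s t t' X Y x, γ s x = X x → γ t x = Y x → γ t' x = Y x → br s t X Y x = br s t' X Y x := by
    intro s t t' X Y x hs ht ht'
    have e := h₀ s (t - t') x (by rw [map_sub, ContMDiffSection.coe_sub, Pi.sub_apply, ht, ht', sub_self])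
    have e2 : V.sderiv (γ (t - t')) x (ρ x (γ s x)) = V.sderiv (fun y => Y y - γ t' y) x (ρ x (X x)) -
        V.sderiv (fun y => Y y - γ t y) x (ρ x (X x)) := by
      rw [hs, ← VB.pderiv_sub (hsub _ _ x) (hsub _ _ x)]
      congr 1
      funext y
      rw [map_sub, ContMDiffSection.coe_sub, Pi.sub_apply]
      abel
    rw [e2, map_sub, ContMDiffSection.coe_sub, Pi.sub_apply] at e
    simp only [br]
    rw [sub_eq_iff_eq_add.1 e]
    abel
  let B : V.Sec → V.Sec → ∀ x, V.fib x := fun X Y x => br (σ x (X x)) (σ x (Y x)) X Y x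
  have hB : ∀ s t X Y x, γ s x = X x → γ t x = Y x → B X Y x = br s t X Y x := by
    intro s t X Y x hs ht
    change br _ _ X Y x = _
    rw [br_right _ _ t X Y x (hσ _ _) (hσ _ _) ht, br_skew, br_right _ _ s Y X x ht (hσ _ _) hs, ← br_skew]
  have sd_zero : ∀ x v, V.sderiv (fun _ => 0) x v = 0 := fun x v => VB.pderiv_zero v
  have B_skew : ∀ X Y x, B X Y x = -B Y X x := fun X Y x => br_skew _ _ _ _ _
  have B_γ : ∀ s t x, B (γ s) (γ t) x = β s t x := by
    intro s t x
    rw [hB s t _ _ x rfl rfl]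
    simp only [br, sub_self]
    rw [sd_zero, sd_zero, add_zero, sub_zero]
  have B_add : ∀ X Y Y' x, B X (Y + Y') x = B X Y x + B X Y' x := by
    intro X Y Y' x
    have e : V.sderiv (fun y => (Y + Y') y - γ (σ x (Y x) + σ x (Y' x)) y) x (ρ x (X x)) =
        V.sderiv (fun y => Y y - γ (σ x (Y x)) y) x (ρ x (X x)) +
          V.sderiv (fun y => Y' y - γ (σ x (Y' x)) y) x (ρ x (X x)) := by
      rw [← VB.pderiv_add (hsub _ _ x) (hsub _ _ x)]
      congr 1
      funext y
      simp only [map_add, ContMDiffSection.coe_add, Pi.add_apply]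
      abel
    rw [hB (σ x (X x)) (σ x (Y x) + σ x (Y' x)) _ _ x (hσ _ _)
      (by rw [map_add, ContMDiffSection.coe_add, Pi.add_apply, hσ, hσ]; rfl)]
    simp only [B, br, e]
    simp only [map_add, ContMDiffSection.coe_add, Pi.add_apply, VB.pderiv_add_vec]
    abel
  have B_smul : ∀ X Y (g : N → ℝ) (hg : ContMDiff I 𝓘(ℝ) ∞ g) x,
      B X (V.smulSec g hg Y) x = g x • B X Y x + dirDeriv I g (ρ x (X x)) • Y x := by
    intro X Y g hg x
    let t := σ x (Y x)
    have hg' : ContMDiff I 𝓘(ℝ) ∞ (fun y => g y - g x) := hg.sub contMDiff_const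
    have hd : ∀ v : TangentSpace I x, dirDeriv I (fun y => g y - g x) v = dirDeriv I g v := fun v => by
      rw [dirDeriv_sub (hg.mdiffAt x) (mdifferentiableAt_const (c := g x)), dirDeriv_const, sub_zero]
    -- The generator through g x • Y x is g x • t. The difference splits into g (Y - t), whose
    -- section vanishes at x, and (g - g x) t, whose function does.
    have e : V.sderiv (fun y => V.smulSec g hg Y y - γ (g x • t) y) x (ρ x (X x)) =
        g x • V.sderiv (fun y => Y y - γ t y) x (ρ x (X x)) + dirDeriv I g (ρ x (X x)) • Y x := by
      have e1 : (fun y => V.smulSec g hg Y y - γ (g x • t) y) =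
          fun y => g y • (Y y - γ t y) + (g y - g x) • γ t y := by
        funext y
        rw [VB.smulSec_apply, map_smul, ContMDiffSection.coe_smul, Pi.smul_apply]
        module
      have e2 := VB.pderiv_smul hg.contMDiffAt (hsub Y (γ t) x) (ρ x (X x))
      have e3 := VB.pderiv_smul hg'.contMDiffAt (γ t).contMDiff.contMDiffAt (ρ x (X x))
      have e4 : γ t x = Y x := hσ _ _
      rw [e1]
      refine (VB.pderiv_add (VB.contMDiffAt_smul hg.contMDiffAt (hsub Y (γ t) x))
        (VB.contMDiffAt_smul hg'.contMDiffAt (γ t).contMDiff.contMDiffAt) _).trans ?_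
      rw [e2, e3, hd]
      simp only [e4, sub_self, smul_zero, zero_add, zero_smul, add_zero]
    rw [hB (σ x (X x)) (g x • t) _ _ x (hσ _ _)
      (by rw [map_smul, ContMDiffSection.coe_smul, Pi.smul_apply, hσ]; rfl)]
    simp only [B, br, e]
    simp only [map_smul, ContMDiffSection.coe_smul, Pi.smul_apply, VB.pderiv_smul_vec, VB.smulSec_apply]
    module
  have B_zero : ∀ X x, B X 0 x = 0 := fun X x => by
    have := B_add X 0 0 x
    rwa [add_zero, left_eq_add] at this
  have B_congr : ∀ X Y Y' x, (∀ᶠ y in 𝓝 x, Y y = Y' y) → B X Y x = B X Y' x := by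
    intro X Y Y' x h
    have h1 := h.self_of_nhds
    rw [hB (σ x (X x)) (σ x (Y' x)) X Y x (hσ _ _) ((hσ _ _).trans h1.symm)]
    simp only [B, br]
    have e : V.sderiv (fun y => Y y - γ (σ x (Y' x)) y) x (ρ x (X x)) =
        V.sderiv (fun y => Y' y - γ (σ x (Y' x)) y) x (ρ x (X x)) :=
      VB.pderiv_congr (h.mono fun y hy => congrArg (· - _) hy) _
    rw [e, h1]
  -- The generators chosen by σ need not vary smoothly with the point. Smoothness comes instead from
  -- a local expansion of the second argument in generators: locality and the Leibniz rule then
  -- express B by brackets with fixed generators.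
  have smooth_step : ∀ X, (∀ t, ContMDiff I V.IT ∞ (fun x => (⟨x, B X (γ t) x⟩ : V.Tot))) →
      ∀ Y, ContMDiff I V.IT ∞ (fun x => (⟨x, B X Y x⟩ : V.Tot)) := by
    intro X h Y x₀
    obtain ⟨ι, _, s, f, hf, hY⟩ := hloc Y x₀
    have hsum : ∀ (t : Finset ι) x, B X (∑ i ∈ t, V.smulSec (f i) (hf i) (γ (s i))) x =
        ∑ i ∈ t, (f i x • B X (γ (s i)) x + dirDeriv I (f i) (ρ x (X x)) • γ (s i) x) := by
      classical
      intro t x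
      induction t using Finset.induction_on with
      | empty => simp [B_zero]
      | insert i t hi ih => rw [Finset.sum_insert hi, Finset.sum_insert hi, B_add, ih, B_smul]
    have hd : ∀ i, ContMDiff I 𝓘(ℝ) ∞ (fun x => dirDeriv I (f i) (ρ x (X x))) := fun i =>
      contMDiff_dirDeriv (hf i) (hρ.comp X.contMDiff :)
    refine VB.contMDiffAt_congr (f := fun x : N => x) (ξ := fun x => ∑ i, (f i x • B X (γ (s i)) x +
      dirDeriv I (f i) (ρ x (X x)) • γ (s i) x)) ?_ ?_
    · filter_upwards [hY.eventually_nhds] with x hx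
      rw [B_congr X _ _ x hx, hsum]
    · exact VB.contMDiffAt_sum _ contMDiffAt_id fun i _ => VB.contMDiffAt_add
        (VB.contMDiffAt_smul (hf i).contMDiffAt (h _).contMDiffAt)
        (VB.contMDiffAt_smul (hd i).contMDiffAt (γ (s i)).contMDiff.contMDiffAt)
  have smooth_neg : ∀ X Y, ContMDiff I V.IT ∞ (fun x => (⟨x, B X Y x⟩ : V.Tot)) →
      ContMDiff I V.IT ∞ (fun x => (⟨x, B Y X x⟩ : V.Tot)) := fun X Y h => by
    have e : (fun x => B Y X x) = fun x => (-(⟨fun x => B X Y x, h⟩ : V.Sec)) x := funext fun x => B_skew Y X x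
    have h' := (-(⟨fun x => B X Y x, h⟩ : V.Sec)).contMDiff
    exact (h'.congr fun x => by rw [B_skew Y X x]; rfl)
  have smooth : ∀ X Y, ContMDiff I V.IT ∞ (fun x => (⟨x, B X Y x⟩ : V.Tot)) := by
    intro X
    refine smooth_step X fun t => smooth_neg _ _ (smooth_step (γ t) (fun s => ?_) X)
    exact (β t s).contMDiff.congr fun x => by rw [B_γ]
  have B_smul_const : ∀ X (r : ℝ) Y x, B X (r • Y) x = r • B X Y x := fun X r Y x => by
    have e := B_smul X Y (fun _ => r) contMDiff_const x
    rw [dirDeriv_const, zero_smul, add_zero] at e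
    exact e
  refine ⟨⟨ρ, hρ, LinearMap.mk₂ ℝ (fun X Y => ⟨fun x => B X Y x, smooth X Y⟩) ?_ ?_ ?_ ?_, ?_, ?_⟩, rfl, ?_⟩
  · intro X X' Y
    ext x
    change B (X + X') Y x = B X Y x + B X' Y x
    rw [B_skew, B_add, B_skew Y X, B_skew Y X']
    abel
  · intro r X Y
    ext x
    change B (r • X) Y x = r • B X Y x
    rw [B_skew, B_smul_const, B_skew Y X, smul_neg, neg_neg]
  · intro X Y Y'
    ext x
    exact B_add X Y Y' x
  · intro r X Y
    ext x
    exact B_smul_const X r Y x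
  · intro X
    ext x
    change br _ _ X X x = 0
    simp only [br, hβ, add_sub_cancel_right, ContMDiffSection.coe_zero, Pi.zero_apply]
  · intro X Y Z g hg hZ x
    obtain rfl : Z = V.smulSec g hg Y := by ext x; exact hZ x
    exact B_smul X Y g hg x
  · intro s t
    ext x
    exact B_γ s t x

end VB

end Commutators

/-! ### Smoothness of bilinear maps along a map -/

section BilinearSmoothness

variable {E : Type*} [NormedAddCommGroup E] [NormedSpace ℝ E] {H : Type*} [TopologicalSpace H]
  {I : ModelWithCorners ℝ E H} {M : Type*} [TopologicalSpace M] [ChartedSpace H M]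
  [FiniteDimensional ℝ E] [T2Space M] [IsManifold I ∞ M] {A B C : VB.{u} I M}
  {X : Type*} [TopologicalSpace X] {EX : Type*} [NormedAddCommGroup EX] [NormedSpace ℝ EX]
  {HX : Type*} [TopologicalSpace HX] [ChartedSpace HX X] {IX : ModelWithCorners ℝ EX HX} {f : X → M}
  {ξ : ∀ x, A.fib (f x)} {η : ∀ x, B.fib (f x)} {x₀ : X}

theorem VB.contMDiffAt_bilinear (ℓ : ∀ m, A.fib m →ₗ[ℝ] B.fib m →ₗ[ℝ] ℝ)
    (hℓ : ∀ (a : A.Sec) (b : B.Sec), ContMDiff I 𝓘(ℝ) ∞ (fun m => ℓ m (a m) (b m)))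
    (hf : ContMDiffAt IX I ∞ f x₀)
    (hξ : ContMDiffAt IX A.IT ∞ (fun x => (⟨f x, ξ x⟩ : A.Tot)) x₀)
    (hη : ContMDiffAt IX B.IT ∞ (fun x => (⟨f x, η x⟩ : B.Tot)) x₀) :
    ContMDiffAt IX 𝓘(ℝ) ∞ (fun x => ℓ (f x) (ξ x) (η x)) x₀ := by
  let frA := A.frame (f x₀)
  let frB := B.frame (f x₀)
  have h1 : ∀ᶠ x in 𝓝 x₀, ℓ (f x) (ξ x) (η x) = ∑ i, ∑ j, frA.coef i (f x) (ξ x) *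
      (frB.coef j (f x) (η x) * ℓ (f x) (frA.sec i (f x)) (frB.sec j (f x))) := by
    filter_upwards [hf.continuousAt.eventually frA.eventually_sum,
      hf.continuousAt.eventually frB.eventually_sum] with x hA hB
    conv_lhs => rw [hA (ξ x), hB (η x)]
    simp only [map_sum, map_smul, LinearMap.sum_apply, LinearMap.smul_apply, smul_eq_mul, Finset.mul_sum]
    rw [Finset.sum_comm]
    exact Finset.sum_congr rfl fun i _ => Finset.sum_congr rfl fun j _ => by ring
  refine ContMDiffAt.congr_of_eventuallyEq ?_ h1
  refine ContMDiffAt.sum fun i _ => ContMDiffAt.sum fun j _ => ContMDiffAt.mul ?_ (ContMDiffAt.mul ?_ ?_)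
  · exact ((frA.smooth_coef i).contMDiffAt.comp x₀ hξ :)
  · exact ((frB.smooth_coef j).contMDiffAt.comp x₀ hη :)
  · exact (hℓ (frA.sec i) (frB.sec j)).contMDiffAt.comp x₀ hf

theorem BilinMap.contMDiffAt (Φ : BilinMap A B C) (hf : ContMDiffAt IX I ∞ f x₀)
    (hξ : ContMDiffAt IX A.IT ∞ (fun x => (⟨f x, ξ x⟩ : A.Tot)) x₀)
    (hη : ContMDiffAt IX B.IT ∞ (fun x => (⟨f x, η x⟩ : B.Tot)) x₀) :
    ContMDiffAt IX C.IT ∞ (fun x => (⟨f x, Φ.fib (f x) (ξ x) (η x)⟩ : C.Tot)) x₀ :=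
  VB.contMDiffAt_of_linearFun hf fun ψ hψ =>
    VB.contMDiffAt_bilinear (fun m => (Φ.fib m).compr₂ (ψ m))
      (fun a b => C.contMDiff_linearFun_sec hψ (Φ.onSec a b)) hf hξ hη

end BilinearSmoothness

/-! ### The anchor defined by a connection and a bundle map -/

section RepresentationAnchor

variable {E : Type*} [NormedAddCommGroup E] [NormedSpace ℝ E] {H : Type*} [TopologicalSpace H]
  {I : ModelWithCorners ℝ E H} {M : Type*} [TopologicalSpace M] [ChartedSpace H M]
  [FiniteDimensional ℝ E] [T2Space M] [IsManifold I ∞ M] {A B C : VB.{u} I M}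

omit [FiniteDimensional ℝ E] [T2Space M] [IsManifold I ∞ M] in
theorem DVB.contMDiff_components : ContMDiff (DVB.trivial A B C).overB.IT B.IT ∞
      (fun v : (DVB.trivial A B C).overB.Tot => v.proj) ∧
    ContMDiff (DVB.trivial A B C).overB.IT A.IT ∞
      (fun v : (DVB.trivial A B C).overB.Tot => (⟨v.proj.proj, DVB.vecA v.proj v.2⟩ : A.Tot)) ∧
    ContMDiff (DVB.trivial A B C).overB.IT C.IT ∞
      (fun v : (DVB.trivial A B C).overB.Tot => (⟨v.proj.proj, DVB.vecC v.proj v.2⟩ : C.Tot)) :=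
  (DVB.contMDiff_trivialOver_iff (A := A) (B := B) (C := C) (IX := (DVB.trivialOver B A C).IT)
    (fun v : (DVB.trivialOver B A C).Tot => v)).1 contMDiff_id

/-- Tangent vectors of the total space with given horizontal and vertical parts. -/
theorem VB.exists_tangent (β : B.Sec) {b : B.Tot} (hb : β b.proj = b.2) (v : TangentSpace I b.proj)
    (y : B.fib b.proj) : ∃ w : TangentSpace B.IT b,
      (∀ g, ContMDiff I 𝓘(ℝ) ∞ g → dirDeriv B.IT (fun x : B.Tot => g x.proj) w = dirDeriv I g v) ∧
      ∀ ψ : ∀ m, B.fib m →ₗ[ℝ] ℝ, ContMDiff B.IT 𝓘(ℝ) ∞ (B.linearFun ψ) →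
        dirDeriv B.IT (B.linearFun ψ) w = dirDeriv I (fun m => ψ m (β m)) v + ψ b.proj y := by
  obtain ⟨m, b⟩ := b
  obtain rfl : β m = b := hb
  -- The desired vector is the sum of the image of v under the tangent map of β and the velocity at
  -- t = 0 of this vertical curve.
  let c : ℝ → B.Tot := fun t => ⟨m, β m + t • y⟩
  have hcst : ∀ z : B.fib m, ContMDiff 𝓘(ℝ) B.IT ∞ (fun _ : ℝ => (⟨m, z⟩ : B.Tot)) := fun z => contMDiff_const
  have hc : ContMDiff 𝓘(ℝ) B.IT ∞ c := fun t => VB.contMDiffAt_add (f := fun _ : ℝ => m) (hcst (β m) t)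
    (VB.contMDiffAt_smul contMDiffAt_id (hcst y t))
  let w₁ : TangentSpace B.IT (⟨m, β m⟩ : B.Tot) := mfderiv I B.IT (fun x => (⟨x, β x⟩ : B.Tot)) m v
  have hc0 : c 0 = ⟨m, β m⟩ := by simp [c]
  have key : ∃ w₂ : TangentSpace B.IT (⟨m, β m⟩ : B.Tot), ∀ f : B.Tot → ℝ, ContMDiff B.IT 𝓘(ℝ) ∞ f →
      dirDeriv B.IT f w₂ = deriv (fun t => f (c t)) 0 := by
    rw [← hc0]
    refine ⟨mfderiv 𝓘(ℝ) B.IT c 0 (1 : ℝ), fun f hf => ?_⟩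
    refine (dirDeriv_comp (hf.mdiffAt _) (hc.mdiffAt 0) (1 : ℝ)).symm.trans ?_
    unfold dirDeriv
    rw [mfderiv_eq_fderiv]
    rfl
  obtain ⟨w₂, hw₂⟩ := key
  refine ⟨w₁ + w₂, fun g hg => ?_, fun ψ hψ => ?_⟩
  · rw [dirDeriv_add_vec, hw₂ _ (B.contMDiff_comp_proj hg), ← dirDeriv_comp
      ((B.contMDiff_comp_proj hg).mdiffAt _) (β.contMDiff.mdiffAt m)]
    simp [c]
  · rw [dirDeriv_add_vec, hw₂ _ hψ, ← dirDeriv_comp (hψ.mdiffAt _) (β.contMDiff.mdiffAt m)]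
    congr 1
    have : (fun t => B.linearFun ψ (c t)) = fun t => ψ m (β m) + t * ψ m y := by
      funext t
      simp [c, VB.linearFun]
    rw [this]
    simp

variable {LA : LieAlgebroid A}

/-- The dual connection, evaluated on a linear function. -/
theorem LieAlgebroid.IsConnection.exists_dual {D : A.Sec → B.Sec → B.Sec} (hD : LA.IsConnection D)
    {ψ : ∀ m, B.fib m →ₗ[ℝ] ℝ} (hψ : ContMDiff B.IT 𝓘(ℝ) ∞ (B.linearFun ψ)) :
    ∃ ℓ : ∀ m, A.fib m →ₗ[ℝ] B.fib m →ₗ[ℝ] ℝ, ∀ (a : A.Sec) (β : B.Sec) m,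
      LA.deriv a (fun x => ψ x (β x)) m - ψ m (D a β m) = ℓ m (a m) (β m) := by
  have hs := fun β : B.Sec => B.contMDiff_linearFun_sec hψ β
  have : ∀ m, ∃ ℓ : A.fib m →ₗ[ℝ] B.fib m →ₗ[ℝ] ℝ, ∀ (a : A.Sec) (β : B.Sec),
      LA.deriv a (fun x => ψ x (β x)) m - ψ m (D a β m) = ℓ (a m) (β m) := by
    intro m
    refine VB.exists_bilinear_of_tensorial A B m _ (fun a a' β => ?_) (fun g hg a β => ?_) (fun a β β' => ?_)
      fun g hg a β => ?_
    · have e : LA.deriv (a + a') (fun x => ψ x (β x)) m = _ := LA.toSkew.deriv_add_section a a' _ m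
      rw [e, hD.add_left, ContMDiffSection.coe_add, Pi.add_apply, map_add]
      exact add_sub_add_comm _ _ _ _
    · have e : LA.deriv (A.smulSec g hg a) (fun x => ψ x (β x)) m = _ := LA.toSkew.deriv_smulSec hg a _ m
      rw [e, hD.smul_left a _ g β hg fun x => rfl, _root_.map_smul]
      exact (mul_sub _ _ _).symm
    · have e : LA.deriv a (fun x => ψ x ((β + β') x)) m = LA.deriv a (fun x => ψ x (β x)) m +
          LA.deriv a (fun x => ψ x (β' x)) m := by
        refine Eq.trans ?_ (dirDeriv_add ((hs β).mdiffAt m) ((hs β').mdiffAt m) _)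
        exact congrArg (fun f => LA.deriv a f m) (funext fun x => map_add _ _ _)
      rw [e, hD.add_right, ContMDiffSection.coe_add, Pi.add_apply, map_add]
      exact add_sub_add_comm _ _ _ _
    · have e : LA.deriv a (fun x => ψ x (B.smulSec g hg β x)) m = g m * LA.deriv a (fun x => ψ x (β x)) m +
          ψ m (β m) * LA.deriv a g m := by
        refine Eq.trans ?_ (dirDeriv_mul (hg.mdiffAt m) ((hs β).mdiffAt m) _)
        exact congrArg (fun f => LA.deriv a f m) (funext fun x => _root_.map_smul _ _ _)
      rw [e, hD.leibniz a β _ g hg fun x => rfl, map_add, _root_.map_smul, _root_.map_smul]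
      simp only [smul_eq_mul]
      ring
  choose ℓ hℓ using this
  exact ⟨ℓ, fun a β m => hℓ m a β⟩

/-- The anchor defined by a connection on `B` and a bundle map `C → B`. -/
theorem LieAlgebroid.IsConnection.exists_anchor {D : A.Sec → B.Sec → B.Sec} (hD : LA.IsConnection D)
    (bd : BundleMap C B) :
    ∃ ρ : ∀ b, (DVB.trivial A B C).overB.fib b →ₗ[ℝ] TangentSpace B.IT b,
      ContMDiff (DVB.trivial A B C).overB.IT B.IT.tangent ∞ (fun v : (DVB.trivial A B C).overB.Tot =>
        (⟨v.proj, ρ v.proj v.2⟩ : TangentBundle B.IT B.Tot)) ∧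
      (∀ g, ContMDiff I 𝓘(ℝ) ∞ g → ∀ b v, dirDeriv B.IT (fun x : B.Tot => g x.proj) (ρ b v) =
        dirDeriv I g (LA.anchor b.proj (DVB.vecA b v))) ∧
      ∀ ψ : ∀ m, B.fib m →ₗ[ℝ] ℝ, ContMDiff B.IT 𝓘(ℝ) ∞ (B.linearFun ψ) →
        ∀ (a : A.Sec) (β : B.Sec) (b : B.Tot) (c : C.fib b.proj), β b.proj = b.2 →
          dirDeriv B.IT (B.linearFun ψ) (ρ b (DVB.vec (a b.proj) c)) =
            LA.deriv a (fun x => ψ x (β x)) b.proj - ψ b.proj (D a β b.proj) + ψ b.proj (bd.fib b.proj c) := by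
  choose ℓ hℓ using fun (ψ : ∀ m, B.fib m →ₗ[ℝ] ℝ) (hψ : ContMDiff B.IT 𝓘(ℝ) ∞ (B.linearFun ψ)) =>
    hD.exists_dual hψ
  -- The requirements on w involve only the vector v and the bilinear forms ℓ, and not the sections
  -- used to construct w. By `VB.tangent_ext` they determine w, whence the linearity of the anchor.
  have ex : ∀ (b : B.Tot) (v : (DVB.trivial A B C).overB.fib b), ∃ w : TangentSpace B.IT b,
      (∀ g, ContMDiff I 𝓘(ℝ) ∞ g → dirDeriv B.IT (fun x : B.Tot => g x.proj) w =
        dirDeriv I g (LA.anchor b.proj (DVB.vecA b v))) ∧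
      ∀ ψ (hψ : ContMDiff B.IT 𝓘(ℝ) ∞ (B.linearFun ψ)), dirDeriv B.IT (B.linearFun ψ) w =
        ℓ ψ hψ b.proj (DVB.vecA b v) b.2 + ψ b.proj (bd.fib b.proj (DVB.vecC b v)) := by
    intro b v
    let a := A.secThrough (DVB.vecA b v)
    let β := B.secThrough b.2
    have hb : β b.proj = b.2 := B.secThrough_self _
    have ha : a b.proj = DVB.vecA b v := A.secThrough_self _
    obtain ⟨w, h0, h1⟩ := VB.exists_tangent β hb (LA.anchor b.proj (DVB.vecA b v))
      (bd.fib b.proj (DVB.vecC b v) - D a β b.proj)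
    refine ⟨w, h0, fun ψ hψ => ?_⟩
    rw [h1 ψ hψ, ← ha, ← hb, ← hℓ ψ hψ a β b.proj, map_sub]
    unfold LieAlgebroid.deriv
    ring
  choose ρ h0 h1 using ex
  refine ⟨fun b => ⟨⟨ρ b, fun v w => ?_⟩, fun r v => ?_⟩, ?_, fun g hg b v => h0 b v g hg,
    fun ψ hψ a β b c hb => ?_⟩
  · refine VB.tangent_ext B (fun g hg => ?_) fun ψ hψ => ?_
    · rw [dirDeriv_add_vec, h0 _ _ g hg, h0 _ _ g hg, h0 _ _ g hg, map_add, map_add, dirDeriv_add_vec]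
    · rw [dirDeriv_add_vec, h1 _ _ ψ hψ, h1 _ _ ψ hψ, h1 _ _ ψ hψ]
      simp only [map_add, LinearMap.add_apply]
      ring
  · refine VB.tangent_ext B (fun g hg => ?_) fun ψ hψ => ?_
    · rw [RingHom.id_apply, dirDeriv_smul_vec, h0 _ _ g hg, h0 _ _ g hg, _root_.map_smul, _root_.map_smul, dirDeriv_smul_vec]
    · rw [RingHom.id_apply, dirDeriv_smul_vec, h1 _ _ ψ hψ, h1 _ _ ψ hψ]
      simp only [_root_.map_smul, LinearMap.smul_apply, smul_eq_mul]
      ring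
  · have hX := DVB.contMDiff_components (A := A) (B := B) (C := C)
    have hm : ContMDiff (DVB.trivial A B C).overB.IT I ∞
        (fun v : (DVB.trivial A B C).overB.Tot => v.proj.proj) := B.projMap.contMDiff.comp hX.1
    refine VB.contMDiff_tangent B hX.1 (fun g hg => ?_) fun ψ hψ => ?_
    · refine ContMDiff.congr ?_ fun v => h0 v.proj v.2 g hg
      exact contMDiff_dirDeriv hg (f := fun v : (DVB.trivial A B C).overB.Tot => v.proj.proj)
        (LA.anchor_smooth.comp hX.2.1 :)
    · refine ContMDiff.congr ?_ fun v => h1 v.proj v.2 ψ hψ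
      refine ContMDiff.add (fun v => VB.contMDiffAt_bilinear (ℓ ψ hψ) (fun a β => ?_) (hm v) (hX.2.1 v) (hX.1 v))
        (hψ.comp (bd.smooth.comp hX.2.2))
      refine ContMDiff.congr ?_ fun m => (hℓ ψ hψ a β m).symm
      exact (LA.toSkew.contMDiff_deriv a (B.contMDiff_linearFun_sec hψ β)).sub
        (B.contMDiff_linearFun_sec hψ (D a β))
  · refine (h1 b _ ψ hψ).trans ?_
    rw [hℓ ψ hψ a β b.proj, hb]
    rfl

end RepresentationAnchor

/-! ### The skew algebroid defined by a representation -/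

section RepresentationAlgebroid

variable {E : Type*} [NormedAddCommGroup E] [NormedSpace ℝ E] {H : Type*} [TopologicalSpace H]
  {I : ModelWithCorners ℝ E H} {M : Type*} [TopologicalSpace M] [ChartedSpace H M]
  [FiniteDimensional ℝ E] [T2Space M] [IsManifold I ∞ M] {A B C : VB.{u} I M}

variable (A B C) in
/-- The section `h(a) + ĉ` of the trivial double vector bundle. -/
def DVB.genSec : A.Sec × C.Sec →ₗ[ℝ] (DVB.trivial A B C).overB.Sec where
  toFun s := DVB.liftSec A B C s.1 + DVB.coreSec A B s.2
  map_add' s t := by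
    rw [Prod.fst_add, Prod.snd_add, DVB.liftSec_add, DVB.coreSec_add]
    abel
  map_smul' r s := by
    rw [Prod.smul_fst, Prod.smul_snd, DVB.liftSec_smul, DVB.coreSec_smul, RingHom.id_apply, smul_add]

omit [FiniteDimensional ℝ E] [T2Space M] [IsManifold I ∞ M] in
theorem DVB.genSec_apply (s : A.Sec × C.Sec) (b : B.Tot) :
    DVB.genSec A B C s b = DVB.vec (s.1 b.proj) (s.2 b.proj) :=
  congrArg₂ DVB.vec (add_zero _) (zero_add _)

omit [FiniteDimensional ℝ E] [T2Space M] [IsManifold I ∞ M] in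
theorem DVB.genSec_lift (a : A.Sec) : DVB.genSec A B C (a, 0) = DVB.liftSec A B C a := by
  ext b
  rw [DVB.genSec_apply]
  rfl

omit [FiniteDimensional ℝ E] [T2Space M] [IsManifold I ∞ M] in
theorem DVB.genSec_core (c : C.Sec) : DVB.genSec A B C (0, c) = DVB.coreSec A B c := by
  ext b
  rw [DVB.genSec_apply]
  rfl

theorem DVB.exists_local_genSec (X : (DVB.trivial A B C).overB.Sec) (b₀ : B.Tot) :
    ∃ (ι : Type) (_ : Fintype ι) (s : ι → A.Sec × C.Sec) (f : ι → B.Tot → ℝ)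
      (hf : ∀ i, ContMDiff B.IT 𝓘(ℝ) ∞ (f i)), ∀ᶠ b in 𝓝 b₀, X b =
        (∑ i, (DVB.trivial A B C).overB.smulSec (f i) (hf i) (DVB.genSec A B C (s i))) b := by
  let fA := A.frame b₀.proj
  let fC := C.frame b₀.proj
  obtain ⟨-, h1, h2⟩ := DVB.contMDiff_components (A := A) (B := B) (C := C)
  refine ⟨Fin fA.n ⊕ Fin fC.n, inferInstance, Sum.elim (fun i => (fA.sec i, 0)) (fun j => (0, fC.sec j)),
    Sum.elim (fun i b => fA.coef i b.proj (DVB.vecA b (X b))) (fun j b => fC.coef j b.proj (DVB.vecC b (X b))),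
    ?_, ?_⟩
  · rintro (i | j)
    · exact ((fA.smooth_coef i).comp (h1.comp X.contMDiff) :)
    · exact ((fC.smooth_coef j).comp (h2.comp X.contMDiff) :)
  · have hq : Tendsto (TotalSpace.proj : B.Tot → M) (𝓝 b₀) (𝓝 b₀.proj) :=
      (FiberBundle.continuous_proj B.F B.fib).continuousAt
    filter_upwards [hq fA.eventually_sum, hq fC.eventually_sum] with b hA hC
    rw [VB.sum_apply, Fintype.sum_sum_type]
    simp only [Sum.elim_inl, Sum.elim_inr, VB.smulSec_apply, DVB.genSec_lift, DVB.genSec_core]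
    refine DVB.vec_ext ?_ ?_
    · rw [map_add, map_sum, map_sum, Finset.sum_eq_zero (s := (Finset.univ : Finset (Fin fC.n))), add_zero]
      · exact (hA _).trans (Finset.sum_congr rfl fun i _ => rfl)
      · intro j _
        exact smul_zero (A := A.fib b.proj) (fC.coef j b.proj (DVB.vecC b (X b)))
    · rw [map_add, map_sum, map_sum, Finset.sum_eq_zero (s := (Finset.univ : Finset (Fin fA.n))), zero_add]
      · exact (hC _).trans (Finset.sum_congr rfl fun i _ => rfl)
      · intro j _
        exact smul_zero (A := C.fib b.proj) (fA.coef j b.proj (DVB.vecA b (X b)))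

variable {LA : LieAlgebroid A} {V : StructureOperators A B C}

theorem LieAlgebroid.IsConnection.smul_const_left {D : A.Sec → B.Sec → B.Sec}
    (h : LA.IsConnection D) (r : ℝ) (a : A.Sec) (β : B.Sec) : D (r • a) β = r • D a β := by
  ext x
  exact h.smul_left a (r • a) (fun _ => r) β contMDiff_const (fun _ => rfl) x

theorem LieAlgebroid.IsConnection.map_zero_left {D : A.Sec → B.Sec → B.Sec}
    (h : LA.IsConnection D) (β : B.Sec) : D 0 β = 0 := by
  simpa using h.smul_const_left 0 0 β

/-- The bracket of the sections `h(a) + ĉ` prescribed by structure operators. -/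
def StructureOperators.genBracket (LA : LieAlgebroid A) (V : StructureOperators A B C) (s t : A.Sec × C.Sec) :
    (DVB.trivial A B C).overB.Sec :=
  DVB.liftSec A B C (LA.bracket s.1 t.1) + DVB.homSec A (V.K.hom s.1 t.1) +
    DVB.coreSec A B (V.nabla₀ s.1 t.2 - V.nabla₀ t.1 s.2)

theorem StructureOperators.genBracket_apply (s t : A.Sec × C.Sec) (b : B.Tot) :
    V.genBracket LA s t b = DVB.vec (LA.bracket s.1 t.1 b.proj)
      (V.K.fib b.proj (s.1 b.proj) (t.1 b.proj) b.2 +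
        (V.nabla₀ s.1 t.2 b.proj - V.nabla₀ t.1 s.2 b.proj)) := by
  refine DVB.vec_ext ?_ ?_
  · change LA.bracket s.1 t.1 b.proj + 0 + 0 = LA.bracket s.1 t.1 b.proj
    rw [add_zero, add_zero]
  · change 0 + V.K.fib b.proj (s.1 b.proj) (t.1 b.proj) b.2 + _ = _
    rw [zero_add]
    rfl

namespace StructureOperators.IsRepresentation

variable (h : V.IsRepresentation LA)

include h

/-- The bracket on generating sections is bilinear. -/
theorem exists_genBracket : ∃ β : A.Sec × C.Sec →ₗ[ℝ] A.Sec × C.Sec →ₗ[ℝ] (DVB.trivial A B C).overB.Sec,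
    ∀ s t, β s t = V.genBracket LA s t := by
  have h₀ := h.connection₀
  refine ⟨LinearMap.mk₂ ℝ (V.genBracket LA) ?_ ?_ ?_ ?_, fun s t => rfl⟩
  · intro s s' t
    ext b
    rw [ContMDiffSection.coe_add, Pi.add_apply, genBracket_apply, genBracket_apply, genBracket_apply,
      DVB.vec_add_vec]
    refine congrArg₂ DVB.vec ?_ ?_ <;>
    simp only [Prod.fst_add, Prod.snd_add, map_add, LinearMap.add_apply, ContMDiffSection.coe_add, Pi.add_apply,
      h₀.add_left, h₀.add_right]
    abel
  · intro r s t
    ext b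
    rw [ContMDiffSection.coe_smul, Pi.smul_apply, genBracket_apply, genBracket_apply, DVB.smul_vec]
    refine congrArg₂ DVB.vec ?_ ?_ <;>
    simp only [Prod.smul_fst, Prod.smul_snd, map_smul, LinearMap.smul_apply, ContMDiffSection.coe_smul,
      Pi.smul_apply, h₀.map_smul, h₀.smul_const_left, smul_add, smul_sub]
  · intro s t t'
    ext b
    rw [ContMDiffSection.coe_add, Pi.add_apply, genBracket_apply, genBracket_apply, genBracket_apply,
      DVB.vec_add_vec]
    refine congrArg₂ DVB.vec ?_ ?_ <;>
    simp only [Prod.fst_add, Prod.snd_add, map_add, LinearMap.add_apply, ContMDiffSection.coe_add, Pi.add_apply,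
      h₀.add_left, h₀.add_right]
    abel
  · intro r s t
    ext b
    rw [ContMDiffSection.coe_smul, Pi.smul_apply, genBracket_apply, genBracket_apply, DVB.smul_vec]
    refine congrArg₂ DVB.vec ?_ ?_ <;>
    simp only [Prod.smul_fst, Prod.smul_snd, map_smul, LinearMap.smul_apply, ContMDiffSection.coe_smul,
      Pi.smul_apply, h₀.map_smul, h₀.smul_const_left, smul_add, smul_sub]

/-- The bracket with a generating section that vanishes at a point. -/
theorem genBracket_eq_sderiv {ρ : ∀ b, (DVB.trivial A B C).overB.fib b →ₗ[ℝ] TangentSpace B.IT b}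
    (hρ : ∀ g, ContMDiff I 𝓘(ℝ) ∞ g → ∀ b v, dirDeriv B.IT (fun x : B.Tot => g x.proj) (ρ b v) =
      dirDeriv I g (LA.anchor b.proj (DVB.vecA b v)))
    (s t : A.Sec × C.Sec) (b : B.Tot) (ht : DVB.genSec A B C t b = 0) :
    V.genBracket LA s t b = (DVB.trivial A B C).overB.sderiv (DVB.genSec A B C t) b
      (ρ b (DVB.genSec A B C s b)) := by
  obtain ⟨β, hβ⟩ := h.exists_genBracket
  let w := ρ b (DVB.genSec A B C s b)
  have hw : ∀ g, ContMDiff I 𝓘(ℝ) ∞ g → dirDeriv B.IT (fun x : B.Tot => g x.proj) w = LA.deriv s.1 g b.proj := by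
    intro g hg
    rw [hρ g hg, DVB.genSec_apply]
    rfl
  -- The claim is T t = 0. T is additive and C^∞(M)-linear in each component of t, since the anchor
  -- term of the bracket cancels that of `sderiv`; so it vanishes when both components vanish at
  -- b.proj.
  let T : A.Sec × C.Sec → (DVB.trivial A B C).overB.fib b := fun t =>
    β s t b - (DVB.trivial A B C).overB.sderiv (DVB.genSec A B C t) b w
  have T_add : ∀ t t', T (t + t') = T t + T t' := by
    intro t t'
    have e : (DVB.trivial A B C).overB.sderiv (DVB.genSec A B C (t + t')) b w =
        (DVB.trivial A B C).overB.sderiv (DVB.genSec A B C t) b w +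
        (DVB.trivial A B C).overB.sderiv (DVB.genSec A B C t') b w := by
      rw [map_add]
      exact VB.pderiv_add (DVB.genSec A B C t).contMDiff.contMDiffAt
        (DVB.genSec A B C t').contMDiff.contMDiffAt w
    simp only [T]
    rw [e, map_add, ContMDiffSection.coe_add, Pi.add_apply]
    abel
  have T_smul : ∀ (t t' : A.Sec × C.Sec) (g : M → ℝ) (hg : ContMDiff I 𝓘(ℝ) ∞ g),
      DVB.genSec A B C t' = (DVB.trivial A B C).overB.smulSec (fun b => g b.proj) (B.contMDiff_comp_proj hg)
        (DVB.genSec A B C t) →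
      V.genBracket LA s t' b = g b.proj • V.genBracket LA s t b + LA.deriv s.1 g b.proj • DVB.genSec A B C t b →
      T t' = g b.proj • T t := by
    intro t t' g hg h1 h2
    have e : (DVB.trivial A B C).overB.sderiv (DVB.genSec A B C t') b w = _ :=
      (congrArg (fun X : (DVB.trivial A B C).overB.Sec => (DVB.trivial A B C).overB.sderiv X b w) h1).trans
        (VB.pderiv_smul (B.contMDiff_comp_proj hg).contMDiffAt (DVB.genSec A B C t).contMDiff.contMDiffAt w)
    simp only [T]
    rw [e, hβ, hβ, h2, hw g hg, smul_sub]
    abel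
  have hA : T (t.1, 0) = 0 := by
    refine A.tensorial_eq_zero b.proj (fun a => T (a, 0)) (fun a a' => ?_) (fun g hg a => ?_)
      (s := t.1) ?_
    · rw [← T_add]
      simp
    · refine T_smul _ _ g hg ?_ ?_
      · rw [DVB.genSec_lift, DVB.genSec_lift, DVB.liftSec_smulSec]
      · have e1 : LA.bracket s.1 (A.smulSec g hg a) b.proj = _ := LA.toSkew.bracket_smulSec s.1 a g hg b.proj
        rw [genBracket_apply, genBracket_apply, DVB.genSec_apply]
        refine DVB.vec_ext ?_ ?_
        · exact e1
        · have e2 := h.connection₀.smul_left a (A.smulSec g hg a) g s.2 hg (fun x => rfl) b.proj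
          simp only [map_add, map_smul, DVB.vecC_vec, h.connection₀.map_zero,
            VB.smulSec_apply, LinearMap.smul_apply, ContMDiffSection.coe_zero, Pi.zero_apply, smul_zero, zero_sub,
            add_zero, e2]
          rw [smul_add, smul_neg]
    · rw [DVB.genSec_apply] at ht
      exact congrArg (DVB.vecA b) ht
  have hC : T (0, t.2) = 0 := by
    refine C.tensorial_eq_zero b.proj (fun c => T (0, c)) (fun a a' => ?_) (fun g hg c => ?_)
      (s := t.2) ?_
    · rw [← T_add]
      simp
    · refine T_smul _ _ g hg ?_ ?_
      · rw [DVB.genSec_core, DVB.genSec_core, DVB.coreSec_smulSec]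
      · rw [genBracket_apply, genBracket_apply, DVB.genSec_apply]
        refine DVB.vec_ext ?_ ?_
        · simp only [map_zero, map_add, map_smul, DVB.vecA_vec, ContMDiffSection.coe_zero, Pi.zero_apply,
            smul_zero, add_zero]
        · have e2 := h.connection₀.leibniz s.1 c (C.smulSec g hg c) g hg (fun x => rfl) b.proj
          simp only [map_add, map_smul, DVB.vecC_vec, h.connection₀.map_zero_left,
            ContMDiffSection.coe_zero, Pi.zero_apply, map_zero, LinearMap.zero_apply, zero_add, sub_zero,
            e2]
    · rw [DVB.genSec_apply] at ht
      exact congrArg (DVB.vecC b) ht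
  have e := T_add (t.1, 0) (0, t.2)
  rw [hA, hC, Prod.mk_add_mk, add_zero, zero_add, add_zero] at e
  rw [← hβ]
  exact sub_eq_zero.1 e

/-- The lemma `genBracket_eq_sderiv` is the consistency condition that
`VB.exists_skewAlgebroid_of_generators` requires. The Jacobi identity is left for later, because its
proof computes with the extended bracket. -/
theorem exists_skewAlgebroid : ∃ L : SkewAlgebroid (DVB.trivial A B C).overB, L.IsAssociated LA V := by
  obtain ⟨ρ, hρ, h0, h1⟩ := h.connection₁.exists_anchor V.bd
  obtain ⟨β, hβ⟩ := h.exists_genBracket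
  have h₀ := h.connection₀
  obtain ⟨L, hL, hb⟩ := VB.exists_skewAlgebroid_of_generators (DVB.genSec A B C) ρ hρ β (fun s => by
      ext b
      rw [hβ, genBracket_apply, LA.bracket_self, h.K_self, sub_self, zero_add]
      rfl)
    DVB.exists_local_genSec (fun s t b ht => by rw [hβ]; exact h.genBracket_eq_sderiv h0 s t b ht)
  subst hL
  refine ⟨L, fun a g hg b => ?_, fun a ψ hψ β m => ?_, fun c g hg b => ?_, fun c ψ hψ b => ?_, fun c c' => ?_,
    fun a c => ?_, fun a a' b => ?_⟩
  · exact h0 g hg b _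
  · refine (h1 ψ hψ a β ⟨m, β m⟩ 0 rfl).trans ?_
    rw [map_zero, map_zero, add_zero]
  · refine (h0 g hg b _).trans ?_
    rw [DVB.coreSec_apply, DVB.vecA_vec, map_zero]
    exact map_zero (mfderiv I 𝓘(ℝ) g b.proj)
  · have e := h1 ψ hψ 0 (B.secThrough b.2) b (c b.proj) (B.secThrough_self _)
    refine e.trans ?_
    rw [h.connection₁.map_zero_left]
    have e2 : LA.deriv 0 (fun x => ψ x (B.secThrough b.2 x)) b.proj = 0 := by
      unfold LieAlgebroid.deriv
      rw [ContMDiffSection.coe_zero, Pi.zero_apply, map_zero]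
      exact map_zero (mfderiv I 𝓘(ℝ) _ b.proj)
    rw [e2, ContMDiffSection.coe_zero, Pi.zero_apply, map_zero, sub_zero, zero_add]
  · rw [← DVB.genSec_core, ← DVB.genSec_core, hb, hβ]
    ext b
    rw [genBracket_apply]
    simp only [map_zero, LinearMap.zero_apply, ContMDiffSection.coe_zero, Pi.zero_apply, h₀.map_zero_left,
      sub_zero, add_zero]
    rfl
  · rw [← DVB.genSec_lift, ← DVB.genSec_core, hb, hβ]
    ext b
    rw [genBracket_apply]
    simp only [map_zero, LinearMap.zero_apply, ContMDiffSection.coe_zero, Pi.zero_apply, h₀.map_zero_left,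
      sub_zero, zero_add]
    rfl
  · rw [← DVB.genSec_lift, ← DVB.genSec_lift, hb, hβ, genBracket_apply]
    simp only [ContMDiffSection.coe_zero, Pi.zero_apply, h₀.map_zero, sub_zero, add_zero]

end StructureOperators.IsRepresentation

end RepresentationAlgebroid

/-! ### The Jacobi identity for the bracket of a representation -/

section RepresentationVBAlgebroid

variable {E : Type*} [NormedAddCommGroup E] [NormedSpace ℝ E] {H : Type*} [TopologicalSpace H]
  {I : ModelWithCorners ℝ E H} {M : Type*} [TopologicalSpace M] [ChartedSpace H M]
  [FiniteDimensional ℝ E] [T2Space M] [IsManifold I ∞ M] {A B C : VB.{u} I M}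

/-- On the total space of a vector bundle, an anchor preserves the bracket of two sections if it does so on
functions pulled back from the base and on linear functions. -/
theorem SkewAlgebroid.anchorDefect_eq_zero [I.Boundaryless] {V : VB.{u} B.IT B.Tot} (L : SkewAlgebroid V)
    {X Y : V.Sec} {b : B.Tot}
    (h₀ : ∀ g : M → ℝ, ContMDiff I 𝓘(ℝ) ∞ g → L.anchorDefect X Y (fun x => g x.proj) b = 0)
    (h₁ : ∀ ψ : ∀ m, B.fib m →ₗ[ℝ] ℝ, ContMDiff B.IT 𝓘(ℝ) ∞ (B.linearFun ψ) →
      L.anchorDefect X Y (B.linearFun ψ) b = 0) {f : B.Tot → ℝ} (hf : ContMDiff B.IT 𝓘(ℝ) ∞ f) :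
    L.anchorDefect X Y f b = 0 := by
  -- The commutator of the two anchors is a tangent vector w. The defect is then the derivative
  -- along the difference of the anchor of the bracket and w, and two kinds of functions suffice to
  -- show that this difference is zero.
  obtain ⟨w, hw⟩ := exists_dirDeriv_commutator (L.anchor_smooth.comp X.contMDiff) (L.anchor_smooth.comp Y.contMDiff) b
  have e : ∀ f, ContMDiff B.IT 𝓘(ℝ) ∞ f →
      (L.anchorDefect X Y f b = 0 ↔ dirDeriv B.IT f (L.anchor b (L.bracket X Y b)) = dirDeriv B.IT f w) :=
    fun f hf => by
      rw [← hw f hf]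
      exact sub_eq_zero
  refine (e f hf).2 (congrArg (dirDeriv B.IT f) ?_)
  exact B.tangent_ext (fun g hg => (e _ (B.contMDiff_comp_proj hg)).1 (h₀ g hg)) (fun ψ hψ => (e _ hψ).1 (h₁ ψ hψ))

/-- The value of X is known only through sections β of B, by a formula T that may differentiate β.
Linearity of T over ℝ nevertheless gives linearity of X on the fibres. -/
theorem DVB.exists_eq_homSec (X : (DVB.trivial A B C).overB.Sec) (hA : ∀ b, DVB.vecA b (X b) = 0)
    (T : B.Sec → C.Sec) (hT : ∀ β m, DVB.vecC ⟨m, β m⟩ (X ⟨m, β m⟩) = T β m)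
    (hadd : ∀ β β', T (β + β') = T β + T β') (hsmul : ∀ (r : ℝ) β, T (r • β) = r • T β) :
    ∃ k, X = DVB.homSec A k := by
  have hX := (DVB.contMDiff_trivialOver_iff (A := A) (B := B) (C := C) _).1 X.contMDiff
  refine ⟨⟨fun m =>
    { toFun := fun b => DVB.vecC ⟨m, b⟩ (X ⟨m, b⟩)
      map_add' := fun b b' => ?_
      map_smul' := fun r b => ?_ }, hX.2.2⟩, ?_⟩
  · have e := hT (B.secThrough b + B.secThrough b') m
    have e1 := hT (B.secThrough b) m
    have e2 := hT (B.secThrough b') m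
    rw [hadd, ContMDiffSection.coe_add, ContMDiffSection.coe_add, Pi.add_apply, Pi.add_apply, ← e1, ← e2,
      VB.secThrough_self, VB.secThrough_self] at e
    exact e
  · have e := hT (r • B.secThrough b) m
    have e1 := hT (B.secThrough b) m
    rw [hsmul, ContMDiffSection.coe_smul, ContMDiffSection.coe_smul, Pi.smul_apply, Pi.smul_apply, ← e1,
      VB.secThrough_self] at e
    exact e
  · ext b
    exact DVB.vec_ext (hA b) rfl

variable {LA : LieAlgebroid A} {V : StructureOperators A B C} {L : SkewAlgebroid (DVB.trivial A B C).overB}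

namespace SkewAlgebroid.IsAssociated

variable (h : L.IsAssociated LA V)

include h

theorem bracket_hom_core (c : C.Sec) (k : BundleMap B C) :
    L.bracket (DVB.homSec A k) (DVB.coreSec A B c) = -DVB.coreSec A B (k.onSec (V.bd.onSec c)) := by
  rw [L.bracket_skew]
  congr 1
  ext b
  exact h.bracket_core_hom c k b

theorem deriv_core_pullback_fun (c : C.Sec) {g : M → ℝ} (hg : ContMDiff I 𝓘(ℝ) ∞ g) :
    L.deriv (DVB.coreSec A B c) (fun x => g x.proj) = fun _ => 0 :=
  funext fun b => h.anchor_core_pullback c g hg b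

theorem deriv_lift_pullback_fun (a : A.Sec) {g : M → ℝ} (hg : ContMDiff I 𝓘(ℝ) ∞ g) :
    L.deriv (DVB.liftSec A B C a) (fun x => g x.proj) = fun x => LA.deriv a g x.proj :=
  funext fun b => h.anchor_lift_pullback a g hg b

theorem anchorDefect_core_core (c c' : C.Sec) {b : B.Tot} [I.Boundaryless] {f : B.Tot → ℝ}
    (hf : ContMDiff B.IT 𝓘(ℝ) ∞ f) :
    L.anchorDefect (DVB.coreSec A B c) (DVB.coreSec A B c') f b = 0 := by
  have hz : ∀ (X : (DVB.trivial A B C).overB.Sec) (r : ℝ), L.deriv X (fun _ => r) b = 0 := fun X r => dirDeriv_const r _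
  have h0 : ∀ f, L.deriv (0 : (DVB.trivial A B C).overB.Sec) f b = 0 := fun f => by
    unfold deriv
    rw [ContMDiffSection.coe_zero, Pi.zero_apply, map_zero]
    exact map_zero (mfderiv B.IT 𝓘(ℝ) f b)
  refine L.anchorDefect_eq_zero (fun g hg => ?_) (fun ψ hψ => ?_) hf
  · unfold anchorDefect
    rw [h.bracket_core_core, h0, h.deriv_core_pullback_fun _ hg, h.deriv_core_pullback_fun _ hg, hz, hz, sub_zero,
      sub_zero]
  · have e3 : ∀ c, L.deriv (DVB.coreSec A B c) (B.linearFun ψ) = fun b => ψ b.proj (V.bd.onSec c b.proj) :=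
      fun c => funext fun b => h.anchor_core_linear c ψ hψ b
    unfold anchorDefect
    rw [h.bracket_core_core, h0, e3, e3,
      h.anchor_core_pullback _ _ (B.contMDiff_linearFun_sec hψ (V.bd.onSec c)),
      h.anchor_core_pullback _ _ (B.contMDiff_linearFun_sec hψ (V.bd.onSec c')), sub_zero, sub_zero]

variable (hV : V.IsRepresentation LA)

include hV

/-- On pulled back functions every term is zero; on linear functions the statement is ∂∇⁰ = ∇¹∂. -/
theorem anchorDefect_lift_core (a : A.Sec) (c : C.Sec) {b : B.Tot} [I.Boundaryless] {f : B.Tot → ℝ}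
    (hf : ContMDiff B.IT 𝓘(ℝ) ∞ f) :
    L.anchorDefect (DVB.liftSec A B C a) (DVB.coreSec A B c) f b = 0 := by
  have hz : ∀ (X : (DVB.trivial A B C).overB.Sec) (r : ℝ), L.deriv X (fun _ => r) b = 0 := fun X r => dirDeriv_const r _
  refine L.anchorDefect_eq_zero (fun g hg => ?_) (fun ψ hψ => ?_) hf
  · unfold anchorDefect
    rw [h.bracket_lift_core, h.deriv_core_pullback_fun _ hg, h.deriv_core_pullback_fun _ hg, hz,
      h.deriv_lift_pullback_fun _ hg, h.anchor_core_pullback c (LA.deriv a g) (LA.toSkew.contMDiff_deriv a hg), sub_zero, sub_zero]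
  · unfold anchorDefect
    rw [h.bracket_lift_core, h.commutator_lift_core hV.connection₁ a c hψ, h.anchor_core_linear _ ψ hψ,
      ← hV.bd_nabla]
    exact sub_self _

/-- On pulled back functions this reduces to the anchor of A, on linear functions to the formula for
the curvature of ∇¹. -/
theorem anchorDefect_lift_lift (a a' : A.Sec) {b : B.Tot} [I.Boundaryless] {f : B.Tot → ℝ}
    (hf : ContMDiff B.IT 𝓘(ℝ) ∞ f) :
    L.anchorDefect (DVB.liftSec A B C a) (DVB.liftSec A B C a') f b = 0 := by
  refine L.anchorDefect_eq_zero (fun g hg => ?_) (fun ψ hψ => ?_) hf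
  · unfold anchorDefect
    rw [h.deriv_bracket_lift_lift_pullback a a' hg, h.deriv_lift_pullback_fun _ hg,
      h.deriv_lift_pullback_fun _ hg, h.anchor_lift_pullback _ (LA.deriv a' g) (LA.toSkew.contMDiff_deriv a' hg),
      h.anchor_lift_pullback _ (LA.deriv a g) (LA.toSkew.contMDiff_deriv a hg), LA.deriv_bracket a a' hg]
    exact sub_self _
  · obtain ⟨m, b⟩ := b
    obtain ⟨β, rfl⟩ : ∃ β : B.Sec, β m = b := ⟨B.secThrough b, B.secThrough_self b⟩
    unfold anchorDefect
    rw [h.deriv_bracket_lift_lift_linear a a' hψ, h.commutator_lift_lift hV.connection₁ a a' hψ]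
    have e := congrArg (fun s : B.Sec => ψ m (s m)) (hV.curvature₁ a a' β)
    simp only [LieAlgebroid.curvature, ContMDiffSection.coe_sub, Pi.sub_apply, ContMDiffSection.coe_neg,
      Pi.neg_apply, map_sub, map_neg] at e
    linarith

theorem jacobiator_lift_lift_core (a a' : A.Sec) (c : C.Sec) :
    L.jacobiator (DVB.liftSec A B C a) (DVB.liftSec A B C a') (DVB.coreSec A B c) = 0 := by
  unfold jacobiator
  rw [h.bracket_lift_lift_eq, map_add, LinearMap.add_apply, h.bracket_lift_core, h.bracket_lift_core,
    h.bracket_lift_core, h.bracket_lift_core, h.bracket_lift_core, h.bracket_hom_core]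
  have e := congrArg (fun c => DVB.coreSec A B c) (hV.curvature₀ a a' c)
  ext b
  have e1 := congrArg (fun s : C.Sec => s b.proj) (hV.curvature₀ a a' c)
  simp only [LieAlgebroid.curvature, ContMDiffSection.coe_sub, Pi.sub_apply, ContMDiffSection.coe_neg,
      Pi.neg_apply] at e1
  refine DVB.vec_ext ?_ ?_
  · simp only [ContMDiffSection.coe_sub, Pi.sub_apply, ContMDiffSection.coe_neg, ContMDiffSection.coe_add,
      Pi.add_apply, Pi.neg_apply, map_sub, map_add, map_neg, DVB.coreSec_apply, DVB.vecA_vec,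
      ContMDiffSection.coe_zero, Pi.zero_apply, map_zero]
    simp
  · simp only [ContMDiffSection.coe_sub, Pi.sub_apply, ContMDiffSection.coe_neg, ContMDiffSection.coe_add,
      Pi.add_apply, Pi.neg_apply, map_sub, map_add, map_neg, DVB.coreSec_apply, DVB.vecC_vec,
      ContMDiffSection.coe_zero, Pi.zero_apply, map_zero]
    rw [← sub_eq_zero] at e1
    refine Eq.trans ?_ e1
    change _ = _ - -(V.K.hom a a').onSec (V.bd.onSec c) b.proj
    abel

/-- The component in A is the Jacobi identity of A. The one in C is the equation d_∇K = 0, up to the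
skew-symmetry of K. -/
theorem jacobiator_lift_lift_lift (a₁ a₂ a₃ : A.Sec) :
    L.jacobiator (DVB.liftSec A B C a₁) (DVB.liftSec A B C a₂) (DVB.liftSec A B C a₃) = 0 := by
  have hK : ∀ a a' β, V.K.onSec a a' β = -V.K.onSec a' a β := fun a a' β => by
    ext x
    have e := hV.K_self x (a x + a' x) (β x)
    simp only [map_add, LinearMap.add_apply, hV.K_self, zero_add, add_zero] at e
    exact eq_neg_of_add_eq_zero_right e
  unfold jacobiator
  rw [h.bracket_lift_lift_eq, h.bracket_lift_lift_eq, h.bracket_lift_lift_eq, map_add, map_add, map_add,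
    LinearMap.add_apply, h.bracket_lift_lift_eq, h.bracket_lift_lift_eq, h.bracket_lift_lift_eq,
    L.bracket_skew (DVB.homSec A _)]
  ext b
  let β := B.secThrough b.2
  have hb : β b.proj = b.2 := B.secThrough_self _
  have e1 : ∀ a a' a'', L.bracket (DVB.liftSec A B C a) (DVB.homSec A (V.K.hom a' a'')) b =
      DVB.vec 0 (V.nablaK a a' a'' β b.proj) := fun a a' a'' => h.bracket_lift_hom a (V.K.hom a' a'') β hb
  have e3 : ∀ a a', ((V.K.hom a a').fib b.proj b.2) = V.K.onSec a a' β b.proj := fun a a' =>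
    congrArg ((V.K.hom a a').fib b.proj) hb.symm
  refine DVB.vec_ext ?_ ?_
  · simp only [ContMDiffSection.coe_sub, Pi.sub_apply, ContMDiffSection.coe_neg, ContMDiffSection.coe_add,
      Pi.add_apply, Pi.neg_apply, map_sub, map_add, map_neg, DVB.liftSec_apply, DVB.homSec_apply, DVB.vecA_vec,
      ContMDiffSection.coe_zero, Pi.zero_apply, map_zero, e1]
    rw [LA.jacobi a₁ a₂ a₃, ContMDiffSection.coe_add, Pi.add_apply]
    abel
  · have s1 := congrArg (fun s : C.Sec => s b.proj) (hK (LA.bracket a₁ a₃) a₂ β)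
    have s2 := congrArg (fun s : C.Sec => s b.proj) (hK (LA.bracket a₂ a₃) a₁ β)
    have s3 := congrArg (fun s : C.Sec => s b.proj) (hV.closed a₁ a₂ a₃ β)
    simp only [ContMDiffSection.coe_neg, Pi.neg_apply, ContMDiffSection.coe_add, Pi.add_apply,
      ContMDiffSection.coe_sub, Pi.sub_apply, ContMDiffSection.coe_zero, Pi.zero_apply] at s1 s2 s3
    simp only [ContMDiffSection.coe_sub, Pi.sub_apply, ContMDiffSection.coe_neg, ContMDiffSection.coe_add,
      Pi.add_apply, Pi.neg_apply, map_sub, map_add, map_neg, DVB.liftSec_apply, DVB.homSec_apply, DVB.vecC_vec,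
      ContMDiffSection.coe_zero, Pi.zero_apply, map_zero, e1, e3]
    rw [s1, s2] at s3
    refine Eq.trans ?_ s3
    abel

/-- With at least two core sections every term is zero, since core sections commute and the bracket
of a lift and a core section is again a core section. The other cases are permutations of those
treated above. -/
theorem jacobiator_eq_zero [I.Boundaryless] (X Y Z : (DVB.trivial A B C).overB.Sec) : L.jacobiator X Y Z = 0 := by
  refine jacobiator_eq_zero_of_generators
    (Set.range (DVB.liftSec A B C) ∪ Set.range (DVB.coreSec A B (C := C))) ?_ ?_ ?_ X Y Z
  · exact fun b v => ⟨_, .inl ⟨_, rfl⟩, _, .inr ⟨_, rfl⟩, DVB.eq_liftSec_add_coreSec v⟩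
  · rintro _ (⟨a, rfl⟩ | ⟨c, rfl⟩) _ (⟨a', rfl⟩ | ⟨c', rfl⟩) f b hf
    · exact h.anchorDefect_lift_lift hV a a' hf
    · exact h.anchorDefect_lift_core hV a c' hf
    · rw [anchorDefect_skew, h.anchorDefect_lift_core hV a' c hf, neg_zero]
    · exact h.anchorDefect_core_core c c' hf
  · have z : ∀ (a : A.Sec) (c c' : C.Sec), L.jacobiator (DVB.liftSec A B C a) (DVB.coreSec A B c) (DVB.coreSec A B c') = 0 := by
      intro a c c'
      unfold jacobiator
      rw [h.bracket_core_core, h.bracket_lift_core, h.bracket_lift_core, h.bracket_core_core, h.bracket_core_core,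
        map_zero, add_zero, sub_zero]
    rintro _ (⟨a, rfl⟩ | ⟨c, rfl⟩) _ (⟨a', rfl⟩ | ⟨c', rfl⟩) _ (⟨a'', rfl⟩ | ⟨c'', rfl⟩)
    · exact h.jacobiator_lift_lift_lift hV a a' a''
    · exact h.jacobiator_lift_lift_core hV a a' c''
    · rw [jacobiator_swap_right, h.jacobiator_lift_lift_core hV a a'' c', neg_zero]
    · exact z a c' c''
    · rw [jacobiator_swap_left, jacobiator_swap_right, h.jacobiator_lift_lift_core hV a' a'' c, neg_zero, neg_zero]
    · rw [jacobiator_swap_left, z, neg_zero]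
    · rw [jacobiator_swap_right, jacobiator_swap_left, z, neg_zero, neg_zero]
    · unfold jacobiator
      rw [h.bracket_core_core, h.bracket_core_core, h.bracket_core_core, map_zero, map_zero, map_zero,
        LinearMap.zero_apply, add_zero, sub_zero]

end SkewAlgebroid.IsAssociated

theorem StructureOperators.IsRepresentation.exists_lieAlgebroid [I.Boundaryless] (h : V.IsRepresentation LA) :
    ∃ LD : LieAlgebroid (DVB.trivial A B C).overB, IsAssociated LA V LD := by
  obtain ⟨L, hL⟩ := h.exists_skewAlgebroid
  exact ⟨{ L with jacobi := fun a b c => sub_eq_zero.1 (hL.jacobiator_eq_zero h a b c) },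
    ⟨hL.1, hL.2, hL.3, hL.4, hL.5, hL.6, hL.7⟩⟩

end RepresentationVBAlgebroid

/-! ### The algebroid of a representation is a VB-algebroid -/

section RepresentationVBAlgebroid

variable {E : Type*} [NormedAddCommGroup E] [NormedSpace ℝ E] {H : Type*} [TopologicalSpace H]
  {I : ModelWithCorners ℝ E H} {M : Type*} [TopologicalSpace M] [ChartedSpace H M]
  [FiniteDimensional ℝ E] [T2Space M] [IsManifold I ∞ M] {A B C : VB.{u} I M}
  {LA : LieAlgebroid A} {V : StructureOperators A B C}

/-- A linear section is a lift plus a homomorphism section. For linear sections to be closed under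
the bracket, the formula of `bracket_lift_hom`, which is written with sections β, must define a
bundle map. -/
theorem StructureOperators.IsRepresentation.exists_nabla_hom (h : V.IsRepresentation LA)
    {L : SkewAlgebroid (DVB.trivial A B C).overB} (hL : L.IsAssociated LA V) (a : A.Sec) (k : BundleMap B C) :
    ∃ k', L.bracket (DVB.liftSec A B C a) (DVB.homSec A k) = DVB.homSec A k' := by
  have hadd : ∀ β β', k.onSec (β + β') = k.onSec β + k.onSec β' := fun β β' => by
    ext m
    exact map_add (k.fib m) _ _
  have hsmul : ∀ (r : ℝ) β, k.onSec (r • β) = r • k.onSec β := fun r β => by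
    ext m
    exact map_smul (k.fib m) _ _
  refine DVB.exists_eq_homSec _ (fun b => ?_) (fun β => V.nabla₀ a (k.onSec β) - k.onSec (V.nabla₁ a β))
    (fun β m => ?_) (fun β β' => ?_) (fun r β => ?_)
  · rw [hL.bracket_lift_hom a k (B.secThrough b.2) (B.secThrough_self _), DVB.vecA_vec]
  · exact congrArg (DVB.vecC _) (hL.bracket_lift_hom a k β (b := ⟨m, β m⟩) rfl)
  · rw [hadd, h.connection₀.add_right, h.connection₁.add_right, hadd]
    abel
  · rw [hsmul, h.connection₀.map_smul, h.connection₁.map_smul, hsmul, smul_sub]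

namespace SkewAlgebroid.IsAssociated

variable {L : SkewAlgebroid (DVB.trivial A B C).overB} (h : L.IsAssociated LA V)

include h

/-- At b the first section agrees with the core section of k(β), so its anchor there is the vertical
vector ∂k(b). This yields k'∂k, and the other order gives k∂k'. -/
theorem bracket_hom_hom (k k' : BundleMap B C) :
    L.bracket (DVB.homSec A k) (DVB.homSec A k') = DVB.homSec A ((k.comp V.bd).comp k') -
      DVB.homSec A ((k'.comp V.bd).comp k) := by
  ext b
  let β := B.secThrough b.2
  have hb : β b.proj = b.2 := B.secThrough_self _
  have h0 : ∀ k : BundleMap B C, DVB.homSec A k b = DVB.coreSec A B (k.onSec β) b := fun k =>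
    congrArg (DVB.vec 0) (congrArg (k.fib b.proj) hb.symm)
  have h2 := L.bracket_eq_sderiv (DVB.homSec A k) (DVB.homSec A k' - DVB.coreSec A B (k'.onSec β))
    (x := b) (sub_eq_zero.2 (h0 k'))
  have h3 := h2.trans (DVB.sderiv_homSec k' β hb _)
  rw [map_sub, h.bracket_hom_core, h0 k, h.vert_core _ β hb, ContMDiffSection.coe_sub, Pi.sub_apply,
    sub_eq_iff_eq_add] at h3
  refine h3.trans ?_
  rw [ContMDiffSection.coe_neg, Pi.neg_apply, ContMDiffSection.coe_sub, Pi.sub_apply, DVB.coreSec_apply,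
    ← sub_eq_add_neg]
  refine congrArg₂ (fun x y => DVB.vec 0 x - DVB.vec 0 y) ?_ ?_
  · exact congrArg (fun y => k'.fib b.proj (V.bd.fib b.proj (k.fib b.proj y))) hb
  · exact congrArg (fun y => k.fib b.proj (V.bd.fib b.proj (k'.fib b.proj y))) hb

end SkewAlgebroid.IsAssociated

theorem DVB.isLinearSection_add_homSec {X : (DVB.trivial A B C).overB.Sec} {a : A.Sec}
    (h : (DVB.trivial A B C).IsLinearSection X a) (k : BundleMap B C) :
    (DVB.trivial A B C).IsLinearSection (X + DVB.homSec A k) a := by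
  obtain ⟨k₁, rfl⟩ := (DVB.isLinearSection_iff _ _).1 h
  refine (DVB.isLinearSection_iff _ _).2
    ⟨BundleMap.ofSec (fun x => k₁.fib x + k.fib x) fun s => (k₁.onSec s + k.onSec s).contMDiff, ?_⟩
  rw [add_assoc]
  congr 1
  ext b
  exact DVB.vec_ext (add_zero _) rfl

theorem DVB.isLinearSection_sub_homSec {X : (DVB.trivial A B C).overB.Sec} {a : A.Sec}
    (h : (DVB.trivial A B C).IsLinearSection X a) (k : BundleMap B C) :
    (DVB.trivial A B C).IsLinearSection (X - DVB.homSec A k) a := by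
  obtain ⟨k₁, rfl⟩ := (DVB.isLinearSection_iff _ _).1 h
  refine (DVB.isLinearSection_iff _ _).2
    ⟨BundleMap.ofSec (fun x => k₁.fib x - k.fib x) fun s => (k₁.onSec s - k.onSec s).contMDiff, ?_⟩
  rw [add_sub_assoc]
  congr 1
  ext b
  exact DVB.vec_ext (sub_zero _) rfl

namespace IsAssociated

variable {LD : LieAlgebroid (DVB.trivial A B C).overB} (h : IsAssociated LA V LD)

include h

/-- The anchor of an arbitrary element on pullback functions. -/
theorem dirDeriv_anchor_pullback {g : M → ℝ} (hg : ContMDiff I 𝓘(ℝ) ∞ g) (b : B.Tot) (a : A.fib b.proj)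
    (c : C.fib b.proj) : dirDeriv B.IT (fun x : B.Tot => g x.proj) (LD.anchor b (DVB.vec a c)) =
      dirDeriv I g (LA.anchor b.proj a) := by
  have e := DVB.eq_liftSec_add_coreSec (DVB.vec a c : (DVB.trivial A B C).overB.fib b)
  have e1 := h.anchor_lift_pullback (A.secThrough a) g hg b
  have e2 := h.anchor_core_pullback (C.secThrough c) g hg b
  rw [DVB.vecA_vec, DVB.vecC_vec] at e
  rw [e, map_add, dirDeriv_add_vec]
  refine (congrArg₂ (· + ·) e1 e2).trans ?_
  rw [add_zero]
  unfold LieAlgebroid.deriv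
  rw [VB.secThrough_self]

/-- The anchor of an arbitrary element on linear functions. -/
theorem dirDeriv_anchor_linear {ψ : ∀ m, B.fib m →ₗ[ℝ] ℝ} (hψ : ContMDiff B.IT 𝓘(ℝ) ∞ (B.linearFun ψ))
    (β : B.Sec) {b : B.Tot} (hb : β b.proj = b.2) (a : A.Sec) (c : C.fib b.proj) :
    dirDeriv B.IT (B.linearFun ψ) (LD.anchor b (DVB.vec (a b.proj) c)) =
      LA.deriv a (fun x => ψ x (β x)) b.proj - ψ b.proj (V.nabla₁ a β b.proj) +
        ψ b.proj (V.bd.fib b.proj c) := by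
  have e1 := h.anchor_lift_linear a ψ hψ β b.proj
  have e2 := h.anchor_core_linear (C.secThrough c) ψ hψ b
  have e : (DVB.vec (a b.proj) c : (DVB.trivial A B C).overB.fib b) =
      DVB.liftSec A B C a b + DVB.coreSec A B (C.secThrough c) b := by
    rw [DVB.liftSec_apply, DVB.coreSec_apply, VB.secThrough_self, DVB.vec_add_vec, add_zero, zero_add]
  rw [VB.secThrough_self] at e2
  rw [e, map_add, dirDeriv_add_vec, ← e1]
  rw [hb]
  exact congrArg₂ (· + ·) rfl e2

theorem tangentMap_anchor (d : (DVB.trivial A B C).Tot) :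
    tangentMap B.IT I TotalSpace.proj (LD.anchorTotal d) = LA.anchorTotal ((DVB.trivial A B C).qA d) := by
  obtain ⟨b, v⟩ := d
  obtain ⟨a, c, rfl⟩ : ∃ a c, v = DVB.vec a c := ⟨DVB.vecA b v, DVB.vecC b v, rfl⟩
  have e : B.tproj (LD.anchor b (DVB.vec a c)) = LA.anchor b.proj a := by
    refine _root_.tangent_ext fun g hg => ?_
    rw [← B.dirDeriv_comp_proj hg, h.dirDeriv_anchor_pullback hg]
  exact congrArg (fun w => (⟨b.proj, w⟩ : TangentBundle I M)) e

end IsAssociated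

/-- A linear function pulled back along φ is linear. The tangent map of φ thus keeps the horizontal
part and applies φ to the vertical part; it is used for the projections of B ⊕ B and for the
addition. -/
theorem VB.tangentMap_total_eq {V W : VB.{u} I M} (φ : BundleMap V W) (σ : V.Sec) {x : V.Tot}
    {v : TangentSpace I x.proj} {y : V.fib x.proj} {w : TangentSpace V.IT x}
    (hw₀ : ∀ g, ContMDiff I 𝓘(ℝ) ∞ g → dirDeriv V.IT (fun x : V.Tot => g x.proj) w = dirDeriv I g v)
    (hw₁ : ∀ ψ : ∀ m, V.fib m →ₗ[ℝ] ℝ, ContMDiff V.IT 𝓘(ℝ) ∞ (V.linearFun ψ) →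
      dirDeriv V.IT (V.linearFun ψ) w = dirDeriv I (fun m => ψ m (σ m)) v + ψ x.proj y)
    {u : TangentSpace W.IT (φ.total x)}
    (hu₀ : ∀ g, ContMDiff I 𝓘(ℝ) ∞ g → dirDeriv W.IT (fun x : W.Tot => g x.proj) u = dirDeriv I g v)
    (hu₁ : ∀ ψ : ∀ m, W.fib m →ₗ[ℝ] ℝ, ContMDiff W.IT 𝓘(ℝ) ∞ (W.linearFun ψ) →
      dirDeriv W.IT (W.linearFun ψ) u =
        dirDeriv I (fun m => ψ m (φ.onSec σ m)) v + ψ x.proj (φ.fib x.proj y)) :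
    tangentMap V.IT W.IT φ.total ⟨x, w⟩ = ⟨φ.total x, u⟩ := by
  have hφ : ContMDiff V.IT W.IT ∞ φ.total := φ.smooth
  refine congrArg (fun z : TangentSpace W.IT (φ.total x) => (⟨φ.total x, z⟩ : TangentBundle W.IT W.Tot)) ?_
  refine W.tangent_ext (fun g hg => ?_) fun ψ hψ => ?_
  · rw [hu₀ g hg, ← hw₀ g hg]
    exact (dirDeriv_comp ((W.contMDiff_comp_proj hg).mdiffAt _) (hφ.mdiffAt _) w).symm
  · rw [hu₁ ψ hψ]
    refine Eq.trans ?_ (hw₁ (fun m => (ψ m).comp (φ.fib m)) (hψ.comp hφ))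
    exact (dirDeriv_comp (hψ.mdiffAt _) (hφ.mdiffAt _) w).symm

/-- The first projection of a direct sum. -/
def VB.prodFst (V W : VB.{u} I M) : BundleMap (V.prod W) V where
  fib _ := LinearMap.fst ℝ _ _
  smooth := ((VB.contMDiff_prod_iff V W _).1 (contMDiff_id (I := (V.prod W).IT) (n := ∞))).1

/-- The second projection of a direct sum. -/
def VB.prodSnd (V W : VB.{u} I M) : BundleMap (V.prod W) W where
  fib _ := LinearMap.snd ℝ _ _
  smooth := ((VB.contMDiff_prod_iff V W _).1 (contMDiff_id (I := (V.prod W).IT) (n := ∞))).2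

/-- The addition of a vector bundle. -/
def VB.prodAdd (V : VB.{u} I M) : BundleMap (V.prod V) V where
  fib _ := LinearMap.fst ℝ _ _ + LinearMap.snd ℝ _ _
  smooth := fun x => VB.contMDiffAt_add (f := fun x : (V.prod V).Tot => x.proj) ((VB.prodFst V V).smooth x)
    ((VB.prodSnd V V).smooth x)

namespace IsAssociated

variable {LD : LieAlgebroid (DVB.trivial A B C).overB} (h : IsAssociated LA V LD) (hV : LA.IsConnection V.nabla₁)

include h hV

/-- The witness is the tangent vector of B ⊕ B at (β, β') whose vertical part consists of the two
vertical parts -∇¹β + ∂c and -∇¹β' + ∂c'. That its image under the addition is right is the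
additivity of ∇¹ and of ∂. -/
theorem isTangentSum_anchor {x y z : (DVB.trivial A B C).Tot} (hs : (DVB.trivial A B C).IsSumA x y z) :
    B.IsTangentSum (LD.anchorTotal x) (LD.anchorTotal y) (LD.anchorTotal z) := by
  obtain ⟨m, a, b, b', c, c', rfl, rfl, rfl⟩ := DVB.trivial_isSumA A B C hs
  obtain ⟨α, rfl⟩ : ∃ α : A.Sec, α m = a := ⟨A.secThrough a, A.secThrough_self a⟩
  obtain ⟨β, rfl⟩ : ∃ β : B.Sec, β m = b := ⟨B.secThrough b, B.secThrough_self b⟩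
  obtain ⟨β', rfl⟩ : ∃ β : B.Sec, β m = b' := ⟨B.secThrough b', B.secThrough_self b'⟩
  let σ : (B.prod B).Sec := ⟨fun m => (β m, β' m), (VB.contMDiff_prod_iff B B _).2 ⟨β.contMDiff, β'.contMDiff⟩⟩
  let v := LA.anchor m (α m)
  let y : B.Sec → C.fib m → B.fib m := fun β c => -V.nabla₁ α β m + V.bd.fib m c
  have e₁ : ∀ (β : B.Sec) (c : C.fib m) (ψ : ∀ m, B.fib m →ₗ[ℝ] ℝ), ContMDiff B.IT 𝓘(ℝ) ∞ (B.linearFun ψ) →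
      dirDeriv B.IT (B.linearFun ψ) (LD.anchor ⟨m, β m⟩ (DVB.vec (b := ⟨m, β m⟩) (α m) c)) =
        dirDeriv I (fun m => ψ m (β m)) v + ψ m (y β c) := fun β c ψ hψ => by
    refine (h.dirDeriv_anchor_linear hψ β (b := ⟨m, β m⟩) rfl α c).trans ?_
    rw [map_add, map_neg, ← add_assoc, ← sub_eq_add_neg]
    rfl
  have e₀ : ∀ (b : B.fib m) (c : C.fib m) (g : M → ℝ), ContMDiff I 𝓘(ℝ) ∞ g →
      dirDeriv B.IT (fun x : B.Tot => g x.proj) (LD.anchor ⟨m, b⟩ (DVB.vec (b := ⟨m, b⟩) (α m) c)) =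
        dirDeriv I g v := fun b c g hg => h.dirDeriv_anchor_pullback hg _ _ _
  have e₂ : y (β + β') (c + c') = y β c + y β' c' := by
    simp only [y]
    rw [hV.add_right, ContMDiffSection.coe_add, Pi.add_apply, map_add]
    abel
  obtain ⟨w, hw₀, hw₁⟩ := VB.exists_tangent (B := B.prod B) σ (b := ⟨m, σ m⟩) rfl v (y β c, y β' c')
  refine ⟨⟨⟨m, σ m⟩, w⟩, ?_, ?_, ?_⟩
  · exact VB.tangentMap_total_eq (VB.prodFst B B) σ (y := (y β c, y β' c')) hw₀ hw₁ (e₀ (β m) c) (e₁ β c)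
  · exact VB.tangentMap_total_eq (VB.prodSnd B B) σ (y := (y β c, y β' c')) hw₀ hw₁ (e₀ (β' m) c') (e₁ β' c')
  · refine VB.tangentMap_total_eq (VB.prodAdd B) σ (y := (y β c, y β' c')) hw₀ hw₁ (e₀ (β m + β' m) (c + c')) ?_
    intro ψ hψ
    refine (e₁ (β + β') (c + c') ψ hψ).trans ?_
    rw [e₂]
    rfl

theorem tangentScale_anchor (r : ℝ) (d : (DVB.trivial A B C).Tot) :
    LD.anchorTotal ((DVB.trivial A B C).scaleA r d) = B.tangentScale r (LD.anchorTotal d) := by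
  obtain ⟨⟨m, b⟩, v⟩ := d
  obtain ⟨a, c, rfl⟩ : ∃ a c, v = DVB.vec (b := ⟨m, b⟩) a c := ⟨DVB.vecA _ v, DVB.vecC _ v, rfl⟩
  obtain ⟨α, rfl⟩ : ∃ α : A.Sec, α m = a := ⟨A.secThrough a, A.secThrough_self a⟩
  obtain ⟨β, rfl⟩ : ∃ β : B.Sec, β m = b := ⟨B.secThrough b, B.secThrough_self b⟩
  let w : TangentSpace B.IT (⟨m, β m⟩ : B.Tot) := LD.anchor ⟨m, β m⟩ (DVB.vec (b := ⟨m, β m⟩) (α m) c)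
  have hg1 : ∀ (b : B.fib m) (c : C.fib m) (g : M → ℝ), ContMDiff I 𝓘(ℝ) ∞ g →
      dirDeriv B.IT (fun x : B.Tot => g x.proj) (LD.anchor ⟨m, b⟩ (DVB.vec (b := ⟨m, b⟩) (α m) c)) =
        dirDeriv I g (LA.anchor m (α m)) := fun b c g hg => h.dirDeriv_anchor_pullback hg _ _ _
  have e : LD.anchor ⟨m, r • β m⟩ (DVB.vec (b := ⟨m, r • β m⟩) (α m) (r • c)) =
      (B.tangentScale r ⟨⟨m, β m⟩, w⟩).2 := by
    refine B.tangent_ext (b := ⟨m, r • β m⟩) (fun g hg => ?_) fun ψ hψ => ?_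
    · rw [hg1 _ _ g hg]
      refine Eq.trans ?_ (VB.dirDeriv_tangentMap (B.contMDiff_scale r) (B.contMDiff_comp_proj hg)
        (rfl : _ = B.tangentScale r ⟨⟨m, β m⟩, w⟩)).symm
      exact (hg1 _ _ g hg).symm
    · refine Eq.trans ?_ (VB.dirDeriv_tangentScale r ⟨⟨m, β m⟩, w⟩ hψ).symm
      have e1 := h.dirDeriv_anchor_linear hψ (r • β) (b := ⟨m, r • β m⟩) rfl α (r • c)
      have e2 := h.dirDeriv_anchor_linear hψ β (b := ⟨m, β m⟩) rfl α c
      refine e1.trans (Eq.trans ?_ (congrArg (r * ·) e2.symm))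
      have e3 : LA.deriv α (fun x => ψ x ((r • β) x)) m = r * LA.deriv α (fun x => ψ x (β x)) m := by
        have e4 := dirDeriv_mul (mdifferentiableAt_const (c := r)) ((B.contMDiff_linearFun_sec hψ β).mdiffAt m)
          (LA.anchor m (α m))
        rw [dirDeriv_const, mul_zero, add_zero] at e4
        refine Eq.trans ?_ e4
        exact congrArg (fun f => dirDeriv I f (LA.anchor m (α m))) (funext fun x => map_smul (ψ x) r (β x))
      have e5 := congrArg (fun s : B.Sec => ψ m (s m)) (hV.map_smul α r β)
      have e6 : ψ m (V.bd.fib m (r • c)) = r * ψ m (V.bd.fib m c) := by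
        rw [map_smul, map_smul, smul_eq_mul]
      have e7 : ψ m ((r • V.nabla₁ α β) m) = r * ψ m (V.nabla₁ α β m) := map_smul (ψ m) _ _
      change LA.deriv α (fun x => ψ x ((r • β) x)) m - ψ m (V.nabla₁ α (r • β) m) + ψ m (V.bd.fib m (r • c)) =
        r * (LA.deriv α (fun x => ψ x (β x)) m - ψ m (V.nabla₁ α β m) + ψ m (V.bd.fib m c))
      rw [e3, e6]
      rw [e5.trans e7]
      ring
  exact congrArg (fun z : TangentSpace B.IT (⟨m, r • β m⟩ : B.Tot) =>
    (⟨⟨m, r • β m⟩, z⟩ : TangentBundle B.IT B.Tot)) e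

end IsAssociated

/-- The Lie algebroid structure associated with a representation is a VB-algebroid structure. -/
theorem StructureOperators.IsRepresentation.isVBAlgebroid (hV : V.IsRepresentation LA)
    {LD : LieAlgebroid (DVB.trivial A B C).overB} (h : IsAssociated LA V LD) :
    (DVB.trivial A B C).IsVBAlgebroid LA LD where
  anchor_covers := h.tangentMap_anchor
  anchor_add _ _ _ := h.isTangentSum_anchor hV.connection₁
  anchor_scale := h.tangentScale_anchor hV.connection₁
  linear_linear X Y a a' hX hY := by
    obtain ⟨k, rfl⟩ := (DVB.isLinearSection_iff _ _).1 hX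
    obtain ⟨k', rfl⟩ := (DVB.isLinearSection_iff _ _).1 hY
    obtain ⟨k₁, h₁⟩ := hV.exists_nabla_hom h.toSkew a k'
    obtain ⟨k₂, h₂⟩ := hV.exists_nabla_hom h.toSkew a' k
    have h₃ := h.toSkew.bracket_hom_hom k k'
    have h₄ := h.toSkew.bracket_lift_lift_eq a a'
    have h₅ : LD.bracket (DVB.homSec A k) (DVB.liftSec A B C a') = -DVB.homSec A k₂ :=
      (LD.toSkew.bracket_skew _ _).trans (congrArg Neg.neg h₂)
    change LD.bracket _ _ = _ at h₁ h₃ h₄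
    have e : LD.bracket (DVB.liftSec A B C a + DVB.homSec A k) (DVB.liftSec A B C a' + DVB.homSec A k') =
        DVB.liftSec A B C (LA.bracket a a') + DVB.homSec A (V.K.hom a a') + DVB.homSec A k₁ +
          DVB.homSec A ((k.comp V.bd).comp k') - DVB.homSec A k₂ - DVB.homSec A ((k'.comp V.bd).comp k) := by
      rw [map_add, map_add, LinearMap.add_apply, LinearMap.add_apply, h₁, h₃, h₄, h₅]
      abel
    rw [e]
    exact DVB.isLinearSection_sub_homSec (DVB.isLinearSection_sub_homSec (DVB.isLinearSection_add_homSec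
      (DVB.isLinearSection_add_homSec (DVB.isLinearSection_add_homSec (DVB.isLinearSection_liftSec _) _) _) _) _) _
  linear_core X Y a hX hY := by
    obtain ⟨k, rfl⟩ := (DVB.isLinearSection_iff _ _).1 hX
    obtain ⟨c, rfl⟩ := (DVB.isCoreSection_iff _).1 hY
    refine (DVB.isCoreSection_iff _).2 ⟨V.nabla₀ a c - k.onSec (V.bd.onSec c), ?_⟩
    have e := h.toSkew.bracket_hom_core c k
    change LD.bracket _ _ = _ at e
    rw [map_add, LinearMap.add_apply, h.bracket_lift_core, e]
    ext b
    exact DVB.vec_ext ((add_neg_cancel (0 : A.fib b.proj))) (sub_eq_add_neg _ _).symm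
  core_core X Y hX hY := by
    obtain ⟨c, rfl⟩ := (DVB.isCoreSection_iff _).1 hX
    obtain ⟨c', rfl⟩ := (DVB.isCoreSection_iff _).1 hY
    exact h.bracket_core_core c c'

end RepresentationVBAlgebroid

/-! ### Fibrewise additive maps, dual families, inverses and images of projections -/

section Subbundles

variable {E : Type*} [NormedAddCommGroup E] [NormedSpace ℝ E] {H : Type*} [TopologicalSpace H]
  {I : ModelWithCorners ℝ E H} {N : Type*} [TopologicalSpace N] [ChartedSpace H N]
  {E' : Type*} [NormedAddCommGroup E'] [NormedSpace ℝ E'] {H' : Type*} [TopologicalSpace H']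
  {I' : ModelWithCorners ℝ E' H'} {N' : Type*} [TopologicalSpace N'] [ChartedSpace H' N']

namespace VB

/-- The fibre at `x` is isomorphic to the model fibre. -/
def fibEquiv (V : VB.{u} I N) (x : N) : V.fib x ≃ₗ[ℝ] V.F :=
  (trivializationAt V.F V.fib x).linearEquivAt ℝ x (mem_baseSet_trivializationAt _ _ _)

instance (V : VB.{u} I N) (x : N) : FiniteDimensional ℝ (V.fib x) := (V.fibEquiv x).symm.finiteDimensional

theorem finrank_fib (V : VB.{u} I N) (x : N) : Module.finrank ℝ (V.fib x) = Module.finrank ℝ V.F :=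
  (V.fibEquiv x).finrank_eq

/-- A continuous additive curve in a fibre is linear. -/
theorem eq_smul_of_additive (V : VB.{u} I N) {x : N} {f : ℝ → V.fib x}
    (hf : Continuous (fun t => (⟨x, f t⟩ : V.Tot))) (hadd : ∀ s t, f (s + t) = f s + f t) (t : ℝ) :
    f t = t • f 1 := by
  let e := trivializationAt V.F V.fib x
  have hx : x ∈ e.baseSet := mem_baseSet_trivializationAt _ _ _
  have h1 : Continuous (fun t => (e ⟨x, f t⟩).2) := by
    refine continuous_snd.comp (e.continuousOn.comp_continuous hf fun t => e.mem_source.2 hx)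
  have h2 : Continuous (fun t => V.coord x x (f t)) := by
    refine h1.congr fun t => ?_
    rw [V.coord_eq hx]
  let g : ℝ →+ V.F := AddMonoidHom.mk' (fun t => V.coord x x (f t)) fun s t => by rw [hadd, map_add]
  have h3 := map_real_smul g h2 t 1
  rw [smul_eq_mul, mul_one] at h3
  have h4 := congrArg (V.coordSymm x x) h3
  rw [map_smul] at h4
  exact (V.coordSymm_coord hx (f t)).symm.trans (h4.trans (congrArg (t • ·) (V.coordSymm_coord hx (f 1))))

end VB

/-- A smooth fibrewise additive map is a vector bundle morphism. -/
theorem VBHom.exists_of_additive {V : VB.{u} I N} {V' : VB.{u} I' N'} {f : V.Tot → V'.Tot}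
    (hf : ContMDiff V.IT V'.IT ∞ f) {g : N → N'} (hg : ∀ v, (f v).proj = g v.proj)
    (hadd : ∀ x (s t : V.fib x), V'.IsSum (f ⟨x, s⟩) (f ⟨x, t⟩) (f ⟨x, s + t⟩)) :
    ∃ F : VBHom V V' g, ∀ v, F.total v = f v := by
  have h : ∀ v : V.Tot, ∃ y : V'.fib (g v.proj), f v = ⟨g v.proj, y⟩ := fun v => by
    have e := hg v
    generalize f v = w at e ⊢
    obtain ⟨p, y⟩ := w
    obtain rfl : p = g v.proj := e
    exact ⟨y, rfl⟩
  choose y hy using h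
  have hy' : ∀ x (s : V.fib x), f ⟨x, s⟩ = ⟨g x, y ⟨x, s⟩⟩ := fun x s => hy ⟨x, s⟩
  have add : ∀ x (s t : V.fib x), y ⟨x, s + t⟩ = y ⟨x, s⟩ + y ⟨x, t⟩ := fun x s t => by
    obtain ⟨p, s', t', h1, h2, h3⟩ := hadd x s t
    rw [hy'] at h1 h2 h3
    obtain rfl : g x = p := congrArg TotalSpace.proj h1
    have e1 : y ⟨x, s⟩ = s' := eq_of_heq ((TotalSpace.mk.injEq _ _ _ _).mp h1).2
    have e2 : y ⟨x, t⟩ = t' := eq_of_heq ((TotalSpace.mk.injEq _ _ _ _).mp h2).2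
    have e3 : y ⟨x, s + t⟩ = s' + t' := eq_of_heq ((TotalSpace.mk.injEq _ _ _ _).mp h3).2
    rw [e1, e2, e3]
  refine ⟨⟨fun x =>
    { toFun := fun s => y ⟨x, s⟩
      map_add' := add x
      map_smul' := fun r s => ?_ }, ?_⟩, fun v => (hy v).symm⟩
  · have hc : Continuous (fun t : ℝ => (⟨g x, y ⟨x, t • s⟩⟩ : V'.Tot)) := by
      have h1 : ContMDiff 𝓘(ℝ) V.IT ∞ (fun t : ℝ => (⟨x, t • s⟩ : V.Tot)) := fun t =>
        VB.contMDiffAt_smul (f := fun _ : ℝ => x) contMDiffAt_id contMDiffAt_const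
      refine ((hf.comp h1).continuous).congr fun t => hy' x _
    have h2 := V'.eq_smul_of_additive hc (fun a b => by rw [add_smul, add]) r
    rw [one_smul] at h2
    exact h2
  · exact hf.congr fun v => (hy v).symm

namespace VB

/-- A vector in the span of a family is determined by its coefficients with respect to a dual family. -/
theorem _root_.eq_sum_of_dual {W : Type*} [AddCommGroup W] [Module ℝ W] [FiniteDimensional ℝ W] {κ : Type*} [Fintype κ]
    [DecidableEq κ] {s : κ → W} {μ : κ → W →ₗ[ℝ] ℝ} (h : ∀ i j, μ i (s j) = if i = j then 1 else 0)
    {R : Submodule ℝ W} (hs : ∀ i, s i ∈ R) (hR : Module.finrank ℝ R = Fintype.card κ) {w : W} (hw : w ∈ R) :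
    w = ∑ i, μ i w • s i := by
  have hc : ∀ (c : κ → ℝ) i, μ i (∑ j, c j • s j) = c i := fun c i => by simp [h]
  have hli : LinearIndependent ℝ s := Fintype.linearIndependent_iff.2 fun c hc0 i => by
    rw [← hc c i, hc0, map_zero]
  have hspan : Submodule.span ℝ (Set.range s) = R := by
    refine Submodule.eq_of_le_of_finrank_eq (Submodule.span_le.2 (Set.range_subset_iff.2 hs)) ?_
    rw [hR, finrank_span_eq_card hli]
  rw [← hspan] at hw
  obtain ⟨c, rfl⟩ := (Submodule.mem_span_range_iff_exists_fun ℝ).1 hw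
  simp only [hc]

variable [FiniteDimensional ℝ E] [T2Space N] [IsManifold I ∞ N] {V W : VB.{u} I N}

theorem exists_functional (V : VB.{u} I N) {x₀ : N} (ℓ : V.fib x₀ →ₗ[ℝ] ℝ) :
    ∃ ψ : ∀ x, V.fib x →ₗ[ℝ] ℝ, ContMDiff V.IT 𝓘(ℝ) ∞ (V.linearFun ψ) ∧ ψ x₀ = ℓ := by
  let fr := V.frame x₀
  refine ⟨fun x => ∑ r, ℓ (fr.sec r x₀) • fr.coef r x, ?_, ?_⟩
  · have e : V.linearFun (fun x => ∑ r, ℓ (fr.sec r x₀) • fr.coef r x) =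
        fun v : V.Tot => ∑ r, ℓ (fr.sec r x₀) * fr.coef r v.proj v.2 := by
      funext v
      simp [linearFun]
    rw [e]
    exact contMDiff_finsetSum fun r _ => contMDiff_const.mul (fr.smooth_coef r)
  · ext v
    conv_rhs => rw [fr.sum_self v, map_sum]
    simp [mul_comm]

/-- A family of sections that is linearly independent at a point has a dual family of linear functions. -/
theorem exists_dual {κ : Type*} [Fintype κ] [DecidableEq κ] {x₀ : N} (s : κ → V.Sec)
    (hs : LinearIndependent ℝ (fun i => s i x₀)) :
    ∃ μ : κ → ∀ x, V.fib x →ₗ[ℝ] ℝ, (∀ i, ContMDiff V.IT 𝓘(ℝ) ∞ (V.linearFun (μ i))) ∧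
      ∀ᶠ x in 𝓝 x₀, ∀ i j, μ i x (s j x) = if i = j then 1 else 0 := by
  obtain ⟨g, hg⟩ := LinearMap.exists_leftInverse_of_injective (Fintype.linearCombination ℝ fun i => s i x₀)
    (LinearMap.ker_eq_bot.2 (hs.fintypeLinearCombination_injective))
  -- These functionals are dual to the sections at x₀ only. Nearby they are corrected by the inverse
  -- of the matrix G of pairings, which is the identity at x₀ and hence invertible in a
  -- neighbourhood.
  choose lam hlam hlam₀ using fun i => V.exists_functional (LinearMap.proj (R := ℝ) (φ := fun _ : κ => ℝ) i ∘ₗ g)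
  have hlam₁ : ∀ i j, lam i x₀ (s j x₀) = if i = j then 1 else 0 := fun i j => by
    have e := congrArg (fun y : κ → ℝ => y i) (LinearMap.congr_fun hg (Pi.single j 1))
    simp only [LinearMap.comp_apply, Fintype.linearCombination_apply_single, one_smul, LinearMap.id_apply] at e
    rw [hlam₀]
    exact e.trans (by simp [Pi.single_apply])
  let R := (κ → ℝ) →L[ℝ] (κ → ℝ)
  let u : κ → κ → R := fun i j =>
    (ContinuousLinearMap.proj (R := ℝ) (φ := fun _ : κ => ℝ) j).smulRight (Pi.single i 1)
  let G : N → R := fun x => ∑ i, ∑ j, lam i x (s j x) • u i j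
  have hG : ContMDiff I 𝓘(ℝ, R) ∞ G := contMDiff_finsetSum fun i _ => contMDiff_finsetSum fun j _ =>
    ((hlam i).comp (s j).contMDiff).smul contMDiff_const
  have hGa : ∀ x i j, G x (Pi.single j 1) i = lam i x (s j x) := fun x i j => by
    have hu : ∀ a b (y : κ → ℝ), u a b y = y b • (Pi.single a 1 : κ → ℝ) := fun _ _ _ => rfl
    simp [G, hu, Pi.single_apply]
  have hG₀ : G x₀ = 1 := by
    refine ContinuousLinearMap.coe_injective (LinearMap.pi_ext' fun j => LinearMap.ext_ring ?_)
    funext i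
    change G x₀ (Pi.single j 1) i = (Pi.single j 1 : κ → ℝ) i
    rw [hGa, hlam₁, Pi.single_apply]
  let U : Set N := {x | IsUnit (G x)}
  have hU : IsOpen U := Units.isOpen.preimage hG.continuous
  have hx₀ : x₀ ∈ U := by
    change IsUnit (G x₀)
    rw [hG₀]
    exact isUnit_one
  have hH : ∀ i k, ContMDiffOn I 𝓘(ℝ) ∞ (fun x => Ring.inverse (G x) (Pi.single k 1) i) U := by
    intro i k x hx
    obtain ⟨r, hr⟩ := hx
    have h1 : ContDiffAt ℝ ∞ Ring.inverse (G x) := hr ▸ contDiffAt_ringInverse ℝ r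
    have h2 : ContMDiffAt I 𝓘(ℝ, R) ∞ (fun x => Ring.inverse (G x)) x := h1.contMDiffAt.comp x hG.contMDiffAt
    let L : R →L[ℝ] ℝ := (ContinuousLinearMap.proj (R := ℝ) (φ := fun _ : κ => ℝ) i).comp
      (ContinuousLinearMap.apply ℝ (κ → ℝ) (Pi.single k 1))
    exact (L.contMDiff.contMDiffAt.comp x h2 :).contMDiffWithinAt
  choose h hh he using fun i k => exists_contMDiff_eventuallyEq (hH i k) (hU.mem_nhds hx₀)
  refine ⟨fun i x => ∑ k, h i k x • lam k x, fun i => ?_, ?_⟩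
  · have e : V.linearFun (fun x => ∑ k, h i k x • lam k x) =
        fun v : V.Tot => ∑ k, h i k v.proj * lam k v.proj v.2 := by
      funext v
      simp [linearFun]
    rw [e]
    exact contMDiff_finsetSum fun k _ => (V.contMDiff_comp_proj (hh i k)).mul (hlam k)
  · have he' : ∀ᶠ x in 𝓝 x₀, ∀ i k, h i k x = Ring.inverse (G x) (Pi.single k 1) i :=
      eventually_all.2 fun i => eventually_all.2 fun k => he i k
    filter_upwards [he', hU.mem_nhds hx₀] with x hx hxU i j
    have e1 : Ring.inverse (G x) (G x (Pi.single j 1)) = Pi.single j 1 :=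
      DFunLike.congr_fun (Ring.inverse_mul_cancel _ hxU) (Pi.single j 1)
    have e2 : G x (Pi.single j 1) = ∑ k, lam k x (s j x) • (Pi.single k 1 : κ → ℝ) := by
      funext k
      rw [hGa]
      simp [Finset.sum_apply, Pi.single_apply]
    rw [e2, map_sum] at e1
    have e3 := congrArg (fun y : κ → ℝ => y i) e1
    simp only [map_smul, Finset.sum_apply, Pi.smul_apply, smul_eq_mul, Pi.single_apply] at e3
    simp only [LinearMap.sum_apply, LinearMap.smul_apply, smul_eq_mul, hx]
    rw [← e3]
    exact Finset.sum_congr rfl fun k _ => mul_comm _ _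

end VB

/-- The inverse of a fibrewise bijective bundle map. -/
theorem BundleMap.exists_inverse [FiniteDimensional ℝ E] [T2Space N] [IsManifold I ∞ N] {V W : VB.{u} I N}
    (φ : BundleMap V W) (hφ : ∀ x, Function.Bijective (φ.fib x)) :
    ∃ ψ : BundleMap W V, (∀ x v, ψ.fib x (φ.fib x v) = v) ∧ ∀ x w, φ.fib x (ψ.fib x w) = w := by
  let e : ∀ x, V.fib x ≃ₗ[ℝ] W.fib x := fun x => LinearEquiv.ofBijective (φ.fib x) (hφ x)
  have he : ∀ x v, e x v = φ.fib x v := fun _ _ => rfl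
  refine ⟨⟨fun x => (e x).symm.toLinearMap, fun w₀ => ?_⟩, fun x v => (e x).symm_apply_apply v,
    fun x w => (e x).apply_symm_apply w⟩
  classical
  let b := Module.finBasis ℝ (V.fib w₀.proj)
  let s : Fin _ → V.Sec := fun i => V.secThrough (b i)
  have hs : LinearIndependent ℝ (fun i => φ.onSec (s i) w₀.proj) := by
    have h1 := b.linearIndependent.map' (φ.fib w₀.proj) (LinearMap.ker_eq_bot.2 (hφ _).1)
    have h2 : (fun i => φ.onSec (s i) w₀.proj) = φ.fib w₀.proj ∘ b :=
      funext fun i => congrArg (φ.fib w₀.proj) (V.secThrough_self (b i))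
    rw [h2]
    exact h1
  obtain ⟨μ, hμ, hμ'⟩ := VB.exists_dual (fun i => φ.onSec (s i)) hs
  have hq : ContMDiff W.IT I ∞ (TotalSpace.proj : W.Tot → N) := contMDiff_proj W.fib
  -- In terms of the images φ(s_i), which form a frame of W near the point, the inverse replaces
  -- φ(s_i) by s_i and keeps the smooth coefficients μ_i.
  refine VB.contMDiffAt_congr (f := (TotalSpace.proj : W.Tot → N))
    (ξ := fun w => ∑ i, μ i w.proj w.2 • s i w.proj) ?_ ?_
  · filter_upwards [hq.continuous.continuousAt.eventually hμ'] with w hw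
    have h1 := eq_sum_of_dual (R := ⊤) hw (fun _ => trivial) (by
      rw [finrank_top, Fintype.card_fin, W.finrank_fib, ← W.finrank_fib w₀.proj, (e w₀.proj).finrank_eq])
      (w := w.2) trivial
    apply (e w.proj).injective
    refine Eq.trans ?_ ((e w.proj).apply_symm_apply w.2).symm
    conv_rhs => rw [h1]
    simp only [map_sum, map_smul]
    rfl
  · exact VB.contMDiffAt_sum _ hq.contMDiffAt fun i _ =>
      VB.contMDiffAt_smul (hμ i).contMDiffAt ((s i).contMDiff.comp hq).contMDiffAt

/-- The image of a smooth projection of constant rank is a vector bundle. -/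
theorem BundleMap.exists_image [FiniteDimensional ℝ E] [T2Space N] [IsManifold I ∞ N] {V : VB.{u} I N}
    (P : BundleMap V V) (hP : ∀ x v, P.fib x (P.fib x v) = P.fib x v) {κ : Type u} [Fintype κ]
    (hk : ∀ x, Module.finrank ℝ (LinearMap.range (P.fib x)) = Fintype.card κ) :
    ∃ (C : VB.{u} I N) (i : BundleMap C V) (r : BundleMap V C), Module.finrank ℝ C.F = Fintype.card κ ∧
      (∀ x c, r.fib x (i.fib x c) = c) ∧ ∀ x v, i.fib x (r.fib x v) = P.fib x v := by
  classical
  let b : ∀ p, Module.Basis κ ℝ (LinearMap.range (P.fib p)) := fun p =>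
    (Module.finBasisOfFinrankEq ℝ _ (hk p)).reindex (Fintype.equivFin κ).symm
  let s : N → κ → V.Sec := fun p j => P.onSec (V.secThrough (b p j : V.fib p))
  have hfix : ∀ x w, w ∈ LinearMap.range (P.fib x) → P.fib x w = w := by
    rintro x _ ⟨v, rfl⟩
    exact hP x v
  have hmem : ∀ p j x, s p j x ∈ LinearMap.range (P.fib x) := fun p j x => ⟨_, rfl⟩
  have hs : ∀ p, LinearIndependent ℝ (fun j => s p j p) := fun p => by
    have h1 := (b p).linearIndependent.map' (LinearMap.range (P.fib p)).subtype (Submodule.ker_subtype _)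
    have h2 : (fun j => s p j p) = (LinearMap.range (P.fib p)).subtype ∘ b p :=
      funext fun j => by
        change P.fib p (V.secThrough (b p j : V.fib p) p) = _
        rw [V.secThrough_self]
        exact hfix p _ (b p j).2
    rw [h2]
    exact h1
  choose μ hμ hdual using fun p => VB.exists_dual (s p) (hs p)
  let U : N → Set N := fun p => interior {x | ∀ i j, μ p i x (s p j x) = if i = j then 1 else 0}
  have hU : ∀ p, p ∈ U p := fun p => mem_interior_iff_mem_nhds.2 (hdual p)
  have hUd : ∀ p, ∀ x ∈ U p, ∀ i j, μ p i x (s p j x) = if i = j then 1 else 0 := fun p x hx => interior_subset hx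
  have key : ∀ p, ∀ x ∈ U p, ∀ w ∈ LinearMap.range (P.fib x), w = ∑ j, μ p j x w • s p j x := fun p x hx w hw =>
    eq_sum_of_dual (hUd p x hx) (fun j => hmem p j x) (hk x) hw
  let σ : ∀ p x, (κ → ℝ) →ₗ[ℝ] V.fib x := fun p x => Fintype.linearCombination ℝ fun j => s p j x
  have hσ : ∀ p x y, σ p x y = ∑ j, y j • s p j x := fun p x y => Fintype.linearCombination_apply ℝ _ y
  have hσm : ∀ p x y, σ p x y ∈ LinearMap.range (P.fib x) := fun p x y => by
    rw [hσ]
    exact Submodule.sum_mem _ fun j _ => Submodule.smul_mem _ _ (hmem p j x)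
  let R := (κ → ℝ) →L[ℝ] (κ → ℝ)
  let w : κ → κ → R := fun i j =>
    (ContinuousLinearMap.proj (R := ℝ) (φ := fun _ : κ => ℝ) j).smulRight (Pi.single i 1)
  -- Near p the image is framed by the sections s p j with coordinates μ p j, and these are the
  -- transition matrices. Each point of N indexes its own local frame.
  let τ : N → N → N → R := fun p q x => ∑ i, ∑ j, μ q i x (s p j x) • w i j
  have hτs : ∀ p q, ContMDiff I 𝓘(ℝ, R) ∞ (τ p q) := fun p q => contMDiff_finsetSum fun i _ =>
    contMDiff_finsetSum fun j _ => ((hμ q i).comp (s p j).contMDiff).smul contMDiff_const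
  have hτ : ∀ p q x y i, τ p q x y i = μ q i x (σ p x y) := fun p q x y i => by
    have hw : ∀ a b (y : κ → ℝ), w a b y = y b • (Pi.single a 1 : κ → ℝ) := fun _ _ _ => rfl
    simp [τ, hw, hσ, Pi.single_apply, mul_comm]
  have hστ : ∀ p q, ∀ x ∈ U q, ∀ y, σ q x (τ p q x y) = σ p x y := fun p q x hx y => by
    conv_rhs => rw [key q x hx _ (hσm p x y)]
    rw [hσ]
    exact Finset.sum_congr rfl fun j _ => by rw [hτ]
  let Z : VectorBundleCore ℝ N (κ → ℝ) N :=
    { baseSet := U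
      isOpen_baseSet := fun p => isOpen_interior
      indexAt := fun x => x
      mem_baseSet_at := hU
      coordChange := τ
      coordChange_self := fun p x hx y => by
        funext i
        rw [hτ, hσ, map_sum]
        simp [hUd p x hx]
      continuousOn_coordChange := fun p q => (hτs p q).continuous.continuousOn
      coordChange_comp := fun p q t x hx y => by
        funext i
        rw [hτ, hτ, hστ p q x hx.1.2] }
  have : Z.IsContMDiff I ∞ := ⟨fun p q => (hτs p q).contMDiffOn⟩
  let C : VB.{u} I N := { F := κ → ℝ, fib := Z.Fiber }
  have hbase : ∀ p, (trivializationAt C.F C.fib p).baseSet = U p := fun p => rfl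
  have hcoord : ∀ p, ∀ x ∈ U p, ∀ c : C.fib x, C.coord p x c = τ x p x c := fun p x hx c => by
    rw [C.coord_eq (hbase p ▸ hx)]
    rfl
  let ι' : ∀ x, C.fib x →ₗ[ℝ] V.fib x := fun x => σ x x
  let r' : ∀ x, V.fib x →ₗ[ℝ] C.fib x := fun x => LinearMap.pi fun j => (μ x j x).comp (P.fib x)
  have hr' : ∀ x v j, (r' x v : κ → ℝ) j = μ x j x (P.fib x v) := fun _ _ _ => rfl
  refine ⟨C, ⟨ι', fun c₀ => ?_⟩, ⟨r', fun v₀ => ?_⟩, ?_, fun x c => ?_, fun x v => ?_⟩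
  · have hq : ContMDiff C.IT I ∞ (TotalSpace.proj : C.Tot → N) := contMDiff_proj C.fib
    have h1 := ((VB.contMDiffAt_iff_coord_self C (f := (TotalSpace.proj : C.Tot → N)) (ξ := fun c => c.2)
      (x₀ := c₀)).1 contMDiffAt_id).2
    have h2 : ∀ j, ContMDiffAt C.IT 𝓘(ℝ) ∞ (fun c : C.Tot => (C.coord c₀.proj c.proj c.2 : κ → ℝ) j) c₀ := fun j =>
      ((ContinuousLinearMap.proj (R := ℝ) (φ := fun _ : κ => ℝ) j).contMDiff.contMDiffAt.comp c₀ h1 :)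
    refine VB.contMDiffAt_congr (f := (TotalSpace.proj : C.Tot → N))
      (ξ := fun c => ∑ j, (C.coord c₀.proj c.proj c.2 : κ → ℝ) j • s c₀.proj j c.proj) ?_ ?_
    · filter_upwards [hq.continuous.continuousAt.preimage_mem_nhds
        (isOpen_interior.mem_nhds (hU c₀.proj))] with c hc
      rw [hcoord _ _ hc]
      exact (hσ _ _ _).symm.trans (hστ c.proj c₀.proj c.proj hc c.2)
    · exact VB.contMDiffAt_sum _ hq.contMDiffAt fun j _ =>
        VB.contMDiffAt_smul (h2 j) ((s c₀.proj j).contMDiff.comp hq).contMDiffAt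
  · have hq : ContMDiff V.IT I ∞ (TotalSpace.proj : V.Tot → N) := contMDiff_proj V.fib
    refine (VB.contMDiffAt_iff_coord_self C (f := (TotalSpace.proj : V.Tot → N)) (ξ := fun v => r' v.proj v.2)).2
      ⟨hq.contMDiffAt, ?_⟩
    have h1 : ContMDiffAt V.IT 𝓘(ℝ, κ → ℝ) ∞
        (fun v : V.Tot => fun j => μ v₀.proj j v.proj (P.fib v.proj v.2)) v₀ :=
      contMDiffAt_pi_space.2 fun j => (((hμ v₀.proj j).comp P.smooth) v₀ :)
    refine h1.congr_of_eventuallyEq ?_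
    filter_upwards [hq.continuous.continuousAt.preimage_mem_nhds
        (isOpen_interior.mem_nhds (hU v₀.proj))] with v hv
    rw [hcoord _ _ hv]
    funext j
    refine (hτ _ _ _ (fun j => μ v.proj j v.proj (P.fib v.proj v.2)) j).trans ?_
    rw [hσ]
    exact congrArg (μ v₀.proj j v.proj) (key v.proj v.proj (hU _) _ ⟨v.2, rfl⟩).symm
  · exact Module.finrank_fintype_fun_eq_card ℝ
  · change κ → ℝ at c
    funext j
    change μ x j x (P.fib x (σ x x c)) = c j
    rw [hfix x _ (hσm x x c), hσ, map_sum]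
    simp [hUd x x (hU x)]
  · exact (hσ x x _).trans (key x x (hU x) _ ⟨v, rfl⟩).symm

end Subbundles

/-! ### Zero sections, the core, and differentiation along the scalar multiplication over A -/

section DoubleVectorBundles

variable {E : Type*} [NormedAddCommGroup E] [NormedSpace ℝ E] {H : Type*} [TopologicalSpace H]
  {I : ModelWithCorners ℝ E H} {M : Type*} [TopologicalSpace M] [ChartedSpace H M] {A B : VB.{u} I M}

namespace DVB

variable (D : DVB A B)

theorem contMDiff_qA : ContMDiff D.overB.IT A.IT ∞ D.qA :=
  (contMDiff_proj D.overA.fib).comp D.flip.contMDiff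

theorem contMDiff_scaleA {X : Type*} [TopologicalSpace X]
    {EX : Type*} [NormedAddCommGroup EX] [NormedSpace ℝ EX]
    {HX : Type*} [TopologicalSpace HX] [ChartedSpace HX X] {IX : ModelWithCorners ℝ EX HX} {g : X → ℝ}
    {f : X → D.Tot} (hg : ContMDiff IX 𝓘(ℝ) ∞ g) (hf : ContMDiff IX D.overB.IT ∞ f) :
    ContMDiff IX D.overB.IT ∞ (fun x => D.scaleA (g x) (f x)) := by
  have h1 : ContMDiff IX D.overA.IT ∞ (fun x => D.flip (f x)) := D.flip.contMDiff.comp hf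
  have h2 : ContMDiff IX D.overA.IT ∞ (fun x => D.overA.scale (g x) (D.flip (f x))) := fun x =>
    VB.contMDiffAt_smul (f := fun x => (D.flip (f x)).proj) (ξ := fun x => (D.flip (f x)).2) (hg x) (h1 x)
  exact D.flip.symm.contMDiff.comp h2

/-- The zero of `D → A` over an element of `A`. -/
def zeroA (a : A.Tot) : D.Tot := D.flip.symm ⟨a, 0⟩

theorem flip_zeroA (a : A.Tot) : D.flip (D.zeroA a) = ⟨a, 0⟩ := D.flip.apply_symm_apply _

theorem contMDiff_zeroA : ContMDiff A.IT D.overB.IT ∞ D.zeroA :=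
  D.flip.symm.contMDiff.comp D.overA.contMDiff_zero

theorem scaleA_zero (d : D.Tot) : D.scaleA 0 d = D.zeroA (D.qA d) :=
  congrArg D.flip.symm (congrArg (TotalSpace.mk _) (zero_smul ℝ _))

theorem scaleA_one (d : D.Tot) : D.scaleA 1 d = d :=
  (congrArg D.flip.symm (congrArg (TotalSpace.mk _) (one_smul ℝ _))).trans (D.flip.symm_apply_apply d)

theorem scaleA_symm (r : ℝ) (a : A.Tot) (v : D.overA.fib a) :
    D.scaleA r (D.flip.symm ⟨a, v⟩) = D.flip.symm ⟨a, r • v⟩ := by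
  unfold PreDVB.scaleA
  rw [D.flip.apply_symm_apply]
  rfl

theorem qA_zeroA (a : A.Tot) : D.qA (D.zeroA a) = a := congrArg TotalSpace.proj (D.flip_zeroA a)

theorem qA_scaleA (r : ℝ) (d : D.Tot) : D.qA (D.scaleA r d) = D.qA d :=
  by have e := congrArg TotalSpace.proj (D.flip.apply_symm_apply (D.overA.scale r (D.flip d))); exact e

theorem proj_zeroA (a : A.Tot) : (D.zeroA a).proj = ⟨a.proj, 0⟩ := by
  have e := D.qB_scale 0 (D.zeroA a)
  rw [scaleA_zero, qA_zeroA] at e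
  have h := D.square (D.zeroA a)
  rw [qA_zeroA] at h
  refine e.trans ?_
  unfold VB.scale
  rw [zero_smul, ← h]

/-- Multiplication by 0 over A sends an element to the zero over its projection to A, and by
`scale_interchange` it preserves sums over B. -/
theorem isSumB_zeroA {m : M} (a a' : A.fib m) :
    D.IsSumB (D.zeroA ⟨m, a⟩) (D.zeroA ⟨m, a'⟩) (D.zeroA ⟨m, a + a'⟩) := by
  have h : ∀ a : A.fib m, ∃ v : D.overB.fib ⟨m, 0⟩, D.zeroA ⟨m, a⟩ = ⟨⟨m, 0⟩, v⟩ := fun a => by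
    have e := D.proj_zeroA ⟨m, a⟩
    generalize D.zeroA ⟨m, a⟩ = d at e ⊢
    obtain ⟨b, v⟩ := d
    obtain rfl : b = ⟨m, 0⟩ := e
    exact ⟨v, rfl⟩
  obtain ⟨v, hv⟩ := h a
  obtain ⟨v', hv'⟩ := h a'
  have hs : D.IsSumB (D.zeroA ⟨m, a⟩) (D.zeroA ⟨m, a'⟩) ⟨⟨m, 0⟩, v + v'⟩ := ⟨⟨m, 0⟩, v, v', hv, hv', rfl⟩
  have h1 := D.scale_interchange 0 _ _ _ hs
  have h2 := D.qA_add _ _ _ hs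
  rw [qA_zeroA, qA_zeroA] at h2
  rw [scaleA_zero, scaleA_zero, scaleA_zero, qA_zeroA, qA_zeroA] at h1
  obtain ⟨p, s, t, e1, e2, e3⟩ := h2
  obtain rfl : m = p := congrArg TotalSpace.proj e1
  obtain rfl := VB.mk_inj e1
  obtain rfl := VB.mk_inj e2
  rw [e3] at h1
  exact h1

/-- The projection `D → A` as a morphism of vector bundles. -/
theorem exists_homA : ∃ F : VBHom D.overB A (TotalSpace.proj : B.Tot → M), ∀ d, F.total d = D.qA d :=
  VBHom.exists_of_additive D.contMDiff_qA D.square fun b s t => D.qA_add _ _ _ ⟨b, s, t, rfl, rfl, rfl⟩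

/-- The zero section of `D → A` as a morphism of vector bundles. -/
theorem exists_homZeroA : ∃ F : VBHom A D.overB (fun m => (⟨m, 0⟩ : B.Tot)), ∀ a, F.total a = D.zeroA a :=
  VBHom.exists_of_additive D.contMDiff_zeroA D.proj_zeroA fun _ s t => D.isSumB_zeroA s t

theorem zeroA_zero (m : M) : D.zeroA ⟨m, 0⟩ = ⟨⟨m, 0⟩, 0⟩ := by
  obtain ⟨F, hF⟩ := D.exists_homZeroA
  rw [← hF]
  exact congrArg (TotalSpace.mk _) (map_zero (F.fib m))

theorem isSumA_zeroA (d : D.Tot) : D.IsSumA d (D.zeroA (D.qA d)) d :=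
  ⟨D.qA d, (D.flip d).2, 0, rfl, D.flip_zeroA _, (congrArg (TotalSpace.mk _) (add_zero _)).symm⟩

theorem isSumA_zeroA_left (d : D.Tot) : D.IsSumA (D.zeroA (D.qA d)) d d :=
  ⟨D.qA d, 0, (D.flip d).2, D.flip_zeroA _, rfl, (congrArg (TotalSpace.mk _) (zero_add _)).symm⟩

theorem isSumA_add_scaleA (s t : ℝ) (d : D.Tot) : D.IsSumA (D.scaleA s d) (D.scaleA t d) (D.scaleA (s + t) d) :=
  ⟨D.qA d, s • (D.flip d).2, t • (D.flip d).2, D.flip.apply_symm_apply _, D.flip.apply_symm_apply _,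
    (D.flip.apply_symm_apply _).trans (congrArg (TotalSpace.mk _) (add_smul s t _))⟩

/-- The two additions agree on the core. -/
theorem isSumB_of_isSumA_core {m : M} {x y z : D.Tot} (h : D.IsSumA x y z) (hx : x.proj = ⟨m, 0⟩)
    (hy : y.proj = ⟨m, 0⟩) (hx' : D.qA x = ⟨m, 0⟩) (hy' : D.qA y = ⟨m, 0⟩) : D.IsSumB x y z := by
  obtain ⟨b, v⟩ := x
  obtain rfl : b = ⟨m, 0⟩ := hx
  obtain ⟨b, w⟩ := y
  obtain rfl : b = ⟨m, 0⟩ := hy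
  let o : D.Tot := ⟨⟨m, 0⟩, 0⟩
  have e1 := D.isSumA_zeroA ⟨⟨m, 0⟩, v⟩
  have e2 := D.isSumA_zeroA_left ⟨⟨m, 0⟩, w⟩
  rw [hx', zeroA_zero] at e1
  rw [hy', zeroA_zero] at e2
  -- The Eckmann–Hilton argument: x = x +_B 0 and y = 0 +_B y, and the interchange law is applied to
  -- these four elements.
  exact D.interchange ⟨⟨m, 0⟩, v⟩ o ⟨⟨m, 0⟩, v⟩ o ⟨⟨m, 0⟩, w⟩ ⟨⟨m, 0⟩, w⟩ _ _ _
    ⟨⟨m, 0⟩, v, 0, rfl, rfl, congrArg (TotalSpace.mk _) (add_zero v).symm⟩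
    ⟨⟨m, 0⟩, 0, w, rfl, rfl, congrArg (TotalSpace.mk _) (zero_add w).symm⟩ e1 e2 h

/-- The two scalar multiplications agree on the core. -/
theorem scaleA_core {m : M} (v : D.overB.fib ⟨m, 0⟩) (hv : D.qA ⟨⟨m, 0⟩, v⟩ = ⟨m, 0⟩) (r : ℝ) :
    D.scaleA r ⟨⟨m, 0⟩, v⟩ = ⟨⟨m, 0⟩, r • v⟩ := by
  have h : ∀ t, ∃ w : D.overB.fib ⟨m, 0⟩, D.scaleA t ⟨⟨m, 0⟩, v⟩ = ⟨⟨m, 0⟩, w⟩ := fun t => by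
    have e : (D.scaleA t ⟨⟨m, 0⟩, v⟩).proj = ⟨m, 0⟩ :=
      (D.qB_scale t ⟨⟨m, 0⟩, v⟩).trans (congrArg (TotalSpace.mk m) (smul_zero t))
    generalize D.scaleA t ⟨⟨m, 0⟩, v⟩ = d at e ⊢
    obtain ⟨b, w⟩ := d
    obtain rfl : b = ⟨m, 0⟩ := e
    exact ⟨w, rfl⟩
  choose f hf using h
  have hc : Continuous (fun t => (⟨⟨m, 0⟩, f t⟩ : D.Tot)) :=
    (D.contMDiff_scaleA (IX := 𝓘(ℝ)) (f := fun _ => ⟨⟨m, 0⟩, v⟩) contMDiff_id contMDiff_const).continuous.congr hf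
  have hadd : ∀ s t, f (s + t) = f s + f t := fun s t => by
    have e := D.isSumB_of_isSumA_core (m := m) (D.isSumA_add_scaleA s t ⟨⟨m, 0⟩, v⟩) (by rw [hf]) (by rw [hf])
      ((D.qA_scaleA _ _).trans hv) ((D.qA_scaleA _ _).trans hv)
    rw [hf, hf, hf] at e
    obtain ⟨p, s', t', e1, e2, e3⟩ := e
    obtain rfl : ⟨m, 0⟩ = p := congrArg TotalSpace.proj e1
    rw [VB.mk_inj e1, VB.mk_inj e2, VB.mk_inj e3]
  have h1 : f 1 = v := by
    have e := hf 1
    rw [scaleA_one] at e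
    exact (VB.mk_inj e).symm
  rw [hf, D.overB.eq_smul_of_additive hc hadd r, h1]

/-- The derivative at `t = 0` of a function along the curve `t ↦ t ·_A d`. -/
def derivA (f : D.Tot → ℝ) (d : D.Tot) : ℝ := deriv (fun t : ℝ => f (D.scaleA t d)) 0

theorem differentiable_scaleA {f : D.Tot → ℝ} (hf : ContMDiff D.overB.IT 𝓘(ℝ) ∞ f) (d : D.Tot) :
    Differentiable ℝ (fun t : ℝ => f (D.scaleA t d)) := by
  have h : ContMDiff 𝓘(ℝ) 𝓘(ℝ) ∞ (fun t : ℝ => f (D.scaleA t d)) :=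
    hf.comp (D.contMDiff_scaleA (IX := 𝓘(ℝ)) contMDiff_id contMDiff_const)
  exact h.contDiff.differentiable (by simp)

/-- The derivative is that of the smooth function (t, d) ↦ f(t ·_A d) in the direction ∂/∂t along t
= 0, so it is smooth in d. -/
theorem contMDiff_derivA [IsManifold I ∞ M] {f : D.Tot → ℝ} (hf : ContMDiff D.overB.IT 𝓘(ℝ) ∞ f) :
    ContMDiff D.overB.IT 𝓘(ℝ) ∞ (D.derivA f) := by
  have hg : ContMDiff (𝓘(ℝ).prod D.overB.IT) 𝓘(ℝ) ∞ (fun p : ℝ × D.Tot => f (D.scaleA p.1 p.2)) :=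
    hf.comp (D.contMDiff_scaleA contMDiff_fst contMDiff_snd)
  have h1 : ContMDiff D.overB.IT (𝓘(ℝ).prod D.overB.IT).tangent ∞ (fun d : D.Tot =>
      (⟨((0 : ℝ), d), ((1 : ℝ), 0)⟩ : TangentBundle (𝓘(ℝ).prod D.overB.IT) (ℝ × D.Tot))) := by
    have h2 : ContMDiff D.overB.IT 𝓘(ℝ).tangent ∞
      (fun _ : D.Tot => (⟨(0 : ℝ), (1 : ℝ)⟩ : TangentBundle 𝓘(ℝ) ℝ)) := contMDiff_const
    have h3 : ContMDiff D.overB.IT D.overB.IT.tangent ∞ (fun d : D.Tot => (⟨d, 0⟩ : TangentBundle D.overB.IT D.Tot)) :=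
      contMDiff_zeroSection ℝ (TangentSpace D.overB.IT : D.Tot → Type _)
    exact contMDiff_equivTangentBundleProd_symm.comp (h2.prodMk h3)
  refine (contMDiff_dirDeriv hg h1).congr fun d => ?_
  have hc : ContMDiff 𝓘(ℝ) (𝓘(ℝ).prod D.overB.IT) ∞ (fun t : ℝ => (t, d)) := contMDiff_id.prodMk contMDiff_const
  have e := dirDeriv_comp (f := fun t : ℝ => (t, d)) (x := (0 : ℝ)) (hg.mdiffAt ((0 : ℝ), d)) (hc.mdiffAt 0) (1 : ℝ)
  have e2 : mfderiv 𝓘(ℝ) (𝓘(ℝ).prod D.overB.IT) (fun t : ℝ => (t, d)) 0 (1 : ℝ) = ((1 : ℝ), 0) := by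
    have h4 := (hasMFDerivAt_id (I := 𝓘(ℝ)) (0 : ℝ)).prodMk (hasMFDerivAt_const (I := 𝓘(ℝ)) (I' := D.overB.IT) d (0 : ℝ))
    exact DFunLike.congr_fun h4.mfderiv (1 : ℝ)
  refine Eq.trans ?_ (e.trans (congrArg (dirDeriv _ _) e2))
  unfold derivA dirDeriv
  rw [mfderiv_eq_fderiv]
  exact (fderiv_apply_one_eq_deriv).symm

/-- For every t, multiplication by t over A preserves sums over B, so additivity holds before
differentiation. -/
theorem derivA_add_overB {ψ : ∀ b, D.overB.fib b →ₗ[ℝ] ℝ} (hψ : ContMDiff D.overB.IT 𝓘(ℝ) ∞ (D.overB.linearFun ψ))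
    {x y z : D.Tot} (h : D.IsSumB x y z) :
    D.derivA (D.overB.linearFun ψ) z = D.derivA (D.overB.linearFun ψ) x + D.derivA (D.overB.linearFun ψ) y := by
  have e : (fun t : ℝ => D.overB.linearFun ψ (D.scaleA t z)) =
      (fun t : ℝ => D.overB.linearFun ψ (D.scaleA t x)) + fun t : ℝ => D.overB.linearFun ψ (D.scaleA t y) := by
    funext t
    obtain ⟨p, s, s', e1, e2, e3⟩ := D.scale_interchange t x y z h
    rw [Pi.add_apply, e1, e2, e3]
    exact map_add (ψ p) s s'
  unfold derivA
  rw [e]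
  exact deriv_add (D.differentiable_scaleA hψ x 0) (D.differentiable_scaleA hψ y 0)

/-- On a fibre of D → A this is the differential of f at the zero vector, which is linear whatever f
is. -/
theorem derivA_add_overA {f : D.Tot → ℝ} (hf : ContMDiff D.overB.IT 𝓘(ℝ) ∞ f) {x y z : D.Tot}
    (h : D.IsSumA x y z) : D.derivA f z = D.derivA f x + D.derivA f y := by
  obtain ⟨a, v, w, hx, hy, hz⟩ := h
  obtain rfl : x = D.flip.symm ⟨a, v⟩ := (D.flip.eq_symm_apply).2 hx
  obtain rfl : y = D.flip.symm ⟨a, w⟩ := (D.flip.eq_symm_apply).2 hy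
  obtain rfl : z = D.flip.symm ⟨a, v + w⟩ := (D.flip.eq_symm_apply).2 hz
  let G : ℝ × ℝ → ℝ := fun p => f (D.flip.symm ⟨a, p.1 • v + p.2 • w⟩)
  have hG : ContMDiff 𝓘(ℝ, ℝ × ℝ) 𝓘(ℝ) ∞ G := by
    have hcst : ∀ z : D.overA.fib a, ContMDiff 𝓘(ℝ, ℝ × ℝ) D.overA.IT ∞ (fun _ : ℝ × ℝ => (⟨a, z⟩ : D.overA.Tot)) :=
      fun z => contMDiff_const
    refine hf.comp (D.flip.symm.contMDiff.comp fun p => ?_)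
    exact VB.contMDiffAt_add (f := fun _ : ℝ × ℝ => a)
      (VB.contMDiffAt_smul contDiff_fst.contMDiff.contMDiffAt (hcst v p))
      (VB.contMDiffAt_smul contDiff_snd.contMDiff.contMDiffAt (hcst w p))
  have hd : DifferentiableAt ℝ G 0 := hG.contDiff.differentiable (by simp) 0
  have key : ∀ (c : ℝ × ℝ), deriv (fun t : ℝ => G (t • c)) 0 = fderiv ℝ G 0 c := fun c => by
    have h1 : HasDerivAt (fun t : ℝ => t • c) c 0 := by
      simpa using (hasDerivAt_id (0 : ℝ)).smul_const c
    have h2 : HasFDerivAt G (fderiv ℝ G 0) ((0 : ℝ) • c) := by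
      rw [zero_smul]
      exact hd.hasFDerivAt
    exact (h2.comp_hasDerivAt (0 : ℝ) h1).deriv
  have e : ∀ (c : ℝ × ℝ), D.derivA f (D.flip.symm ⟨a, c.1 • v + c.2 • w⟩) = fderiv ℝ G 0 c := fun c => by
    rw [← key]
    unfold derivA
    congr 1
    funext t
    rw [D.scaleA_symm]
    refine congrArg (fun z => f (D.flip.symm ⟨a, z⟩)) ?_
    rw [smul_add, smul_smul, smul_smul]
    rfl
  have e1 := e (1, 0)
  have e2 := e (0, 1)
  have e3 := e (1, 1)
  simp only [one_smul, zero_smul, add_zero, zero_add] at e1 e2 e3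
  rw [e1, e2, e3, ← map_add]
  simp

/-- The two scalar multiplications agree on the core, so ψ is already linear along the curve. -/
theorem derivA_core {ψ : ∀ b, D.overB.fib b →ₗ[ℝ] ℝ} {m : M} (v : D.overB.fib ⟨m, 0⟩)
    (hv : D.qA ⟨⟨m, 0⟩, v⟩ = ⟨m, 0⟩) : D.derivA (D.overB.linearFun ψ) ⟨⟨m, 0⟩, v⟩ = ψ ⟨m, 0⟩ v := by
  have e : (fun t : ℝ => D.overB.linearFun ψ (D.scaleA t ⟨⟨m, 0⟩, v⟩)) = fun t => t * ψ ⟨m, 0⟩ v := by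
    funext t
    rw [D.scaleA_core v hv]
    exact map_smul (ψ ⟨m, 0⟩) t v
  unfold derivA
  rw [e]
  simp

end DVB

end DoubleVectorBundles

/-! ### The core bundle and splittings of a double vector bundle -/

section Splittings

variable {E : Type*} [NormedAddCommGroup E] [NormedSpace ℝ E] {H : Type*} [TopologicalSpace H]
  {I : ModelWithCorners ℝ E H} {M : Type*} [TopologicalSpace M] [ChartedSpace H M] {A B : VB.{u} I M}
  [FiniteDimensional ℝ E] [T2Space M] [IsManifold I ∞ M]

theorem LinearMap.finrank_range_id_sub {U W : Type*} [AddCommGroup U] [Module ℝ U] [AddCommGroup W] [Module ℝ W]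
    [FiniteDimensional ℝ W] (p : W →ₗ[ℝ] U) (z : U →ₗ[ℝ] W) (h : ∀ u, p (z u) = u) :
    Module.finrank ℝ (LinearMap.range ((LinearMap.id : W →ₗ[ℝ] W) - z ∘ₗ p)) + Module.finrank ℝ U = Module.finrank ℝ W := by
  have hk : LinearMap.ker ((LinearMap.id : W →ₗ[ℝ] W) - z ∘ₗ p) = LinearMap.range z := by
    ext v
    simp only [LinearMap.mem_ker, LinearMap.sub_apply, LinearMap.id_apply, LinearMap.comp_apply, sub_eq_zero,
      LinearMap.mem_range]
    constructor
    · intro e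
      exact ⟨_, e.symm⟩
    · rintro ⟨u, rfl⟩
      rw [h]
  rw [← LinearMap.finrank_range_add_finrank_ker ((LinearMap.id : W →ₗ[ℝ] W) - z ∘ₗ p), hk,
    LinearMap.finrank_range_of_inj (f := z) (Function.LeftInverse.injective h)]

namespace DVB

variable (D : DVB A B)

/-- The core of a double vector bundle, with a projection of the restriction of `D → B` to the zero section. -/
theorem exists_core : ∃ (C : VB.{u} I M) (r : ∀ m, D.overB.fib ⟨m, 0⟩ →ₗ[ℝ] C.fib m),
    (∀ s : D.overB.Sec, ContMDiff I C.IT ∞ (fun m => (⟨m, r m (s ⟨m, 0⟩)⟩ : C.Tot))) ∧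
    (∀ m v, D.qA ⟨⟨m, 0⟩, v⟩ = ⟨m, 0⟩ → r m v = 0 → v = 0) ∧
    ∀ b : B.Tot, Module.finrank ℝ (A.fib b.proj × C.fib b.proj) = Module.finrank ℝ (D.overB.fib b) := by
  obtain ⟨p, hp⟩ := D.exists_homA
  obtain ⟨z, hz⟩ := D.exists_homZeroA
  let pf : ∀ m, D.overB.fib ⟨m, 0⟩ →ₗ[ℝ] A.fib m := fun m => p.fib ⟨m, 0⟩
  let zf : ∀ m, A.fib m →ₗ[ℝ] D.overB.fib ⟨m, 0⟩ := z.fib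
  have hpz : ∀ m (a : A.fib m), pf m (zf m a) = a := fun m a => by
    have e := D.qA_zeroA ⟨m, a⟩
    rw [← hz, ← hp] at e
    exact VB.mk_inj e
  let o : C^∞⟮I, M; B.IT, B.Tot⟯ := ⟨fun m => ⟨m, 0⟩, B.contMDiff_zero⟩
  let D₀ := D.overB.pullback o
  have hD₀ : ContMDiff D₀.IT D.overB.IT ∞ (fun v : D₀.Tot => (⟨⟨v.proj, 0⟩, v.2⟩ : D.Tot)) :=
    ((VB.contMDiff_pullback_iff D.overB o _).1 contMDiff_id).2
  -- The projection onto the kernel of D → A over the zero section of B, along the image of the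
  -- zeros of D → A. Its rank is the constant rk D - rk A, so its image, the core, is a vector
  -- bundle.
  let q : ∀ m, D.overB.fib ⟨m, 0⟩ →ₗ[ℝ] D.overB.fib ⟨m, 0⟩ := fun m => LinearMap.id - zf m ∘ₗ pf m
  have hq : ∀ m v, q m v = v - zf m (pf m v) := fun _ _ => rfl
  have hqq : ∀ m v, q m (q m v) = q m v := fun m v => by
    rw [hq m v, map_sub, hq m v, hq m (zf m _), hpz, sub_self, sub_zero]
  let P : BundleMap D₀ D₀ := ⟨q, (VB.contMDiff_pullback_iff D.overB o _).2
    ⟨contMDiff_proj D₀.fib, fun v => VB.contMDiffAt_sub hD₀.contMDiffAt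
      ((z.smooth.comp (p.smooth.comp hD₀)) v)⟩⟩
  have hrank : ∀ m, Module.finrank ℝ (LinearMap.range (q m)) + Module.finrank ℝ A.F = Module.finrank ℝ D.overB.F :=
    fun m => by
      rw [← A.finrank_fib m, ← D.overB.finrank_fib ⟨m, 0⟩]
      exact LinearMap.finrank_range_id_sub (pf m) (zf m) (hpz m)
  -- The index type is lifted to the universe of the model fibres.
  obtain ⟨C, i, r, hC, -, hir⟩ := P.exists_image (κ := ULift.{u} (Fin (Module.finrank ℝ D.overB.F - Module.finrank ℝ A.F)))
    hqq
    (fun m => by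
      have e := hrank m
      rw [Fintype.card_ulift, Fintype.card_fin]
      exact Nat.eq_sub_of_add_eq e)
  refine ⟨C, r.fib, fun s => ?_, fun m v hv h0 => ?_, fun b => ?_⟩
  · exact r.smooth.comp ((VB.contMDiff_pullback_iff D.overB o (fun m : M => (⟨m, s ⟨m, 0⟩⟩ : D₀.Tot))).2
      ⟨contMDiff_id, s.contMDiff.comp B.contMDiff_zero⟩)
  · have e : pf m v = 0 := VB.mk_inj ((hp ⟨⟨m, 0⟩, v⟩).trans hv)
    have h1 : i.fib m (r.fib m v) = v - zf m (pf m v) := hir m v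
    rw [e, map_zero, sub_zero] at h1
    rw [← h1]
    exact (congrArg (i.fib m) h0).trans (map_zero (i.fib m))
  · have e := hrank b.proj
    rw [Fintype.card_ulift, Fintype.card_fin] at hC
    rw [Module.finrank_prod, A.finrank_fib, C.finrank_fib, D.overB.finrank_fib, hC]
    omega

/-- A double vector bundle admits a smooth map to its core that is linear over both sides and injective on the core. -/
theorem exists_splitting [SigmaCompactSpace M] : ∃ (C : VB.{u} I M) (Θ : ∀ m, D.Tot → C.fib m),
    ContMDiff D.overB.IT C.IT ∞ (fun d : D.Tot => (⟨d.proj.proj, Θ d.proj.proj d⟩ : C.Tot)) ∧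
    (∀ m x y z, D.IsSumB x y z → Θ m z = Θ m x + Θ m y) ∧
    (∀ m x y z, D.IsSumA x y z → Θ m z = Θ m x + Θ m y) ∧
    (∀ m v, D.qA ⟨⟨m, 0⟩, v⟩ = ⟨m, 0⟩ → Θ m ⟨⟨m, 0⟩, v⟩ = 0 → v = 0) ∧
    ∀ b : B.Tot, Module.finrank ℝ (A.fib b.proj × C.fib b.proj) = Module.finrank ℝ (D.overB.fib b) := by
  obtain ⟨C, r, hr, hr0, hrk⟩ := D.exists_core
  let fr := fun p : M => D.overB.frame (⟨p, 0⟩ : B.Tot)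
  -- Differentiated coefficients of a frame of D → B at the zero of B over p: they are linear for
  -- both structures, and on the core near p they are the coefficients themselves, so `τ` reproduces
  -- r there.
  let c : ∀ p, Fin (fr p).n → D.Tot → ℝ := fun p i => D.derivA (D.overB.linearFun ((fr p).coef i))
  have hc : ∀ p i, ContMDiff D.overB.IT 𝓘(ℝ) ∞ (c p i) := fun p i => D.contMDiff_derivA ((fr p).smooth_coef i)
  let σ : ∀ p, Fin (fr p).n → ∀ m, C.fib m := fun p i m => r m ((fr p).sec i ⟨m, 0⟩)
  have hU : ∀ p : M, ∃ U : Set M, IsOpen U ∧ p ∈ U ∧ ∀ m ∈ U, ∀ v, D.qA ⟨⟨m, 0⟩, v⟩ = ⟨m, 0⟩ →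
      ∑ i, c p i ⟨⟨m, 0⟩, v⟩ • σ p i m = r m v := fun p => by
    have h1 : Filter.Tendsto (fun m : M => (⟨m, 0⟩ : B.Tot)) (𝓝 p) (𝓝 ⟨p, 0⟩) :=
      B.contMDiff_zero.continuous.continuousAt
    obtain ⟨U, hU, hUo, hp⟩ := _root_.mem_nhds_iff.1 (h1.eventually (fr p).eventually_sum)
    refine ⟨U, hUo, hp, fun m hm v hv => ?_⟩
    conv_rhs => rw [hU hm v, map_sum]
    refine Finset.sum_congr rfl fun i _ => ?_
    rw [map_smul]
    exact congrArg (· • σ p i m) (D.derivA_core v hv)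
  choose U hUo hUp hUr using hU
  obtain ⟨ρ, hρ⟩ := SmoothPartitionOfUnity.exists_isSubordinate I isClosed_univ U hUo
    fun p _ => Set.mem_iUnion.2 ⟨p, hUp p⟩
  -- The point m is kept separate from the base point of d, so that sums of values at different
  -- elements need no transport between fibres.
  let τ : ∀ p m, D.Tot → C.fib m := fun p m d => ∑ i, c p i d • σ p i m
  have hadd : ∀ m x y z, (∀ p i, c p i z = c p i x + c p i y) → ∑ p ∈ ρ.finsupport m, ρ p m • τ p m z =
      ∑ p ∈ ρ.finsupport m, ρ p m • τ p m x + ∑ p ∈ ρ.finsupport m, ρ p m • τ p m y := fun m x y z h => by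
    rw [← Finset.sum_add_distrib]
    refine Finset.sum_congr rfl fun p _ => ?_
    rw [← smul_add, ← Finset.sum_add_distrib]
    exact congrArg (ρ p m • ·) (Finset.sum_congr rfl fun i _ => by rw [h, add_smul])
  have hq : ContMDiff D.overB.IT I ∞ (fun d : D.Tot => d.proj.proj) :=
    (contMDiff_proj B.fib).comp (contMDiff_proj D.overB.fib)
  refine ⟨C, fun m d => ∑ p ∈ ρ.finsupport m, ρ p m • τ p m d, fun d₀ => ?_, fun m x y z h => hadd m x y z fun p i =>
    D.derivA_add_overB ((fr p).smooth_coef i) h, fun m x y z h => hadd m x y z fun p i =>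
    D.derivA_add_overA ((fr p).smooth_coef i) h, fun m v hv h0 => hr0 m v hv ?_, hrk⟩
  · refine VB.contMDiffAt_congr (f := fun d : D.Tot => d.proj.proj)
      (ξ := fun d => ∑ p ∈ ρ.fintsupport d₀.proj.proj, ρ p d.proj.proj • τ p d.proj.proj d) ?_ ?_
    · filter_upwards [hq.continuous.continuousAt.eventually (ρ.eventually_finsupport_subset d₀.proj.proj)] with d hd
      refine (Finset.sum_subset hd fun p _ hp => ?_).symm
      rw [ρ.mem_finsupport, Function.notMem_support] at hp
      rw [hp, zero_smul]
    · exact VB.contMDiffAt_sum _ hq.contMDiffAt fun p _ => VB.contMDiffAt_smul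
        (((ρ p).contMDiff.comp hq).contMDiffAt (x := d₀)) (VB.contMDiffAt_sum _ hq.contMDiffAt fun i _ =>
          VB.contMDiffAt_smul (hc p i).contMDiffAt (((hr _).comp hq).contMDiffAt (x := d₀)))
  · rw [← h0, ← one_smul ℝ (r m v), ← ρ.sum_finsupport m (Set.mem_univ m), Finset.sum_smul]
    refine Finset.sum_congr rfl fun p hp => congrArg (ρ p m • ·) (hUr p m ?_ v hv).symm
    exact hρ p (subset_tsupport _ ((ρ.mem_finsupport m).1 hp))

end DVB

end Splittings

/-! ### Every double vector bundle is isomorphic to a trivial one -/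

section Trivializations

variable {E : Type*} [NormedAddCommGroup E] [NormedSpace ℝ E] {H : Type*} [TopologicalSpace H]
  {I : ModelWithCorners ℝ E H} {M : Type*} [TopologicalSpace M] [ChartedSpace H M]

theorem BundleMap.ext_total {V W : VB.{u} I M} {φ ψ : BundleMap V W} (h : ∀ v, φ.total v = ψ.total v) : φ = ψ :=
  BundleMap.ext (funext fun x => LinearMap.ext fun v => VB.mk_inj (h ⟨x, v⟩))

theorem VBHom.ext_total {E' : Type*} [NormedAddCommGroup E'] [NormedSpace ℝ E'] {H' : Type*} [TopologicalSpace H']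
    {I' : ModelWithCorners ℝ E' H'} {N' : Type*} [TopologicalSpace N'] [ChartedSpace H' N'] {V : VB.{u} I M}
    {V' : VB.{u} I' N'} {f : M → N'} {F G : VBHom V V' f} (h : ∀ v, F.total v = G.total v) : F = G :=
  VBHom.ext (funext fun x => LinearMap.ext fun v => VB.mk_inj (h ⟨x, v⟩))

/-- A morphism of double vector bundles is determined by the map between the total spaces. -/
theorem DVBHom.ext_total {A B A' B' : VB.{u} I M} {D : DVB A B} {D' : DVB A' B'} {F G : DVBHom D D'}
    (h : ∀ d, F.homB.total d = G.homB.total d) : F = G := by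
  obtain ⟨v, k, b, a, c⟩ := F
  obtain ⟨v', k', b', a', c'⟩ := G
  have h2 : ∀ x, a.total x = a'.total x := fun x => by
    rw [← D.flip.apply_symm_apply x, ← c, ← c']
    exact congrArg D'.flip (h _)
  obtain rfl : k = k' := BundleMap.ext_total fun x => congrArg TotalSpace.proj (h ⟨x, 0⟩)
  obtain rfl : v = v' := BundleMap.ext_total fun x => congrArg TotalSpace.proj (h2 ⟨x, 0⟩)
  obtain rfl : b = b' := VBHom.ext_total h
  obtain rfl : a = a' := VBHom.ext_total h2
  rfl

variable {A B : VB.{u} I M}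

namespace DVB

theorem _root_.PreDVB.IsSumA.right_unique {D : DVB A B} {x y z z' : D.Tot} (h : D.IsSumA x y z) (h' : D.IsSumA x y z') : z = z' := by
  obtain ⟨a, v, w, e1, e2, e3⟩ := h
  obtain ⟨a', v', w', f1, f2, f3⟩ := h'
  obtain rfl : a = a' := congrArg TotalSpace.proj (e1.symm.trans f1)
  obtain rfl := VB.mk_inj (e1.symm.trans f1)
  obtain rfl := VB.mk_inj (e2.symm.trans f2)
  exact D.flip.injective (e3.trans f3.symm)

theorem exists_isSumA (D : DVB A B) {x y : D.Tot} (h : D.qA x = D.qA y) : ∃ z, D.IsSumA x y z := by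
  have e : ∃ w : D.overA.fib (D.qA x), D.flip y = ⟨D.qA x, w⟩ := by
    rw [h]
    exact ⟨_, rfl⟩
  obtain ⟨w, hw⟩ := e
  let v : D.overA.fib (D.qA x) := (D.flip x).2
  exact ⟨D.flip.symm ⟨D.qA x, v + w⟩, D.qA x, v, w, rfl, hw, D.flip.apply_symm_apply _⟩

theorem exists_isSumA_right (D : DVB A B) {x z : D.Tot} (h : D.qA x = D.qA z) : ∃ y, D.IsSumA x y z := by
  have e : ∃ w : D.overA.fib (D.qA x), D.flip z = ⟨D.qA x, w⟩ := by
    rw [h]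
    exact ⟨_, rfl⟩
  obtain ⟨w, hw⟩ := e
  let v : D.overA.fib (D.qA x) := (D.flip x).2
  exact ⟨D.flip.symm ⟨D.qA x, w - v⟩, D.qA x, v, w - v, rfl,
    D.flip.apply_symm_apply _, hw.trans (congrArg (TotalSpace.mk _) (add_sub_cancel _ _).symm)⟩

theorem _root_.PreDVB.IsSumA.qA_eq {D : DVB A B} {x y z : D.Tot} (h : D.IsSumA x y z) : D.qA y = D.qA x ∧ D.qA z = D.qA x := by
  obtain ⟨a, v, w, e1, e2, e3⟩ := h
  have h1 : D.qA x = a := congrArg TotalSpace.proj e1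
  have h2 : D.qA y = a := congrArg TotalSpace.proj e2
  have h3 : D.qA z = a := congrArg TotalSpace.proj e3
  exact ⟨h2.trans h1.symm, h3.trans h1.symm⟩

end DVB

/-- A bijective morphism of double vector bundles over the identities of the sides has an inverse. -/
theorem DVBHom.exists_inverse [FiniteDimensional ℝ E] [T2Space M] [IsManifold I ∞ M] {D D' : DVB A B} (F : DVBHom D D')
    (hv : F.ver = BundleMap.id A) (hh : F.hor = BundleMap.id B) (hF : Function.Bijective F.homB.total) :
    ∃ G : DVBHom D' D, G.ver = BundleMap.id A ∧ G.hor = BundleMap.id B ∧ F.comp G = DVBHom.id D ∧ G.comp F = DVBHom.id D' := by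
  obtain ⟨v, k, f, a, c⟩ := F
  obtain rfl : v = BundleMap.id A := hv
  obtain rfl : k = BundleMap.id B := hh
  have hb : ∀ b, Function.Bijective (f.fib b) := fun b => by
    refine ⟨fun s t h => ?_, fun y => ?_⟩
    · exact VB.mk_inj (hF.1 (a₁ := ⟨b, s⟩) (a₂ := ⟨b, t⟩) (congrArg (TotalSpace.mk b) h))
    · obtain ⟨⟨b', x⟩, hx⟩ := hF.2 ⟨b, y⟩
      obtain rfl : b' = b := congrArg TotalSpace.proj hx
      exact ⟨x, VB.mk_inj hx⟩
  obtain ⟨g, hg, hg'⟩ := BundleMap.exists_inverse (⟨f.fib, f.smooth⟩ : BundleMap D.overB D'.overB) hb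
  have hgf : ∀ d, g.total (f.total d) = d := fun d => congrArg (TotalSpace.mk d.proj) (hg d.proj d.2)
  have hfg : ∀ d, f.total (g.total d) = d := fun d => congrArg (TotalSpace.mk d.proj) (hg' d.proj d.2)
  have hq : ∀ d, D.qA (g.total d) = D'.qA d := fun d => by
    have e : (D'.flip (f.total (g.total d))).proj = (D.flip (g.total d)).proj := congrArg TotalSpace.proj (c (g.total d))
    rw [hfg] at e
    exact e.symm
  have hsum : ∀ x y z, D.IsSumA x y z → D'.IsSumA (f.total x) (f.total y) (f.total z) := fun x y z h => by
    obtain ⟨p, s, t, h1, h2, h3⟩ := h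
    refine ⟨p, a.fib p s, a.fib p t, (c x).trans (congrArg a.total h1), (c y).trans (congrArg a.total h2),
      ((c z).trans (congrArg a.total h3)).trans (congrArg (TotalSpace.mk p) (map_add (a.fib p) s t))⟩
  have hsum' : ∀ x y z, D'.IsSumA x y z → D.IsSumA (g.total x) (g.total y) (g.total z) := fun x y z h => by
    -- The map f sends the sum w of the preimages to the sum of x and y. Sums over A are unique, so
    -- w is the preimage of z, and the inverse is additive over A.
    obtain ⟨w, hw⟩ := D.exists_isSumA (x := g.total x) (y := g.total y) (by rw [hq, hq, h.qA_eq.1])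
    have e := hsum _ _ _ hw
    rw [hfg, hfg] at e
    rw [h.right_unique e, hgf]
    exact hw
  obtain ⟨g', hg'⟩ := VBHom.exists_of_additive (V := D'.overA) (V' := D.overA)
    (f := fun x => D.flip (g.total (D'.flip.symm x))) (g := fun x => x)
    (D.flip.contMDiff.comp (g.smooth.comp D'.flip.symm.contMDiff))
    (fun x => (hq _).trans (congrArg TotalSpace.proj (D'.flip.apply_symm_apply x)))
    (fun p s t => hsum' _ _ _ ⟨p, s, t, D'.flip.apply_symm_apply _, D'.flip.apply_symm_apply _,
      D'.flip.apply_symm_apply _⟩)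
  refine ⟨⟨BundleMap.id A, BundleMap.id B, ⟨g.fib, g.smooth⟩, g', fun d => ?_⟩, rfl, rfl, DVBHom.ext_total hgf,
    DVBHom.ext_total hfg⟩
  refine Eq.trans ?_ (hg' _).symm
  rw [D'.flip.symm_apply_apply]
  rfl

/-- Every double vector bundle is isomorphic to a trivial one. -/
theorem DVB.exists_trivialization [FiniteDimensional ℝ E] [T2Space M] [SigmaCompactSpace M] [IsManifold I ∞ M]
    (D : DVB A B) : ∃ (C : VB.{u} I M) (F : DVBHom D (trivial A B C)) (G : DVBHom (trivial A B C) D),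
      F.ver = BundleMap.id A ∧ F.hor = BundleMap.id B ∧ G.ver = BundleMap.id A ∧ G.hor = BundleMap.id B ∧ F.comp G = DVBHom.id D ∧
        G.comp F = DVBHom.id (trivial A B C) := by
  obtain ⟨C, Θ, hs, hB, hA, hcore, hrk⟩ := D.exists_splitting
  obtain ⟨p, hp⟩ := D.exists_homA
  let Δ : D.Tot → (trivial A B C).Tot := fun d => ⟨d.proj, (p.fib d.proj d.2, Θ d.proj.proj d)⟩
  have hΔ : ContMDiff D.overB.IT (trivial A B C).overB.IT ∞ Δ :=
    (contMDiff_trivialOver_iff (A := A) (B := B) (C := C) Δ).2 ⟨contMDiff_proj D.overB.fib, p.smooth, hs⟩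
  have hsumA : ∀ x y z, D.IsSumA x y z → (trivial A B C).IsSumA (Δ x) (Δ y) (Δ z) := fun x y z h => by
    have hΘ := fun m => hA m x y z h
    have h1 := h.qA_eq
    obtain ⟨m, s, t, e1, e2, e3⟩ := D.qB_add x y z h
    obtain ⟨b, v⟩ := x
    obtain rfl : b = ⟨m, s⟩ := e1
    obtain ⟨b, w⟩ := y
    obtain rfl : b = ⟨m, t⟩ := e2
    obtain ⟨b, y⟩ := z
    obtain rfl : b = ⟨m, s + t⟩ := e3
    rw [← hp, ← hp, ← hp] at h1
    have h2 : p.fib ⟨m, t⟩ w = p.fib ⟨m, s⟩ v := VB.mk_inj h1.1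
    have h3 : p.fib ⟨m, s + t⟩ y = p.fib ⟨m, s⟩ v := VB.mk_inj h1.2
    refine ⟨⟨m, p.fib ⟨m, s⟩ v⟩, (s, Θ m _), (t, Θ m _), rfl,
      congrArg (fun a : A.fib m => (⟨⟨m, a⟩, (t, Θ m ⟨⟨m, t⟩, w⟩)⟩ : (trivial A B C).overA.Tot)) h2, ?_⟩
    refine (congrArg (fun a : A.fib m => (⟨⟨m, a⟩, (s + t, Θ m ⟨⟨m, s + t⟩, y⟩)⟩ : (trivial A B C).overA.Tot)) h3).trans ?_
    exact congrArg (fun c : C.fib m => (⟨⟨m, p.fib ⟨m, s⟩ v⟩, (s + t, c)⟩ : (trivial A B C).overA.Tot)) (hΘ m)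
  obtain ⟨f, hf⟩ := VBHom.exists_of_additive (V := D.overB) (V' := (trivial A B C).overB) (g := fun b => b) hΔ
    (fun _ => rfl) (fun b s t => ⟨b, (p.fib b s, Θ b.proj ⟨b, s⟩), (p.fib b t, Θ b.proj ⟨b, t⟩), rfl, rfl,
      congrArg (TotalSpace.mk b) (Prod.ext (map_add (p.fib b) s t)
        (hB b.proj _ _ _ ⟨b, s, t, rfl, rfl, rfl⟩))⟩)
  obtain ⟨a, ha⟩ := VBHom.exists_of_additive (V := D.overA) (V' := (trivial A B C).overA) (g := fun b => b)
    (f := fun x => (trivial A B C).flip (Δ (D.flip.symm x)))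
    ((trivial A B C).flip.contMDiff.comp (hΔ.comp D.flip.symm.contMDiff))
    (fun x => (hp _).trans (congrArg TotalSpace.proj (D.flip.apply_symm_apply x)))
    (fun q s t => hsumA _ _ _ ⟨q, s, t, D.flip.apply_symm_apply _, D.flip.apply_symm_apply _,
      D.flip.apply_symm_apply _⟩)
  let F : DVBHom D (trivial A B C) := ⟨BundleMap.id A, BundleMap.id B, f, a, fun d => by
    refine Eq.trans ?_ (ha _).symm
    rw [D.flip.symm_apply_apply, ← hf]
    rfl⟩
  -- An element v over b with zero image lies over 0 in A, so v = 0_b +_A k. Comparison of the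
  -- projections shows that k is in the core, and Θ(k) = 0, hence k = 0.
  have hinj : ∀ b, Function.Injective (f.fib b) := fun b => by
    refine (injective_iff_map_eq_zero (f.fib b)).2 fun v hv => ?_
    have e : ((p.fib b v, Θ b.proj ⟨b, v⟩) : A.fib b.proj × C.fib b.proj) = 0 :=
      VB.mk_inj (V := (trivial A B C).overB) ((hf ⟨b, v⟩).symm.trans (congrArg (TotalSpace.mk b) hv))
    have e1 : D.qA ⟨b, v⟩ = ⟨b.proj, 0⟩ := (hp _).symm.trans (congrArg (TotalSpace.mk _) (congrArg Prod.fst e))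
    have e2 : D.qA ⟨b, 0⟩ = ⟨b.proj, 0⟩ := (hp _).symm.trans (congrArg (TotalSpace.mk _) (map_zero (p.fib b)))
    obtain ⟨k, hk⟩ := D.exists_isSumA_right (e2.trans e1.symm)
    have e3 : Θ b.proj ⟨b, 0⟩ = 0 := by
      have := hB b.proj ⟨b, 0⟩ ⟨b, 0⟩ ⟨b, 0⟩ ⟨b, 0, 0, rfl, rfl, congrArg (TotalSpace.mk b) (add_zero _).symm⟩
      simpa using this
    have e4 : Θ b.proj k = 0 := by
      have := hA b.proj _ _ _ hk
      rw [e3, zero_add] at this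
      exact this.symm.trans (congrArg Prod.snd e)
    have e5 : D.qA k = ⟨b.proj, 0⟩ := hk.qA_eq.1.trans e2
    have e6 : k.proj = ⟨b.proj, 0⟩ := by
      obtain ⟨m, s, t, f1, f2, f3⟩ := D.qB_add _ _ _ hk
      obtain rfl : b = ⟨m, s⟩ := f1
      have f4 : s = s + t := VB.mk_inj f3
      have f5 : t = 0 := by simpa using f4
      rw [f5] at f2
      exact f2
    have e7 : k = D.zeroA (D.qA ⟨b, 0⟩) := by
      rw [e2, D.zeroA_zero]
      obtain ⟨b', w⟩ := k
      obtain rfl : b' = ⟨b.proj, 0⟩ := e6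
      rw [hcore b.proj w e5 e4]
    rw [e7] at hk
    exact VB.mk_inj (hk.right_unique (D.isSumA_zeroA _))
  have hbij : ∀ b, Function.Bijective (f.fib b) := fun b =>
    ⟨hinj b, (LinearMap.injective_iff_surjective_of_finrank_eq_finrank (hrk b).symm).1 (hinj b)⟩
  obtain ⟨G, hG, hG', h1, h2⟩ := F.exists_inverse rfl rfl ⟨fun x y h => by
      obtain ⟨b, s⟩ := x
      obtain ⟨b', t⟩ := y
      obtain rfl : b = b' := congrArg TotalSpace.proj h
      exact congrArg (TotalSpace.mk b) ((hbij b).1 (VB.mk_inj h)), fun y => by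
      obtain ⟨v, hv⟩ := (hbij y.proj).2 y.2
      exact ⟨⟨y.proj, v⟩, congrArg (TotalSpace.mk y.proj) hv⟩⟩
  exact ⟨C, F, G, rfl, rfl, hG, hG', h1, h2⟩

end Trivializations

/-! ### Transport of algebroid structures along isomorphisms -/

section Transport

variable {E : Type*} [NormedAddCommGroup E] [NormedSpace ℝ E] {H : Type*} [TopologicalSpace H]
  {I : ModelWithCorners ℝ E H} {M : Type*} [TopologicalSpace M] [ChartedSpace H M] [IsManifold I ∞ M]

/-- The Lie algebroid structure transported along an isomorphism of vector bundles. -/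
def LieAlgebroid.transport {V W : VB.{u} I M} (L : LieAlgebroid V) (φ : BundleMap V W) (ψ : BundleMap W V)
    (h₁ : ∀ x v, ψ.fib x (φ.fib x v) = v) (h₂ : ∀ x w, φ.fib x (ψ.fib x w) = w) : LieAlgebroid W where
  anchor x := L.anchor x ∘ₗ ψ.fib x
  anchor_smooth := (L.anchor_smooth.comp ψ.smooth :)
  bracket := LinearMap.mk₂ ℝ (fun X Y => φ.onSec (L.bracket (ψ.onSec X) (ψ.onSec Y)))
    (fun X X' Y => by
      have e : ψ.onSec (X + X') = ψ.onSec X + ψ.onSec X' := by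
        ext x
        exact map_add (ψ.fib x) _ _
      rw [e, map_add]
      ext x
      exact map_add (φ.fib x) _ _)
    (fun r X Y => by
      have e : ψ.onSec (r • X) = r • ψ.onSec X := by
        ext x
        exact map_smul (ψ.fib x) _ _
      rw [e, map_smul]
      ext x
      exact map_smul (φ.fib x) _ _)
    (fun X Y Y' => by
      have e : ψ.onSec (Y + Y') = ψ.onSec Y + ψ.onSec Y' := by
        ext x
        exact map_add (ψ.fib x) _ _
      rw [e, map_add]
      ext x
      exact map_add (φ.fib x) _ _)
    (fun r X Y => by
      have e : ψ.onSec (r • Y) = r • ψ.onSec Y := by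
        ext x
        exact map_smul (ψ.fib x) _ _
      rw [e, map_smul]
      ext x
      exact map_smul (φ.fib x) _ _)
  bracket_self X := by
    ext x
    change φ.fib x (L.bracket (ψ.onSec X) (ψ.onSec X) x) = 0
    rw [L.bracket_self]
    exact map_zero (φ.fib x)
  jacobi X Y Z := by
    have e : ∀ s, ψ.onSec (φ.onSec s) = s := fun s => by
      ext x
      exact h₁ x (s x)
    change φ.onSec (L.bracket _ (ψ.onSec (φ.onSec _))) =
      φ.onSec (L.bracket (ψ.onSec (φ.onSec _)) _) + φ.onSec (L.bracket _ (ψ.onSec (φ.onSec _)))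
    rw [e, e, e, L.jacobi]
    ext x
    exact map_add (φ.fib x) _ _
  leibniz X Y Z g hg h x := by
    have e := L.leibniz (ψ.onSec X) (ψ.onSec Y) (ψ.onSec Z) g hg
      (fun x => (congrArg (ψ.fib x) (h x)).trans (map_smul (ψ.fib x) _ _)) x
    refine (congrArg (φ.fib x) e).trans ?_
    rw [map_add, map_smul, map_smul]
    exact congrArg (fun w => g x • φ.fib x _ + dirDeriv I g (L.anchor x (ψ.fib x (X x))) • w) (h₂ x (Y x))

theorem LieAlgebroid.isMorphism_transport [FiniteDimensional ℝ E] [T2Space M] {V W : VB.{u} I M} (L : LieAlgebroid V)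
    (φ : BundleMap V W) (ψ : BundleMap W V) (h₁ : ∀ x v, ψ.fib x (φ.fib x v) = v) (h₂ : ∀ x w, φ.fib x (ψ.fib x w) = w) :
    L.IsMorphism (L.transport φ ψ h₁ h₂) φ.toVBHom ∧ (L.transport φ ψ h₁ h₂).IsMorphism L ψ.toVBHom := by
  have e : ∀ s, ψ.onSec (φ.onSec s) = s := fun s => by
    ext x
    exact h₁ x (s x)
  refine ⟨(L.isMorphism_toVBHom_iff _ φ).2 ⟨fun x v => congrArg (L.anchor x) (h₁ x v).symm, fun a b => ?_⟩,
    (isMorphism_toVBHom_iff _ L ψ).2 ⟨fun x v => rfl, fun a b => e _⟩⟩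
  change _ = φ.onSec (L.bracket (ψ.onSec (φ.onSec a)) (ψ.onSec (φ.onSec b)))
  rw [e, e]

namespace DVB

variable {A B : VB.{u} I M} {D D' : DVB A B}

/-- The bundle map `f : D → D'` over `B` is compatible with the vector bundle structures over `A`. -/
structure IsLinearOverA (f : BundleMap D.overB D'.overB) : Prop where
  qA_eq : ∀ d, D'.qA (f.total d) = D.qA d
  add : ∀ x y z, D.IsSumA x y z → D'.IsSumA (f.total x) (f.total y) (f.total z)
  scale : ∀ r d, f.total (D.scaleA r d) = D'.scaleA r (f.total d)

theorem IsLinearOverA.isLinearSection {f : BundleMap D.overB D'.overB} (hf : IsLinearOverA f) {X : D.overB.Sec} {a : A.Sec}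
    (h : D.IsLinearSection X a) : D'.IsLinearSection (f.onSec X) a where
  covers b := (hf.qA_eq ⟨b, X b⟩).trans (h.covers b)
  add b b' b'' hb := hf.add _ _ _ (h.add b b' b'' hb)
  scale r b := (congrArg f.total (h.scale r b)).trans (hf.scale r ⟨b, X b⟩)

theorem IsLinearOverA.isCoreSection {f : BundleMap D.overB D'.overB} (hf : IsLinearOverA f) {X : D.overB.Sec}
    (h : D.IsCoreSection X) : D'.IsCoreSection (f.onSec X) := by
  obtain ⟨c, hc, h0, hs⟩ := h
  refine ⟨fun m => f.total (c m), f.smooth.comp hc, fun m => ⟨(hf.qA_eq _).trans (h0 m).1, (h0 m).2⟩, fun b => ?_⟩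
  have e := hf.add _ _ _ (hs b)
  rwa [show f.total ⟨b, 0⟩ = ⟨b, 0⟩ from congrArg (TotalSpace.mk b) (map_zero (f.fib b))] at e

theorem IsVBAlgebroid.transport {LA : LieAlgebroid A} {LD : LieAlgebroid D.overB} (h : D.IsVBAlgebroid LA LD)
    {φ : BundleMap D.overB D'.overB} {ψ : BundleMap D'.overB D.overB} (hφ : IsLinearOverA φ) (hψ : IsLinearOverA ψ)
    (h₁ : ∀ x v, ψ.fib x (φ.fib x v) = v) (h₂ : ∀ x w, φ.fib x (ψ.fib x w) = w) :
    D'.IsVBAlgebroid LA (LD.transport φ ψ h₁ h₂) where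
  anchor_covers d := (h.anchor_covers (ψ.total d)).trans (congrArg LA.anchorTotal (hψ.qA_eq d))
  anchor_add x y z hs := h.anchor_add _ _ _ (hψ.add x y z hs)
  anchor_scale r d := (congrArg LD.anchorTotal (hψ.scale r d)).trans (h.anchor_scale r (ψ.total d))
  linear_linear X Y a a' hX hY := hφ.isLinearSection
    (h.linear_linear _ _ a a' (hψ.isLinearSection hX) (hψ.isLinearSection hY))
  linear_core X Y a hX hY := hφ.isCoreSection (h.linear_core _ _ a (hψ.isLinearSection hX) (hψ.isCoreSection hY))
  core_core X Y hX hY := by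
    change φ.onSec (LD.bracket (ψ.onSec X) (ψ.onSec Y)) = 0
    rw [h.core_core _ _ (hψ.isCoreSection hX) (hψ.isCoreSection hY)]
    ext b
    exact map_zero (φ.fib b)

/-- The bundle map over `B` underlying a morphism over the identities of the sides. -/
theorem _root_.DVBHom.exists_bundleMap (F : DVBHom D D') (hv : F.ver = BundleMap.id A) (hh : F.hor = BundleMap.id B) :
    ∃ f : BundleMap D.overB D'.overB, IsLinearOverA f ∧ (∀ d, f.total d = F.homB.total d) ∧
      ∀ (LD : LieAlgebroid D.overB) (LD' : LieAlgebroid D'.overB),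
        LD.IsMorphism LD' f.toVBHom → F.IsVBAlgebroidMorphism LD LD' := by
  obtain ⟨v, k, f, a, c⟩ := F
  obtain rfl : v = BundleMap.id A := hv
  obtain rfl : k = BundleMap.id B := hh
  refine ⟨⟨f.fib, f.smooth⟩, ⟨fun d => congrArg TotalSpace.proj (c d), fun x y z h => ?_, fun r d => ?_⟩,
    fun _ => rfl, fun _ _ h => h⟩
  · obtain ⟨p, s, t, h1, h2, h3⟩ := h
    exact ⟨p, a.fib p s, a.fib p t, (c x).trans (congrArg a.total h1), (c y).trans (congrArg a.total h2),
      ((c z).trans (congrArg a.total h3)).trans (congrArg (TotalSpace.mk p) (map_add (a.fib p) s t))⟩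
  · refine (D'.flip.eq_symm_apply).2 ((c _).trans ?_)
    unfold PreDVB.scaleA
    rw [D.flip.apply_symm_apply]
    refine Eq.trans ?_ (congrArg (D'.overA.scale r) (c d).symm)
    exact congrArg (TotalSpace.mk _) (map_smul (a.fib (D.flip d).proj) r _)

end DVB

end Transport

/-! ### The equivalence of categories -/

section Equivalence

variable {E : Type*} [NormedAddCommGroup E] [NormedSpace ℝ E] {H : Type*} [TopologicalSpace H]
  {I : ModelWithCorners ℝ E H} {M : Type*} [TopologicalSpace M] [ChartedSpace H M]

/-- The morphism `(a, b, c) ↦ (a, φ₁ b, φ₀ c + Φ_a b)` of trivial double vector bundles. -/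
def DVBHom.ofComponents [FiniteDimensional ℝ E] [T2Space M] [IsManifold I ∞ M] {A B C B' C' : VB.{u} I M}
    (φ₁ : BundleMap B B') (φ₀ : BundleMap C C') (Φ : BilinMap A B C') :
    DVBHom (DVB.trivial A B C) (DVB.trivial A B' C') where
  ver := BundleMap.id A
  hor := φ₁
  homB :=
    { fib := fun b => (LinearMap.prod (LinearMap.fst ℝ (A.fib b.proj) (C.fib b.proj))
        (φ₀.fib b.proj ∘ₗ LinearMap.snd ℝ (A.fib b.proj) (C.fib b.proj) +
          (Φ.fib b.proj).flip b.2 ∘ₗ LinearMap.fst ℝ (A.fib b.proj) (C.fib b.proj)) :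
        (A.fib b.proj × C.fib b.proj) →ₗ[ℝ] (A.fib b.proj × C'.fib b.proj))
      smooth := by
        obtain ⟨h1, h2, h3⟩ := (DVB.contMDiff_trivialOver_iff (A := A) (B := B) (C := C) _).1
          (contMDiff_id (I := (DVB.trivialOver B A C).IT) (n := ∞))
        refine (DVB.contMDiff_trivialOver_iff (A := A) (B := B') (C := C') _).2 ⟨φ₁.smooth.comp h1, h2, fun v => ?_⟩
        exact VB.contMDiffAt_add ((φ₀.smooth.comp h3) v)
          (Φ.contMDiffAt (((contMDiff_proj B.fib).comp h1) v) (h2 v) (h1 v)) }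
  homA :=
    { fib := fun a => (LinearMap.prod (φ₁.fib a.proj ∘ₗ LinearMap.fst ℝ (B.fib a.proj) (C.fib a.proj))
        (φ₀.fib a.proj ∘ₗ LinearMap.snd ℝ (B.fib a.proj) (C.fib a.proj) +
          (Φ.fib a.proj) a.2 ∘ₗ LinearMap.fst ℝ (B.fib a.proj) (C.fib a.proj)) :
        (B.fib a.proj × C.fib a.proj) →ₗ[ℝ] (B'.fib a.proj × C'.fib a.proj))
      smooth := by
        obtain ⟨h1, h2, h3⟩ := (DVB.contMDiff_trivialOver_iff (A := B) (B := A) (C := C) _).1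
          (contMDiff_id (I := (DVB.trivialOver A B C).IT) (n := ∞))
        refine (DVB.contMDiff_trivialOver_iff (A := B') (B := A) (C := C') _).2 ⟨h1, φ₁.smooth.comp h2, fun v => ?_⟩
        exact VB.contMDiffAt_add ((φ₀.smooth.comp h3) v)
          (Φ.contMDiffAt (((contMDiff_proj A.fib).comp h1) v) (h1 v) (h2 v)) }
  comm _ := rfl

variable [FiniteDimensional ℝ E] [T2Space M] [IsManifold I ∞ M] {A : VB.{u} I M} {LA : LieAlgebroid A}

theorem StructureOperators.pullback_id {B C : VB.{u} I M} (V : StructureOperators A B C) :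
    V.pullback (BundleMap.id A) = V := rfl

/-- The criterion for morphisms of VB-algebroids inducing the identity of `A`. -/
theorem DVBHom.HasComponents.isVBAlgebroidMorphism_iff_isMorphism {B C B' C' : VB.{u} I M}
    {LD : LieAlgebroid (DVB.trivial A B C).overB} {LD' : LieAlgebroid (DVB.trivial A B' C').overB}
    {V : StructureOperators A B C} {W : StructureOperators A B' C'} (hV : IsAssociated LA V LD)
    (hW : IsAssociated LA W LD') {F : DVBHom (DVB.trivial A B C) (DVB.trivial A B' C')} {φ₁ : BundleMap B B'}
    {φ₀ : BundleMap C C'} {Φ : BilinMap A B C'} (h : F.HasComponents (BundleMap.id A) φ₁ φ₀ Φ) :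
    F.IsVBAlgebroidMorphism LD LD' ↔ V.IsMorphism LA W φ₀ φ₁ Φ := by
  obtain ⟨h1, rfl, h3⟩ := h
  have h' : F.HasComponents F.ver F.hor φ₀ Φ := ⟨rfl, rfl, fun m a b c => (h3 m a b c).trans (by rw [h1])⟩
  rw [h'.isVBAlgebroidMorphism_iff hV hW, h1, W.pullback_id]
  exact and_iff_right (LieAlgebroid.IsMorphism.id LA)

namespace TwoTermRep

variable (L : ∀ R : TwoTermRep LA, LieAlgebroid (DVB.trivial A R.B R.C).overB)
  (hL : ∀ R, IsAssociated LA R.ops (L R))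

/-- The functor from representations up to homotopy to VB-algebroids. -/
def toVBAlgebroid : TwoTermRep LA ⥤ VBAlgebroid LA where
  obj R := ⟨R.B, DVB.trivial A R.B R.C, L R, R.isRepresentation.isVBAlgebroid (hL R)⟩
  map {R S} f := ⟨DVBHom.ofComponents f.φ₁ f.φ₀ f.Φ, rfl,
    (DVBHom.HasComponents.isVBAlgebroidMorphism_iff_isMorphism (hL R) (hL S) ⟨rfl, rfl, fun _ _ _ _ => rfl⟩).2
      f.isMorphism⟩
  map_id R := VBAlgebroid.Hom.ext (DVBHom.ext_total fun d =>
    congrArg (DVB.trivialMk d.2.1 d.proj.2) (add_zero d.2.2))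
  map_comp {R S T} f g := VBAlgebroid.Hom.ext (DVBHom.ext_total fun d => by
    refine congrArg (DVB.trivialMk d.2.1 (g.φ₁.fib _ (f.φ₁.fib _ d.proj.2)))
      (?_ : g.φ₀.fib _ (f.φ₀.fib _ d.2.2) + (g.φ₀.fib _ (f.Φ.fib _ d.2.1 d.proj.2) +
        g.Φ.fib _ d.2.1 (f.φ₁.fib _ d.proj.2)) = g.φ₀.fib _ (f.φ₀.fib _ d.2.2 + f.Φ.fib _ d.2.1 d.proj.2) +
        g.Φ.fib _ d.2.1 (f.φ₁.fib _ d.proj.2))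
    rw [map_add, add_assoc])

theorem faithful_toVBAlgebroid : (toVBAlgebroid L hL).Faithful where
  map_injective {R S f g} h := by
    have e : ∀ {m : M} (a : A.fib m) (b : R.B.fib m) (c : R.C.fib m), f.φ₁.fib m b = g.φ₁.fib m b ∧
        f.φ₀.fib m c + f.Φ.fib m a b = g.φ₀.fib m c + g.Φ.fib m a b := fun a b c => by
      have := congrArg (fun k : (toVBAlgebroid L hL).obj R ⟶ (toVBAlgebroid L hL).obj S =>
        (VBAlgebroid.Hom.map k).homB.total (DVB.trivialMk a b c)) h
      exact (DVB.trivialMk_inj this).2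
    refine Hom.ext (BundleMap.ext (funext fun m => LinearMap.ext fun c => ?_))
      (BundleMap.ext (funext fun m => LinearMap.ext fun b => (e (0 : A.fib m) b 0).1))
      (BilinMap.ext (funext fun m => LinearMap.ext fun a => LinearMap.ext fun b => ?_))
    · simpa using (e (0 : A.fib m) 0 c).2
    · simpa using (e a b 0).2

/-- A morphism over the identity of A has components, and the criterion for VB-algebroid morphisms
says that these form a morphism of representations. -/
theorem full_toVBAlgebroid : (toVBAlgebroid L hL).Full where
  map_surjective {R S} k := by
    let F : DVBHom (DVB.trivial A R.B R.C) (DVB.trivial A S.B S.C) := VBAlgebroid.Hom.map k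
    have hv : F.ver = BundleMap.id A := VBAlgebroid.Hom.ver_eq k
    have hc : F.HasComponents (BundleMap.id A) F.hor F.coreMap F.bilinPart := hv ▸ F.hasComponents
    refine ⟨⟨F.coreMap, F.hor, F.bilinPart, (hc.isVBAlgebroidMorphism_iff_isMorphism (hL R) (hL S)).1
      (VBAlgebroid.Hom.isMorphism k)⟩, VBAlgebroid.Hom.ext (DVBHom.ext_total fun d => ?_)⟩
    exact (hc.2.2 d.proj.proj d.2.1 d.proj.2 d.2.2).symm

/-- The structure is transported to a trivialization of D, where it has an associated representation
R. The chosen structure L R is not asserted to equal the transported one. Both are associated with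
the same operators, however, so by the criterion for components the identity is a morphism between
them in both directions. -/
theorem essSurj_toVBAlgebroid [SigmaCompactSpace M] : (toVBAlgebroid L hL).EssSurj where
  mem_essImage X := by
    obtain ⟨C, F, G, hF, hF', hG, hG', hFG, hGF⟩ := X.D.exists_trivialization
    obtain ⟨φ, hφ, eφ, mφ⟩ := F.exists_bundleMap hF hF'
    obtain ⟨ψ, hψ, eψ, mψ⟩ := G.exists_bundleMap hG hG'
    have h₁ : ∀ b v, ψ.fib b (φ.fib b v) = v := fun b v => VB.mk_inj <| by
      have e := congrArg (fun K : DVBHom X.D X.D => K.homB.total ⟨b, v⟩) hFG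
      exact ((eψ _).trans (congrArg G.homB.total (eφ ⟨b, v⟩))).trans e
    have h₂ : ∀ b v, φ.fib b (ψ.fib b v) = v := fun b v => VB.mk_inj <| by
      have e := congrArg (fun K : DVBHom (DVB.trivial A X.B C) (DVB.trivial A X.B C) => K.homB.total ⟨b, v⟩) hGF
      exact ((eφ _).trans (congrArg F.homB.total (eψ ⟨b, v⟩))).trans e
    have hm := X.LD.isMorphism_transport φ ψ h₁ h₂
    obtain ⟨V, ⟨hV, hVa⟩, -⟩ := (X.isVBAlgebroid.transport hφ hψ h₁ h₂).existsUnique_isAssociated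
    let R : TwoTermRep LA := ⟨X.B, C, V, hV⟩
    have hid : (DVBHom.id (DVB.trivial A X.B C)).HasComponents (BundleMap.id A) (BundleMap.id X.B) (BundleMap.id C)
        (Hom.id R).Φ := ⟨rfl, rfl, fun m a b c => congrArg (DVB.trivialMk a b) (add_zero c).symm⟩
    have i₁ := (hid.isVBAlgebroidMorphism_iff_isMorphism (hL R) hVa).2 (Hom.id R).isMorphism
    have i₂ := (hid.isVBAlgebroidMorphism_iff_isMorphism hVa (hL R)).2 (Hom.id R).isMorphism
    have n₁ := i₁.comp (mψ _ X.LD hm.2)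
    have n₂ := (mφ X.LD _ hm.1).comp i₂
    refine ⟨R, ⟨⟨⟨G, hG, n₁⟩, ⟨F, hF, n₂⟩, VBAlgebroid.Hom.ext hGF, VBAlgebroid.Hom.ext hFG⟩⟩⟩

end TwoTermRep

end Equivalence

end

theorem mainTheorem1 {E : Type*} [NormedAddCommGroup E] [NormedSpace ℝ E] [FiniteDimensional ℝ E]
    {M : Type*} [TopologicalSpace M] [T2Space M] [SigmaCompactSpace M] [ChartedSpace E M]
    [IsManifold 𝓘(ℝ, E) ∞ M] :
    -- every VB-algebroid structure on a trivial double vector bundle has exactly one associated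
    -- representation up to homotopy
    (∀ (A B C : VB.{u} 𝓘(ℝ, E) M) (LA : LieAlgebroid A)
      (LD : LieAlgebroid (DVB.trivial A B C).overB),
      (DVB.trivial A B C).IsVBAlgebroid LA LD →
        ∃! V : StructureOperators A B C, V.IsRepresentation LA ∧ IsAssociated LA V LD) ∧
    -- every morphism of trivial double vector bundles has unique components
    (∀ (A B C A' B' C' : VB.{u} 𝓘(ℝ, E) M)
      (F : DVBHom (DVB.trivial A B C) (DVB.trivial A' B' C')),
      ∃! p : BundleMap C C' × BilinMap A B C', F.HasComponents F.ver F.hor p.1 p.2) ∧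
    -- the criterion for VB-algebroid morphisms
    (∀ (A B C A' B' C' : VB.{u} 𝓘(ℝ, E) M) (LA : LieAlgebroid A) (LA' : LieAlgebroid A')
      (LD : LieAlgebroid (DVB.trivial A B C).overB)
      (LD' : LieAlgebroid (DVB.trivial A' B' C').overB)
      (V : StructureOperators A B C) (W : StructureOperators A' B' C')
      (F : DVBHom (DVB.trivial A B C) (DVB.trivial A' B' C'))
      (Fver : BundleMap A A') (Fhor : BundleMap B B') (Fc : BundleMap C C')
      (Φ : BilinMap A B C'),
      (DVB.trivial A B C).IsVBAlgebroid LA LD → (DVB.trivial A' B' C').IsVBAlgebroid LA' LD' →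
      V.IsRepresentation LA → W.IsRepresentation LA' →
      IsAssociated LA V LD → IsAssociated LA' W LD' →
      F.HasComponents Fver Fhor Fc Φ →
        (F.IsVBAlgebroidMorphism LD LD' ↔
          LA.IsMorphism LA' Fver.toVBHom ∧ V.IsMorphism LA (W.pullback Fver) Fc Fhor Φ)) ∧
    -- the equivalence of categories
    (∀ (A : VB.{u} 𝓘(ℝ, E) M) (LA : LieAlgebroid A),
      ∃ (L : ∀ R : TwoTermRep LA, LieAlgebroid (DVB.trivial A R.B R.C).overB)
        (hL : ∀ R, (DVB.trivial A R.B R.C).IsVBAlgebroid LA (L R))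
        (Ψ : TwoTermRep LA ⥤ VBAlgebroid LA)
        (σ : ∀ R, Ψ.obj R ≅ VBAlgebroid.mk R.B (DVB.trivial A R.B R.C) (L R) (hL R)),
        (∀ R, IsAssociated LA R.ops (L R)) ∧ Ψ.IsEquivalence ∧
        ∀ (R S : TwoTermRep LA) (f : R ⟶ S),
          ((σ R).inv ≫ Ψ.map f ≫ (σ S).hom).map.HasComponents
            (BundleMap.id A) f.φ₁ f.φ₀ f.Φ) := by
  refine ⟨fun A B C LA LD h => h.existsUnique_isAssociated, fun A B C A' B' C' F => F.existsUnique_components,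
    fun A B C A' B' C' LA LA' LD LD' V W F Fver Fhor Fc Φ _ _ _ _ hV hW h => ?_, fun A LA => ?_⟩
  · obtain rfl := h.1
    obtain rfl := h.2.1
    exact h.isVBAlgebroidMorphism_iff hV hW
  · choose L hL using fun R : TwoTermRep LA => R.isRepresentation.exists_lieAlgebroid
    have h₁ := TwoTermRep.faithful_toVBAlgebroid L hL
    have h₂ := TwoTermRep.full_toVBAlgebroid L hL
    have h₃ := TwoTermRep.essSurj_toVBAlgebroid L hL
    -- The functor takes R to the chosen VB-algebroid on the nose, so identities serve as the
    -- isomorphisms σ, and the components can be read off by definition.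
    exact ⟨L, fun R => R.isRepresentation.isVBAlgebroid (hL R), TwoTermRep.toVBAlgebroid L hL, fun R => Iso.refl _, hL,
      { }, fun R S f => ⟨rfl, rfl, fun _ _ _ _ => rfl⟩⟩
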